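/- **Setting.** Let $p\ge 1$, $q\ge 2$ be integers with $n:=p+q-2\ge 1$, let $\lambda\in\mathbb C$, and put $\epsilon_i=1$ for $1\le i\le p-1$ and $\epsilon_i=-1$ for $p\le i\le n$. Let $Cl_n$ be the complex Clifford algebra with generators $e_1,\dots,e_n$, $e_i^2=-\epsilon_i$, $e_ie_j=-e_je_i$ $(i\ne j)$, and let $\mathbb S$ be a simple $Cl_n$-module. For $n$ even let $\mathbb S=\mathbb S_+\oplus\mathbb S_-$ be its half-spin spaces, the eigenspaces of $e_1\cdots e_n$, normalized to have square $1$. For $n$ odd let $\mathbb S^{n-1}_\pm\subset\mathbb S$ be the eigenspaces of $e_1\cdots e_{n-1}$, normalized to have square $1$. For $n$ even write $\mathbb S^{n-1}$ for the spin space of $\mathfrak{so}(n-1,\mathbb C)$, realized as $\mathbb S_\epsilon$. Let $\mathfrak g=\mathfrak{so}(p,q)\otimes\mathbb C$ be the orthogonal Lie algebra of the form $2x_0x_{n+1}+\sum_{i=1}^n\epsilon_ix_i^2$ on $\mathbb C^{n+2}$ with standard basis $e_0,\dots,e_{n+1}$, let $\mathfrak p=\mathfrak l\oplus\mathfrak n_+$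 be the stabilizer of the null line $\mathbb Ce_0$, $\mathfrak l=\mathfrak m\oplus\mathfrak a$ with $\mathfrak m=\mathfrak{so}(n,\mathbb C)$, and let $\mathfrak n_-$ be the opposite nilradical. Let $E_{ab}$ be the matrix units, and let $E_j=E_{0,j}-\epsilon_jE_{j,n+1}$ and $F_j=E_{j,0}-\epsilon_jE_{n+1,j}$ $(1\le j\le n)$ be the standard bases of $\mathfrak n_+$ and $\mathfrak n_-$. Let $\mathfrak g'$ be the annihilator of $e_n$ in $\mathfrak g$ and put $\mathfrak n_+'=\mathfrak n_+\cap\mathfrak g'=\langle E_1,\dots,E_{n-1}\rangle$, $\mathfrak l'=\mathfrak l\cap\mathfrak g'$, $\mathfrak m'=\mathfrak m\cap\mathfrak g'=\mathfrak{so}(n-1,\mathbb C)$. For $V=\mathbb S$ (and, if $n$ is even, also for $V=\mathbb S_\epsilon$, $\epsilon=\pm$) let $V_\lambda$ be the $\mathfrak p$-module on which $\mathfrak m$ acts by the spin representation $\epsilon_j\epsilon_kE_{jk}-E_{kj}\mapsto-\tfrac12\epsilon_je_je_k$, $E_{00}-E_{n+1,n+1}$ acts by $\lambda$, and $\mathfrak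 n_+$ acts by $0$. Let $M(V_\lambda)=U(\mathfrak g)\otimes_{U(\mathfrak p)}V_\lambda$; its *singular vectors* are the elements of $M(V_\lambda)^{\mathfrak n_+'}$, those annihilated by $\mathfrak n_+'$. Let $\widetilde L'=Spin(p-1,q-2)\times\mathbb R_{>0}$, where $Spin(p-1,q-2)$ is generated by the products $vw$ of vectors $v,w\in\mathbb R^{n-1}=\langle e_1,\dots,e_{n-1}\rangle_{\mathbb R}$ with $\sum\epsilon_iv_i^2=\pm1$, $\sum\epsilon_iw_i^2=\pm1$. An element $(x,a)$ is mapped to $\mathrm{diag}(\varepsilon a,\mathsf m,\varepsilon a^{-1})\in SO_o(p,q)$, where $\mathsf m$ is given by $v\mapsto xvx^{-1}$ and $\varepsilon=\pm1$ is the spinor norm of $x$ ($+1$ iff $\mathsf m$ lies in the identity component), and it acts on $V_\lambda$ by $a^\lambda x$, on $M(V_\lambda)$ by $u\otimes v\mapsto\mathrm{Ad}(x,a)u\otimes a^\lambda xv$, and on $\mathrm{Pol}[\xi_1,\dots,\xi_n]\otimes V_\lambda$ by $\xi_k\mapsto\varepsilon a^{-1}\sum_j\mathsf m_{jk}\xi_j$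 and $a^\lambda x$ on $V$. The Lie algebra $\mathfrak l'$ acts on this space by the adjoint action on $\mathfrak n_-$ (with $\xi_k\leftrightarrow F_k$) together with its action on $V_\lambda$. Let $E=\sum_k\xi_k\partial_{\xi_k}$, $\square=\sum_k\epsilon_k\partial_{\xi_k}^2$, $D=\sum_ke_k\partial_{\xi_k}$ and $$P_j=-i\Bigl(\tfrac12\epsilon_j\xi_j\square+(\lambda-E-\tfrac12)\partial_{\xi_j}-\tfrac12\epsilon_je_jD\Bigr)\quad(1\le j\le n),$$ and let $\mathrm{Sol}(\mathfrak g,\mathfrak g';V_\lambda)\subset\mathrm{Pol}[\xi_1,\dots,\xi_n]\otimes V$ be the common kernel of $P_1,\dots,P_{n-1}$. Let $\varphi:\mathrm{Pol}[\xi_1,\dots,\xi_n]\otimes V\to M(V_\lambda)$ be the inverse Fourier transform $\xi^\beta\otimes v\mapsto(-i)^{|\beta|}F^\beta\otimes v$. *Gegenbauer polynomials.* Let $C_l^\alpha(x)=\sum_{k=0}^{[l/2]}(-1)^k\frac{(\alpha)_{l-k}}{k!\,(l-2k)!}(2x)^{l-2k}$, where $(\alpha)_k=\alpha(\alpha+1)\cdots(\alpha+k-1)$,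 and define the polynomial $\widetilde{\mathcal C}{}^\alpha_l$ by $(\alpha)_{[(l+1)/2]}\,\widetilde{\mathcal C}{}^\alpha_l(x^2)=x^lC_l^\alpha(x^{-1})$ (extended polynomially to all $\alpha\in\mathbb C$), $\widetilde{\mathcal C}{}^\alpha_{-1}=0$. Put $\alpha=-\lambda-\frac n2+1$, $t=\frac{\sum_{j<n}\epsilon_j\xi_j^2}{\epsilon_n\xi_n^2}$, $\underline{\xi'}=\sum_{j<n}\epsilon_je_j\xi_j$, $\underline{\xi_n}=\epsilon_ne_n\xi_n$, and for $N\in\mathbb N=\{0,1,\dots\}$ $$\widetilde F_{2N}=\xi_n^{2N}\widetilde{\mathcal C}{}^\alpha_{2N}(-t)+\xi_n^{2N-2}\widetilde{\mathcal C}{}^\alpha_{2N-1}(-t)\,\underline{\xi'}\,\underline{\xi_n},$$ $$\widetilde F_{2N+1}=\xi_n^{2N}\Bigl(\widetilde{\mathcal C}{}^\alpha_{2N}(-t)\,\underline{\xi'}+(-\lambda-\tfrac n2+N+1)\,\widetilde{\mathcal C}{}^\alpha_{2N+1}(-t)\,\underline{\xi_n}\Bigr).$$ *Monogenics.* For $j\in\mathbb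 N$ let $\mathcal M^j(\mathbb R^{p-1,q-1},W)$ be the space of $W$-valued polynomials $f$ in $\xi_1,\dots,\xi_n$ with $Df=0$, $Ef=jf$; let $\mathcal M^i(\mathbb R^{p-1,q-2},W)$ be the analogous space of polynomials in $\xi_1,\dots,\xi_{n-1}$, with $D'=\sum_{k<n}e_k\partial_{\xi_k}$ instead of $D$. **Theorem.** (0) For every $\lambda$ and $V$ as above, $\varphi\circ P_j=E_j\circ\varphi$ for $1\le j\le n$, and $\varphi$ restricts to an isomorphism $\mathrm{Sol}(\mathfrak g,\mathfrak g';V_\lambda)\xrightarrow{\sim}M(V_\lambda)^{\mathfrak n_+'}$ of $\widetilde L'$-modules and of $\mathfrak l'$-modules. (1) For every $\lambda\in\mathbb C$ the spaces below are stable under $\widetilde L'$ and $\mathfrak l'$, their sums are direct, and $$\mathrm{Sol}(\mathfrak g,\mathfrak g';\mathbb S_\lambda)\supset\bigoplus_{K=0}^\infty\{\widetilde F_K\cdot s:\ s\in\mathbb S\},$$ $$\mathrm{Sol}(\mathfrak g,\mathfrak g';\mathbb S_{\epsilon,\lambda})\supset\bigoplus_{K=0}^\infty\{\widetilde F_K\cdot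 s:\ s\in\mathbb S_{(-1)^K\epsilon}\}\qquad(n\text{ even},\ \epsilon=\pm).$$ If moreover $\lambda+n-\frac32\notin\{1,2,3,\dots\}$ and $2\lambda+n-1\notin\{1,2,3,\dots\}$, then these inclusions are equalities; so, by (0), $\varphi$ then gives all singular vectors, $M(V_\lambda)^{\mathfrak n_+'}\xleftarrow{\sim}\mathrm{Sol}(\mathfrak g,\mathfrak g';V_\lambda)=\bigoplus_K\{\widetilde F_K\cdot s\}$, as modules of $\widetilde L'$. (2) Let $\lambda\in\mathbb N+\frac12$ and $j=\lambda+\frac12$. For $n\ge3$ odd, there is a decomposition $\mathcal M^j(\mathbb R^{p-1,q-1},\mathbb S)=\bigoplus_{\epsilon=\pm}\bigoplus_{i=0}^j\mathcal M_{i,\epsilon}$ into $\mathfrak m'$-submodules with $\mathcal M_{i,\epsilon}\simeq\mathcal M^i(\mathbb R^{p-1,q-2},\mathbb S^{n-1}_\epsilon)$, and for every such decomposition $$\mathrm{Sol}(\mathfrak g,\mathfrak g';\mathbb S_\lambda)\supset\bigoplus_{K=0}^\infty\{\widetilde F_K\cdot s:\ s\in\mathbb S\}\oplus\bigoplus_{\epsilon=\pm}\bigoplus_{i=1}^{\lambda+\frac12}\mathcal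 M_{i,\epsilon}.$$ For $n$ even and $\epsilon=\pm$, there is a decomposition $\mathcal M^j(\mathbb R^{p-1,q-1},\mathbb S_\epsilon)=\bigoplus_{i=0}^j\mathcal M_i$ into $\mathfrak m'$-submodules with $\mathcal M_i\simeq\mathcal M^i(\mathbb R^{p-1,q-2},\mathbb S^{n-1})$, and for every such decomposition $$\mathrm{Sol}(\mathfrak g,\mathfrak g';\mathbb S_{\epsilon,\lambda})\supset\bigoplus_{K=0}^\infty\{\widetilde F_K\cdot s:\ s\in\mathbb S_{(-1)^K\epsilon}\}\oplus\bigoplus_{i=1}^{\lambda+\frac12}\mathcal M_i.$$ By (0), $\varphi$ maps these spaces injectively and $\mathfrak l'$-equivariantly into the space of singular vectors. -/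

import Mathlib

open scoped TensorProduct

attribute [local instance 100] LieRing.ofAssociativeRing

namespace SpinorSingular

noncomputable section

/-! ### Signature, Clifford algebra -/

/-- The signs `ε_1, …, ε_n` (`n = m + 1`, indices shifted by one): `ε_i = 1` for `i ≤ p - 1` and
`ε_i = -1` for `i ≥ p`. -/
def eps (p : ℕ) {n : ℕ} (i : Fin n) : ℂ := if (i : ℕ) + 1 < p then 1 else -1

theorem eps_mul_eps (p : ℕ) {n : ℕ} (i : Fin n) : eps p i * eps p i = 1 := by
  unfold eps; split_ifs <;> norm_num

/-- The form `v ↦ -∑ ε_i v_i²` on `ℂ^n`, `n = m + 1`. -/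
def cliffordForm (p m : ℕ) : QuadraticForm ℂ (Fin (m + 1) → ℂ) :=
  QuadraticMap.weightedSumSquares ℂ (fun i => -eps p i)

/-- The complexified Clifford algebra: generators `e_1, …, e_n` with `e_i² = -ε_i` which
anticommute pairwise. -/
abbrev Cl (p m : ℕ) : Type := CliffordAlgebra (cliffordForm p m)

/-- The even part of the Clifford algebra. -/
abbrev ClEven (p m : ℕ) : Type := CliffordAlgebra.even (cliffordForm p m)

/-- A vector of `ℂ^n` as an element of the Clifford algebra. -/
abbrev vec (p m : ℕ) : (Fin (m + 1) → ℂ) →ₗ[ℂ] Cl p m := CliffordAlgebra.ι (cliffordForm p m)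

/-- The generator `e_i`. -/
def e (p m : ℕ) (i : Fin (m + 1)) : Cl p m := vec p m (Pi.single i 1)

/-- The product `e_j e_k` as an element of the even part. -/
def ee (p m : ℕ) (j k : Fin (m + 1)) : ClEven p m :=
  (CliffordAlgebra.even.ι (cliffordForm p m)).bilin (Pi.single j 1) (Pi.single k 1)

theorem coe_ee (p m : ℕ) (j k : Fin (m + 1)) : (ee p m j k : Cl p m) = e p m j * e p m k := rfl

theorem e_mul_self (p m : ℕ) (i : Fin (m + 1)) :
    e p m i * e p m i = algebraMap ℂ (Cl p m) (-eps p i) := by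
  rw [e, CliffordAlgebra.ι_sq_scalar]
  congr 1
  simp [cliffordForm, QuadraticMap.weightedSumSquares_apply, Pi.single_apply]

theorem e_mul_e_add_swap (p m : ℕ) (i j : Fin (m + 1)) :
    e p m i * e p m j + e p m j * e p m i
      = algebraMap ℂ (Cl p m) (if i = j then -2 * eps p i else 0) := by
  by_cases h : i = j
  · subst h
    rw [e_mul_self, ← map_add, if_pos rfl]; congr 1; ring
  · rw [e, e, CliffordAlgebra.ι_mul_ι_add_swap]
    congr 1
    have h' : ∀ x : Fin (m + 1), x = i → x = j → False := fun x h1 h2 => h (h1.symm.trans h2)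
    simp only [QuadraticMap.polar, cliffordForm, QuadraticMap.weightedSumSquares_apply,
      Pi.add_apply, Pi.single_apply, h, if_false]
    rw [← Finset.sum_sub_distrib, ← Finset.sum_sub_distrib]
    refine Finset.sum_eq_zero fun x _ => ?_
    by_cases h1 : x = i
    · by_cases h2 : x = j
      · exact (h' x h1 h2).elim
      · simp [h1, h]
    · simp [h1]

theorem vec_eq_sum (p m : ℕ) (v : Fin (m + 1) → ℂ) : vec p m v = ∑ i, v i • e p m i := by
  conv_lhs => rw [pi_eq_sum_univ' v]
  simp [map_sum, e]

/-! ### Half-spin spaces -/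

/-- `e_k` rescaled to have square `1`. -/
def gam (p m : ℕ) (k : Fin (m + 1)) : Cl p m :=
  (if (k : ℕ) + 1 < p then Complex.I else 1) • e p m k

/-- The volume element of `e_1, …, e_n` for `n = m + 1`, normalized so that its square is `1` if
`n` is even. -/
def volume (p m : ℕ) : Cl p m :=
  Complex.I ^ ((m + 1) / 2) • ((List.finRange (m + 1)).map (gam p m)).prod

/-- The volume element of `e_1, …, e_{n-1}` for `n = m + 1`, normalized so that its square is `1`
if `n - 1` is even. -/
def volume' (p m : ℕ) : Cl p m :=
  Complex.I ^ (m / 2) • ((List.finRange m).map fun k => gam p m k.castSucc).prod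

theorem e_mul_prod_gam (p m : ℕ) (i : Fin (m + 1)) (l : List (Fin (m + 1))) :
    e p m i * (l.map (gam p m)).prod
      = ((-1 : ℂ) ^ (l.length + l.count i)) • ((l.map (gam p m)).prod * e p m i) := by
  induction l with
  | nil => simp
  | cons k l ih =>
    have hk : e p m i * gam p m k
        = (if k = i then (1 : ℂ) else -1) • (gam p m k * e p m i) := by
      by_cases h : k = i
      · subst h; simp [gam]
      · have := e_mul_e_add_swap p m i k
        rw [if_neg (Ne.symm h), map_zero, add_eq_zero_iff_eq_neg] at this
        simp [gam, h, this]
    rw [List.map_cons, List.prod_cons, ← mul_assoc, hk, smul_mul_assoc, mul_assoc, ih,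
      mul_smul_comm, smul_smul, mul_assoc, List.length_cons, List.count_cons]
    congr 1
    by_cases h : k = i
    · simp [h, pow_add]
    · simp [h, pow_add]

theorem vec_mul_volume (p m : ℕ) (v : Fin (m + 1) → ℂ) :
    vec p m v * volume p m = ((-1 : ℂ) ^ m) • (volume p m * vec p m v) := by
  have key : ∀ i, e p m i * volume p m = ((-1 : ℂ) ^ m) • (volume p m * e p m i) := by
    intro i
    have h : (-1 : ℂ) ^ (m + 1 + 1) = (-1) ^ m := by rw [pow_succ, pow_succ]; ring
    rw [volume, mul_smul_comm, e_mul_prod_gam, smul_mul_assoc, smul_comm, List.length_finRange,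
      List.count_eq_one_of_mem (List.nodup_finRange _) (List.mem_finRange i), h]
  rw [vec_eq_sum, Finset.sum_mul, Finset.mul_sum, Finset.smul_sum]
  refine Finset.sum_congr rfl fun i _ => ?_
  rw [smul_mul_assoc, key, mul_smul_comm, smul_comm]

theorem even_commute_volume (p m : ℕ) (a : ClEven p m) :
    (a : Cl p m) * volume p m = volume p m * (a : Cl p m) := by
  obtain ⟨a, ha⟩ := a
  change a * volume p m = volume p m * a
  induction a, ha using CliffordAlgebra.even_induction with
  | algebraMap r => exact Algebra.commutes r _
  | add x y hx hy ihx ihy => rw [add_mul, mul_add, ihx, ihy]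
  | ι_mul_ι_mul m₁ m₂ x hx ih =>
    rw [mul_assoc, ih, ← mul_assoc, mul_assoc _ _ (volume p m), vec_mul_volume, mul_smul_comm,
      ← mul_assoc, vec_mul_volume, smul_mul_assoc, smul_mul_assoc, smul_mul_assoc,
      smul_smul, ← mul_pow]
    simp [mul_assoc]

section Spinors

variable (p m : ℕ) (S : Type*) [AddCommGroup S] [Module ℂ S] [Module (Cl p m) S]
  [IsScalarTower ℂ (Cl p m) S]

/-- The half-spin space `𝕊_ε` (for `n` even): the eigenspace of the normalized volume element for
the eigenvalue `ε = ±1`. -/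
def halfSpin (ε : ℤˣ) : Submodule (ClEven p m) S where
  carrier := {s | volume p m • s = (((ε : ℤ) : ℂ)) • s}
  add_mem' {a b} ha hb := by
    simp only [Set.mem_ofPred_eq] at *
    rw [smul_add, smul_add, ha, hb]
  zero_mem' := by simp
  smul_mem' c s hs := by
    simp only [Set.mem_ofPred_eq] at *
    rw [Subalgebra.smul_def, smul_smul, ← even_commute_volume, mul_smul, hs, smul_comm]

/-- The half-spin space `𝕊^{n-1}_ε ⊂ 𝕊^n` (for `n` odd) of the subspace spanned by
`e_1, …, e_{n-1}`. -/
def halfSpin' (ε : ℤˣ) : Submodule ℂ S where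
  carrier := {s | volume' p m • s = (((ε : ℤ) : ℂ)) • s}
  add_mem' {a b} ha hb := by
    simp only [Set.mem_ofPred_eq] at *
    rw [smul_add, smul_add, ha, hb]
  zero_mem' := by simp
  smul_mem' c s hs := by
    simp only [Set.mem_ofPred_eq] at *
    rw [smul_comm, hs, smul_comm]

end Spinors

/-! ### The Lie algebra `𝔤 = 𝔰𝔬(n + 2, ℂ)` and its subalgebras -/

/-- Index set of the standard basis of `ℂ^{n+2}`, `n = m + 1`: `inl i` stands for `e_1, …, e_n`,
while `inr 0` is the null vector `e_0` and `inr 1` is the null vector `e_{n+1}`. -/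
abbrev Idx (m : ℕ) : Type := Fin (m + 1) ⊕ Fin 2

/-- The Gram matrix of the quadratic form `2 x_0 x_{n+1} + ∑ ε_i x_i²`. -/
def gram (p m : ℕ) : Matrix (Idx m) (Idx m) ℂ :=
  Matrix.fromBlocks (Matrix.diagonal (eps p)) 0 0 !![0, 1; 1, 0]

/-- `𝔤 = 𝔰𝔬(p, q) ⊗ ℂ = 𝔰𝔬(n + 2, ℂ)`. -/
def so (p m : ℕ) : LieSubalgebra ℂ (Matrix (Idx m) (Idx m) ℂ) :=
  skewAdjointMatricesLieSubalgebra (gram p m)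

theorem mem_so_iff {p m : ℕ} {A : Matrix (Idx m) (Idx m) ℂ} :
    A ∈ so p m ↔ A.transpose * gram p m = -(gram p m * A) := by
  rw [← mul_neg, so, mem_skewAdjointMatricesLieSubalgebra, mem_skewAdjointMatricesSubmodule]
  rfl

theorem so_block {p m : ℕ} {A : Matrix (Idx m) (Idx m) ℂ} (hA : A ∈ so p m)
    (j k : Fin (m + 1)) :
    eps p j * A (Sum.inl j) (Sum.inl k) = -(eps p k * A (Sum.inl k) (Sum.inl j)) := by
  have h := congrFun (congrFun (mem_so_iff.1 hA) (Sum.inl k)) (Sum.inl j)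
  simp [Matrix.mul_apply, gram, Matrix.diagonal_apply, Fintype.sum_sum_type] at h
  rw [← h, mul_comm]

theorem so_last_row {p m : ℕ} {A : Matrix (Idx m) (Idx m) ℂ} (hA : A ∈ so p m)
    (k : Fin (m + 1)) :
    A (Sum.inr 1) (Sum.inl k) = -(eps p k * A (Sum.inl k) (Sum.inr 0)) := by
  have h := congrFun (congrFun (mem_so_iff.1 hA) (Sum.inr 0)) (Sum.inl k)
  simp [Matrix.mul_apply, gram, Matrix.diagonal_apply, Fintype.sum_sum_type] at h
  rw [mul_comm, h, neg_neg]

/-- The parabolic subalgebra `𝔭`, the stabilizer of the null line spanned by `e_0`. -/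
def parabolic (p m : ℕ) : LieSubalgebra ℂ (so p m) where
  carrier := {A | ∀ i, i ≠ Sum.inr 0 → (A : Matrix (Idx m) (Idx m) ℂ) i (Sum.inr 0) = 0}
  add_mem' {A B} hA hB i hi := by simp [hA i hi, hB i hi]
  zero_mem' i _ := by simp
  smul_mem' c A hA i hi := by simp [hA i hi]
  lie_mem' {A B} hA hB i hi := by
    have key : ∀ X Y : so p m,
        (∀ i, i ≠ Sum.inr 0 → (X : Matrix (Idx m) (Idx m) ℂ) i (Sum.inr 0) = 0) →
        (∀ i, i ≠ Sum.inr 0 → (Y : Matrix (Idx m) (Idx m) ℂ) i (Sum.inr 0) = 0) →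
        ((X : Matrix (Idx m) (Idx m) ℂ) * (Y : Matrix (Idx m) (Idx m) ℂ)) i (Sum.inr 0) = 0 := by
      intro X Y hX hY
      rw [Matrix.mul_apply]
      refine Finset.sum_eq_zero fun c _ => ?_
      by_cases hc : c = Sum.inr 0
      · rw [hc, hX i hi, zero_mul]
      · rw [hY c hc, mul_zero]
    rw [LieSubalgebra.coe_bracket, LieRing.of_associative_ring_bracket, Matrix.sub_apply,
      key A B hA hB, key B A hB hA, sub_zero]

/-- `𝔩' = 𝔩 ∩ 𝔤'`: the elements of `𝔤` which stabilize the lines spanned by `e_0` and by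
`e_{n+1}` and annihilate `e_n`. -/
def leviPrime (p m : ℕ) : Set (so p m) :=
  {A | (∀ i, i ≠ Sum.inr 0 → (A : Matrix (Idx m) (Idx m) ℂ) i (Sum.inr 0) = 0) ∧
    (∀ i, i ≠ Sum.inr 1 → (A : Matrix (Idx m) (Idx m) ℂ) i (Sum.inr 1) = 0) ∧
    ∀ i, (A : Matrix (Idx m) (Idx m) ℂ) i (Sum.inl (Fin.last m)) = 0}

/-- `𝔪' = 𝔪 ∩ 𝔤' = 𝔰𝔬(n - 1, ℂ)`: the elements of `𝔩'` which annihilate `e_0` (and then also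
`e_{n+1}`). -/
def mPrime (p m : ℕ) : Set (so p m) :=
  {A | A ∈ leviPrime p m ∧ (A : Matrix (Idx m) (Idx m) ℂ) (Sum.inr 0) (Sum.inr 0) = 0}

/-- `𝔫₊' = 𝔫₊ ∩ 𝔤'`: the elements of `𝔤` which annihilate `e_0`, map `e_1, …, e_n` into the line
spanned by `e_0`, and annihilate `e_n`. -/
def nPlusPrime (p m : ℕ) : Set (so p m) :=
  {A | (∀ i, (A : Matrix (Idx m) (Idx m) ℂ) i (Sum.inr 0) = 0) ∧
    (∀ i k, i ≠ Sum.inr 0 → (A : Matrix (Idx m) (Idx m) ℂ) i (Sum.inl k) = 0) ∧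
    ∀ i, (A : Matrix (Idx m) (Idx m) ℂ) i (Sum.inl (Fin.last m)) = 0}

theorem nilpotent_mem_so₁ (p m : ℕ) (j : Fin (m + 1)) :
    Matrix.single (Sum.inr 0) (Sum.inl j) 1 - eps p j • Matrix.single (Sum.inl j) (Sum.inr 1) 1
      ∈ so p m := by
  rw [mem_so_iff]
  ext a b
  have hs := eps_mul_eps p j
  rcases a with a | a
  · rcases b with b | b
    · simp [Matrix.mul_apply, gram, Fintype.sum_sum_type, Matrix.single_apply]
    · fin_cases b
      · simp [Matrix.mul_apply, gram, Matrix.diagonal_apply, Fintype.sum_sum_type,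
          Matrix.single_apply]
      · simp [Matrix.mul_apply, gram, Matrix.diagonal_apply, Fintype.sum_sum_type,
          Matrix.single_apply]
        grind
  · rcases b with b | b
    · fin_cases a
      · simp [Matrix.mul_apply, gram, Matrix.diagonal_apply, Fintype.sum_sum_type,
          Matrix.single_apply]
      · simp [Matrix.mul_apply, gram, Matrix.diagonal_apply, Fintype.sum_sum_type,
          Matrix.single_apply]
        grind
    · fin_cases a <;> fin_cases b <;> simp [Matrix.mul_apply, gram, Matrix.single_apply]

theorem nilpotent_mem_so₂ (p m : ℕ) (j : Fin (m + 1)) :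
    Matrix.single (Sum.inl j) (Sum.inr 0) 1 - eps p j • Matrix.single (Sum.inr 1) (Sum.inl j) 1
      ∈ so p m := by
  rw [mem_so_iff]
  ext a b
  have hs := eps_mul_eps p j
  rcases a with a | a
  · rcases b with b | b
    · simp [Matrix.mul_apply, gram, Fintype.sum_sum_type, Matrix.single_apply]
    · fin_cases b
      · simp [Matrix.mul_apply, gram, Matrix.diagonal_apply, Fintype.sum_sum_type,
          Matrix.single_apply]
        grind
      · simp [Matrix.mul_apply, gram, Matrix.diagonal_apply, Fintype.sum_sum_type,
          Matrix.single_apply]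
  · rcases b with b | b
    · fin_cases a
      · simp [Matrix.mul_apply, gram, Matrix.diagonal_apply, Fintype.sum_sum_type,
          Matrix.single_apply]
      · simp [Matrix.mul_apply, gram, Matrix.diagonal_apply, Fintype.sum_sum_type,
          Matrix.single_apply]
    · fin_cases a <;> fin_cases b <;> simp [Matrix.mul_apply, gram, Matrix.single_apply]

/-- The standard basis vector `E_j` of `𝔫₊`. -/
def nPlusBasis (p m : ℕ) (j : Fin (m + 1)) : so p m :=
  ⟨Matrix.single (Sum.inr 0) (Sum.inl j) 1 - eps p j • Matrix.single (Sum.inl j) (Sum.inr 1) 1,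
    nilpotent_mem_so₁ p m j⟩

/-- The standard basis vector `F_j` of `𝔫₋`: it maps `e_0` to `e_j`, `e_j` to `-ε_j e_{n+1}` and
all other basis vectors to `0`. -/
def nMinusBasis (p m : ℕ) (j : Fin (m + 1)) : so p m :=
  ⟨Matrix.single (Sum.inl j) (Sum.inr 0) 1 - eps p j • Matrix.single (Sum.inr 1) (Sum.inl j) 1,
    nilpotent_mem_so₂ p m j⟩

/-! ### The spin representation and generalized Verma modules -/

/-- The spin representation of `𝔰𝔬(n, ℂ)` as a map into the Clifford algebra,
`B ↦ -(1/4) ∑ ε_k B_{jk} e_j e_k`; it maps `ε_j ε_k E_{jk} - E_{kj}` to `-(1/2) ε_j e_j e_k`. -/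
def spinEl (p m : ℕ) (B : Matrix (Fin (m + 1)) (Fin (m + 1)) ℂ) : ClEven p m :=
  (-(1 / 4) : ℂ) • ∑ j, ∑ k, (eps p k * B j k) • ee p m j k

theorem coe_spinEl (p m : ℕ) (B : Matrix (Fin (m + 1)) (Fin (m + 1)) ℂ) :
    (spinEl p m B : Cl p m)
      = (-(1 / 4) : ℂ) • ∑ j, ∑ k, (eps p k * B j k) • (e p m j * e p m k) := by
  simp [spinEl, coe_ee]

theorem spinEl_comm_e (p m : ℕ) (B : Matrix (Fin (m + 1)) (Fin (m + 1)) ℂ)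
    (hB : ∀ j k, eps p j * B j k = -(eps p k * B k j)) (l : Fin (m + 1)) :
    (spinEl p m B : Cl p m) * e p m l - e p m l * (spinEl p m B : Cl p m)
      = ∑ j, B j l • e p m j := by
  have key : ∀ j k, e p m j * e p m k * e p m l - e p m l * (e p m j * e p m k)
      = (if k = l then (-2 * eps p k) • e p m j else 0)
        - (if j = l then (-2 * eps p j) • e p m k else 0) := by
    intro j k
    have h1 := e_mul_e_add_swap p m k l
    have h2 := e_mul_e_add_swap p m j l
    have : e p m j * e p m k * e p m l - e p m l * (e p m j * e p m k)
        = e p m j * (e p m k * e p m l + e p m l * e p m k)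
          - (e p m j * e p m l + e p m l * e p m j) * e p m k := by noncomm_ring
    rw [this, h1, h2, ← Algebra.commutes, ← Algebra.smul_def, ← Algebra.smul_def]
    simp only [ite_smul, zero_smul]
  rw [coe_spinEl, smul_mul_assoc, mul_smul_comm, ← smul_sub, Finset.sum_mul, Finset.mul_sum,
    ← Finset.sum_sub_distrib]
  have : ∀ j, (∑ k, (eps p k * B j k) • (e p m j * e p m k)) * e p m l
        - e p m l * ∑ k, (eps p k * B j k) • (e p m j * e p m k)
      = (-2 * B j l) • e p m j
        - ∑ k, if j = l then (-2 * (eps p k * eps p j * B j k)) • e p m k else 0 := by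
    intro j
    rw [Finset.sum_mul, Finset.mul_sum, ← Finset.sum_sub_distrib]
    simp_rw [smul_mul_assoc, mul_smul_comm, ← smul_sub, key, smul_sub, Finset.sum_sub_distrib]
    congr 1
    · simp only [smul_ite, smul_zero, smul_smul, Finset.sum_ite_eq', Finset.mem_univ, if_true]
      congr 1
      linear_combination (-2 * B j l) * eps_mul_eps p l
    · refine Finset.sum_congr rfl fun k _ => ?_
      split_ifs
      · rw [smul_smul]; congr 1; ring
      · simp
  simp_rw [this]
  rw [Finset.sum_sub_distrib, Finset.sum_comm (γ := Fin (m + 1)), ← Finset.sum_sub_distrib,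
    Finset.smul_sum]
  refine Finset.sum_congr rfl fun j _ => ?_
  rw [Finset.sum_ite_eq' Finset.univ l (fun x => (-2 * (eps p j * eps p x * B x j)) • e p m j),
    if_pos (Finset.mem_univ _), ← sub_smul, smul_smul]
  congr 1
  linear_combination (-1 / 2 * eps p j) * hB l j + (1 / 2 * B j l) * eps_mul_eps p j

theorem spinEl_lie (p m : ℕ) (A B : Matrix (Fin (m + 1)) (Fin (m + 1)) ℂ)
    (hA : ∀ j k, eps p j * A j k = -(eps p k * A k j)) :
    spinEl p m (A * B - B * A) = spinEl p m A * spinEl p m B - spinEl p m B * spinEl p m A := by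
  apply Subtype.ext
  have hc := spinEl_comm_e p m A hA
  set X : Cl p m := (spinEl p m A : Cl p m) with hX
  have key : ∀ j k, X * (e p m j * e p m k) - (e p m j * e p m k) * X
      = ∑ a, A a j • (e p m a * e p m k) + ∑ a, A a k • (e p m j * e p m a) := by
    intro j k
    have : X * (e p m j * e p m k) - (e p m j * e p m k) * X
        = (X * e p m j - e p m j * X) * e p m k + e p m j * (X * e p m k - e p m k * X) := by
      noncomm_ring
    rw [this, hc, hc, Finset.sum_mul, Finset.mul_sum]
    simp_rw [smul_mul_assoc, mul_smul_comm]
  have hR : ((spinEl p m A * spinEl p m B - spinEl p m B * spinEl p m A : ClEven p m) : Cl p m)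
      = X * (spinEl p m B : Cl p m) - (spinEl p m B : Cl p m) * X := rfl
  have h1 : ∑ j, ∑ k, ∑ a, (eps p k * B j k * A a j) • (e p m a * e p m k)
      = ∑ j, ∑ k, (eps p k * (A * B) j k) • (e p m j * e p m k) := by
    rw [Finset.sum_congr rfl fun j _ => Finset.sum_comm, Finset.sum_comm,
      Finset.sum_congr rfl fun j _ => Finset.sum_comm]
    refine Finset.sum_congr rfl fun j _ => Finset.sum_congr rfl fun k _ => ?_
    rw [← Finset.sum_smul, Matrix.mul_apply, Finset.mul_sum]
    congr 1
    exact Finset.sum_congr rfl fun a _ => by ring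
  have h2 : ∑ j, ∑ k, ∑ a, (eps p k * B j k * A a k) • (e p m j * e p m a)
      = -∑ j, ∑ k, (eps p k * (B * A) j k) • (e p m j * e p m k) := by
    rw [Finset.sum_congr rfl fun j _ => Finset.sum_comm, ← Finset.sum_neg_distrib]
    refine Finset.sum_congr rfl fun j _ => ?_
    rw [← Finset.sum_neg_distrib]
    refine Finset.sum_congr rfl fun k _ => ?_
    rw [← Finset.sum_smul, Matrix.mul_apply, Finset.mul_sum, ← neg_smul,
      ← Finset.sum_neg_distrib]
    congr 1
    refine Finset.sum_congr rfl fun a _ => ?_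
    linear_combination (B j a * eps p k * eps p a) * hA k a
      - (B j a * A k a * eps p a) * eps_mul_eps p k - (B j a * A a k * eps p k) * eps_mul_eps p a
  rw [hR, coe_spinEl p m B, coe_spinEl, mul_smul_comm, smul_mul_assoc, ← smul_sub]
  congr 1
  simp_rw [Finset.mul_sum, Finset.sum_mul, ← Finset.sum_sub_distrib, smul_mul_assoc,
    mul_smul_comm, ← smul_sub, key, smul_add, Finset.smul_sum, smul_smul, Finset.sum_add_distrib]
  rw [h1, h2, ← sub_eq_add_neg, ← Finset.sum_sub_distrib]
  refine Finset.sum_congr rfl fun j _ => ?_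
  rw [← Finset.sum_sub_distrib]
  refine Finset.sum_congr rfl fun k _ => ?_
  rw [← sub_smul, Matrix.sub_apply, mul_sub]

theorem spinEl_add (p m : ℕ) (A B : Matrix (Fin (m + 1)) (Fin (m + 1)) ℂ) :
    spinEl p m (A + B) = spinEl p m A + spinEl p m B := by
  simp [spinEl, mul_add, add_smul, Finset.sum_add_distrib, smul_add]

theorem spinEl_smul (p m : ℕ) (c : ℂ) (A : Matrix (Fin (m + 1)) (Fin (m + 1)) ℂ) :
    spinEl p m (c • A) = c • spinEl p m A := by
  simp only [spinEl, Finset.smul_sum, smul_smul, Matrix.smul_apply, smul_eq_mul]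
  refine Finset.sum_congr rfl fun j _ => Finset.sum_congr rfl fun k _ => ?_
  congr 1
  ring

theorem parabolic_mul_block {p m : ℕ} (A B : parabolic p m) :
    ((A : Matrix (Idx m) (Idx m) ℂ) * (B : Matrix (Idx m) (Idx m) ℂ)).toBlocks₁₁
      = (A : Matrix (Idx m) (Idx m) ℂ).toBlocks₁₁ * (B : Matrix (Idx m) (Idx m) ℂ).toBlocks₁₁ := by
  ext j k
  have h1 : (A : Matrix (Idx m) (Idx m) ℂ) (Sum.inl j) (Sum.inr 0) = 0 := A.2 _ (by simp)
  have h2 : (B : Matrix (Idx m) (Idx m) ℂ) (Sum.inr 1) (Sum.inl k) = 0 := by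
    rw [so_last_row B.1.2, B.2 _ (by simp), mul_zero, neg_zero]
  simp [Matrix.toBlocks₁₁, Matrix.mul_apply, Fintype.sum_sum_type, h1, h2]

theorem parabolic_mul_corner {p m : ℕ} (A B : parabolic p m) :
    ((A : Matrix (Idx m) (Idx m) ℂ) * (B : Matrix (Idx m) (Idx m) ℂ)) (Sum.inr 0) (Sum.inr 0)
      = (A : Matrix (Idx m) (Idx m) ℂ) (Sum.inr 0) (Sum.inr 0)
        * (B : Matrix (Idx m) (Idx m) ℂ) (Sum.inr 0) (Sum.inr 0) := by
  rw [Matrix.mul_apply]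
  refine Finset.sum_eq_single _ (fun c _ hc => ?_) (by simp)
  rw [B.2 c hc, mul_zero]

section Verma

variable (p m : ℕ) (lam : ℂ) (V : Type*) [AddCommGroup V] [Module ℂ V] [Module (ClEven p m) V]
  [IsScalarTower ℂ (ClEven p m) V]

/-- The representation `V_λ` of `𝔭` for an even Clifford module `V` (a spinor space): `𝔰𝔬(n, ℂ)`
acts by the spin representation, the grading element acts by `λ`, and `𝔫₊` acts trivially. -/
def spinRep : parabolic p m →ₗ⁅ℂ⁆ Module.End ℂ V where
  toFun A := (lam * (A : Matrix (Idx m) (Idx m) ℂ) (Sum.inr 0) (Sum.inr 0)) • LinearMap.id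
    + Algebra.lsmul ℂ ℂ V (spinEl p m (A : Matrix (Idx m) (Idx m) ℂ).toBlocks₁₁)
  map_add' A B := by
    have : ((A + B : parabolic p m) : Matrix (Idx m) (Idx m) ℂ).toBlocks₁₁
        = (A : Matrix (Idx m) (Idx m) ℂ).toBlocks₁₁
          + (B : Matrix (Idx m) (Idx m) ℂ).toBlocks₁₁ := rfl
    rw [this, spinEl_add, map_add]
    have h2 : ((A + B : parabolic p m) : Matrix (Idx m) (Idx m) ℂ) (Sum.inr 0) (Sum.inr 0)
        = (A : Matrix (Idx m) (Idx m) ℂ) (Sum.inr 0) (Sum.inr 0)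
          + (B : Matrix (Idx m) (Idx m) ℂ) (Sum.inr 0) (Sum.inr 0) := rfl
    rw [h2, mul_add, add_smul]
    abel
  map_smul' c A := by
    have : ((c • A : parabolic p m) : Matrix (Idx m) (Idx m) ℂ).toBlocks₁₁
        = c • (A : Matrix (Idx m) (Idx m) ℂ).toBlocks₁₁ := rfl
    rw [this, spinEl_smul, map_smul]
    have h2 : ((c • A : parabolic p m) : Matrix (Idx m) (Idx m) ℂ) (Sum.inr 0) (Sum.inr 0)
        = c * (A : Matrix (Idx m) (Idx m) ℂ) (Sum.inr 0) (Sum.inr 0) := rfl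
    rw [h2, RingHom.id_apply, smul_add, smul_smul, mul_left_comm]
  map_lie' {A B} := by
    have h0 : ((⁅A, B⁆ : parabolic p m) : Matrix (Idx m) (Idx m) ℂ)
        = (A : Matrix (Idx m) (Idx m) ℂ) * (B : Matrix (Idx m) (Idx m) ℂ)
          - (B : Matrix (Idx m) (Idx m) ℂ) * (A : Matrix (Idx m) (Idx m) ℂ) := rfl
    have h1 : ((⁅A, B⁆ : parabolic p m) : Matrix (Idx m) (Idx m) ℂ).toBlocks₁₁
        = (A : Matrix (Idx m) (Idx m) ℂ).toBlocks₁₁ * (B : Matrix (Idx m) (Idx m) ℂ).toBlocks₁₁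
          - (B : Matrix (Idx m) (Idx m) ℂ).toBlocks₁₁
            * (A : Matrix (Idx m) (Idx m) ℂ).toBlocks₁₁ := by
      rw [← parabolic_mul_block, ← parabolic_mul_block, h0]; rfl
    have h2 : ((⁅A, B⁆ : parabolic p m) : Matrix (Idx m) (Idx m) ℂ) (Sum.inr 0) (Sum.inr 0) = 0 := by
      rw [h0, Matrix.sub_apply, parabolic_mul_corner, parabolic_mul_corner]; ring
    rw [h1, h2, spinEl_lie p m (A : Matrix (Idx m) (Idx m) ℂ).toBlocks₁₁ _
      (fun j k => so_block A.1.2 j k)]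
    ext v
    simp only [LieRing.of_associative_ring_bracket, mul_zero, zero_smul, zero_add, map_sub,
      map_mul, LinearMap.sub_apply, Module.End.mul_apply, LinearMap.add_apply, LinearMap.smul_apply,
      LinearMap.id_apply, map_add, map_smul, smul_add]
    rw [smul_comm (lam * (A : Matrix (Idx m) (Idx m) ℂ) (Sum.inr 0) (Sum.inr 0))]
    abel

/-- The universal enveloping algebra `U(𝔤)`. -/
abbrev Env : Type := UniversalEnvelopingAlgebra ℂ (so p m)

/-- The relations `u x ⊗ v = u ⊗ x v` (`x ∈ 𝔭`), as a left `U(𝔤)`-submodule. -/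
def vermaRel : Submodule (Env p m) (Env p m ⊗[ℂ] V) :=
  Submodule.span (Env p m) {y | ∃ (x : parabolic p m) (v : V),
    y = (UniversalEnvelopingAlgebra.ι ℂ (x : so p m)) ⊗ₜ[ℂ] v
      - (1 : Env p m) ⊗ₜ[ℂ] (spinRep p m lam V x v)}

/-- The generalized Verma module `U(𝔤) ⊗_{U(𝔭)} V_λ`. -/
abbrev Verma : Type _ := (Env p m ⊗[ℂ] V) ⧸ vermaRel p m lam V

end Verma

/-! ### Spinor-valued polynomials -/

/-- The polynomial ring `Pol[ξ_1, …, ξ_n]`, `n = m + 1`. -/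
abbrev Poly (m : ℕ) : Type := MvPolynomial (Fin (m + 1)) ℂ

section Operators

variable {m : ℕ} {V : Type*} [AddCommGroup V] [Module ℂ V]

/-- The partial derivative `∂_{ξ_j}` on `V`-valued polynomials. -/
def dX (j : Fin (m + 1)) : Module.End ℂ (Poly m ⊗[ℂ] V) :=
  (MvPolynomial.pderiv (R := ℂ) j).toLinearMap.rTensor V

/-- Multiplication by `ξ_j` on `V`-valued polynomials. -/
def mulX (j : Fin (m + 1)) : Module.End ℂ (Poly m ⊗[ℂ] V) :=
  (LinearMap.mulLeft ℂ (MvPolynomial.X j : Poly m)).rTensor V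

/-- The pointwise action of an element of an algebra acting on `V`. -/
def act {A : Type*} [Ring A] [Algebra ℂ A] [Module A V] [IsScalarTower ℂ A V] (a : A) :
    Module.End ℂ (Poly m ⊗[ℂ] V) :=
  (Algebra.lsmul ℂ ℂ V a).lTensor (Poly m)

/-- The Euler operator `E = ∑ ξ_k ∂_{ξ_k}`. -/
def euler : Module.End ℂ (Poly m ⊗[ℂ] V) := ∑ k, mulX k * dX k

/-- The operator `□ = ∑ ε_k ∂_{ξ_k}²`. -/
def box (p : ℕ) : Module.End ℂ (Poly m ⊗[ℂ] V) := ∑ k, eps p k • (dX k * dX k)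

end Operators

section Fourier

variable (p m : ℕ) (lam : ℂ) (V : Type*) [AddCommGroup V] [Module ℂ V] [Module (ClEven p m) V]
  [IsScalarTower ℂ (ClEven p m) V]

/-- The second-order differential operator
`-i (½ ε_j ξ_j □ + (λ - E - ½) ∂_{ξ_j} - ½ ε_j e_j D)` with the Dirac operator
`D = ∑ e_k ∂_{ξ_k}`: the action of the basis vector `E_j` of `𝔫₊` on the Fourier transform of the
generalized Verma module. -/
def dpi (j : Fin (m + 1)) : Module.End ℂ (Poly m ⊗[ℂ] V) :=
  (-Complex.I) • ((1 / 2 * eps p j : ℂ) • (mulX j * box p)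
    + ((lam - 1 / 2) • 1 - euler) * dX j
    - (1 / 2 * eps p j : ℂ) • ∑ k, act (ee p m j k) * dX k)

/-- `Sol(𝔤, 𝔤'; V_λ)`: the common kernel of the operators by which `E_1, …, E_{n-1}`, i.e. the
standard basis of `𝔫₊'`, act on `Pol[ξ_1, …, ξ_n] ⊗ V`. -/
def Sol : Submodule ℂ (Poly m ⊗[ℂ] V) :=
  ⨅ j : Fin m, LinearMap.ker (dpi p m lam V j.castSucc)

/-- The space of singular vectors: the elements of the generalized Verma module annihilated by
`𝔫₊'`. -/
def singular : Submodule ℂ (Verma p m lam V) :=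
  ⨅ Z ∈ nPlusPrime p m,
    LinearMap.ker (Algebra.lsmul ℂ ℂ (Verma p m lam V) (UniversalEnvelopingAlgebra.ι ℂ Z))

/-- The element `∏ (-i F_j)^{α_j}` of `U(𝔫₋) ⊂ U(𝔤)` (the `F_j` commute with each other). -/
def monomialToEnv (α : Fin (m + 1) →₀ ℕ) : Env p m :=
  (List.ofFn fun j =>
    ((-Complex.I) • (UniversalEnvelopingAlgebra.ι ℂ (nMinusBasis p m j) : Env p m)) ^ α j).prod

/-- The inverse Fourier transform `Pol[𝔫₊] → U(𝔫₋) ⊂ U(𝔤)`, `ξ_j ↦ -i F_j`. -/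
def polyToEnv : Poly m →ₗ[ℂ] Env p m :=
  (MvPolynomial.basisMonomials (Fin (m + 1)) ℂ).constr ℂ (monomialToEnv p m)

/-- The map `φ : Pol[𝔫₊] ⊗ V → U(𝔤) ⊗_{U(𝔭)} V_λ` given by the inverse Fourier transform:
`ξ^α ⊗ v ↦ (-i)^{|α|} F^α ⊗ v`. -/
def fourierInv : Poly m ⊗[ℂ] V →ₗ[ℂ] Verma p m lam V :=
  ((vermaRel p m lam V).mkQ.restrictScalars ℂ) ∘ₗ (polyToEnv p m).rTensor V

/-- The action of `A ∈ 𝔩'` on `Pol[𝔫₊] ⊗ V_λ`: the adjoint action of `𝔩'` on `𝔫₋` (`ξ_k`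
corresponding to `F_k`) and the action on `V_λ`. -/
def leviAct (A : so p m) : Module.End ℂ (Poly m ⊗[ℂ] V) :=
  (∑ j, ∑ k, ((A : Matrix (Idx m) (Idx m) ℂ) (Sum.inl j) (Sum.inl k)
      - if j = k then (A : Matrix (Idx m) (Idx m) ℂ) (Sum.inr 0) (Sum.inr 0) else 0)
        • (mulX j * dX k))
    + (lam * (A : Matrix (Idx m) (Idx m) ℂ) (Sum.inr 0) (Sum.inr 0)) • 1
    + act (spinEl p m (A : Matrix (Idx m) (Idx m) ℂ).toBlocks₁₁)

end Fourier

/-! ### Gegenbauer polynomials and the spinor-valued polynomials `F̃_K` -/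

/-- The Gegenbauer polynomial `C_l^α(x) = ∑_k (-1)^k (α)_{l-k} / (k! (l-2k)!) (2x)^{l-2k}`. -/
def gegenbauer (α : ℂ) (l : ℕ) : Polynomial ℂ :=
  ∑ k ∈ Finset.range (l / 2 + 1),
    Polynomial.C ((-1) ^ k * (ascPochhammer ℂ (l - k)).eval α
      / ((k.factorial : ℂ) * ((l - 2 * k).factorial : ℂ)) * 2 ^ (l - 2 * k))
        * Polynomial.X ^ (l - 2 * k)

/-- The coefficient of `t^k` in the renormalized polynomial `𝒞̃_l^α(t)`, where
`(α)_{[(l+1)/2]} 𝒞̃_l^α(x²) = x^l C_l^α(1/x)`; the quotient `(α)_{l-k} / (α)_{[(l+1)/2]}` is written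
as the product of the remaining factors, so that all `α` are allowed. -/
def gegCoeff (α : ℂ) (l k : ℕ) : ℂ :=
  (-1) ^ k * (ascPochhammer ℂ (l - k - (l + 1) / 2)).eval (α + ((l + 1) / 2 : ℕ))
    / ((k.factorial : ℂ) * ((l - 2 * k).factorial : ℂ)) * 2 ^ (l - 2 * k)

theorem gegenbauer_coeff (α : ℂ) {l k : ℕ} (hk : k ≤ l / 2) :
    (gegenbauer α l).coeff (l - 2 * k)
      = (ascPochhammer ℂ ((l + 1) / 2)).eval α * gegCoeff α l k := by
  have h1 : (ascPochhammer ℂ (l - k)).eval α = (ascPochhammer ℂ ((l + 1) / 2)).eval α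
      * (ascPochhammer ℂ (l - k - (l + 1) / 2)).eval (α + ((l + 1) / 2 : ℕ)) := by
    have : (l + 1) / 2 + (l - k - (l + 1) / 2) = l - k := by omega
    rw [← congrArg (fun d => (ascPochhammer ℂ d).eval α) this, ← ascPochhammer_mul]
    simp
  rw [gegenbauer, Polynomial.finsetSum_coeff, Finset.sum_eq_single k]
  · rw [Polynomial.coeff_C_mul, Polynomial.coeff_X_pow, if_pos rfl, mul_one, h1, gegCoeff]
    ring
  · intro k' hk' hne
    have := Finset.mem_range.1 hk'
    rw [Polynomial.coeff_C_mul, Polynomial.coeff_X_pow, if_neg (by omega), mul_zero]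
  · intro h
    exact absurd (Finset.mem_range.2 (by omega)) h

/-- The polynomial `ξ_n^{2[l/2]} 𝒞̃_l^α(-t)` with `t = ∑_{j<n} ε_j ξ_j² / (ε_n ξ_n²)`. -/
def gegPoly (p m : ℕ) (α : ℂ) (l : ℕ) : Poly m :=
  ∑ k ∈ Finset.range (l / 2 + 1),
    MvPolynomial.C (gegCoeff α l k)
      * (-(MvPolynomial.C (eps p (Fin.last m))
          * ∑ j : Fin m, MvPolynomial.C (eps p j.castSucc) * MvPolynomial.X j.castSucc ^ 2)) ^ k
      * MvPolynomial.X (Fin.last m) ^ (2 * (l / 2 - k))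

/-- `ξ' = ∑_{j<n} ε_j e_j ξ_j`. -/
def xiPrime (p m : ℕ) : Poly m ⊗[ℂ] Cl p m :=
  ∑ j : Fin m, (MvPolynomial.C (eps p j.castSucc) * MvPolynomial.X j.castSucc) ⊗ₜ e p m j.castSucc

/-- The Clifford element `ε_n e_n ξ_n`. -/
def xiLast (p m : ℕ) : Poly m ⊗[ℂ] Cl p m :=
  (MvPolynomial.C (eps p (Fin.last m)) * MvPolynomial.X (Fin.last m)) ⊗ₜ e p m (Fin.last m)

/-- The parameter `α = -λ - n/2 + 1`, `n = m + 1`. -/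
def alpha (m : ℕ) (lam : ℂ) : ℂ := -lam - ((m + 1 : ℕ) : ℂ) / 2 + 1

/-- `F̃_{2N}`; for `N = 0` this is `1`, as `𝒞̃_{-1} = 0`. -/
def spinorF_even (p m : ℕ) (lam : ℂ) (N : ℕ) : Poly m ⊗[ℂ] Cl p m :=
  gegPoly p m (alpha m lam) (2 * N) ⊗ₜ 1
    + if N = 0 then 0 else gegPoly p m (alpha m lam) (2 * N - 1) ⊗ₜ 1 * (xiPrime p m * xiLast p m)

/-- `F̃_{2N+1}`. -/
def spinorF_odd (p m : ℕ) (lam : ℂ) (N : ℕ) : Poly m ⊗[ℂ] Cl p m :=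
  gegPoly p m (alpha m lam) (2 * N) ⊗ₜ 1 * xiPrime p m
    + (-lam - ((m + 1 : ℕ) : ℂ) / 2 + N + 1) •
        (gegPoly p m (alpha m lam) (2 * N + 1) ⊗ₜ 1 * xiLast p m)

/-- `F̃_K ∈ Pol[ξ_1, …, ξ_n] ⊗ Cl`. -/
def spinorF (p m : ℕ) (lam : ℂ) (K : ℕ) : Poly m ⊗[ℂ] Cl p m :=
  if Even K then spinorF_even p m lam (K / 2) else spinorF_odd p m lam (K / 2)

section Spinors

variable (p m : ℕ) (lam : ℂ) (S : Type*) [AddCommGroup S] [Module ℂ S] [Module (Cl p m) S]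
  [IsScalarTower ℂ (Cl p m) S]

/-- The map `s ↦ F̃_K · s`. -/
def spinorFMul (K : ℕ) : S →ₗ[ℂ] Poly m ⊗[ℂ] S where
  toFun s := (LinearMap.lTensor (Poly m) ((Algebra.lsmul ℂ ℂ S).toLinearMap.flip s))
    (spinorF p m lam K)
  map_add' s t := by rw [map_add, LinearMap.lTensor_add, LinearMap.add_apply]
  map_smul' c s := by
    rw [map_smul, LinearMap.lTensor_smul, LinearMap.smul_apply, RingHom.id_apply]

/-- The Dirac operator `D = ∑ e_k ∂_{ξ_k}`. -/
def dirac : Module.End ℂ (Poly m ⊗[ℂ] S) := ∑ k, act (e p m k) * dX k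

/-- The Dirac operator `D' = ∑_{k<n} e_k ∂_{ξ_k}` of the hyperplane `ξ_n = 0`. -/
def dirac' : Module.End ℂ (Poly m ⊗[ℂ] S) :=
  ∑ k : Fin m, act (e p m k.castSucc) * dX k.castSucc

variable {S}

/-- The polynomials with values in a subspace `W`. -/
def polyVal (m : ℕ) (W : Submodule ℂ S) : Submodule ℂ (Poly m ⊗[ℂ] S) :=
  LinearMap.range (W.subtype.lTensor (Poly m))

/-- The monogenic polynomials of degree `j` on `ℝ^{p-1,q-1}` with values in `W`. -/
def monogenic (j : ℕ) (W : Submodule ℂ S) : Submodule ℂ (Poly m ⊗[ℂ] S) :=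
  polyVal m W ⊓ LinearMap.ker (dirac p m S) ⊓ LinearMap.ker (euler - (j : ℂ) • 1)

/-- The monogenic polynomials of degree `i` on the hyperplane `ℝ^{p-1,q-2}` with values in `W`:
the polynomials are those not depending on `ξ_n`, the Dirac operator is `D'`. -/
def monogenic' (i : ℕ) (W : Submodule ℂ S) : Submodule ℂ (Poly m ⊗[ℂ] S) :=
  polyVal m W ⊓ LinearMap.ker (dirac' p m S) ⊓ LinearMap.ker (euler - (i : ℂ) • 1)
    ⊓ LinearMap.ker (dX (Fin.last m))

/-- `N` is isomorphic to `M` as a module over `𝔪' = 𝔰𝔬(n - 1, ℂ)`: it is the image of the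
`𝔪'`-module `M` under an injective linear map `T` which commutes with the action of `𝔪'`. -/
def IsCopy (M N : Submodule ℂ (Poly m ⊗[ℂ] S)) : Prop :=
  ∃ T : M →ₗ[ℂ] Poly m ⊗[ℂ] S, Function.Injective T ∧ LinearMap.range T = N ∧
    ∀ A ∈ mPrime p m, ∀ f : M, ∃ g : M,
      (g : Poly m ⊗[ℂ] S) = leviAct p m 0 S A (f : Poly m ⊗[ℂ] S) ∧
        T g = leviAct p m 0 S A (T f)

end Spinors

/-! ### The group `L̃' = Spin(p - 1, q - 2) × ℝ_{>0}` and its actions -/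

/-- `Spin(p-1, q-2)`, the group generated in the even Clifford algebra by the products `v w` of two
real vectors `v, w ∈ ℝ^{p-1,q-2} = {v_n = 0}` with `∑ ε_i v_i² = ±1` and `∑ ε_i w_i² = ±1`. -/
def spinPrime (p m : ℕ) : Subgroup (ClEven p m)ˣ :=
  Subgroup.closure {x | ∃ v w : Fin (m + 1) → ℝ, v (Fin.last m) = 0 ∧ w (Fin.last m) = 0 ∧
    (∑ i, eps p i * (v i : ℂ) ^ 2 = 1 ∨ ∑ i, eps p i * (v i : ℂ) ^ 2 = -1) ∧
    (∑ i, eps p i * (w i : ℂ) ^ 2 = 1 ∨ ∑ i, eps p i * (w i : ℂ) ^ 2 = -1) ∧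
    ((x : ClEven p m) : Cl p m) = vec p m (fun i => (v i : ℂ)) * vec p m (fun i => (w i : ℂ))}

theorem isUnit_vec (p m : ℕ) (v : Fin (m + 1) → ℂ)
    (hv : ∑ i, eps p i * v i ^ 2 = 1 ∨ ∑ i, eps p i * v i ^ 2 = -1) : IsUnit (vec p m v) := by
  have h : cliffordForm p m v = -∑ i, eps p i * v i ^ 2 := by
    rw [cliffordForm, QuadraticMap.weightedSumSquares_apply, ← Finset.sum_neg_distrib]
    exact Finset.sum_congr rfl fun i _ => by rw [smul_eq_mul]; ring
  have hu : IsUnit (vec p m v * vec p m v) := by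
    rw [CliffordAlgebra.ι_sq_scalar, h]
    refine IsUnit.map _ (isUnit_iff_ne_zero.2 ?_)
    rcases hv with hv | hv <;> rw [hv] <;> norm_num
  rw [← pow_two] at hu
  exact (isUnit_pow_iff two_ne_zero).1 hu

/-- The inclusion of the units of the even Clifford algebra. -/
def unitsVal (p m : ℕ) : (ClEven p m)ˣ →* (Cl p m)ˣ :=
  Units.map ((CliffordAlgebra.even (cliffordForm p m)).val : ClEven p m →* Cl p m)

theorem spinPrime_le (p m : ℕ) :
    spinPrime p m ≤ (lipschitzGroup (cliffordForm p m)).comap (unitsVal p m) := by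
  rw [spinPrime, Subgroup.closure_le]
  rintro x ⟨v, w, -, -, hv, hw, hx⟩
  obtain ⟨a, ha⟩ := isUnit_vec p m _ hv
  obtain ⟨b, hb⟩ := isUnit_vec p m _ hw
  have : unitsVal p m x = a * b := by
    ext
    rw [Units.val_mul, ha, hb, ← hx]
    rfl
  rw [SetLike.mem_coe, Subgroup.mem_comap, this]
  exact mul_mem (Subgroup.subset_closure ⟨_, ha.symm⟩) (Subgroup.subset_closure ⟨_, hb.symm⟩)

theorem spinPrime_conj (p m : ℕ) (x : spinPrime p m) (v : Fin (m + 1) → ℂ) :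
    ∃ w, ((x : (ClEven p m)ˣ) : Cl p m) * vec p m v * (((x : (ClEven p m)ˣ)⁻¹ : (ClEven p m)ˣ) : Cl p m)
      = vec p m w := by
  let _ : Invertible (2 : ℂ) := invertibleOfNonzero two_ne_zero
  obtain ⟨w, hw⟩ := lipschitzGroup.conjAct_smul_ι_mem_range_ι (spinPrime_le p m x.2) v
  exact ⟨w, hw.symm⟩

/-- The matrix of the vector representation `x ↦ (v ↦ x v x⁻¹)` of the spin group on `ℂ^n`. -/
def vecMat (p m : ℕ) (x : spinPrime p m) : Matrix (Fin (m + 1)) (Fin (m + 1)) ℂ :=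
  fun j k => (spinPrime_conj p m x (Pi.single k 1)).choose j

theorem vecMat_spec (p m : ℕ) (x : spinPrime p m) (k : Fin (m + 1)) :
    ((x : (ClEven p m)ˣ) : Cl p m) * e p m k * (((x : (ClEven p m)ˣ)⁻¹ : (ClEven p m)ˣ) : Cl p m)
      = ∑ j, vecMat p m x j k • e p m j := by
  rw [e, (spinPrime_conj p m x (Pi.single k 1)).choose_spec, vec_eq_sum]
  rfl

theorem inv_mul_coe (p m : ℕ) (x : (ClEven p m)ˣ) : ((x⁻¹ : (ClEven p m)ˣ) : Cl p m) * (x : Cl p m) = 1 :=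
  congrArg Subtype.val (Units.inv_mul x)

theorem mul_inv_coe (p m : ℕ) (x : (ClEven p m)ˣ) : (x : Cl p m) * ((x⁻¹ : (ClEven p m)ˣ) : Cl p m) = 1 :=
  congrArg Subtype.val (Units.mul_inv x)

theorem vecMat_conj_mul (p m : ℕ) (x : spinPrime p m) (k l : Fin (m + 1)) :
    ((x : (ClEven p m)ˣ) : Cl p m) * (e p m k * e p m l)
        * (((x : (ClEven p m)ˣ)⁻¹ : (ClEven p m)ˣ) : Cl p m)
      = ∑ i, ∑ j, (vecMat p m x i k * vecMat p m x j l) • (e p m i * e p m j) := by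
  set y : Cl p m := ((x : (ClEven p m)ˣ) : Cl p m) with hy
  set z : Cl p m := (((x : (ClEven p m)ˣ)⁻¹ : (ClEven p m)ˣ) : Cl p m) with hz
  have h : y * (e p m k * e p m l) * z = (y * e p m k * z) * (y * e p m l * z) := by
    have : z * y = 1 := inv_mul_coe p m x
    calc y * (e p m k * e p m l) * z = y * e p m k * 1 * e p m l * z := by noncomm_ring
      _ = _ := by rw [← this]; noncomm_ring
  rw [h, vecMat_spec, vecMat_spec, Finset.sum_mul]
  refine Finset.sum_congr rfl fun i _ => ?_
  rw [Finset.mul_sum]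
  exact Finset.sum_congr rfl fun j _ => by rw [smul_mul_smul_comm]

theorem vecMat_orth (p m : ℕ) (x : spinPrime p m) :
    (vecMat p m x).transpose * Matrix.diagonal (eps p) * vecMat p m x
      = Matrix.diagonal (eps p) := by
  let _ : Invertible (2 : ℂ) := invertibleOfNonzero two_ne_zero
  ext k l
  have h1 : ((x : (ClEven p m)ˣ) : Cl p m) * (e p m k * e p m l + e p m l * e p m k)
        * (((x : (ClEven p m)ˣ)⁻¹ : (ClEven p m)ˣ) : Cl p m)
      = algebraMap ℂ (Cl p m) (if k = l then -2 * eps p k else 0) := by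
    rw [e_mul_e_add_swap, ← Algebra.commutes, mul_assoc, mul_inv_coe, mul_one]
  have h2 : ((x : (ClEven p m)ˣ) : Cl p m) * (e p m k * e p m l + e p m l * e p m k)
        * (((x : (ClEven p m)ˣ)⁻¹ : (ClEven p m)ˣ) : Cl p m)
      = algebraMap ℂ (Cl p m) (∑ i, -2 * (vecMat p m x i k * eps p i * vecMat p m x i l)) := by
    rw [mul_add, add_mul, vecMat_conj_mul, vecMat_conj_mul,
      Finset.sum_comm (f := fun i j => (vecMat p m x i l * vecMat p m x j k) • (e p m i * e p m j)),
      ← Finset.sum_add_distrib, map_sum]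
    refine Finset.sum_congr rfl fun i _ => ?_
    rw [← Finset.sum_add_distrib]
    simp_rw [mul_comm (vecMat p m x _ l) (vecMat p m x i k), ← smul_add, e_mul_e_add_swap]
    rw [Finset.sum_eq_single i]
    · rw [if_pos rfl, Algebra.smul_def, ← map_mul]
      congr 1; ring
    · intro j _ hj
      rw [if_neg (Ne.symm hj), map_zero, smul_zero]
    · intro h; exact absurd (Finset.mem_univ i) h
  have h3 := (algebraMap ℂ (Cl p m)).injective (h2.symm.trans h1)
  rw [← Finset.mul_sum] at h3
  rw [Matrix.mul_apply, Matrix.diagonal_apply]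
  simp_rw [Matrix.mul_diagonal, Matrix.transpose_apply]
  by_cases hkl : k = l
  · rw [if_pos hkl] at h3 ⊢
    exact mul_left_cancel₀ (by norm_num) h3
  · rw [if_neg hkl] at h3 ⊢
    exact (mul_eq_zero.1 h3).resolve_left (by norm_num)

/-- The sign `ε(m) = ±1` which is `1` if and only if the image `m ∈ SO(p - 1, q - 2)` of the element
`x` of the spin group lies in the identity component; it is equal to the spinor norm `x xᵗ` of `x`,
where `xᵗ` is the reversal. -/
def spinSign (p m : ℕ) (x : spinPrime p m) : ℂ :=
  open Classical in
  if ((x : (ClEven p m)ˣ) : Cl p m) * CliffordAlgebra.reverse (((x : (ClEven p m)ˣ) : Cl p m)) = 1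
    then 1 else -1

theorem spinSign_sq (p m : ℕ) (x : spinPrime p m) : spinSign p m x * spinSign p m x = 1 := by
  unfold spinSign; split_ifs <;> norm_num

/-- `L̃' = Spin(p - 1, q - 2) × A` with `A = ℝ_{>0}`. -/
abbrev LeviGroup (p m : ℕ) : Type := spinPrime p m × {a : ℝ // 0 < a}

/-- The image `diag(ε(m) a, m, ε(m) a⁻¹)` (with respect to `ℂ e_0 ⊕ ℂ^n ⊕ ℂ e_{n+1}`) of an element
of `L̃'` in `SO_o(p, q)`. -/
def leviMat (p m : ℕ) (l : LeviGroup p m) : Matrix (Idx m) (Idx m) ℂ :=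
  Matrix.fromBlocks (vecMat p m l.1) 0 0
    (Matrix.diagonal ![spinSign p m l.1 * ((l.2 : ℝ) : ℂ), spinSign p m l.1 * ((l.2 : ℝ) : ℂ)⁻¹])

theorem gram_mul_gram (p m : ℕ) : gram p m * gram p m = 1 := by
  rw [gram, Matrix.fromBlocks_multiply, ← Matrix.fromBlocks_one]
  congr 1
  · simp [Matrix.diagonal_mul_diagonal, eps_mul_eps]
  · simp
  · simp
  · ext i j; fin_cases i <;> fin_cases j <;> simp [Matrix.mul_apply]

theorem gram_transpose (p m : ℕ) : (gram p m).transpose = gram p m := by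
  rw [gram, Matrix.fromBlocks_transpose]
  congr 1
  · simp
  · ext i j; fin_cases i <;> fin_cases j <;> simp

theorem leviMat_orth (p m : ℕ) (l : LeviGroup p m) :
    (leviMat p m l).transpose * gram p m * leviMat p m l = gram p m := by
  have ha : ((l.2 : ℝ) : ℂ) ≠ 0 := by exact_mod_cast l.2.2.ne'
  have hs := spinSign_sq p m l.1
  rw [leviMat, gram, Matrix.fromBlocks_transpose, Matrix.fromBlocks_multiply,
    Matrix.fromBlocks_multiply]
  congr 1
  · simpa using vecMat_orth p m l.1
  · simp
  · simp
  · ext i j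
    fin_cases i <;> fin_cases j <;>
      simp [Matrix.mul_apply, Matrix.diagonal_apply] <;> field_simp <;> linear_combination hs

/-- The inverse of `leviMat`. -/
def leviMatInv (p m : ℕ) (l : LeviGroup p m) : Matrix (Idx m) (Idx m) ℂ :=
  gram p m * (leviMat p m l).transpose * gram p m

theorem leviMatInv_mul (p m : ℕ) (l : LeviGroup p m) : leviMatInv p m l * leviMat p m l = 1 := by
  rw [leviMatInv, mul_assoc, mul_assoc, ← mul_assoc _ (gram p m), leviMat_orth, gram_mul_gram]

theorem leviConj_mem (p m : ℕ) (l : LeviGroup p m) {A : Matrix (Idx m) (Idx m) ℂ}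
    (hA : A ∈ so p m) : leviMat p m l * A * leviMatInv p m l ∈ so p m := by
  rw [mem_so_iff] at hA ⊢
  have h1 : gram p m * A.transpose = -(A * gram p m) := by
    calc gram p m * A.transpose = gram p m * (A.transpose * gram p m) * gram p m := by
          rw [mul_assoc, mul_assoc, gram_mul_gram, mul_one]
      _ = -((gram p m * gram p m) * A * gram p m) := by rw [hA]; noncomm_ring
      _ = _ := by rw [gram_mul_gram, one_mul]
  have h2 : (leviMat p m l * A * leviMatInv p m l).transpose * gram p m
      = gram p m * leviMat p m l * (gram p m * A.transpose) * (leviMat p m l).transpose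
        * gram p m := by
    simp only [leviMatInv, Matrix.transpose_mul, Matrix.transpose_transpose, gram_transpose,
      mul_assoc]
  rw [h2, h1, leviMatInv]
  noncomm_ring

/-- The adjoint action of `L̃'` on `𝔤`. -/
def leviAd (p m : ℕ) (l : LeviGroup p m) : so p m →ₗ⁅ℂ⁆ so p m where
  toFun A := ⟨leviMat p m l * (A : Matrix (Idx m) (Idx m) ℂ) * leviMatInv p m l,
    leviConj_mem p m l A.2⟩
  map_add' A B := by
    apply Subtype.ext
    simp [mul_add, add_mul]
  map_smul' c A := by
    apply Subtype.ext
    simp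
  map_lie' {A B} := by
    apply Subtype.ext
    have key : ∀ X Y : Matrix (Idx m) (Idx m) ℂ,
        (leviMat p m l * X * leviMatInv p m l) * (leviMat p m l * Y * leviMatInv p m l)
          = leviMat p m l * (X * Y) * leviMatInv p m l := by
      intro X Y
      calc _ = leviMat p m l * X * (leviMatInv p m l * leviMat p m l) * Y * leviMatInv p m l := by
            simp only [mul_assoc]
        _ = _ := by rw [leviMatInv_mul]; simp only [mul_assoc, one_mul]
    simp only [LieSubalgebra.coe_bracket, LieRing.of_associative_ring_bracket, key]
    rw [mul_sub, sub_mul]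

/-- The adjoint action of `L̃'` on `U(𝔤)`. -/
def leviAdEnv (p m : ℕ) (l : LeviGroup p m) : Env p m →ₐ[ℂ] Env p m :=
  UniversalEnvelopingAlgebra.lift ℂ ((UniversalEnvelopingAlgebra.ι ℂ).comp (leviAd p m l))

theorem leviMatInv_eq (p m : ℕ) (l : LeviGroup p m) :
    leviMatInv p m l = Matrix.fromBlocks
      (Matrix.diagonal (eps p) * (vecMat p m l.1).transpose * Matrix.diagonal (eps p)) 0 0
      (Matrix.diagonal ![spinSign p m l.1 * ((l.2 : ℝ) : ℂ)⁻¹,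
        spinSign p m l.1 * ((l.2 : ℝ) : ℂ)]) := by
  rw [leviMatInv, leviMat, gram, Matrix.fromBlocks_transpose, Matrix.fromBlocks_multiply,
    Matrix.fromBlocks_multiply]
  congr 1
  · simp
  · simp
  · simp
  · ext i j
    fin_cases i <;> fin_cases j <;>
      simp [Matrix.mul_apply, Matrix.diagonal_apply, Matrix.vecMul, dotProduct, Fin.sum_univ_two]

theorem leviConj_apply (p m : ℕ) (l : LeviGroup p m) (A : Matrix (Idx m) (Idx m) ℂ) :
    leviMat p m l * A * leviMatInv p m l = Matrix.fromBlocks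
      (vecMat p m l.1 * A.toBlocks₁₁
        * (Matrix.diagonal (eps p) * (vecMat p m l.1).transpose * Matrix.diagonal (eps p)))
      (vecMat p m l.1 * A.toBlocks₁₂ * Matrix.diagonal ![spinSign p m l.1 * ((l.2 : ℝ) : ℂ)⁻¹,
        spinSign p m l.1 * ((l.2 : ℝ) : ℂ)])
      (Matrix.diagonal ![spinSign p m l.1 * ((l.2 : ℝ) : ℂ),
        spinSign p m l.1 * ((l.2 : ℝ) : ℂ)⁻¹] * A.toBlocks₂₁
        * (Matrix.diagonal (eps p) * (vecMat p m l.1).transpose * Matrix.diagonal (eps p)))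
      (Matrix.diagonal ![spinSign p m l.1 * ((l.2 : ℝ) : ℂ),
        spinSign p m l.1 * ((l.2 : ℝ) : ℂ)⁻¹] * A.toBlocks₂₂
        * Matrix.diagonal ![spinSign p m l.1 * ((l.2 : ℝ) : ℂ)⁻¹,
          spinSign p m l.1 * ((l.2 : ℝ) : ℂ)]) := by
  conv_lhs => rw [← Matrix.fromBlocks_toBlocks A]
  rw [leviMatInv_eq, leviMat, Matrix.fromBlocks_multiply, Matrix.fromBlocks_multiply]
  simp

theorem leviAd_corner (p m : ℕ) (l : LeviGroup p m) (A : so p m) :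
    (leviAd p m l A : Matrix (Idx m) (Idx m) ℂ) (Sum.inr 0) (Sum.inr 0)
      = (A : Matrix (Idx m) (Idx m) ℂ) (Sum.inr 0) (Sum.inr 0) := by
  have ha : ((l.2 : ℝ) : ℂ) ≠ 0 := by exact_mod_cast l.2.2.ne'
  have h : (leviAd p m l A : Matrix (Idx m) (Idx m) ℂ)
      = leviMat p m l * (A : Matrix (Idx m) (Idx m) ℂ) * leviMatInv p m l := rfl
  rw [h, leviConj_apply, Matrix.fromBlocks_apply₂₂, Matrix.mul_diagonal, Matrix.diagonal_mul]
  simp only [Matrix.toBlocks₂₂, Matrix.of_apply, Matrix.cons_val_zero]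
  field_simp
  linear_combination (A : Matrix (Idx m) (Idx m) ℂ) (Sum.inr 0) (Sum.inr 0) * spinSign_sq p m l.1

theorem leviAd_parabolic (p m : ℕ) (l : LeviGroup p m) (A : parabolic p m) :
    leviAd p m l A ∈ parabolic p m := by
  intro i hi
  have h : (leviAd p m l A : Matrix (Idx m) (Idx m) ℂ)
      = leviMat p m l * (A : Matrix (Idx m) (Idx m) ℂ) * leviMatInv p m l := rfl
  rw [h, leviConj_apply]
  rcases i with i | i
  · rw [Matrix.fromBlocks_apply₁₂, Matrix.mul_diagonal, Matrix.mul_apply,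
      Finset.sum_eq_zero, zero_mul]
    intro k _
    have : (A : Matrix (Idx m) (Idx m) ℂ) (Sum.inl k) (Sum.inr 0) = 0 := A.2 _ (by simp)
    simp [Matrix.toBlocks₁₂, this]
  · rw [Matrix.fromBlocks_apply₂₂, Matrix.mul_diagonal, Matrix.diagonal_mul]
    have : (A : Matrix (Idx m) (Idx m) ℂ) (Sum.inr i) (Sum.inr 0) = 0 := A.2 _ hi
    simp [Matrix.toBlocks₂₂, this]

theorem sum_comm_four {ι M : Type*} [Fintype ι] [AddCommMonoid M] (f : ι → ι → ι → ι → M) :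
    ∑ a, ∑ b, ∑ j, ∑ k, f a b j k = ∑ j, ∑ k, ∑ a, ∑ b, f a b j k := by
  have h : ∀ a, ∑ b, ∑ j, ∑ k, f a b j k = ∑ j, ∑ k, ∑ b, f a b j k := fun a => by
    rw [Finset.sum_comm]
    exact Finset.sum_congr rfl fun j _ => Finset.sum_comm
  simp_rw [h]
  rw [Finset.sum_comm]
  exact Finset.sum_congr rfl fun j _ => Finset.sum_comm

theorem spinEl_conj (p m : ℕ) (l : LeviGroup p m) (A : so p m) :
    spinEl p m (leviAd p m l A : Matrix (Idx m) (Idx m) ℂ).toBlocks₁₁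
        * ((l.1 : (ClEven p m)ˣ) : ClEven p m)
      = ((l.1 : (ClEven p m)ˣ) : ClEven p m)
        * spinEl p m (A : Matrix (Idx m) (Idx m) ℂ).toBlocks₁₁ := by
  have h : (leviAd p m l A : Matrix (Idx m) (Idx m) ℂ)
      = leviMat p m l * (A : Matrix (Idx m) (Idx m) ℂ) * leviMatInv p m l := rfl
  rw [h, leviConj_apply, Matrix.toBlocks_fromBlocks₁₁]
  set B := (A : Matrix (Idx m) (Idx m) ℂ).toBlocks₁₁
  apply Subtype.ext
  set x : Cl p m := ((l.1 : (ClEven p m)ˣ) : Cl p m) with hx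
  set y : Cl p m := (((l.1 : (ClEven p m)ˣ)⁻¹ : (ClEven p m)ˣ) : Cl p m) with hy
  have hyx : y * x = 1 := inv_mul_coe p m l.1
  suffices H : (spinEl p m (vecMat p m l.1 * B
      * (Matrix.diagonal (eps p) * (vecMat p m l.1).transpose * Matrix.diagonal (eps p))) : Cl p m)
      = x * (spinEl p m B : Cl p m) * y by
    change (spinEl p m _ : Cl p m) * x = x * (spinEl p m B : Cl p m)
    rw [H, mul_assoc, hyx, mul_one]
  rw [coe_spinEl, coe_spinEl, mul_smul_comm, smul_mul_assoc]
  congr 1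
  have hR : x * (∑ a, ∑ b, (eps p b * B a b) • (e p m a * e p m b)) * y
      = ∑ a, ∑ b, ∑ j, ∑ k,
        ((eps p b * B a b) * (vecMat p m l.1 j a * vecMat p m l.1 k b))
          • (e p m j * e p m k) := by
    rw [Finset.mul_sum, Finset.sum_mul]
    refine Finset.sum_congr rfl fun a _ => ?_
    rw [Finset.mul_sum, Finset.sum_mul]
    refine Finset.sum_congr rfl fun b _ => ?_
    rw [mul_smul_comm, smul_mul_assoc, vecMat_conj_mul]
    simp_rw [Finset.smul_sum, smul_smul]
  rw [hR, sum_comm_four]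
  refine Finset.sum_congr rfl fun j _ => ?_
  refine Finset.sum_congr rfl fun k _ => ?_
  simp_rw [← Finset.sum_smul]
  congr 1
  rw [Matrix.mul_apply, Finset.mul_sum, Finset.sum_comm]
  refine Finset.sum_congr rfl fun b _ => ?_
  rw [Matrix.mul_apply, Matrix.mul_diagonal, Matrix.diagonal_mul, Matrix.transpose_apply,
    Finset.sum_mul, Finset.mul_sum]
  refine Finset.sum_congr rfl fun a _ => ?_
  linear_combination (vecMat p m l.1 j a * B a b * eps p b * vecMat p m l.1 k b) * eps_mul_eps p k

section Actions

variable (p m : ℕ) (lam : ℂ) (V : Type*) [AddCommGroup V] [Module ℂ V] [Module (ClEven p m) V]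
  [IsScalarTower ℂ (ClEven p m) V]

/-- The representation of `L̃'` on `V_λ`: `(x, a)` acts by `v ↦ a^λ x v`. -/
def leviRep (l : LeviGroup p m) : Module.End ℂ V :=
  (((l.2 : ℝ) : ℂ) ^ lam) • Algebra.lsmul ℂ ℂ V ((l.1 : (ClEven p m)ˣ) : ClEven p m)

/-- The action of `L̃'` on `Pol[𝔫₊] ⊗ V_λ`: on polynomials by
`ξ_k ↦ ε(m) a⁻¹ ∑_j m_{jk} ξ_j` (i.e. `f ↦ f(Ad(l)⁻¹ ·)`), and on `V_λ` by the given action. -/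
def polyAct (l : LeviGroup p m) : Module.End ℂ (Poly m ⊗[ℂ] V) :=
  TensorProduct.map
    (MvPolynomial.aeval fun k => (spinSign p m l.1 * ((l.2 : ℝ) : ℂ)⁻¹) •
      ∑ j, vecMat p m l.1 j k • (MvPolynomial.X j : Poly m)).toLinearMap
    (leviRep p m lam V l)

/-- `u ⊗ v ↦ Ad(l) u ⊗ l v` on `U(𝔤) ⊗ V`. -/
def envAct (l : LeviGroup p m) : Module.End ℂ (Env p m ⊗[ℂ] V) :=
  TensorProduct.map (leviAdEnv p m l).toLinearMap (leviRep p m lam V l)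

theorem envAct_mem (l : LeviGroup p m) (y : Env p m ⊗[ℂ] V) (hy : y ∈ vermaRel p m lam V) :
    envAct p m lam V l y ∈ vermaRel p m lam V := by
  have hsmul : ∀ (u : Env p m) (y : Env p m ⊗[ℂ] V),
      envAct p m lam V l (u • y) = leviAdEnv p m l u • envAct p m lam V l y := by
    intro u y
    induction y with
    | zero => simp
    | tmul w v => simp [envAct, TensorProduct.smul_tmul']
    | add a b ha hb => rw [smul_add, map_add, ha, hb, map_add, smul_add]
  refine Submodule.span_induction ?_ ?_ ?_ ?_ hy
  · rintro _ ⟨x, v, rfl⟩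
    have h1 : leviAdEnv p m l (UniversalEnvelopingAlgebra.ι ℂ (x : so p m))
        = UniversalEnvelopingAlgebra.ι ℂ (leviAd p m l x) := by
      rw [leviAdEnv, UniversalEnvelopingAlgebra.lift_ι_apply]; rfl
    have h2 : leviRep p m lam V l (spinRep p m lam V x v)
        = spinRep p m lam V ⟨leviAd p m l x, leviAd_parabolic p m l x⟩
          (leviRep p m lam V l v) := by
      have h3 := leviAd_corner p m l x
      have h4 := spinEl_conj p m l x
      change leviRep p m lam V l
          ((lam * (x : Matrix (Idx m) (Idx m) ℂ) (Sum.inr 0) (Sum.inr 0)) • v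
            + spinEl p m (x : Matrix (Idx m) (Idx m) ℂ).toBlocks₁₁ • v)
        = (lam * (leviAd p m l x : Matrix (Idx m) (Idx m) ℂ) (Sum.inr 0) (Sum.inr 0))
            • leviRep p m lam V l v
          + spinEl p m (leviAd p m l x : Matrix (Idx m) (Idx m) ℂ).toBlocks₁₁
            • leviRep p m lam V l v
      have h5 : ∀ w, leviRep p m lam V l w
          = (((l.2 : ℝ) : ℂ) ^ lam) • (((l.1 : (ClEven p m)ˣ) : ClEven p m) • w) := fun w => rfl
      rw [h3, map_add, map_smul]
      congr 1
      rw [h5, h5, smul_comm (spinEl p m _), smul_smul, smul_smul, h4]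
    refine Submodule.subset_span
      ⟨⟨leviAd p m l x, leviAd_parabolic p m l x⟩, leviRep p m lam V l v, ?_⟩
    rw [← h2, map_sub, envAct, TensorProduct.map_tmul, TensorProduct.map_tmul,
      AlgHom.toLinearMap_apply, AlgHom.toLinearMap_apply, h1, map_one]
  · simp
  · intro a b _ _ ha hb
    rw [map_add]; exact Submodule.add_mem _ ha hb
  · intro u y _ h
    rw [hsmul]; exact Submodule.smul_mem _ _ h

/-- The action of `L̃'` on the generalized Verma module, induced by `u ⊗ v ↦ Ad(l) u ⊗ l v`. -/
def vermaAct (l : LeviGroup p m) : Module.End ℂ (Verma p m lam V) :=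
  ((vermaRel p m lam V).restrictScalars ℂ).mapQ ((vermaRel p m lam V).restrictScalars ℂ)
    (envAct p m lam V l) (envAct_mem p m lam V l)

end Actions

section Results

variable (p m : ℕ) (lam : ℂ)

/-- The inverse Fourier transform `φ` turns the operators `dpi` into the action of the basis vectors
`E_j` of `𝔫₊`, and restricts to a bijection from `Sol(𝔤, 𝔤'; V_λ)` onto the space of singular
vectors which is an isomorphism of modules over `L̃'` and over `𝔩'`. -/
structure IsFourierIso (V : Type*) [AddCommGroup V] [Module ℂ V] [Module (ClEven p m) V]
    [IsScalarTower ℂ (ClEven p m) V] : Prop where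
  intertwines : ∀ (j : Fin (m + 1)) (f : Poly m ⊗[ℂ] V),
    fourierInv p m lam V (dpi p m lam V j f)
      = (UniversalEnvelopingAlgebra.ι ℂ (nPlusBasis p m j) : Env p m) • fourierInv p m lam V f
  bijOn : Set.BijOn (fourierInv p m lam V) (Sol p m lam V) (singular p m lam V)
  group_equivariant : ∀ (l : LeviGroup p m), ∀ f ∈ Sol p m lam V,
    polyAct p m lam V l f ∈ Sol p m lam V ∧
      fourierInv p m lam V (polyAct p m lam V l f)
        = vermaAct p m lam V l (fourierInv p m lam V f)
  lie_equivariant : ∀ A ∈ leviPrime p m, ∀ f ∈ Sol p m lam V,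
    leviAct p m lam V A f ∈ Sol p m lam V ∧
      fourierInv p m lam V (leviAct p m lam V A f)
        = (UniversalEnvelopingAlgebra.ι ℂ A : Env p m) • fourierInv p m lam V f

variable {S : Type*} [AddCommGroup S] [Module ℂ S] [Module (Cl p m) S]
  [IsScalarTower ℂ (Cl p m) S]

/-- `N` is stable under `L̃'` and under `𝔩'`. -/
def IsLeviStable (N : Submodule ℂ (Poly m ⊗[ℂ] S)) : Prop :=
  (∀ (l : LeviGroup p m), ∀ f ∈ N, polyAct p m lam S l f ∈ N) ∧
    ∀ A ∈ leviPrime p m, ∀ f ∈ N, leviAct p m lam S A f ∈ N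

/-- The space `{F̃_K · s : s ∈ W}`. -/
def spinorFSpace (K : ℕ) (W : Submodule ℂ S) : Submodule ℂ (Poly m ⊗[ℂ] S) :=
  W.map (spinorFMul p m lam S K)

variable (S)

/-- The half-spin space `𝕊_ε` as a complex vector space. -/
def halfSpinC (ε : ℤˣ) : Submodule ℂ S := (halfSpin p m S ε).restrictScalars ℂ

/-- `Sol(𝔤, 𝔤'; 𝕊_{ε,λ})` (for `n` even), regarded as a space of `𝕊`-valued polynomials. -/
def halfSol (ε : ℤˣ) : Submodule ℂ (Poly m ⊗[ℂ] S) :=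
  (Sol p m lam (halfSpin p m S ε)).map
    (((halfSpin p m S ε).subtype.restrictScalars ℂ).lTensor (Poly m))

variable {S}

/-- The branching law for `n` odd: the subspaces `N i ε` are the summands in a decomposition of the
monogenic polynomials of degree `j` into a direct sum of `𝔪'`-submodules such that `N i ε` is
isomorphic to the space of monogenic polynomials of degree `i` on `ℝ^{p-1,q-2}` with values in
`𝕊^{n-1}_ε`. -/
def IsBranchingOdd (j : ℕ) (N : Fin (j + 1) → ℤˣ → Submodule ℂ (Poly m ⊗[ℂ] S)) : Prop :=
  (∀ (i : Fin (j + 1)) (ε : ℤˣ), IsCopy p m (monogenic' p m i (halfSpin' p m S ε)) (N i ε)) ∧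
    iSupIndep (fun x : Fin (j + 1) × ℤˣ => N x.1 x.2) ∧
    (⨆ x : Fin (j + 1) × ℤˣ, N x.1 x.2) = monogenic p m j (⊤ : Submodule ℂ S)

/-- The branching law for `n` even: the subspaces `N i` are the summands in a decomposition of the
`𝕊_ε`-valued monogenic polynomials of degree `j` into a direct sum of `𝔪'`-submodules such that
`N i` is isomorphic to the space of monogenic polynomials of degree `i` on `ℝ^{p-1,q-2}` with values
in `𝕊^{n-1}`. The spin space `𝕊^{n-1}` is realized as `𝕊_ε`; as `e_n` commutes with `𝔪'`, maps
`𝕊_{-ε}` isomorphically onto `𝕊_ε` and anticommutes with `D'`, the operators `D'` and `e_n D'`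
have the same kernel, the second one being the Dirac operator on `𝕊^{n-1}`-valued polynomials. -/
def IsBranchingEven (ε : ℤˣ) (j : ℕ) (N : Fin (j + 1) → Submodule ℂ (Poly m ⊗[ℂ] S)) : Prop :=
  (∀ i : Fin (j + 1), IsCopy p m (monogenic' p m i (halfSpinC p m S ε)) (N i)) ∧
    iSupIndep N ∧ (⨆ i, N i) = monogenic p m j (halfSpinC p m S ε)

end Results

end

end SpinorSingular

open SpinorSingular

/-! Throughout `n = m + 1`, and `q ≥ 2` gives `ε_n = -1`, so `e_n² = 1`. Write `r = ∑_{j<n} ε_j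
ξ_j²`, and write `D'`, `□'`, `E'`, `ξ'` for the Dirac operator, Laplacian, Euler operator and
Clifford multiplication in `ξ_1, …, ξ_{n-1}`.

Fourier transform. Let `F_j` act on `Pol ⊗ V` by `iξ_j`, `E_j` by `P_j`, and `𝔩` in the natural way
(`polyRep`). The only commutators computed by hand are those with `iξ_k` (`polyRep_mul_mulX`): the
second-order operator `P_j` then leaves a first-order operator, which is the action of `[E_j, F_k] ∈
𝔩`. The constants form a copy of the `𝔭`-module `V_λ`, and multiplication by the `ξ_k` generates
everything from them, so the Jacobi identity spreads the representation property to all of `Pol ⊗ V`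
(`mem_lieCompat`). The map `u ⊗ v ↦ u (1 ⊗ v)` then descends to the generalized Verma module and
inverts `φ`; no PBW basis is needed. Singular vectors thus correspond to `Sol`, and `L̃'`, `𝔩'`
preserve both because they normalize `𝔫₊'`.

Gegenbauer solutions. Every `F̃_K s` has the form `a ⊗ σ + ξ'(b ⊗ e_n σ)` with `a`, `b` polynomials
in `r` and `ξ_n`. The coefficient recursions amount to two first-order relations between `a` and `b`
(`IsRadialPair`). With `f = F̃_K s`, `μ = λ - K + 1/2` and `B = b ⊗ e_n σ` they give `D f = 2μ B`
and, for `G = D B`, `∂_j f = ε_j (ξ_j G + e_j B)`. As `D² = -□`, the three terms of `P_j f` cancel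
(`radialSpinor_mem_Sol`). The sum over `K` is direct by degree.

Exhaustion. `∂_n` maps solutions for `λ` to solutions for `λ - 1`. If a solution of degree `d > 0`
does not depend on `ξ_n`, then contracting the equations with `e_j` and with `ξ_j` yields `(2μ + m +
d - 1)(μ + m - 1) D' f = 0`, now with `μ = λ - d + 1/2`, and for the generic parameters `f = 0`. So
a solution of degree `K` is determined by the constant spinor `∂_n^K f`, and `F̃_K` attains every
such spinor since its coefficient of `ξ_n^K` is nonzero (`Sol_eq_iSup`). For half-spin spaces one
projects with the volume element.

Half-integral parameters. For a monogenic polynomial of degree `λ + 1/2` each term of `P_j` vanishes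
separately. The Casimir operator of `𝔪'` acts on all `F̃_K s` as on spinors and by a different
scalar on a copy of monogenics of degree `i ≥ 1`, so the additional sum is direct. The branching law
comes from the Cauchy-Kovalevskaya extension `exp(-ξ_n e_n D')`, which identifies monogenics of
degree `j` with polynomials of degree `j` on `ξ_n = 0`, together with the Fischer decomposition of
the latter into powers of `e_n ξ'` times monogenics. -/

namespace SpinorSingular

noncomputable section

/-! ### Commutation relations of coordinates, derivatives and pointwise actions -/

section OperatorCalculus

variable {m : ℕ} {V : Type*} [AddCommGroup V] [Module ℂ V]

/-- The ring structure on `Module.End ℂ (Poly m ⊗[ℂ] V)` whose subtraction is syntactically that of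
linear maps. -/
instance (priority := 2000) polyEndRing : Ring (Module.End ℂ (Poly m ⊗[ℂ] V)) :=
  { (inferInstance : Semiring (Module.End ℂ (Poly m ⊗[ℂ] V))) with
    neg := fun f => -f
    sub := fun f g => f - g
    sub_eq_add_neg := fun f g => sub_eq_add_neg f g
    zsmul := fun n f => n • f
    zsmul_zero' := fun f => zero_zsmul f
    zsmul_succ' := fun n f => SubNegMonoid.zsmul_succ' n f
    zsmul_neg' := fun n f => SubNegMonoid.zsmul_neg' n f
    neg_add_cancel := fun f => neg_add_cancel f
    intCast := Int.castDef
    intCast_ofNat := fun _ => rfl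
    intCast_negSucc := fun _ => rfl }

@[simp] theorem dX_tmul (j : Fin (m + 1)) (f : Poly m) (v : V) :
    dX j (f ⊗ₜ[ℂ] v) = MvPolynomial.pderiv j f ⊗ₜ[ℂ] v := rfl

@[simp] theorem mulX_tmul (j : Fin (m + 1)) (f : Poly m) (v : V) :
    mulX j (f ⊗ₜ[ℂ] v) = (MvPolynomial.X j * f) ⊗ₜ[ℂ] v := rfl

theorem mulX_mul_mulX (j k : Fin (m + 1)) :
    (mulX j * mulX k : Module.End ℂ (Poly m ⊗[ℂ] V)) = mulX k * mulX j := by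
  refine TensorProduct.ext' fun f v => ?_
  simp only [Module.End.mul_apply, mulX_tmul]
  rw [mul_left_comm]

/-- The commutator of two derivations is again a derivation, and a derivation of a polynomial ring
is determined by its values on the variables, where this one vanishes. -/
theorem pderiv_comm (j k : Fin (m + 1)) (f : Poly m) :
    MvPolynomial.pderiv j (MvPolynomial.pderiv k f)
      = MvPolynomial.pderiv k (MvPolynomial.pderiv j f) := by
  have h : ⁅MvPolynomial.pderiv (R := ℂ) j, MvPolynomial.pderiv k⁆
      = (0 : Derivation ℂ (Poly m) (Poly m)) := by
    refine MvPolynomial.derivation_ext fun i => ?_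
    rw [Derivation.commutator_apply, MvPolynomial.pderiv_X, MvPolynomial.pderiv_X]
    simp [Pi.single_apply, apply_ite]
  have := congrArg (fun d => d f) h
  simpa [Derivation.commutator_apply, sub_eq_zero] using this

theorem dX_mul_dX (j k : Fin (m + 1)) :
    (dX j * dX k : Module.End ℂ (Poly m ⊗[ℂ] V)) = dX k * dX j := by
  refine TensorProduct.ext' fun f v => ?_
  simp only [Module.End.mul_apply, dX_tmul, pderiv_comm j k]

theorem dX_mul_mulX (j k : Fin (m + 1)) :
    (dX j * mulX k : Module.End ℂ (Poly m ⊗[ℂ] V))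
      = mulX k * dX j + if j = k then 1 else 0 := by
  refine TensorProduct.ext' fun f v => ?_
  have : (Pi.single j 1 : Fin (m + 1) → Poly m) k = if j = k then 1 else 0 := by
    rw [Pi.single_apply]; simp only [eq_comm]
  simp only [Module.End.mul_apply, mulX_tmul, dX_tmul, LinearMap.add_apply]
  rw [Derivation.leibniz, MvPolynomial.pderiv_X, this, TensorProduct.add_tmul, smul_eq_mul]
  congr 1
  split_ifs <;> simp

section Act

variable {A : Type*} [Ring A] [Algebra ℂ A] [Module A V] [IsScalarTower ℂ A V]

@[simp] theorem act_tmul (a : A) (f : Poly m) (v : V) :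
    act a (f ⊗ₜ[ℂ] v) = f ⊗ₜ[ℂ] (a • v) := rfl

theorem act_mul_mulX (a : A) (j : Fin (m + 1)) :
    (act a * mulX j : Module.End ℂ (Poly m ⊗[ℂ] V)) = mulX j * act a :=
  TensorProduct.ext' fun _ _ => rfl

theorem act_mul_dX (a : A) (j : Fin (m + 1)) :
    (act a * dX j : Module.End ℂ (Poly m ⊗[ℂ] V)) = dX j * act a :=
  TensorProduct.ext' fun _ _ => rfl

theorem act_mul (a b : A) :
    (act (a * b) : Module.End ℂ (Poly m ⊗[ℂ] V)) = act a * act b :=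
  TensorProduct.ext' fun f v => by simp [mul_smul]

theorem act_add (a b : A) :
    (act (a + b) : Module.End ℂ (Poly m ⊗[ℂ] V)) = act a + act b := by
  simp [act]

theorem act_sub (a b : A) :
    (act (a - b) : Module.End ℂ (Poly m ⊗[ℂ] V)) = act a - act b := by
  simp [act]

theorem act_zero : (act (0 : A) : Module.End ℂ (Poly m ⊗[ℂ] V)) = 0 := by
  simp [act]

theorem act_smul (c : ℂ) (a : A) :
    (act (c • a) : Module.End ℂ (Poly m ⊗[ℂ] V)) = c • act a := by
  simp [act]

theorem act_sum {ι : Type*} (s : Finset ι) (a : ι → A) :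
    (act (∑ i ∈ s, a i) : Module.End ℂ (Poly m ⊗[ℂ] V)) = ∑ i ∈ s, act (a i) :=
  TensorProduct.ext' fun f v => by
    simp [Finset.sum_smul, TensorProduct.tmul_sum, LinearMap.sum_apply]

theorem act_one : (act (1 : A) : Module.End ℂ (Poly m ⊗[ℂ] V)) = 1 :=
  TensorProduct.ext' fun f v => by simp

theorem act_algebraMap (c : ℂ) :
    (act (algebraMap ℂ A c) : Module.End ℂ (Poly m ⊗[ℂ] V)) = c • 1 := by
  rw [Algebra.algebraMap_eq_smul_one, act_smul, act_one]

end Act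

/-- To prove a statement about all `V`-valued polynomials it suffices to consider constants, sums
and multiples by the coordinates. -/
theorem polyTensor_induction {P : Poly m ⊗[ℂ] V → Prop} (hC : ∀ v, P (1 ⊗ₜ v))
    (hadd : ∀ f g, P f → P g → P (f + g)) (hX : ∀ k f, P f → P (mulX k f)) (f : Poly m ⊗[ℂ] V) :
    P f := by
  induction f with
  | zero => simpa using hC 0
  | add f g hf hg => exact hadd _ _ hf hg
  | tmul q v =>
    induction q using MvPolynomial.induction_on generalizing v with
    | C a =>
      have : (MvPolynomial.C a : Poly m) ⊗ₜ[ℂ] v = 1 ⊗ₜ (a • v) := by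
        rw [← mul_one (MvPolynomial.C a), ← MvPolynomial.smul_eq_C_mul, TensorProduct.smul_tmul]
      rw [this]; exact hC _
    | add q r hq hr => rw [TensorProduct.add_tmul]; exact hadd _ _ (hq v) (hr v)
    | mul_X q k hq =>
      rw [mul_comm, ← mulX_tmul]; exact hX k _ (hq v)

theorem euler_mul_mulX (k : Fin (m + 1)) :
    (euler * mulX k : Module.End ℂ (Poly m ⊗[ℂ] V)) = mulX k * euler + mulX k := by
  have h : ∀ j, (mulX j * dX j * mulX k : Module.End ℂ (Poly m ⊗[ℂ] V))
      = mulX k * (mulX j * dX j) + if j = k then mulX j else 0 := fun j => by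
    rw [mul_assoc, dX_mul_mulX, mul_add, ← mul_assoc, ← mul_assoc, mulX_mul_mulX j k]
    congr 1
    split_ifs <;> simp
  rw [euler, Finset.sum_mul, Finset.mul_sum, Finset.sum_congr rfl fun j _ => h j,
    Finset.sum_add_distrib]
  simp

theorem dX_mul_euler (k : Fin (m + 1)) :
    (dX k * euler : Module.End ℂ (Poly m ⊗[ℂ] V)) = euler * dX k + dX k := by
  have h : ∀ j, (dX k * (mulX j * dX j) : Module.End ℂ (Poly m ⊗[ℂ] V))
      = mulX j * dX j * dX k + if k = j then dX j else 0 := fun j => by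
    rw [← mul_assoc, dX_mul_mulX, add_mul, mul_assoc, mul_assoc, dX_mul_dX k j]
    congr 1
    split_ifs <;> simp
  rw [euler, Finset.sum_mul, Finset.mul_sum, Finset.sum_congr rfl fun j _ => h j,
    Finset.sum_add_distrib]
  simp

theorem box_mul_mulX (p : ℕ) (k : Fin (m + 1)) :
    (box p * mulX k : Module.End ℂ (Poly m ⊗[ℂ] V))
      = mulX k * box p + (2 * eps p k) • dX k := by
  have h : ∀ j, (eps p j • (dX j * dX j) * mulX k : Module.End ℂ (Poly m ⊗[ℂ] V))
      = mulX k * (eps p j • (dX j * dX j)) + if j = k then (2 * eps p j) • dX j else 0 := fun j => by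
    rw [smul_mul_assoc, mul_assoc, dX_mul_mulX, mul_add, ← mul_assoc, dX_mul_mulX, add_mul,
      mul_smul_comm, mul_assoc, add_assoc, smul_add]
    congr 1
    split_ifs with hj
    · subst hj; simp [two_mul, add_smul]
    · simp
  rw [box, Finset.sum_mul, Finset.mul_sum, Finset.sum_congr rfl fun j _ => h j,
    Finset.sum_add_distrib]
  simp

/-- The first-order operator `∑ B_{jk} ξ_j ∂_k` commutes with `ξ_k` up to the action of `B`. -/
theorem linVF_mul_mulX (B : Matrix (Fin (m + 1)) (Fin (m + 1)) ℂ) (k : Fin (m + 1)) :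
    ((∑ a, ∑ b, B a b • (mulX a * dX b)) * mulX k : Module.End ℂ (Poly m ⊗[ℂ] V))
      = mulX k * (∑ a, ∑ b, B a b • (mulX a * dX b)) + ∑ a, B a k • mulX a := by
  have h : ∀ a b, (B a b • (mulX a * dX b) * mulX k : Module.End ℂ (Poly m ⊗[ℂ] V))
      = mulX k * (B a b • (mulX a * dX b)) + if b = k then B a b • mulX a else 0 := fun a b => by
    rw [smul_mul_assoc, mul_assoc, dX_mul_mulX, mul_add, ← mul_assoc, mulX_mul_mulX a k,
      mul_smul_comm, smul_add, mul_assoc]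
    congr 1
    split_ifs <;> simp
  simp_rw [Finset.sum_mul, Finset.mul_sum, h, Finset.sum_add_distrib]
  simp

theorem dX_mul_linVF (B : Matrix (Fin (m + 1)) (Fin (m + 1)) ℂ) (k : Fin (m + 1)) :
    (dX k * (∑ a, ∑ b, B a b • (mulX a * dX b)) : Module.End ℂ (Poly m ⊗[ℂ] V))
      = (∑ a, ∑ b, B a b • (mulX a * dX b)) * dX k + ∑ b, B k b • dX b := by
  have h : ∀ a b, (dX k * (B a b • (mulX a * dX b)) : Module.End ℂ (Poly m ⊗[ℂ] V))
      = (B a b • (mulX a * dX b)) * dX k + if k = a then B a b • dX b else 0 := fun a b => by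
    rw [mul_smul_comm, ← mul_assoc, dX_mul_mulX, add_mul, mul_assoc, dX_mul_dX k b,
      smul_mul_assoc, smul_add, mul_assoc]
    congr 1
    split_ifs <;> simp
  simp_rw [Finset.sum_mul, Finset.mul_sum, h, Finset.sum_add_distrib]
  congr 1
  rw [Finset.sum_comm]
  simp

end OperatorCalculus

/-! ### The commutator of `P_j` with a coordinate -/

section RepresentationOnPolynomials

variable (p m : ℕ) (lam : ℂ) (V : Type*) [AddCommGroup V] [Module ℂ V] [Module (ClEven p m) V]
  [IsScalarTower ℂ (ClEven p m) V]

/-- Commuting past one coordinate costs one derivative. What is left is a rotation in `ξ_j, ξ_k`, a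
grading term and a Clifford product; by `leviAct_lie_nMinusBasis` this is the action of `[E_j, F_k]
∈ 𝔩`. -/
theorem dpi_mul_mulX (j k : Fin (m + 1)) :
    dpi p m lam V j * mulX k = mulX k * dpi p m lam V j
      + (-Complex.I) • ((eps p j * eps p k) • (mulX j * dX k) - mulX k * dX j
        + (if j = k then (lam - 1 / 2) • 1 - euler else 0)
        - (1 / 2 * eps p j : ℂ) • act (ee p m j k)) := by
  have h1 : (mulX j * box p * mulX k : Module.End ℂ (Poly m ⊗[ℂ] V))
      = mulX k * (mulX j * box p) + (2 * eps p k) • (mulX j * dX k) := by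
    rw [mul_assoc, box_mul_mulX, mul_add, ← mul_assoc, mulX_mul_mulX j k, mul_smul_comm, mul_assoc]
  have h2 : (((lam - 1 / 2) • 1 - euler) * dX j * mulX k : Module.End ℂ (Poly m ⊗[ℂ] V))
      = mulX k * (((lam - 1 / 2) • 1 - euler) * dX j) - mulX k * dX j
        + if j = k then (lam - 1 / 2) • 1 - euler else 0 := by
    have : (((lam - 1 / 2) • 1 - euler) * mulX k : Module.End ℂ (Poly m ⊗[ℂ] V))
        = mulX k * ((lam - 1 / 2) • 1 - euler) - mulX k := by
      rw [sub_mul, euler_mul_mulX, mul_sub]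
      simp only [smul_mul_assoc, mul_smul_comm, one_mul, mul_one]
      abel
    rw [mul_assoc, dX_mul_mulX, mul_add, ← mul_assoc, this, sub_mul, mul_assoc]
    congr 1
    split_ifs <;> simp
  have h3 : ((∑ a, act (ee p m j a) * dX a) * mulX k : Module.End ℂ (Poly m ⊗[ℂ] V))
      = mulX k * (∑ a, act (ee p m j a) * dX a) + act (ee p m j k) := by
    have : ∀ a, (act (ee p m j a) * dX a * mulX k : Module.End ℂ (Poly m ⊗[ℂ] V))
        = mulX k * (act (ee p m j a) * dX a) + if a = k then act (ee p m j a) else 0 := fun a => by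
      rw [mul_assoc, dX_mul_mulX, mul_add, ← mul_assoc, act_mul_mulX, mul_assoc]
      congr 1
      split_ifs <;> simp
    rw [Finset.sum_mul, Finset.mul_sum, Finset.sum_congr rfl fun a _ => this a,
      Finset.sum_add_distrib]
    simp
  rw [dpi, smul_mul_assoc, mul_smul_comm, ← smul_add, sub_mul, add_mul, mul_sub, mul_add,
    smul_mul_assoc, smul_mul_assoc, h1, h2, h3, mul_smul_comm, mul_smul_comm]
  congr 1
  rw [smul_add, smul_add, smul_smul,
    show (1 / 2 * eps p j * (2 * eps p k) : ℂ) = eps p j * eps p k by ring]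
  abel

/-- The action of `𝔤` on `Pol[𝔫₊] ⊗ V_λ` by differential operators. -/
def polyRep (A : so p m) : Module.End ℂ (Poly m ⊗[ℂ] V) :=
  (∑ j, (A : Matrix (Idx m) (Idx m) ℂ) (Sum.inl j) (Sum.inr 0) • (Complex.I • mulX j))
    + leviAct p m lam V A
    + ∑ j, (A : Matrix (Idx m) (Idx m) ℂ) (Sum.inr 0) (Sum.inl j) • dpi p m lam V j

end RepresentationOnPolynomials

end

end SpinorSingular

namespace SpinorSingular

noncomputable section

/-! ### Matrix entries of elements of `𝔤` and of their brackets with `F_k` -/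

theorem ee_add_swap (p m : ℕ) (j k : Fin (m + 1)) :
    ee p m j k + ee p m k j = algebraMap ℂ (ClEven p m) (if j = k then -2 * eps p j else 0) := by
  apply Subtype.ext
  exact e_mul_e_add_swap p m j k

theorem lie_nMinusBasis (p m : ℕ) (A : so p m) (k : Fin (m + 1)) :
    (⁅A, nMinusBasis p m k⁆ : so p m).1
      = A.1 * (nMinusBasis p m k).1 - (nMinusBasis p m k).1 * A.1 := rfl

/-- The form pairs `e_0` with `e_{n+1}`, so skewness makes this entry equal to its own negative. -/
theorem so_corner {p m : ℕ} (A : so p m) : A.1 (Sum.inr 0) (Sum.inr 1) = 0 := by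
  have h := congrFun (congrFun (mem_so_iff.1 A.2) (Sum.inr 1)) (Sum.inr 1)
  simp [Matrix.mul_apply, gram, Fintype.sum_sum_type] at h
  linear_combination h / 2

theorem so_corner' {p m : ℕ} (A : so p m) : A.1 (Sum.inr 1) (Sum.inr 0) = 0 := by
  have h := congrFun (congrFun (mem_so_iff.1 A.2) (Sum.inr 0)) (Sum.inr 0)
  simp [Matrix.mul_apply, gram, Fintype.sum_sum_type] at h
  linear_combination h / 2

theorem so_diag {p m : ℕ} (A : so p m) :
    A.1 (Sum.inr 1) (Sum.inr 1) = -A.1 (Sum.inr 0) (Sum.inr 0) := by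
  have h := congrFun (congrFun (mem_so_iff.1 A.2) (Sum.inr 0)) (Sum.inr 1)
  simp [Matrix.mul_apply, gram, Fintype.sum_sum_type] at h
  rw [h, neg_neg]

theorem so_last_col {p m : ℕ} (A : so p m) (k : Fin (m + 1)) :
    A.1 (Sum.inl k) (Sum.inr 1) = -(eps p k * A.1 (Sum.inr 0) (Sum.inl k)) := by
  have h := congrFun (congrFun (mem_so_iff.1 A.2) (Sum.inr 1)) (Sum.inl k)
  simp [Matrix.mul_apply, gram, Matrix.diagonal_apply, Fintype.sum_sum_type] at h
  linear_combination eps p k * h - A.1 (Sum.inl k) (Sum.inr 1) * eps_mul_eps p k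

theorem lie_nMinusBasis_col (p m : ℕ) (A : so p m) (k j : Fin (m + 1)) :
    (⁅A, nMinusBasis p m k⁆ : so p m).1 (Sum.inl j) (Sum.inr 0)
      = A.1 (Sum.inl j) (Sum.inl k) - if j = k then A.1 (Sum.inr 0) (Sum.inr 0) else 0 := by
  rw [lie_nMinusBasis]
  have h : k = j ↔ j = k := eq_comm
  simp [nMinusBasis, Matrix.mul_apply, Matrix.single_apply, ite_and, h]

theorem lie_nMinusBasis_corner (p m : ℕ) (A : so p m) (k : Fin (m + 1)) :
    (⁅A, nMinusBasis p m k⁆ : so p m).1 (Sum.inr 0) (Sum.inr 0) = A.1 (Sum.inr 0) (Sum.inl k) := by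
  rw [lie_nMinusBasis]
  simp [nMinusBasis, Matrix.mul_apply, Matrix.single_apply]

/-- In the grading `𝔫₋ ⊕ 𝔩 ⊕ 𝔫₊` a bracket with `𝔫₋` lowers the degree, so nothing lands in the top
piece `𝔫₊`. -/
theorem lie_nMinusBasis_row (p m : ℕ) (A : so p m) (k j : Fin (m + 1)) :
    (⁅A, nMinusBasis p m k⁆ : so p m).1 (Sum.inr 0) (Sum.inl j) = 0 := by
  rw [lie_nMinusBasis]
  simp [nMinusBasis, Matrix.mul_apply, Fintype.sum_sum_type, Matrix.single_apply, so_corner]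

theorem lie_nMinusBasis_block (p m : ℕ) (A : so p m) (k a b : Fin (m + 1)) :
    (⁅A, nMinusBasis p m k⁆ : so p m).1 (Sum.inl a) (Sum.inl b)
      = (if b = k then eps p a * eps p k * A.1 (Sum.inr 0) (Sum.inl a) else 0)
        - if a = k then A.1 (Sum.inr 0) (Sum.inl b) else 0 := by
  have h0 := so_last_col A a
  rw [lie_nMinusBasis]
  have h1 : k = a ↔ a = k := eq_comm
  have h2 : k = b ↔ b = k := eq_comm
  simp [nMinusBasis, Matrix.mul_apply, Matrix.single_apply, ite_and, h1, h2, h0]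
  split_ifs <;> ring

/-! ### The operators of `𝔤` on polynomials and their commutators with `ξ_k` -/

section RepresentationOnPolynomials

variable (p m : ℕ) (lam : ℂ) (V : Type*) [AddCommGroup V] [Module ℂ V] [Module (ClEven p m) V]
  [IsScalarTower ℂ (ClEven p m) V]

/-- The first-order part of `leviAct`. -/
def leviVF {p m : ℕ} (A : so p m) : Matrix (Fin (m + 1)) (Fin (m + 1)) ℂ :=
  fun j k => A.1 (Sum.inl j) (Sum.inl k) - if j = k then A.1 (Sum.inr 0) (Sum.inr 0) else 0

theorem leviAct_eq (A : so p m) :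
    leviAct p m lam V A = (∑ j, ∑ k, leviVF A j k • (mulX j * dX k))
      + (lam * A.1 (Sum.inr 0) (Sum.inr 0)) • 1 + act (spinEl p m A.1.toBlocks₁₁) := rfl

theorem leviAct_mul_mulX (A : so p m) (k : Fin (m + 1)) :
    leviAct p m lam V A * mulX k = mulX k * leviAct p m lam V A + ∑ a, leviVF A a k • mulX a := by
  rw [leviAct_eq, add_mul, add_mul, linVF_mul_mulX, act_mul_mulX, mul_add, mul_add, smul_mul_assoc,
    mul_smul_comm, one_mul, mul_one]
  abel

theorem dX_mul_leviAct (A : so p m) (k : Fin (m + 1)) :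
    dX k * leviAct p m lam V A = leviAct p m lam V A * dX k + ∑ b, leviVF A k b • dX b := by
  rw [leviAct_eq, add_mul, add_mul, mul_add, mul_add, dX_mul_linVF, act_mul_dX, smul_mul_assoc,
    mul_smul_comm, one_mul, mul_one]
  abel

theorem leviAct_add (A B : so p m) :
    leviAct p m lam V (A + B) = leviAct p m lam V A + leviAct p m lam V B := by
  have h : (A + B).1.toBlocks₁₁ = A.1.toBlocks₁₁ + B.1.toBlocks₁₁ := rfl
  have h2 : (A + B).1 = A.1 + B.1 := rfl
  have h3 : ∀ j k, leviVF (A + B) j k = leviVF A j k + leviVF B j k := fun j k => by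
    simp only [leviVF, h2, Matrix.add_apply]; split_ifs <;> ring
  simp only [leviAct_eq, h, spinEl_add, act_add, h3, add_smul, Finset.sum_add_distrib]
  rw [h2, Matrix.add_apply, mul_add, add_smul]
  abel

theorem leviAct_smul (c : ℂ) (A : so p m) :
    leviAct p m lam V (c • A) = c • leviAct p m lam V A := by
  have h : (c • A).1.toBlocks₁₁ = c • A.1.toBlocks₁₁ := rfl
  have h2 : (c • A).1 = c • A.1 := rfl
  have h3 : ∀ j k, leviVF (c • A) j k = c * leviVF A j k := fun j k => by
    simp only [leviVF, h2, Matrix.smul_apply, smul_eq_mul]; split_ifs <;> ring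
  simp only [leviAct_eq, h, spinEl_smul, act_smul, h3, smul_add, Finset.smul_sum, smul_smul]
  rw [h2, Matrix.smul_apply, smul_eq_mul, mul_left_comm]

/-- `polyRep` as a linear map. -/
def polyRepLin : so p m →ₗ[ℂ] Module.End ℂ (Poly m ⊗[ℂ] V) where
  toFun := polyRep p m lam V
  map_add' A B := by
    have h2 : (A + B).1 = A.1 + B.1 := rfl
    simp only [polyRep, leviAct_add, h2, Matrix.add_apply, add_smul, Finset.sum_add_distrib]
    abel
  map_smul' c A := by
    have h2 : (c • A).1 = c • A.1 := rfl
    simp only [polyRep, leviAct_smul, h2, Matrix.smul_apply, smul_eq_mul, mul_smul, smul_add,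
      Finset.smul_sum, RingHom.id_apply]

@[simp] theorem polyRepLin_apply (A : so p m) :
    polyRepLin p m lam V A = polyRep p m lam V A := rfl

/-- The block of `[A, F_k]` is supported in row and column `k`. Rewriting `e_a e_k - e_k e_a` as `2
e_a e_k` leaves a scalar at `a = k`; this scalar is the source of the shift from `λ` to `λ - 1/2` in
`dpi`. -/
theorem spinEl_lie_nMinusBasis (A : so p m) (k : Fin (m + 1)) :
    spinEl p m (⁅A, nMinusBasis p m k⁆ : so p m).1.toBlocks₁₁
      = -((1 / 2 : ℂ) * A.1 (Sum.inr 0) (Sum.inl k)) • 1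
        - ∑ j, (A.1 (Sum.inr 0) (Sum.inl j) * (1 / 2 * eps p j)) • ee p m j k := by
  have h1 : ∀ a b, (eps p b * (⁅A, nMinusBasis p m k⁆ : so p m).1.toBlocks₁₁ a b) • ee p m a b
      = (if b = k then (eps p a * A.1 (Sum.inr 0) (Sum.inl a)) • ee p m a b else 0)
        - if a = k then (eps p b * A.1 (Sum.inr 0) (Sum.inl b)) • ee p m a b else 0 := by
    intro a b
    have : (⁅A, nMinusBasis p m k⁆ : so p m).1.toBlocks₁₁ a b = _ :=
      lie_nMinusBasis_block p m A k a b
    rw [this]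
    by_cases hb : b = k
    · subst hb
      by_cases ha : a = b
      · subst ha
        simp only [if_true]
        rw [← sub_smul]; congr 1
        linear_combination (eps p a * A.1 (Sum.inr 0) (Sum.inl a)) * eps_mul_eps p a
      · simp only [if_true, ha, if_false, sub_zero]
        congr 1
        linear_combination (eps p a * A.1 (Sum.inr 0) (Sum.inl a)) * eps_mul_eps p b
    · by_cases ha : a = k
      · simp [hb, ha]
      · simp [hb, ha]
  have h2 : ∀ a, ee p m a k - ee p m k a
      = (2 : ℂ) • ee p m a k + (if a = k then (2 * eps p a) • (1 : ClEven p m) else 0) := by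
    intro a
    have := ee_add_swap p m a k
    rw [← eq_sub_iff_add_eq'] at this
    rw [this]
    split_ifs
    · rw [Algebra.algebraMap_eq_smul_one]; module
    · rw [map_zero]; module
  rw [spinEl]
  simp_rw [h1, Finset.sum_sub_distrib]
  rw [Finset.sum_comm (f := fun a b => if a = k then _ else _)]
  simp only [Finset.sum_ite_eq', Finset.mem_univ, if_true]
  rw [← Finset.sum_sub_distrib]
  simp_rw [← smul_sub, h2, smul_add, Finset.sum_add_distrib, smul_ite, smul_zero]
  simp only [Finset.sum_ite_eq', Finset.mem_univ, if_true]
  rw [smul_add, smul_smul, smul_smul, Finset.smul_sum, sub_eq_add_neg, ← Finset.sum_neg_distrib,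
    add_comm]
  congr 1
  · congr 1
    linear_combination (-1 / 2 * A.1 (Sum.inr 0) (Sum.inl k)) * eps_mul_eps p k
  · refine Finset.sum_congr rfl fun j _ => ?_
    module

/-- The `𝔩`-component of `[A, F_k]` depends only on the `𝔫₊`-component of `A`, that is, on the
entries in the row of `e_0`. The operator attached to each entry is the one that appears in
`dpi_mul_mulX`. -/
theorem leviAct_lie_nMinusBasis (A : so p m) (k : Fin (m + 1)) :
    leviAct p m lam V ⁅A, nMinusBasis p m k⁆
      = ∑ j, A.1 (Sum.inr 0) (Sum.inl j) • ((eps p j * eps p k) • (mulX j * dX k) - mulX k * dX j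
        + (if j = k then (lam - 1 / 2) • 1 - euler else 0)
        - (1 / 2 * eps p j : ℂ) • act (ee p m j k)) := by
  have h1 : ∀ a b, leviVF ⁅A, nMinusBasis p m k⁆ a b • (mulX a * dX b : Module.End ℂ (Poly m ⊗[ℂ] V))
      = (if b = k then (eps p a * eps p k * A.1 (Sum.inr 0) (Sum.inl a)) • (mulX a * dX b) else 0)
        - (if a = k then A.1 (Sum.inr 0) (Sum.inl b) • (mulX a * dX b) else 0)
        - (if a = b then A.1 (Sum.inr 0) (Sum.inl k) • (mulX a * dX b) else 0) := by
    intro a b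
    rw [leviVF, lie_nMinusBasis_block, lie_nMinusBasis_corner, sub_smul, sub_smul]
    simp only [ite_smul, zero_smul]
  rw [leviAct_eq]
  simp_rw [h1, Finset.sum_sub_distrib]
  rw [Finset.sum_comm (f := fun a b => if a = k then _ else _), lie_nMinusBasis_corner,
    spinEl_lie_nMinusBasis, act_sub, act_smul, act_one, act_sum]
  simp only [Finset.sum_ite_eq', Finset.sum_ite_eq, Finset.mem_univ, if_true, act_smul]
  simp_rw [smul_sub, smul_add, smul_sub, Finset.sum_sub_distrib, Finset.sum_add_distrib,
    Finset.sum_sub_distrib, smul_ite, smul_zero, Finset.sum_ite_eq', Finset.mem_univ, if_true,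
    smul_smul, ← Finset.smul_sum]
  have h3 : (∑ i, mulX i * dX i : Module.End ℂ (Poly m ⊗[ℂ] V)) = euler := rfl
  rw [h3]
  have h4 : (∑ x, (eps p x * eps p k * A.1 (Sum.inr 0) (Sum.inl x)) • (mulX x * dX k)
      : Module.End ℂ (Poly m ⊗[ℂ] V))
      = ∑ x, (A.1 (Sum.inr 0) (Sum.inl x) * (eps p x * eps p k)) • (mulX x * dX k) :=
    Finset.sum_congr rfl fun x _ => by rw [mul_comm]
  rw [h4]
  module

theorem polyRep_eq (A : so p m) :
    polyRep p m lam V A = (∑ j, A.1 (Sum.inl j) (Sum.inr 0) • (Complex.I • mulX j))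
      + leviAct p m lam V A + ∑ j, A.1 (Sum.inr 0) (Sum.inl j) • dpi p m lam V j := rfl

/-- The commutator of `polyRep A` with multiplication by a coordinate. -/
theorem polyRep_mul_mulX (A : so p m) (k : Fin (m + 1)) :
    polyRep p m lam V A * (Complex.I • mulX k)
      = (Complex.I • mulX k) * polyRep p m lam V A + polyRep p m lam V ⁅A, nMinusBasis p m k⁆ := by
  -- The factor `i` by which `F_k` acts cancels the factor `-i` in front of `dpi`.
  have hI : Complex.I * -Complex.I = 1 := by rw [mul_neg, Complex.I_mul_I, neg_neg]
  rw [mul_smul_comm, smul_mul_assoc]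
  rw [polyRep_eq p m lam V ⁅A, nMinusBasis p m k⁆]
  have h0 : ∀ j, (⁅A, nMinusBasis p m k⁆ : so p m).1 (Sum.inl j) (Sum.inr 0) = leviVF A j k :=
    fun j => lie_nMinusBasis_col p m A k j
  simp_rw [lie_nMinusBasis_row, zero_smul, Finset.sum_const_zero, add_zero, h0]
  rw [leviAct_lie_nMinusBasis, polyRep_eq, add_mul, add_mul, leviAct_mul_mulX, mul_add, mul_add,
    Finset.sum_mul, Finset.sum_mul, Finset.mul_sum, Finset.mul_sum]
  have h1 : ∀ j, A.1 (Sum.inl j) (Sum.inr 0) • Complex.I • mulX j * mulX k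
      = mulX k * (A.1 (Sum.inl j) (Sum.inr 0) • Complex.I • mulX j
        : Module.End ℂ (Poly m ⊗[ℂ] V)) := fun j => by
    rw [smul_mul_assoc, smul_mul_assoc, mulX_mul_mulX, mul_smul_comm, mul_smul_comm]
  have h2 : ∀ j, A.1 (Sum.inr 0) (Sum.inl j) • dpi p m lam V j * mulX k
      = mulX k * (A.1 (Sum.inr 0) (Sum.inl j) • dpi p m lam V j)
        + (-Complex.I) • (A.1 (Sum.inr 0) (Sum.inl j) • ((eps p j * eps p k) • (mulX j * dX k)
          - mulX k * dX j + (if j = k then (lam - 1 / 2) • 1 - euler else 0)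
          - (1 / 2 * eps p j : ℂ) • act (ee p m j k))) := fun j => by
    rw [smul_mul_assoc, dpi_mul_mulX, smul_add, mul_smul_comm, smul_comm (-Complex.I)]
  simp_rw [h1, h2, Finset.sum_add_distrib, smul_add, Finset.smul_sum, smul_smul _ (-Complex.I), hI,
    one_smul, smul_comm Complex.I (leviVF A _ _)]

  abel

end RepresentationOnPolynomials

end

end SpinorSingular

namespace SpinorSingular

noncomputable section

/-! ### The operators form a representation of `𝔤` and of `U(𝔤)` -/

theorem exists_parabolic_add (p m : ℕ) (A : so p m) :
    ∃ B : parabolic p m, A = ∑ j, A.1 (Sum.inl j) (Sum.inr 0) • nMinusBasis p m j + B := by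
  refine ⟨⟨A - ∑ j, A.1 (Sum.inl j) (Sum.inr 0) • nMinusBasis p m j, ?_⟩, by simp⟩
  intro i hi
  rcases i with i | i
  · have h : ∀ j, (A.1 (Sum.inl j) (Sum.inr 0) • nMinusBasis p m j).1 (Sum.inl i) (Sum.inr 0)
        = if j = i then A.1 (Sum.inl j) (Sum.inr 0) else 0 := fun j => by
      simp [nMinusBasis, Matrix.single_apply]
    rw [AddSubgroupClass.coe_sub, Matrix.sub_apply, AddSubmonoidClass.coe_finsetSum,
      Matrix.sum_apply, Finset.sum_congr rfl fun j _ => h j]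
    simp
  · fin_cases i
    · exact absurd rfl hi
    · exact so_corner' _

section RepresentationOnPolynomials

variable (p m : ℕ) (lam : ℂ) (V : Type*) [AddCommGroup V] [Module ℂ V] [Module (ClEven p m) V]
  [IsScalarTower ℂ (ClEven p m) V]

theorem polyRep_nMinusBasis (k : Fin (m + 1)) :
    polyRep p m lam V (nMinusBasis p m k) = Complex.I • mulX k := by
  have h1 : ∀ j, (nMinusBasis p m k).1 (Sum.inl j) (Sum.inr 0) = if j = k then 1 else 0 := fun j => by
    simp [nMinusBasis, Matrix.single_apply, eq_comm (a := j)]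
  have h2 : ∀ j, (nMinusBasis p m k).1 (Sum.inr 0) (Sum.inl j) = 0 := fun j => by
    simp [nMinusBasis]
  have h3 : (nMinusBasis p m k).1 (Sum.inr 0) (Sum.inr 0) = 0 := by
    simp [nMinusBasis]
  have h4 : (nMinusBasis p m k).1.toBlocks₁₁ = 0 := by
    ext a b
    simp [nMinusBasis, Matrix.toBlocks₁₁]
  have h5 : ∀ a b, leviVF (nMinusBasis p m k) a b = 0 := fun a b => by
    have : (nMinusBasis p m k).1 (Sum.inl a) (Sum.inl b) = 0 := congrFun (congrFun h4 a) b
    simp [leviVF, h3, this]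
  have h6 : spinEl p m 0 = 0 := by simp [spinEl]
  rw [polyRep_eq, leviAct_eq, h3, h4, h6, act_zero]
  simp_rw [h1, h2, h5]
  simp

theorem leviAct_one_tmul (A : so p m) (v : V) :
    leviAct p m lam V A (1 ⊗ₜ v)
      = 1 ⊗ₜ ((lam * A.1 (Sum.inr 0) (Sum.inr 0)) • v + spinEl p m A.1.toBlocks₁₁ • v) := by
  rw [leviAct_eq]
  simp [LinearMap.sum_apply, TensorProduct.tmul_add]

theorem dpi_one_tmul (j : Fin (m + 1)) (v : V) : dpi p m lam V j (1 ⊗ₜ v) = 0 := by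
  simp [dpi, box, LinearMap.sum_apply]

/-- The constants are a copy of `V_λ` in the polynomial model: `A` has no component in `𝔫₋`, and the
operators of `𝔫₊` kill constants because they end in derivatives. -/
theorem polyRep_one_tmul (A : parabolic p m) (v : V) :
    polyRep p m lam V A.1 (1 ⊗ₜ v) = 1 ⊗ₜ spinRep p m lam V A v := by
  have h : ∀ j, A.1.1 (Sum.inl j) (Sum.inr 0) = 0 := fun j => A.2 _ (by simp)
  rw [polyRep_eq]
  simp_rw [h]
  simp only [zero_smul, Finset.sum_const_zero, zero_add, LinearMap.add_apply, LinearMap.sum_apply,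
    LinearMap.smul_apply, dpi_one_tmul, smul_zero, add_zero, leviAct_one_tmul]
  rfl

theorem polyRep_lie_nMinusBasis (A : so p m) (k : Fin (m + 1)) :
    polyRep p m lam V ⁅A, nMinusBasis p m k⁆ = polyRep p m lam V A * polyRep p m lam V (nMinusBasis p m k)
      - polyRep p m lam V (nMinusBasis p m k) * polyRep p m lam V A := by
  rw [polyRep_nMinusBasis, polyRep_mul_mulX, add_sub_cancel_left]

/-- The elements `B` for which `[A, B]` acts on `f` as the commutator of `A` and `B`. -/
def lieCompat (A : so p m) (f : Poly m ⊗[ℂ] V) : Submodule ℂ (so p m) where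
  carrier := {B | polyRepLin p m lam V ⁅A, B⁆ f
    = polyRepLin p m lam V A (polyRepLin p m lam V B f)
      - polyRepLin p m lam V B (polyRepLin p m lam V A f)}
  add_mem' {B C} hB hC := by
    simp only [Set.mem_ofPred_eq] at *
    rw [lie_add, map_add, map_add, LinearMap.add_apply, LinearMap.add_apply, LinearMap.add_apply,
      map_add, hB, hC]
    abel
  zero_mem' := by
    simp only [Set.mem_ofPred_eq, lie_zero, map_zero, LinearMap.zero_apply, sub_zero]
  smul_mem' c B hB := by
    simp only [Set.mem_ofPred_eq] at *
    rw [lie_smul, map_smul, map_smul, LinearMap.smul_apply, LinearMap.smul_apply,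
      LinearMap.smul_apply, map_smul, hB, smul_sub]

theorem mem_lieCompat_comm {A B : so p m} {f : Poly m ⊗[ℂ] V}
    (h : B ∈ lieCompat p m lam V A f) : A ∈ lieCompat p m lam V B f := by
  have h' : polyRepLin p m lam V ⁅A, B⁆ f = polyRepLin p m lam V A (polyRepLin p m lam V B f)
      - polyRepLin p m lam V B (polyRepLin p m lam V A f) := h
  change polyRepLin p m lam V ⁅B, A⁆ f = polyRepLin p m lam V B (polyRepLin p m lam V A f)
      - polyRepLin p m lam V A (polyRepLin p m lam V B f)
  rw [← lie_skew, map_neg, LinearMap.neg_apply, h', neg_sub]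

theorem nMinusBasis_mem_lieCompat (A : so p m) (k : Fin (m + 1)) (f : Poly m ⊗[ℂ] V) :
    nMinusBasis p m k ∈ lieCompat p m lam V A f := by
  change polyRep p m lam V ⁅A, nMinusBasis p m k⁆ f = _
  rw [polyRep_lie_nMinusBasis]
  rfl

/-- Compatibility with the `F_k` is the commutator already computed, so along `𝔤 = 𝔫₋ + 𝔭` only `𝔭`
has to be checked. -/
theorem mem_lieCompat_of_parabolic {A : so p m} {f : Poly m ⊗[ℂ] V}
    (h : ∀ B : parabolic p m, B.1 ∈ lieCompat p m lam V A f) (B : so p m) :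
    B ∈ lieCompat p m lam V A f := by
  obtain ⟨B', hB'⟩ := exists_parabolic_add p m B
  rw [hB']
  exact Submodule.add_mem _ (Submodule.sum_mem _ fun j _ => Submodule.smul_mem _ _
    (nMinusBasis_mem_lieCompat p m lam V A j f)) (h B')

/-- On constants both arguments may be taken in `𝔭`, which acts there by `V_λ`. The step from `f` to
`ξ_k f` is the Jacobi identity for `A`, `B`, `F_k`. No commutator of two second-order operators is
ever expanded. -/
theorem mem_lieCompat (f : Poly m ⊗[ℂ] V) (A B : so p m) : B ∈ lieCompat p m lam V A f := by
  induction f using polyTensor_induction generalizing A B with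
  | hC v =>
    refine mem_lieCompat_of_parabolic p m lam V (fun B' => ?_) B
    -- Exchanging the two arguments reduces the other one to `𝔭` as well.
    refine mem_lieCompat_comm p m lam V (mem_lieCompat_of_parabolic p m lam V (fun A' => ?_) A)
    change polyRep p m lam V (⁅B', A'⁆ : parabolic p m).1 _ = polyRep p m lam V B'.1
      (polyRep p m lam V A'.1 _) - polyRep p m lam V A'.1 (polyRep p m lam V B'.1 _)
    simp only [polyRep_one_tmul]
    rw [← TensorProduct.tmul_sub, LieHom.map_lie]
    rfl
  | hadd f g hf hg =>
    have hf' : polyRepLin p m lam V ⁅A, B⁆ f = _ := hf A B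
    have hg' : polyRepLin p m lam V ⁅A, B⁆ g = _ := hg A B
    change polyRepLin p m lam V ⁅A, B⁆ (f + g) = polyRepLin p m lam V A (polyRepLin p m lam V B _)
      - polyRepLin p m lam V B (polyRepLin p m lam V A _)
    simp only [map_add, hf', hg']
    abel
  | hX k f hf =>
    set R := polyRepLin p m lam V with hR
    set F := nMinusBasis p m k with hF
    -- Since `ξ_k f` is a multiple of `R F f`, it is enough to move `F` to the left past `A`, `B`
    -- and `[A, B]`.
    suffices H : ∀ A B, R ⁅A, B⁆ (R F f) = R A (R B (R F f)) - R B (R A (R F f)) by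
      have h1 : mulX k f = (-Complex.I) • R F f := by
        change _ = (-Complex.I) • polyRep p m lam V F f
        rw [hF, polyRep_nMinusBasis, LinearMap.smul_apply, smul_smul]
        simp
      change R ⁅A, B⁆ _ = R A (R B _) - R B (R A _)
      simp only [h1, map_smul, H, smul_sub]
    intro A B
    have key : ∀ A g, R A (R F g) = R F (R A g) + R ⁅A, F⁆ g := fun A g => by
      have : R ⁅A, F⁆ g = R A (R F g) - R F (R A g) :=
        nMinusBasis_mem_lieCompat p m lam V A k g
      rw [this]; abel
    have h1 : R ⁅⁅A, F⁆, B⁆ f = R ⁅A, F⁆ (R B f) - R B (R ⁅A, F⁆ f) := hf _ _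
    have h2 : R ⁅A, ⁅B, F⁆⁆ f = R A (R ⁅B, F⁆ f) - R ⁅B, F⁆ (R A f) := hf _ _
    have h3 : R ⁅A, B⁆ f = R A (R B f) - R B (R A f) := hf _ _
    -- After moving `F`, both sides consist of `R F` applied to the relation for `f` and of terms
    -- with `[A, F]` and `[B, F]`; the latter agree by Jacobi and the induction hypothesis, which
    -- therefore has to hold for all pairs.
    have h4 : ⁅⁅A, B⁆, F⁆ = ⁅⁅A, F⁆, B⁆ + ⁅A, ⁅B, F⁆⁆ := by
      rw [lie_lie A B F, ← lie_skew B ⁅A, F⁆]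
      abel
    simp only [key, h4, map_add, LinearMap.add_apply, h1, h2, h3, map_sub]
    abel

/-- The representation of `𝔤` on `Pol[𝔫₊] ⊗ V_λ` as a homomorphism of Lie algebras. -/
def polyRepLie : so p m →ₗ⁅ℂ⁆ Module.End ℂ (Poly m ⊗[ℂ] V) :=
  { polyRepLin p m lam V with
    map_lie' := fun {A B} => LinearMap.ext fun f => mem_lieCompat p m lam V f A B }

/-- The representation of `U(𝔤)` on `Pol[𝔫₊] ⊗ V_λ`. -/
def polyRepEnv : Env p m →ₐ[ℂ] Module.End ℂ (Poly m ⊗[ℂ] V) :=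
  UniversalEnvelopingAlgebra.lift ℂ (polyRepLie p m lam V)

theorem polyRepEnv_ι (A : so p m) :
    polyRepEnv p m lam V (UniversalEnvelopingAlgebra.ι ℂ A) = polyRep p m lam V A :=
  UniversalEnvelopingAlgebra.lift_ι_apply ℂ _ A

end RepresentationOnPolynomials

/-- The enveloping algebra is generated by the Lie algebra. -/
theorem adjoin_range_ι {L : Type*} [LieRing L] [LieAlgebra ℂ L] :
    Algebra.adjoin ℂ (Set.range (UniversalEnvelopingAlgebra.ι ℂ (L := L))) = ⊤ := by
  set B := Algebra.adjoin ℂ (Set.range (UniversalEnvelopingAlgebra.ι ℂ (L := L))) with hB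
  let g : L →ₗ⁅ℂ⁆ B :=
    { toFun := fun x => ⟨UniversalEnvelopingAlgebra.ι ℂ x, Algebra.subset_adjoin ⟨x, rfl⟩⟩
      map_add' := fun x y => Subtype.ext (map_add _ x y)
      map_smul' := fun c x => Subtype.ext (map_smul _ c x)
      map_lie' := fun {x y} => Subtype.ext (LieHom.map_lie _ x y) }
  -- The universal property gives a homomorphism into the generated subalgebra whose composite with
  -- the inclusion fixes the generators. It is the identity, so the subalgebra is everything.
  have h : B.val.comp (UniversalEnvelopingAlgebra.lift ℂ g) = AlgHom.id ℂ _ := by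
    apply UniversalEnvelopingAlgebra.hom_ext
    ext x
    change B.val (UniversalEnvelopingAlgebra.lift ℂ g (UniversalEnvelopingAlgebra.ι ℂ x)) = _
    rw [UniversalEnvelopingAlgebra.lift_ι_apply]
    rfl
  rw [eq_top_iff]
  intro u _
  rw [show u = B.val (UniversalEnvelopingAlgebra.lift ℂ g u) from (DFunLike.congr_fun h u).symm]
  exact Subtype.property _

theorem env_induction {L : Type*} [LieRing L] [LieAlgebra ℂ L]
    {P : UniversalEnvelopingAlgebra ℂ L → Prop} (h1 : ∀ c : ℂ, P (algebraMap ℂ _ c))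
    (hι : ∀ x : L, P (UniversalEnvelopingAlgebra.ι ℂ x)) (hadd : ∀ u v, P u → P v → P (u + v))
    (hmul : ∀ u v, P u → P v → P (u * v)) (u : UniversalEnvelopingAlgebra ℂ L) : P u := by
  have hu : u ∈ Algebra.adjoin ℂ (Set.range (UniversalEnvelopingAlgebra.ι ℂ (L := L))) := by
    rw [adjoin_range_ι]; exact Algebra.mem_top
  induction hu using Algebra.adjoin_induction with
  | mem x hx => obtain ⟨y, rfl⟩ := hx; exact hι y
  | algebraMap r => exact h1 r
  | add x y _ _ hx hy => exact hadd _ _ hx hy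
  | mul x y _ _ hx hy => exact hmul _ _ hx hy

end

end SpinorSingular

namespace SpinorSingular

noncomputable section

/-! ### The inverse Fourier transform as an algebra homomorphism -/

section PolyToEnv

variable (p m : ℕ)

theorem nMinusBasis_lie (j k : Fin (m + 1)) : ⁅nMinusBasis p m j, nMinusBasis p m k⁆ = 0 := by
  apply Subtype.ext
  rw [lie_nMinusBasis]
  ext a b
  rcases a with a | a <;> rcases b with b | b
  · simp [nMinusBasis, Matrix.mul_apply, Matrix.single_apply]
  · simp [nMinusBasis, Matrix.mul_apply, Matrix.single_apply]
  · simp [nMinusBasis, Matrix.mul_apply, Matrix.single_apply]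
  · simp [nMinusBasis, Matrix.mul_apply, Matrix.single_apply, ite_and]
    by_cases h : j = k
    · simp [h]
    · simp [h, Ne.symm h]

/-- The image `-i F_j` of `ξ_j` in `U(𝔤)`. -/
def envVar (j : Fin (m + 1)) : Env p m :=
  (-Complex.I) • UniversalEnvelopingAlgebra.ι ℂ (nMinusBasis p m j)

theorem envVar_comm (j k : Fin (m + 1)) : envVar p m j * envVar p m k = envVar p m k * envVar p m j := by
  have h := LieHom.map_lie (UniversalEnvelopingAlgebra.ι ℂ) (nMinusBasis p m j) (nMinusBasis p m k)
  rw [nMinusBasis_lie, map_zero, LieRing.of_associative_ring_bracket, eq_comm, sub_eq_zero] at h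
  rw [envVar, envVar, smul_mul_smul_comm, smul_mul_smul_comm, h]

/-- `U(𝔫₋)` as a subalgebra of `U(𝔤)`. -/
def envMinus : Subalgebra ℂ (Env p m) := Algebra.adjoin ℂ (Set.range (envVar p m))

/-- Evaluation of polynomials needs a commutative target, so the homomorphism is built into the
subalgebra generated by the commuting `-iF_j` and not directly into `U(𝔤)`. -/
instance : CommRing (envMinus p m) :=
  { (inferInstance : Ring (envMinus p m)) with
    mul_comm := (Algebra.isMulCommutative_adjoin ℂ (s := Set.range (envVar p m)) (by
      rintro _ ⟨j, rfl⟩ _ ⟨k, rfl⟩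
      exact envVar_comm p m j k)).is_comm.comm }

/-- `ξ_j ↦ -i F_j` as a homomorphism of algebras. -/
def polyToEnvHom : Poly m →ₐ[ℂ] Env p m :=
  (envMinus p m).val.comp (MvPolynomial.aeval fun j =>
    (⟨envVar p m j, Algebra.subset_adjoin ⟨j, rfl⟩⟩ : envMinus p m))

theorem polyToEnvHom_X (j : Fin (m + 1)) : polyToEnvHom p m (MvPolynomial.X j) = envVar p m j := by
  simp [polyToEnvHom]

/-- The ordered product on monomials turns out to be multiplicative because the `F_j` commute; later
arguments only use the homomorphism. -/
theorem polyToEnv_eq (f : Poly m) : polyToEnv p m f = polyToEnvHom p m f := by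
  suffices h : polyToEnv p m = (polyToEnvHom p m).toLinearMap by rw [h]; rfl
  refine (MvPolynomial.basisMonomials (Fin (m + 1)) ℂ).ext fun α => ?_
  rw [polyToEnv, Module.Basis.constr_basis, AlgHom.toLinearMap_apply,
    MvPolynomial.coe_basisMonomials]
  beta_reduce
  rw [MvPolynomial.monomial_eq, map_mul, Finsupp.prod_fintype _ _
      (by simp), ← List.prod_ofFn, map_list_prod, List.map_ofFn, monomialToEnv, map_one, map_one,
    one_mul]
  congr 2
  funext j
  simp [polyToEnvHom_X, envVar]

end PolyToEnv

/-! ### The Fourier transform as an isomorphism of `𝔤`-modules -/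

section Fourier

variable (p m : ℕ) (lam : ℂ) (V : Type*) [AddCommGroup V] [Module ℂ V] [Module (ClEven p m) V]
  [IsScalarTower ℂ (ClEven p m) V]

/-- The class of `u ⊗ v` in the generalized Verma module. -/
def vermaMk : Env p m ⊗[ℂ] V →ₗ[Env p m] Verma p m lam V := (vermaRel p m lam V).mkQ

theorem fourierInv_tmul (f : Poly m) (v : V) :
    fourierInv p m lam V (f ⊗ₜ v) = vermaMk p m lam V (polyToEnvHom p m f ⊗ₜ v) := by
  rw [← polyToEnv_eq]; rfl

theorem fourierInv_one_tmul (v : V) :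
    fourierInv p m lam V (1 ⊗ₜ v) = vermaMk p m lam V (1 ⊗ₜ v) := by
  rw [fourierInv_tmul, map_one]

theorem vermaMk_smul (u w : Env p m) (v : V) :
    vermaMk p m lam V ((u * w) ⊗ₜ v) = u • vermaMk p m lam V (w ⊗ₜ v) := by
  rw [← map_smul, TensorProduct.smul_tmul', smul_eq_mul]

theorem vermaMk_parabolic (A : parabolic p m) (v : V) :
    UniversalEnvelopingAlgebra.ι ℂ A.1 • vermaMk p m lam V (1 ⊗ₜ v)
      = vermaMk p m lam V (1 ⊗ₜ spinRep p m lam V A v) := by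
  rw [← vermaMk_smul, mul_one, ← sub_eq_zero, ← map_sub]
  exact (Submodule.Quotient.mk_eq_zero _).2 (Submodule.subset_span ⟨A, v, rfl⟩)

theorem fourierInv_mulX (k : Fin (m + 1)) (f : Poly m ⊗[ℂ] V) :
    fourierInv p m lam V (mulX k f) = envVar p m k • fourierInv p m lam V f := by
  induction f with
  | zero => simp
  | add f g hf hg => rw [map_add, map_add, map_add, hf, hg, smul_add]
  | tmul f v =>
    rw [mulX_tmul, fourierInv_tmul, fourierInv_tmul, map_mul, polyToEnvHom_X, vermaMk_smul]

theorem fourierInv_nMinusBasis (k : Fin (m + 1)) (f : Poly m ⊗[ℂ] V) :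
    fourierInv p m lam V (polyRep p m lam V (nMinusBasis p m k) f)
      = UniversalEnvelopingAlgebra.ι ℂ (nMinusBasis p m k) • fourierInv p m lam V f := by
  rw [polyRep_nMinusBasis, LinearMap.smul_apply, map_smul, fourierInv_mulX, envVar, smul_assoc,
    smul_smul]
  simp

/-- The inverse Fourier transform is `𝔤`-equivariant. -/
theorem fourierInv_polyRep (A : so p m) (f : Poly m ⊗[ℂ] V) :
    fourierInv p m lam V (polyRep p m lam V A f)
      = UniversalEnvelopingAlgebra.ι ℂ A • fourierInv p m lam V f := by
  induction f using polyTensor_induction generalizing A with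
  | hC v =>
    -- On constants the part of `A` in `𝔫₋` is covered by the definition of `φ`, and the part in `𝔭`
    -- by the defining relations of the Verma module.
    obtain ⟨B, hB⟩ := exists_parabolic_add p m A
    set c := fun j => A.1 (Sum.inl j) (Sum.inr 0) with hc
    have hA : A = ∑ j, c j • nMinusBasis p m j + B := hB
    rw [← polyRepLin_apply, hA, map_add, map_add, map_sum, map_sum, LinearMap.add_apply,
      LinearMap.sum_apply, map_add, map_sum, add_smul, Finset.sum_smul]
    congr 1
    · refine Finset.sum_congr rfl fun j _ => ?_
      rw [map_smul, map_smul, LinearMap.smul_apply, map_smul, polyRepLin_apply,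
        fourierInv_nMinusBasis, smul_assoc]
    · rw [polyRepLin_apply, polyRep_one_tmul, fourierInv_one_tmul, fourierInv_one_tmul,
        vermaMk_parabolic]
  | hadd f g hf hg => rw [map_add, map_add, map_add, hf, hg, smul_add]
  | hX k f hf =>
    suffices H : ∀ A, fourierInv p m lam V (polyRep p m lam V A
        (polyRep p m lam V (nMinusBasis p m k) f)) = UniversalEnvelopingAlgebra.ι ℂ A •
          fourierInv p m lam V (polyRep p m lam V (nMinusBasis p m k) f) by
      have h1 : mulX k f = (-Complex.I) • polyRep p m lam V (nMinusBasis p m k) f := by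
        rw [polyRep_nMinusBasis, LinearMap.smul_apply, smul_smul]
        simp
      simp only [h1, map_smul, H]
      rw [smul_comm]
    intro A
    -- Move `F_k` to the left, where equivariance is known for every argument; the induction
    -- hypothesis for `f` then covers both `A` and `[A, F_k]`.
    have key : polyRep p m lam V A (polyRep p m lam V (nMinusBasis p m k) f)
        = polyRep p m lam V ⁅A, nMinusBasis p m k⁆ f
          + polyRep p m lam V (nMinusBasis p m k) (polyRep p m lam V A f) := by
      rw [polyRep_lie_nMinusBasis, LinearMap.sub_apply, Module.End.mul_apply, Module.End.mul_apply]
      abel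
    rw [key, map_add, hf, fourierInv_nMinusBasis, fourierInv_nMinusBasis, hf, LieHom.map_lie,
      LieRing.of_associative_ring_bracket, sub_smul, mul_smul, mul_smul]
    abel

theorem fourierInv_polyRepEnv (u : Env p m) (f : Poly m ⊗[ℂ] V) :
    fourierInv p m lam V (polyRepEnv p m lam V u f) = u • fourierInv p m lam V f := by
  induction u using env_induction generalizing f with
  | h1 c =>
    rw [Algebra.algebraMap_eq_smul_one, map_smul, map_one, LinearMap.smul_apply, map_smul,
      smul_assoc, one_smul, Module.End.one_apply]
  | hι A => rw [polyRepEnv_ι, fourierInv_polyRep]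
  | hadd u v hu hv => rw [map_add, LinearMap.add_apply, map_add, hu, hv, add_smul]
  | hmul u v hu hv => rw [map_mul, Module.End.mul_apply, hu, hv, mul_smul]

/-- By `U(𝔤)`-equivariance the class of `u ⊗ v` is the image of `u (1 ⊗ v)`. -/
theorem fourierInv_surjective : Function.Surjective (fourierInv p m lam V) := by
  intro y
  obtain ⟨y, rfl⟩ := Submodule.mkQ_surjective _ y
  change ∃ f, _ = vermaMk p m lam V y
  induction y with
  | zero => exact ⟨0, by simp⟩
  | add a b ha hb =>
    obtain ⟨f, hf⟩ := ha
    obtain ⟨g, hg⟩ := hb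
    exact ⟨f + g, by rw [map_add, map_add, hf, hg]⟩
  | tmul u v =>
    refine ⟨polyRepEnv p m lam V u (1 ⊗ₜ v), ?_⟩
    rw [fourierInv_polyRepEnv, fourierInv_one_tmul, ← vermaMk_smul, mul_one]

/-- The map `u ⊗ v ↦ u (1 ⊗ v)`. -/
def envToPoly : Env p m ⊗[ℂ] V →ₗ[ℂ] Poly m ⊗[ℂ] V :=
  TensorProduct.lift
    ((polyRepEnv p m lam V).toLinearMap.compl₂ (TensorProduct.mk ℂ (Poly m) V 1))

theorem envToPoly_tmul (u : Env p m) (v : V) :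
    envToPoly p m lam V (u ⊗ₜ v) = polyRepEnv p m lam V u (1 ⊗ₜ v) := rfl

theorem envToPoly_smul (u : Env p m) (y : Env p m ⊗[ℂ] V) :
    envToPoly p m lam V (u • y) = polyRepEnv p m lam V u (envToPoly p m lam V y) := by
  induction y with
  | zero => simp
  | add a b ha hb => rw [smul_add, map_add, ha, hb, map_add, map_add]
  | tmul w v =>
    rw [TensorProduct.smul_tmul', envToPoly_tmul, envToPoly_tmul, smul_eq_mul, map_mul,
      Module.End.mul_apply]

/-- The constants carry the representation `V_λ` of `𝔭`, so the generating relations are killed; the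
kernel is a `U(𝔤)`-submodule. -/
theorem envToPoly_vermaRel (y : Env p m ⊗[ℂ] V) (hy : y ∈ vermaRel p m lam V) :
    envToPoly p m lam V y = 0 := by
  refine Submodule.span_induction ?_ (map_zero _) ?_ ?_ hy
  · rintro _ ⟨x, v, rfl⟩
    rw [map_sub, envToPoly_tmul, envToPoly_tmul, polyRepEnv_ι, map_one, polyRep_one_tmul,
      Module.End.one_apply, sub_self]
  · intro a b _ _ ha hb
    rw [map_add, ha, hb, add_zero]
  · intro u y _ h
    rw [envToPoly_smul, h, map_zero]

/-- The Fourier transform, inverse to `fourierInv`. -/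
def fourier : Verma p m lam V →ₗ[ℂ] Poly m ⊗[ℂ] V :=
  ((vermaRel p m lam V).restrictScalars ℂ).liftQ (envToPoly p m lam V)
    (fun y hy => envToPoly_vermaRel p m lam V y hy)

/-- The composite fixes constants and commutes with multiplication by each `ξ_k`. This yields
injectivity of `φ` without a basis of `U(𝔤)`. -/
theorem fourier_fourierInv (f : Poly m ⊗[ℂ] V) :
    fourier p m lam V (fourierInv p m lam V f) = f := by
  have h : ∀ y, fourier p m lam V (vermaMk p m lam V y) = envToPoly p m lam V y := fun _ => rfl
  induction f using polyTensor_induction with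
  | hC v => rw [fourierInv_one_tmul, h, envToPoly_tmul, map_one, Module.End.one_apply]
  | hadd f g hf hg => rw [map_add, map_add, hf, hg]
  | hX k f hf =>
    have h2 : ∀ (u : Env p m) y, fourier p m lam V (u • y)
        = polyRepEnv p m lam V u (fourier p m lam V y) := by
      intro u y
      obtain ⟨y, rfl⟩ := Submodule.mkQ_surjective _ y
      change fourier p m lam V (u • vermaMk p m lam V y)
        = polyRepEnv p m lam V u (fourier p m lam V (vermaMk p m lam V y))
      rw [← map_smul, h, h, envToPoly_smul]
    rw [fourierInv_mulX, h2, hf, envVar, map_smul, polyRepEnv_ι, polyRep_nMinusBasis, smul_smul]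
    simp

theorem fourierInv_injective : Function.Injective (fourierInv p m lam V) :=
  Function.LeftInverse.injective (fourier_fourierInv p m lam V)

theorem polyRep_nPlusBasis (j : Fin (m + 1)) :
    polyRep p m lam V (nPlusBasis p m j) = dpi p m lam V j := by
  have h1 : ∀ k, (nPlusBasis p m j).1 (Sum.inr 0) (Sum.inl k) = if k = j then 1 else 0 := fun k => by
    simp [nPlusBasis, Matrix.single_apply, eq_comm (a := k)]
  have h2 : ∀ k, (nPlusBasis p m j).1 (Sum.inl k) (Sum.inr 0) = 0 := fun k => by
    simp [nPlusBasis]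
  have h3 : (nPlusBasis p m j).1 (Sum.inr 0) (Sum.inr 0) = 0 := by
    simp [nPlusBasis]
  have h4 : (nPlusBasis p m j).1.toBlocks₁₁ = 0 := by
    ext a b
    simp [nPlusBasis, Matrix.toBlocks₁₁]
  have h5 : ∀ a b, leviVF (nPlusBasis p m j) a b = 0 := fun a b => by
    have : (nPlusBasis p m j).1 (Sum.inl a) (Sum.inl b) = 0 := congrFun (congrFun h4 a) b
    simp [leviVF, h3, this]
  have h6 : spinEl p m 0 = 0 := by simp [spinEl]
  rw [polyRep_eq, leviAct_eq, h3, h4, h6, act_zero]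
  simp_rw [h1, h2, h5]
  simp

theorem polyRep_leviPrime {A : so p m} (hA : A ∈ leviPrime p m) :
    polyRep p m lam V A = leviAct p m lam V A := by
  have h1 : ∀ k, A.1 (Sum.inl k) (Sum.inr 0) = 0 := fun k => hA.1 _ (by simp)
  have h2 : ∀ k, A.1 (Sum.inr 0) (Sum.inl k) = 0 := fun k => by
    have h := so_last_col A k
    rw [hA.2.1 _ (by simp)] at h
    have he := eps_mul_eps p k
    linear_combination eps p k * h - A.1 (Sum.inr 0) (Sum.inl k) * he
  rw [polyRep_eq]
  simp_rw [h1, h2]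
  simp

theorem eq_sum_nPlusBasis {Z : so p m} (hZ : Z ∈ nPlusPrime p m) :
    Z = ∑ j : Fin m, Z.1 (Sum.inr 0) (Sum.inl j.castSucc) • nPlusBasis p m j.castSucc := by
  obtain ⟨h1, h2, h3⟩ := hZ
  have key : Z = ∑ j, Z.1 (Sum.inr 0) (Sum.inl j) • nPlusBasis p m j := by
    apply Subtype.ext
    rw [AddSubmonoidClass.coe_finsetSum]
    ext a b
    rw [Matrix.sum_apply]
    rcases a with a | a
    · rcases b with b | b
      · rw [h2 _ _ (by simp)]
        simp [nPlusBasis]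
      · fin_cases b
        · simp [nPlusBasis, h1]
        · simp [nPlusBasis, Matrix.single_apply, so_last_col Z a, mul_comm]
    · rcases b with b | b
      · fin_cases a
        · simp [nPlusBasis, Matrix.single_apply]
        · simp [nPlusBasis, h2]
      · fin_cases a <;> fin_cases b
        · simp [nPlusBasis, h1]
        · simp [nPlusBasis, so_corner Z]
        · simp [nPlusBasis, h1]
        · simp [nPlusBasis, so_diag Z, h1]
  conv_lhs => rw [key, Fin.sum_univ_castSucc]
  rw [h3, zero_smul, add_zero]

theorem nPlusBasis_mem (j : Fin m) : nPlusBasis p m j.castSucc ∈ nPlusPrime p m := by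
  have hj : Fin.last m ≠ j.castSucc := (Fin.castSucc_lt_last j).ne'
  refine ⟨fun i => ?_, fun i k hi => ?_, fun i => ?_⟩
  · simp [nPlusBasis]
  · simp [nPlusBasis, Ne.symm hi]
  · simp [nPlusBasis, Ne.symm hj]

theorem mem_singular_iff (y : Verma p m lam V) : y ∈ singular p m lam V ↔
    ∀ Z ∈ nPlusPrime p m, UniversalEnvelopingAlgebra.ι ℂ Z • y = 0 := by
  simp only [singular, Submodule.mem_iInf, LinearMap.mem_ker]
  rfl

theorem mem_Sol_iff (f : Poly m ⊗[ℂ] V) : f ∈ Sol p m lam V ↔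
    ∀ j : Fin m, dpi p m lam V j.castSucc f = 0 := by
  simp only [Sol, Submodule.mem_iInf, LinearMap.mem_ker]

/-- `φ` carries `dpi` to `E_j`, and `E_1, …, E_{n-1}` span `𝔫₊'`; for the direction towards `Sol`
injectivity of `φ` is needed. -/
theorem fourierInv_mem_singular_iff (f : Poly m ⊗[ℂ] V) :
    fourierInv p m lam V f ∈ singular p m lam V ↔ f ∈ Sol p m lam V := by
  rw [mem_singular_iff, mem_Sol_iff]
  constructor
  · intro h j
    apply fourierInv_injective p m lam V
    rw [← polyRep_nPlusBasis, fourierInv_polyRep, h _ (nPlusBasis_mem p m j), map_zero]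
  · intro h Z hZ
    rw [← fourierInv_polyRep, eq_sum_nPlusBasis p m hZ, ← polyRepLin_apply, map_sum,
      LinearMap.sum_apply]
    simp only [map_smul, LinearMap.smul_apply, polyRepLin_apply, polyRep_nPlusBasis, h, smul_zero,
      Finset.sum_const_zero, map_zero]

theorem lie_leviPrime_nPlusPrime {A Z : so p m} (hA : A ∈ leviPrime p m) (hZ : Z ∈ nPlusPrime p m) :
    ⁅Z, A⁆ ∈ nPlusPrime p m := by
  have h : (⁅Z, A⁆ : so p m).1 = Z.1 * A.1 - A.1 * Z.1 := rfl
  obtain ⟨a1, a2, a3⟩ := hA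
  obtain ⟨z1, z2, z3⟩ := hZ
  have a4 : ∀ i, i ≠ Sum.inr 0 → A.1 (Sum.inr 0) i = 0 := by
    intro i hi
    rcases i with i | i
    · have h := so_last_col A i
      rw [a2 _ (by simp)] at h
      have he := eps_mul_eps p i
      linear_combination eps p i * h - A.1 (Sum.inr 0) (Sum.inl i) * he
    · fin_cases i
      · exact absurd rfl hi
      · exact so_corner A
  refine ⟨fun i => ?_, fun i k hi => ?_, fun i => ?_⟩
  · rw [h, Matrix.sub_apply, Matrix.mul_apply, Matrix.mul_apply]
    simp only [z1, mul_zero, Finset.sum_const_zero, sub_zero]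
    refine Finset.sum_eq_zero fun c _ => ?_
    by_cases hc : c = Sum.inr 0
    · rw [hc, z1, zero_mul]
    · rw [a1 c hc, mul_zero]
  · rw [h, Matrix.sub_apply, Matrix.mul_apply, Matrix.mul_apply, Finset.sum_eq_zero,
      Finset.sum_eq_zero, sub_zero]
    · intro c _
      by_cases hc : c = Sum.inr 0
      · rw [hc, a1 i hi, zero_mul]
      · rw [z2 c k hc, mul_zero]
    · intro c _
      rcases c with c | c
      · rw [z2 i c hi, zero_mul]
      · fin_cases c
        · rw [show (Sum.inr ((fun i => i) ⟨0, by decide⟩) : Idx m) = Sum.inr 0 from rfl, z1, zero_mul]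
        · rw [show (Sum.inr ((fun i => i) ⟨1, by decide⟩) : Idx m) = Sum.inr 1 from rfl,
            so_last_row A.2, a1 _ (by simp)]
          simp
  · rw [h, Matrix.sub_apply, Matrix.mul_apply, Matrix.mul_apply]
    simp [a3, z3]

/-- On a singular vector `Z A = A Z + [Z, A]` vanishes for `Z ∈ 𝔫₊'`, because `𝔩'` normalizes `𝔫₊'`.
-/
theorem Sol_lie {A : so p m} (hA : A ∈ leviPrime p m) {f : Poly m ⊗[ℂ] V} (hf : f ∈ Sol p m lam V) :
    leviAct p m lam V A f ∈ Sol p m lam V := by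
  rw [← polyRep_leviPrime p m lam V hA, ← fourierInv_mem_singular_iff, mem_singular_iff]
  rw [← fourierInv_mem_singular_iff, mem_singular_iff] at hf
  intro Z hZ
  have h := LieHom.map_lie (UniversalEnvelopingAlgebra.ι ℂ) Z A
  rw [LieRing.of_associative_ring_bracket] at h
  rw [fourierInv_polyRep, smul_smul, ← sub_add_cancel (_ * _) (UniversalEnvelopingAlgebra.ι ℂ A *
    UniversalEnvelopingAlgebra.ι ℂ Z), ← h, add_smul, hf _ (lie_leviPrime_nPlusPrime p m hA hZ),
    mul_smul, hf _ hZ, smul_zero, add_zero]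

end Fourier

end

end SpinorSingular

namespace SpinorSingular

noncomputable section

/-! ### The spin group fixes `e_n`; adjoint action on `𝔫₋` and `𝔫₊` -/

section SpinGroup

variable (p m : ℕ)

theorem vec_mul_e_last (v : Fin (m + 1) → ℂ) (hv : v (Fin.last m) = 0) :
    vec p m v * e p m (Fin.last m) = -(e p m (Fin.last m) * vec p m v) := by
  rw [vec_eq_sum, Finset.sum_mul, Finset.mul_sum, ← Finset.sum_neg_distrib]
  refine Finset.sum_congr rfl fun i _ => ?_
  rw [smul_mul_assoc, mul_smul_comm, ← smul_neg]
  by_cases hi : i = Fin.last m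
  · rw [hi, hv, zero_smul, zero_smul]
  · have h := e_mul_e_add_swap p m i (Fin.last m)
    rw [if_neg hi, map_zero, add_eq_zero_iff_eq_neg] at h
    rw [h]

/-- `e_n` anticommutes with every vector of the hyperplane, hence commutes with products of two of
them. -/
theorem spinPrime_commute_e_last (x : spinPrime p m) :
    Commute ((x : (ClEven p m)ˣ) : Cl p m) (e p m (Fin.last m)) := by
  obtain ⟨x, hx⟩ := x
  change Commute ((x : ClEven p m) : Cl p m) _
  induction hx using Subgroup.closure_induction with
  | mem x hx =>
    obtain ⟨v, w, hv, hw, -, -, h⟩ := hx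
    have h1 := vec_mul_e_last p m (fun i => (v i : ℂ)) (by simp [hv])
    have h2 := vec_mul_e_last p m (fun i => (w i : ℂ)) (by simp [hw])
    rw [h, Commute, SemiconjBy, mul_assoc, h2, mul_neg, ← mul_assoc, h1, neg_mul, neg_neg, mul_assoc]
  | one => exact Commute.one_left _
  | mul x y _ _ hx hy => exact Commute.mul_left hx hy
  | inv x _ hx =>
    have h1 := inv_mul_coe p m x
    have h2 := mul_inv_coe p m x
    set a : Cl p m := ((x : ClEven p m) : Cl p m)
    set b : Cl p m := ((x⁻¹ : (ClEven p m)ˣ) : Cl p m)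
    change b * _ = _ * b
    calc b * e p m (Fin.last m) = b * (e p m (Fin.last m) * a) * b := by
          rw [mul_assoc, mul_assoc, h2, mul_one]
      _ = (b * a) * e p m (Fin.last m) * b := by rw [← hx.eq]; noncomm_ring
      _ = _ := by rw [h1, one_mul]

theorem vecMat_last_col (x : spinPrime p m) (j : Fin (m + 1)) :
    vecMat p m x j (Fin.last m) = if j = Fin.last m then 1 else 0 := by
  have h := vecMat_spec p m x (Fin.last m)
  rw [(spinPrime_commute_e_last p m x).eq, mul_assoc, mul_inv_coe, mul_one] at h
  -- The anticommutator with `e_j` is a scalar that reads off the coefficient of `e_j` in `x e_n x⁻¹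
  -- = e_n`.
  have h1 := e_mul_e_add_swap p m j (Fin.last m)
  rw [h, Finset.mul_sum, Finset.sum_mul, ← Finset.sum_add_distrib] at h1
  simp_rw [mul_smul_comm, smul_mul_assoc, ← smul_add, e_mul_e_add_swap] at h1
  rw [Finset.sum_eq_single j (fun k _ hk => by rw [if_neg (Ne.symm hk), map_zero, smul_zero])
    (fun hj => absurd (Finset.mem_univ j) hj), if_pos rfl, Algebra.smul_def, ← map_mul] at h1
  have h2 := (algebraMap ℂ (Cl p m)).injective h1
  have he := eps_mul_eps p j
  split_ifs at h2 ⊢ with hj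
  · linear_combination (-1 / 2 * eps p j) * h2 + (-vecMat p m x j (Fin.last m) + 1) * he
  · linear_combination (-1 / 2 * eps p j) * h2 + (-vecMat p m x j (Fin.last m)) * he

theorem vecMat_last_row (x : spinPrime p m) (k : Fin (m + 1)) :
    vecMat p m x (Fin.last m) k = if k = Fin.last m then 1 else 0 := by
  have h := congrFun (congrFun (vecMat_orth p m x) (Fin.last m)) k
  rw [Matrix.mul_apply, Finset.sum_eq_single (Fin.last m)] at h
  · rw [Matrix.mul_diagonal, Matrix.transpose_apply, vecMat_last_col, if_pos rfl, one_mul,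
      Matrix.diagonal_apply] at h
    have he := eps_mul_eps p (Fin.last m)
    simp only [eq_comm (a := Fin.last m) (b := k)] at h
    split_ifs at h ⊢ with hk
    · linear_combination eps p (Fin.last m) * h - (vecMat p m x (Fin.last m) k - 1) * he
    · linear_combination eps p (Fin.last m) * h - vecMat p m x (Fin.last m) k * he
  · intro i _ hi
    rw [Matrix.mul_diagonal, Matrix.transpose_apply, vecMat_last_col, if_neg hi]
    ring
  · intro hi; exact absurd (Finset.mem_univ _) hi

/-- A left inverse of a square matrix is also a right inverse. -/
theorem vecMat_orth' (x : spinPrime p m) :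
    vecMat p m x * Matrix.diagonal (eps p) * (vecMat p m x).transpose = Matrix.diagonal (eps p) := by
  have hd : (Matrix.diagonal (eps p) * Matrix.diagonal (eps p)
      : Matrix (Fin (m + 1)) (Fin (m + 1)) ℂ) = 1 := by
    rw [Matrix.diagonal_mul_diagonal]
    simp [eps_mul_eps]
  have h1 : (Matrix.diagonal (eps p) * (vecMat p m x).transpose * Matrix.diagonal (eps p))
      * vecMat p m x = 1 := by
    rw [mul_assoc, mul_assoc, ← mul_assoc _ (Matrix.diagonal (eps p)), vecMat_orth, hd]
  have h2 := mul_eq_one_comm.1 h1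
  calc _ = vecMat p m x * (Matrix.diagonal (eps p) * (vecMat p m x).transpose
        * Matrix.diagonal (eps p)) * Matrix.diagonal (eps p) := by
        simp only [mul_assoc]; rw [hd, mul_one]
    _ = _ := by rw [h2, one_mul]

theorem leviAd_coe (l : LeviGroup p m) (A : so p m) :
    (leviAd p m l A).1 = leviMat p m l * A.1 * leviMatInv p m l := rfl

theorem leviAd_nMinusBasis (l : LeviGroup p m) (k : Fin (m + 1)) :
    leviAd p m l (nMinusBasis p m k)
      = ∑ j, (spinSign p m l.1 * ((l.2 : ℝ) : ℂ)⁻¹ * vecMat p m l.1 j k) • nMinusBasis p m j := by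
  apply Subtype.ext
  rw [leviAd_coe, leviConj_apply, AddSubmonoidClass.coe_finsetSum]
  ext a b
  rw [Matrix.sum_apply]
  have he := eps_mul_eps p k
  rcases a with a | a <;> rcases b with b | b
  · simp [nMinusBasis, Matrix.mul_apply, Matrix.toBlocks₁₁]
  · rw [Matrix.fromBlocks_apply₁₂, Matrix.mul_diagonal, Matrix.mul_apply]
    fin_cases b <;>
      simp [nMinusBasis, Matrix.toBlocks₁₂, Matrix.single_apply]
    ring
  · rw [Matrix.fromBlocks_apply₂₁, Matrix.mul_apply]
    simp_rw [Matrix.diagonal_mul, Matrix.mul_diagonal, Matrix.diagonal_mul]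
    fin_cases a <;>
      simp [nMinusBasis, Matrix.toBlocks₂₁, Matrix.single_apply]
    linear_combination (spinSign p m l.1 * ((l.2 : ℝ) : ℂ)⁻¹ * vecMat p m l.1 b k * eps p b) * he
  · rw [Matrix.fromBlocks_apply₂₂, Matrix.mul_diagonal, Matrix.diagonal_mul]
    simp [nMinusBasis, Matrix.toBlocks₂₂]

/-- As `𝔫₊` is dual to `𝔫₋`, the character is inverted and the matrix is replaced by its inverse
transpose, which for an orthogonal matrix is its conjugate by the signs `ε`. -/
theorem leviAd_nPlusBasis (l : LeviGroup p m) (k : Fin (m + 1)) :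
    leviAd p m l (nPlusBasis p m k) = ∑ j, (spinSign p m l.1 * ((l.2 : ℝ) : ℂ) *
      (eps p k * eps p j * vecMat p m l.1 j k)) • nPlusBasis p m j := by
  apply Subtype.ext
  rw [leviAd_coe, leviConj_apply, AddSubmonoidClass.coe_finsetSum]
  ext a b
  rw [Matrix.sum_apply]
  have he := eps_mul_eps p k
  rcases a with a | a <;> rcases b with b | b
  · simp [nPlusBasis, Matrix.mul_apply, Matrix.toBlocks₁₁]
  · have he' := eps_mul_eps p a
    rw [Matrix.fromBlocks_apply₁₂, Matrix.mul_diagonal, Matrix.mul_apply]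
    fin_cases b <;>
      simp [nPlusBasis, Matrix.toBlocks₁₂, Matrix.single_apply]
    linear_combination (-spinSign p m l.1 * ((l.2 : ℝ) : ℂ) * vecMat p m l.1 a k * eps p k) * he'
  · rw [Matrix.fromBlocks_apply₂₁, Matrix.mul_apply]
    simp_rw [Matrix.diagonal_mul, Matrix.mul_diagonal, Matrix.diagonal_mul]
    fin_cases a <;>
      simp [nPlusBasis, Matrix.toBlocks₂₁, Matrix.single_apply]
    exact Or.inl (by ring)
  · rw [Matrix.fromBlocks_apply₂₂, Matrix.mul_diagonal, Matrix.diagonal_mul]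
    simp [nPlusBasis, Matrix.toBlocks₂₂]

/-- This plays the role of `Ad(l)⁻¹ E_j ∈ 𝔫₊'`. By orthogonality the coefficients are the `j`-th row
of the matrix times the inverse character; the coefficient of `E_n` vanishes because `e_n` is fixed.
-/
theorem exists_leviAd_eq_nPlusBasis (l : LeviGroup p m) (j : Fin m) :
    ∃ c : Fin m → ℂ, nPlusBasis p m j.castSucc
      = leviAd p m l (∑ k : Fin m, c k • nPlusBasis p m k.castSucc) := by
  have ha : ((l.2 : ℝ) : ℂ) ≠ 0 := by exact_mod_cast l.2.2.ne'
  have hs := spinSign_sq p m l.1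
  set c : Fin (m + 1) → ℂ :=
    fun k => spinSign p m l.1 * ((l.2 : ℝ) : ℂ)⁻¹ * vecMat p m l.1 j.castSucc k with hc
  refine ⟨fun k => c k.castSucc, ?_⟩
  have hlast : c (Fin.last m) = 0 := by
    rw [hc]
    simp only
    rw [vecMat_last_col, if_neg (Fin.castSucc_lt_last j).ne, mul_zero]
  have h1 : ∑ k : Fin m, c k.castSucc • nPlusBasis p m k.castSucc = ∑ k, c k • nPlusBasis p m k := by
    rw [Fin.sum_univ_castSucc, hlast, zero_smul, add_zero]
  rw [h1, map_sum]
  simp_rw [map_smul, leviAd_nPlusBasis, Finset.smul_sum, smul_smul]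
  rw [Finset.sum_comm]
  simp_rw [← Finset.sum_smul]
  have h2 : ∀ i, ∑ k, c k * (spinSign p m l.1 * ((l.2 : ℝ) : ℂ)
      * (eps p k * eps p i * vecMat p m l.1 i k)) = if j.castSucc = i then 1 else 0 := by
    intro i
    have h := congrFun (congrFun (vecMat_orth' p m l.1) j.castSucc) i
    rw [Matrix.mul_apply, Matrix.diagonal_apply] at h
    simp_rw [Matrix.mul_diagonal, Matrix.transpose_apply] at h
    have h3 : ∀ k, c k * (spinSign p m l.1 * ((l.2 : ℝ) : ℂ)
      * (eps p k * eps p i * vecMat p m l.1 i k))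
        = eps p i * (vecMat p m l.1 j.castSucc k * eps p k * vecMat p m l.1 i k) := by
      intro k
      simp only [hc]
      field_simp
      linear_combination (vecMat p m l.1 j.castSucc k * eps p k * vecMat p m l.1 i k * eps p i) * hs
    simp_rw [h3]
    rw [← Finset.mul_sum, h]
    split_ifs with hji
    · rw [hji, eps_mul_eps]
    · rw [mul_zero]
  simp_rw [h2]
  simp

end SpinGroup

/-! ### Equivariance of the Fourier transform under the Levi group -/

section Fourier

variable (p m : ℕ) (lam : ℂ) (V : Type*) [AddCommGroup V] [Module ℂ V] [Module (ClEven p m) V]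
  [IsScalarTower ℂ (ClEven p m) V]

theorem leviAdEnv_ι (l : LeviGroup p m) (A : so p m) :
    leviAdEnv p m l (UniversalEnvelopingAlgebra.ι ℂ A)
      = UniversalEnvelopingAlgebra.ι ℂ (leviAd p m l A) := by
  rw [leviAdEnv, UniversalEnvelopingAlgebra.lift_ι_apply]; rfl

theorem vermaAct_mk (l : LeviGroup p m) (y : Env p m ⊗[ℂ] V) :
    vermaAct p m lam V l (vermaMk p m lam V y) = vermaMk p m lam V (envAct p m lam V l y) := rfl

theorem vermaAct_smul (l : LeviGroup p m) (u : Env p m) (y : Verma p m lam V) :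
    vermaAct p m lam V l (u • y) = leviAdEnv p m l u • vermaAct p m lam V l y := by
  obtain ⟨y, rfl⟩ := Submodule.mkQ_surjective _ y
  change vermaAct p m lam V l (u • vermaMk p m lam V y)
    = leviAdEnv p m l u • vermaAct p m lam V l (vermaMk p m lam V y)
  rw [← map_smul, vermaAct_mk, vermaAct_mk, ← map_smul]
  congr 1
  induction y with
  | zero => simp
  | tmul w v => simp [envAct, TensorProduct.smul_tmul']
  | add a b ha hb => rw [smul_add, map_add, ha, hb, map_add, smul_add]

/-- The substitution on the `ξ_k` matches `Ad(l)` on the `F_k`, and homomorphisms out of a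
polynomial ring which agree on the variables are equal. -/
theorem fourierInv_polyAct (l : LeviGroup p m) (f : Poly m ⊗[ℂ] V) :
    fourierInv p m lam V (polyAct p m lam V l f)
      = vermaAct p m lam V l (fourierInv p m lam V f) := by
  have h : (polyToEnvHom p m).comp (MvPolynomial.aeval fun k =>
      (spinSign p m l.1 * ((l.2 : ℝ) : ℂ)⁻¹) •
        ∑ j, vecMat p m l.1 j k • (MvPolynomial.X j : Poly m))
      = (leviAdEnv p m l).comp (polyToEnvHom p m) := by
    refine MvPolynomial.algHom_ext fun k => ?_
    simp only [AlgHom.comp_apply, MvPolynomial.aeval_X, map_smul, map_sum, polyToEnvHom_X, envVar,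
      leviAdEnv_ι, leviAd_nMinusBasis, Finset.smul_sum, smul_smul]
    refine Finset.sum_congr rfl fun j _ => ?_
    congr 1
    ring
  induction f with
  | zero => simp
  | add f g hf hg => rw [map_add, map_add, map_add, map_add, hf, hg]
  | tmul f v =>
    rw [fourierInv_tmul, vermaAct_mk, envAct, TensorProduct.map_tmul, polyAct,
      TensorProduct.map_tmul, fourierInv_tmul]
    exact congrArg (fun u => vermaMk p m lam V (u ⊗ₜ _)) (DFunLike.congr_fun h f)

/-- `E_j` applied to `l y` is `l` applied to `(Ad(l)⁻¹ E_j) y`, and `Ad(l)⁻¹ E_j` is a combination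
of `E_1, …, E_{n-1}`. -/
theorem Sol_polyAct (l : LeviGroup p m) {f : Poly m ⊗[ℂ] V} (hf : f ∈ Sol p m lam V) :
    polyAct p m lam V l f ∈ Sol p m lam V := by
  rw [mem_Sol_iff]
  intro j
  apply fourierInv_injective p m lam V
  obtain ⟨c, hc⟩ := exists_leviAd_eq_nPlusBasis p m l j
  rw [← polyRep_nPlusBasis, fourierInv_polyRep, fourierInv_polyAct, hc, ← leviAdEnv_ι,
    ← vermaAct_smul, ← fourierInv_polyRep, ← polyRepLin_apply, map_sum, LinearMap.sum_apply]
  rw [mem_Sol_iff] at hf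
  simp only [map_smul, LinearMap.smul_apply, polyRepLin_apply, polyRep_nPlusBasis, hf, smul_zero,
    Finset.sum_const_zero, map_zero]

theorem isFourierIso : IsFourierIso p m lam V where
  intertwines j f := by rw [← polyRep_nPlusBasis, fourierInv_polyRep]
  bijOn := by
    refine ⟨fun f hf => (fourierInv_mem_singular_iff p m lam V f).2 hf,
      (fourierInv_injective p m lam V).injOn, fun y hy => ?_⟩
    obtain ⟨f, rfl⟩ := fourierInv_surjective p m lam V y
    exact ⟨f, (fourierInv_mem_singular_iff p m lam V f).1 hy, rfl⟩
  group_equivariant l f hf := ⟨Sol_polyAct p m lam V l hf, fourierInv_polyAct p m lam V l f⟩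
  lie_equivariant A hA f hf :=
    ⟨Sol_lie p m lam V hA hf, by rw [← polyRep_leviPrime p m lam V hA, fourierInv_polyRep]⟩

end Fourier

end

end SpinorSingular

namespace SpinorSingular

noncomputable section

/-! ### Dirac operators, Clifford multiplication and their relations -/

section PrimedOperators

variable (p m : ℕ) (S : Type*) [AddCommGroup S] [Module ℂ S]

/-- The Euler operator in the variables `ξ_1, …, ξ_{n-1}`. -/
def eulerPrime :
    Module.End ℂ (Poly m ⊗[ℂ] S) := ∑ k : Fin m, mulX k.castSucc * dX k.castSucc

/-- Multiplication by `∑_{j<n} ε_j ξ_j²`. -/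
def normOp :
    Module.End ℂ (Poly m ⊗[ℂ] S) :=
  ∑ k : Fin m, eps p k.castSucc • (mulX k.castSucc * mulX k.castSucc)

/-- The Laplacian in the variables `ξ_1, …, ξ_{n-1}`. -/
def boxPrime :
    Module.End ℂ (Poly m ⊗[ℂ] S) :=
  ∑ k : Fin m, eps p k.castSucc • (dX k.castSucc * dX k.castSucc)

theorem box_eq : (box p : Module.End ℂ (Poly m ⊗[ℂ] S))
    = boxPrime p m S + eps p (Fin.last m) • (dX (Fin.last m) * dX (Fin.last m)) := by
  rw [box, boxPrime, Fin.sum_univ_castSucc]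

end PrimedOperators

section Spinors

variable (p m : ℕ) (lam : ℂ) (S : Type*) [AddCommGroup S] [Module ℂ S] [Module (Cl p m) S]
  [IsScalarTower ℂ (Cl p m) S]

/-- Clifford multiplication by `ξ' = ∑_{j<n} ε_j e_j ξ_j`. -/
def xiOp : Module.End ℂ (Poly m ⊗[ℂ] S) :=
  ∑ k : Fin m, eps p k.castSucc • (mulX k.castSucc * act (e p m k.castSucc))

theorem act_e_mul_act_e (j k : Fin (m + 1)) :
    (act (e p m j) * act (e p m k) + act (e p m k) * act (e p m j)
      : Module.End ℂ (Poly m ⊗[ℂ] S)) = (if j = k then -2 * eps p j else 0 : ℂ) • 1 := by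
  rw [← act_mul, ← act_mul, ← act_add, e_mul_e_add_swap, act_algebraMap]

theorem act_e_sq (j : Fin (m + 1)) :
    (act (e p m j) * act (e p m j) : Module.End ℂ (Poly m ⊗[ℂ] S)) = (-eps p j) • 1 := by
  rw [← act_mul, e_mul_self, act_algebraMap]

theorem act_e_anticomm {j k : Fin (m + 1)} (h : j ≠ k) :
    (act (e p m j) * act (e p m k) : Module.End ℂ (Poly m ⊗[ℂ] S))
      = -(act (e p m k) * act (e p m j)) := by
  have := act_e_mul_act_e p m S j k
  rwa [if_neg h, zero_smul, add_eq_zero_iff_eq_neg] at this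

theorem dirac_eq : dirac p m S = dirac' p m S + act (e p m (Fin.last m)) * dX (Fin.last m) := by
  rw [dirac, dirac', Fin.sum_univ_castSucc]

theorem euler_eq : (euler : Module.End ℂ (Poly m ⊗[ℂ] S))
    = eulerPrime m S + mulX (Fin.last m) * dX (Fin.last m) := by
  rw [euler, eulerPrime, Fin.sum_univ_castSucc]

theorem sum_mul_sum_add_swap {R ι : Type*} [Ring R] [Fintype ι] (a : ι → R) :
    (∑ i, a i) * (∑ i, a i) + (∑ i, a i) * (∑ i, a i)
      = ∑ i, ∑ j, (a i * a j + a j * a i) := by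
  simp_rw [Finset.sum_add_distrib]
  rw [Finset.sum_comm (f := fun i j => a j * a i), Finset.sum_mul_sum]

/-- In the symmetrized double sum the mixed terms cancel by anticommutation. The operators `u` are
derivatives or signed coordinates, which gives `D² = -□`, `D'² = -□'` and `ξ'² = -r` at once. -/
theorem cliffordSum_sq {ι : Type*} [Fintype ι] [DecidableEq ι] (i : ι → Fin (m + 1))
    (hi : Function.Injective i) (u : ι → Module.End ℂ (Poly m ⊗[ℂ] S))
    (hu : ∀ a b, u a * u b = u b * u a)
    (hact : ∀ a b, act (e p m (i a)) * u b = u b * act (e p m (i a))) :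
    (∑ a, act (e p m (i a)) * u a) * (∑ a, act (e p m (i a)) * u a)
      = -∑ a, eps p (i a) • (u a * u a) := by
  have h := sum_mul_sum_add_swap fun a => act (e p m (i a)) * u a
  have h1 : ∀ a b, act (e p m (i a)) * u a * (act (e p m (i b)) * u b)
      + act (e p m (i b)) * u b * (act (e p m (i a)) * u a)
      = if a = b then (-2 * eps p (i a)) • (u a * u a) else 0 := by
    intro a b
    have h2 : act (e p m (i a)) * u a * (act (e p m (i b)) * u b)
        = act (e p m (i a)) * act (e p m (i b)) * (u a * u b) := by
      rw [mul_assoc, ← mul_assoc (u a), ← hact]; simp only [mul_assoc]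
    have h3 : act (e p m (i b)) * u b * (act (e p m (i a)) * u a)
        = act (e p m (i b)) * act (e p m (i a)) * (u a * u b) := by
      rw [mul_assoc, ← mul_assoc (u b), ← hact, hu a b]; simp only [mul_assoc]
    rw [h2, h3, ← add_mul, act_e_mul_act_e, smul_mul_assoc, one_mul]
    by_cases hab : a = b
    · rw [if_pos hab, if_pos (by rw [hab]), ← hab]
    · rw [if_neg hab, if_neg (fun h => hab (hi h)), zero_smul]
  simp_rw [h1] at h
  simp only [Finset.sum_ite_eq, Finset.mem_univ, if_true] at h
  rw [← two_smul ℂ] at h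
  have h4 := congrArg (fun z => (2⁻¹ : ℂ) • z) h
  simp only [smul_smul, Finset.smul_sum] at h4
  rw [inv_mul_cancel₀ two_ne_zero, one_smul] at h4
  rw [h4, ← Finset.sum_neg_distrib]
  refine Finset.sum_congr rfl fun a _ => ?_
  rw [← neg_smul]
  congr 1
  ring

theorem dirac_sq : dirac p m S * dirac p m S = -box p :=
  cliffordSum_sq p m S id Function.injective_id _ dX_mul_dX fun _ _ => act_mul_dX _ _

theorem diracPrime_sq : dirac' p m S * dirac' p m S = -boxPrime p m S :=
  cliffordSum_sq p m S Fin.castSucc (Fin.castSucc_injective m) _ (fun _ _ => dX_mul_dX _ _)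
    fun _ _ => act_mul_dX _ _

theorem xiOp_eq : xiOp p m S = ∑ k : Fin m,
    act (e p m k.castSucc) * (eps p k.castSucc • mulX k.castSucc) := by
  refine Finset.sum_congr rfl fun k _ => ?_
  rw [mul_smul_comm, act_mul_mulX]

theorem xiOp_sq : xiOp p m S * xiOp p m S = -normOp p m S := by
  rw [xiOp_eq, cliffordSum_sq p m S Fin.castSucc (Fin.castSucc_injective m)
    (fun k => eps p k.castSucc • mulX k.castSucc), normOp]
  · congr 1
    refine Finset.sum_congr rfl fun k _ => ?_
    rw [smul_mul_smul_comm, eps_mul_eps, one_smul]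
  · intro a b
    rw [smul_mul_smul_comm, smul_mul_smul_comm, mulX_mul_mulX, mul_comm]
  · intro a b
    rw [mul_smul_comm, smul_mul_assoc, act_mul_mulX]

/-- In the anticommutator only the diagonal pairs survive, each contributing `-2ξ_j∂_j - 1`.
Together with the formulas for the squares this relation of `𝔬𝔰𝔭(1|2)` governs the later
computations with `D'` and `ξ'`. -/
theorem diracPrime_mul_xiOp : dirac' p m S * xiOp p m S
    = -(xiOp p m S * dirac' p m S) - (2 : ℂ) • eulerPrime m S - (m : ℂ) • 1 := by
  have h1 : dirac' p m S * xiOp p m S + xiOp p m S * dirac' p m S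
      = ∑ j : Fin m, ∑ k : Fin m, (act (e p m j.castSucc) * dX j.castSucc *
          (eps p k.castSucc • (mulX k.castSucc * act (e p m k.castSucc)))
        + eps p k.castSucc • (mulX k.castSucc * act (e p m k.castSucc)) *
          (act (e p m j.castSucc) * dX j.castSucc)) := by
    simp_rw [Finset.sum_add_distrib]
    rw [Finset.sum_comm (f := fun j k => eps p (Fin.castSucc k) • _ * _), dirac', xiOp,
      Finset.sum_mul_sum, Finset.sum_mul_sum]
  have h2 : ∀ j k : Fin m, (act (e p m j.castSucc) * dX j.castSucc *
          (eps p k.castSucc • (mulX k.castSucc * act (e p m k.castSucc)))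
        + eps p k.castSucc • (mulX k.castSucc * act (e p m k.castSucc)) *
          (act (e p m j.castSucc) * dX j.castSucc) : Module.End ℂ (Poly m ⊗[ℂ] S))
      = if j = k then -((2 : ℂ) • (mulX j.castSucc * dX j.castSucc)) - 1 else 0 := by
    intro j k
    have h3 : (act (e p m j.castSucc) * dX j.castSucc *
          (mulX k.castSucc * act (e p m k.castSucc)) : Module.End ℂ (Poly m ⊗[ℂ] S))
        = mulX k.castSucc * dX j.castSucc * (act (e p m j.castSucc) * act (e p m k.castSucc))
          + if j = k then act (e p m j.castSucc) * act (e p m k.castSucc) else 0 := by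
      have : (act (e p m j.castSucc) * dX j.castSucc *
          (mulX k.castSucc * act (e p m k.castSucc)) : Module.End ℂ (Poly m ⊗[ℂ] S))
          = dX j.castSucc * mulX k.castSucc * (act (e p m j.castSucc) * act (e p m k.castSucc)) := by
        rw [act_mul_dX, mul_assoc, ← mul_assoc (act _), act_mul_mulX]
        simp only [mul_assoc]
      rw [this, dX_mul_mulX, add_mul]
      congr 1
      by_cases h : j = k
      · rw [if_pos h, if_pos (by rw [h]), one_mul]
      · rw [if_neg h, if_neg (fun h' => h (Fin.castSucc_injective m h')), zero_mul]
    have h4 : (mulX k.castSucc * act (e p m k.castSucc) *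
          (act (e p m j.castSucc) * dX j.castSucc) : Module.End ℂ (Poly m ⊗[ℂ] S))
        = mulX k.castSucc * dX j.castSucc * (act (e p m k.castSucc) * act (e p m j.castSucc)) := by
      rw [act_mul_dX, mul_assoc, ← mul_assoc (act _), act_mul_dX]
      simp only [mul_assoc]
    rw [mul_smul_comm, smul_mul_assoc, ← smul_add, h3, h4, add_right_comm, ← mul_add,
      act_e_mul_act_e]
    by_cases h : j = k
    · subst h
      have he := eps_mul_eps p j.castSucc
      rw [if_pos rfl, if_pos rfl, if_pos rfl, act_e_sq, mul_smul_comm, smul_add, smul_smul,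
        smul_smul, mul_one]
      rw [show eps p j.castSucc * (-2 * eps p j.castSucc) = -2 by linear_combination (-2) * he,
        show eps p j.castSucc * -eps p j.castSucc = -1 by linear_combination -he]
      module
    · rw [if_neg h, if_neg h, if_neg (fun h' => h (Fin.castSucc_injective m h')), zero_smul,
        mul_zero, add_zero, smul_zero]
  rw [← sub_eq_zero]
  simp_rw [h2] at h1
  simp only [Finset.sum_ite_eq, Finset.mem_univ, if_true, Finset.sum_sub_distrib,
    Finset.sum_neg_distrib, ← Finset.smul_sum, Finset.sum_const, Finset.card_univ,
    Fintype.card_fin] at h1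
  have h5 : (∑ k : Fin m, mulX k.castSucc * dX k.castSucc : Module.End ℂ (Poly m ⊗[ℂ] S))
      = eulerPrime m S := rfl
  rw [h5, ← Nat.cast_smul_eq_nsmul ℂ] at h1
  rw [← eq_sub_iff_add_eq] at h1
  rw [h1]
  abel

theorem dX_mul_xiOp (j : Fin m) : dX j.castSucc * xiOp p m S
    = xiOp p m S * dX j.castSucc + eps p j.castSucc • act (e p m j.castSucc) := by
  have h : ∀ k : Fin m, (dX j.castSucc * (eps p k.castSucc • (mulX k.castSucc *
        act (e p m k.castSucc))) : Module.End ℂ (Poly m ⊗[ℂ] S))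
      = eps p k.castSucc • (mulX k.castSucc * act (e p m k.castSucc)) * dX j.castSucc
        + if j = k then eps p k.castSucc • act (e p m k.castSucc) else 0 := fun k => by
    rw [mul_smul_comm, ← mul_assoc, dX_mul_mulX, add_mul, smul_mul_assoc, mul_assoc, ← act_mul_dX,
      smul_add, mul_assoc]
    congr 1
    by_cases h : j = k
    · rw [if_pos h, if_pos (by rw [h]), one_mul]
    · rw [if_neg h, if_neg (fun h' => h (Fin.castSucc_injective m h')), zero_mul, smul_zero]
  rw [xiOp, Finset.mul_sum, Finset.sum_mul, Finset.sum_congr rfl fun k _ => h k,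
    Finset.sum_add_distrib]
  simp

theorem dX_last_mul_xiOp : dX (Fin.last m) * xiOp p m S = xiOp p m S * dX (Fin.last m) := by
  rw [xiOp, Finset.mul_sum, Finset.sum_mul]
  refine Finset.sum_congr rfl fun k _ => ?_
  rw [mul_smul_comm, ← mul_assoc, dX_mul_mulX, if_neg (Fin.castSucc_lt_last k).ne', add_zero,
    smul_mul_assoc, mul_assoc, ← act_mul_dX, mul_assoc]

theorem mulX_mul_xiOp (j : Fin (m + 1)) : mulX j * xiOp p m S = xiOp p m S * mulX j := by
  rw [xiOp, Finset.mul_sum, Finset.sum_mul]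
  refine Finset.sum_congr rfl fun k _ => ?_
  rw [mul_smul_comm, ← mul_assoc, mulX_mul_mulX, smul_mul_assoc, mul_assoc, ← act_mul_mulX,
    mul_assoc]

theorem act_last_mul_xiOp : act (e p m (Fin.last m)) * xiOp p m S
    = -(xiOp p m S * act (e p m (Fin.last m))) := by
  rw [xiOp, Finset.mul_sum, Finset.sum_mul, ← Finset.sum_neg_distrib]
  refine Finset.sum_congr rfl fun k _ => ?_
  rw [mul_smul_comm, ← mul_assoc, act_mul_mulX, mul_assoc,
    act_e_anticomm p m S (Fin.castSucc_lt_last k).ne', smul_mul_assoc, mul_neg, smul_neg, mul_assoc]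

theorem act_last_mul_diracPrime : act (e p m (Fin.last m)) * dirac' p m S
    = -(dirac' p m S * act (e p m (Fin.last m))) := by
  rw [dirac', Finset.mul_sum, Finset.sum_mul, ← Finset.sum_neg_distrib]
  refine Finset.sum_congr rfl fun k _ => ?_
  rw [← mul_assoc, act_e_anticomm p m S (Fin.castSucc_lt_last k).ne', neg_mul, mul_assoc,
    act_mul_dX, ← mul_assoc]

theorem mulX_last_mul_diracPrime :
    mulX (Fin.last m) * dirac' p m S = dirac' p m S * mulX (Fin.last m) := by
  rw [dirac', Finset.mul_sum, Finset.sum_mul]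
  refine Finset.sum_congr rfl fun k _ => ?_
  rw [mul_assoc, dX_mul_mulX, if_neg (Fin.castSucc_lt_last k).ne, add_zero, ← mul_assoc,
    ← act_mul_mulX, mul_assoc]

theorem dX_mul_diracPrime (j : Fin (m + 1)) : dX j * dirac' p m S = dirac' p m S * dX j := by
  rw [dirac', Finset.mul_sum, Finset.sum_mul]
  refine Finset.sum_congr rfl fun k _ => ?_
  rw [← mul_assoc, ← act_mul_dX, mul_assoc, dX_mul_dX, mul_assoc]

theorem dX_mul_dirac (j : Fin (m + 1)) : dX j * dirac p m S = dirac p m S * dX j := by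
  rw [dirac, Finset.mul_sum, Finset.sum_mul]
  refine Finset.sum_congr rfl fun k _ => ?_
  rw [← mul_assoc, ← act_mul_dX, mul_assoc, dX_mul_dX, mul_assoc]

theorem act_mul_euler (a : Cl p m) :
    (act a * euler : Module.End ℂ (Poly m ⊗[ℂ] S)) = euler * act a := by
  rw [euler, Finset.mul_sum, Finset.sum_mul]
  refine Finset.sum_congr rfl fun k _ => ?_
  rw [← mul_assoc, act_mul_mulX, mul_assoc, act_mul_dX, mul_assoc]

theorem euler_mul_xiOp : euler * xiOp p m S = xiOp p m S * euler + xiOp p m S := by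
  rw [xiOp, Finset.mul_sum, Finset.sum_mul, ← Finset.sum_add_distrib]
  refine Finset.sum_congr rfl fun k _ => ?_
  rw [mul_smul_comm, ← mul_assoc, euler_mul_mulX, add_mul, smul_add, smul_mul_assoc, mul_assoc,
    mul_assoc, act_mul_euler]

theorem diracPrime_mul_euler : dirac' p m S * euler = euler * dirac' p m S + dirac' p m S := by
  rw [dirac', Finset.mul_sum, Finset.sum_mul, ← Finset.sum_add_distrib]
  refine Finset.sum_congr rfl fun k _ => ?_
  rw [mul_assoc, dX_mul_euler, mul_add, ← mul_assoc, act_mul_euler, mul_assoc]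

/-- On a module over the full Clifford algebra the products `e_j e_k` split, and `D` becomes an
operator of its own. -/
theorem dpi_eq (j : Fin (m + 1)) : dpi p m lam S j = (-Complex.I) •
    ((1 / 2 * eps p j : ℂ) • (mulX j * box p) + ((lam - 1 / 2) • 1 - euler) * dX j
    - (1 / 2 * eps p j : ℂ) • (act (e p m j) * dirac p m S)) := by
  have h : ∀ k, (act (ee p m j k) : Module.End ℂ (Poly m ⊗[ℂ] S))
      = act (e p m j) * act (e p m k) := fun k => by
    rw [← act_mul]; rfl
  rw [dpi, dirac, Finset.mul_sum]
  simp_rw [h, mul_assoc]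

end Spinors

end

end SpinorSingular

namespace SpinorSingular

noncomputable section

/-! ### Polynomials in `r` and `ξ_n` -/

section RadialPolynomials

variable (p m : ℕ)

/-- The polynomial `∑_{j<n} ε_j ξ_j²`. -/
def normPoly : Poly m :=
  ∑ j : Fin m, MvPolynomial.C (eps p j.castSucc) * MvPolynomial.X j.castSucc ^ 2

/-- The polynomial `∑_{k<L} c_k r^k ξ_n^{d-2k}` with `r = ∑_{j<n} ε_j ξ_j²`. -/
def radial (c : ℕ → ℂ) (d L : ℕ) : Poly m :=
  ∑ k ∈ Finset.range L, MvPolynomial.C (c k) * normPoly p m ^ k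
    * MvPolynomial.X (Fin.last m) ^ (d - 2 * k)

/-- The polynomial `f♭` with `∂_j f = ε_j ξ_j f♭` for `j < n` and `f = radial p m c d L`. -/
def radialFlat (c : ℕ → ℂ) (d L : ℕ) : Poly m :=
  ∑ k ∈ Finset.range L, MvPolynomial.C (2 * k * c k) * normPoly p m ^ (k - 1)
    * MvPolynomial.X (Fin.last m) ^ (d - 2 * k)

theorem pderiv_normPoly (j : Fin m) : MvPolynomial.pderiv j.castSucc (normPoly p m)
    = MvPolynomial.C (2 * eps p j.castSucc) * MvPolynomial.X j.castSucc := by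
  rw [normPoly, map_sum, Finset.sum_eq_single j]
  · rw [MvPolynomial.pderiv_C_mul, Derivation.leibniz_pow, MvPolynomial.pderiv_X_self, map_mul]
    simp only [smul_eq_mul, nsmul_eq_mul, Nat.cast_ofNat, mul_one, map_ofNat]
    ring
  · intro k _ hk
    have : k.castSucc ≠ j.castSucc := fun h => hk (Fin.castSucc_injective m h)
    rw [MvPolynomial.pderiv_C_mul, Derivation.leibniz_pow, MvPolynomial.pderiv_X_of_ne this]
    simp
  · intro h; exact absurd (Finset.mem_univ j) h

theorem pderiv_last_normPoly : MvPolynomial.pderiv (Fin.last m) (normPoly p m) = 0 := by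
  rw [normPoly, map_sum]
  refine Finset.sum_eq_zero fun k _ => ?_
  rw [MvPolynomial.pderiv_C_mul, Derivation.leibniz_pow,
    MvPolynomial.pderiv_X_of_ne (Fin.castSucc_lt_last k).ne]
  simp

theorem pderiv_radial (c : ℕ → ℂ) (d L : ℕ) (j : Fin m) :
    MvPolynomial.pderiv j.castSucc (radial p m c d L)
      = MvPolynomial.C (eps p j.castSucc) * (MvPolynomial.X j.castSucc * radialFlat p m c d L) := by
  rw [radial, radialFlat, map_sum, Finset.mul_sum, Finset.mul_sum]
  refine Finset.sum_congr rfl fun k _ => ?_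
  rw [mul_assoc, MvPolynomial.pderiv_C_mul, Derivation.leibniz, Derivation.leibniz_pow,
    Derivation.leibniz_pow, pderiv_normPoly,
    MvPolynomial.pderiv_X_of_ne (Fin.castSucc_lt_last j).ne']
  simp only [smul_eq_mul, nsmul_eq_mul, map_mul, map_natCast, map_ofNat]
  ring

theorem pderiv_last_radial (c : ℕ → ℂ) (d L : ℕ) :
    MvPolynomial.pderiv (Fin.last m) (radial p m c d L)
      = ∑ k ∈ Finset.range L, MvPolynomial.C (((d - 2 * k : ℕ) : ℂ) * c k) * normPoly p m ^ k
        * MvPolynomial.X (Fin.last m) ^ (d - 2 * k - 1) := by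
  rw [radial, map_sum]
  refine Finset.sum_congr rfl fun k _ => ?_
  rw [mul_assoc, MvPolynomial.pderiv_C_mul, Derivation.leibniz, Derivation.leibniz_pow,
    Derivation.leibniz_pow, pderiv_last_normPoly, MvPolynomial.pderiv_X_self]
  simp only [smul_eq_mul, nsmul_eq_mul, map_mul, map_natCast]
  ring

/-- This product is the image of the radial polynomial under `E'`, which weights `r^k` by `2k`. For
`k = 0` the factor `k` hides the truncated exponent `k - 1`. -/
theorem normPoly_mul_radialFlat (c : ℕ → ℂ) (d L : ℕ) :
    normPoly p m * radialFlat p m c d L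
      = ∑ k ∈ Finset.range L, MvPolynomial.C (2 * k * c k) * normPoly p m ^ k
        * MvPolynomial.X (Fin.last m) ^ (d - 2 * k) := by
  rw [radialFlat, Finset.mul_sum]
  refine Finset.sum_congr rfl fun k _ => ?_
  rcases k with _ | k
  · simp
  · rw [Nat.add_sub_cancel, pow_succ]; ring

theorem isHomogeneous_normPoly : (normPoly p m).IsHomogeneous 2 := by
  refine MvPolynomial.IsHomogeneous.sum _ _ _ fun j _ => ?_
  simpa using (MvPolynomial.isHomogeneous_C _ (eps p j.castSucc)).mul
    ((MvPolynomial.isHomogeneous_X ℂ j.castSucc).pow 2)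

theorem isHomogeneous_radial (c : ℕ → ℂ) (d L : ℕ) (hL : 2 * (L - 1) ≤ d) :
    (radial p m c d L).IsHomogeneous d := by
  refine MvPolynomial.IsHomogeneous.sum _ _ _ fun k hk => ?_
  have hk' := Finset.mem_range.1 hk
  have h := ((MvPolynomial.isHomogeneous_C _ (c k)).mul ((isHomogeneous_normPoly p m).pow k)).mul
    ((MvPolynomial.isHomogeneous_X ℂ (Fin.last m)).pow (d - 2 * k))
  convert h using 1
  omega

theorem C_mul_X_mul_radial (z : ℂ) (c : ℕ → ℂ) (d L : ℕ) (hL : 2 * (L - 1) ≤ d) :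
    MvPolynomial.C z * MvPolynomial.X (Fin.last m) * radial p m c d L
      = radial p m (fun k => z * c k) (d + 1) L := by
  rw [radial, radial, Finset.mul_sum]
  refine Finset.sum_congr rfl fun k hk => ?_
  have hk' := Finset.mem_range.1 hk
  rw [show d + 1 - 2 * k = d - 2 * k + 1 by omega, pow_succ, map_mul]
  ring

/-- `gegPoly` as a radial polynomial, for `ε_n = -1`. -/
theorem gegPoly_eq_radial (he : eps p (Fin.last m) = -1) (α : ℂ) (l : ℕ) :
    gegPoly p m α l = radial p m (gegCoeff α l) (2 * (l / 2)) (l / 2 + 1) := by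
  rw [gegPoly, radial]
  refine Finset.sum_congr rfl fun k _ => ?_
  rw [he, map_neg, map_one, neg_mul, neg_neg, one_mul, Nat.mul_sub]
  rfl

/-- The substitution by which `L̃'` acts on polynomials. -/
def leviSubst (l : LeviGroup p m) : Poly m →ₐ[ℂ] Poly m :=
  MvPolynomial.aeval fun k => (spinSign p m l.1 * ((l.2 : ℝ) : ℂ)⁻¹) •
      ∑ j, vecMat p m l.1 j k • (MvPolynomial.X j : Poly m)

theorem leviSubst_last (l : LeviGroup p m) : leviSubst p m l (MvPolynomial.X (Fin.last m))
    = MvPolynomial.C (spinSign p m l.1 * ((l.2 : ℝ) : ℂ)⁻¹) * MvPolynomial.X (Fin.last m) := by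
  rw [leviSubst, MvPolynomial.aeval_X, ← MvPolynomial.smul_eq_C_mul]
  congr 1
  rw [Finset.sum_eq_single (Fin.last m)]
  · rw [vecMat_last_col, if_pos rfl, one_smul]
  · intro j _ hj
    rw [vecMat_last_col, if_neg hj, zero_smul]
  · intro h; exact absurd (Finset.mem_univ _) h

theorem leviSubst_castSucc (l : LeviGroup p m) (k : Fin m) :
    leviSubst p m l (MvPolynomial.X k.castSucc)
      = MvPolynomial.C (spinSign p m l.1 * ((l.2 : ℝ) : ℂ)⁻¹) *
        ∑ j : Fin m, MvPolynomial.C (vecMat p m l.1 j.castSucc k.castSucc)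
          * MvPolynomial.X j.castSucc := by
  rw [leviSubst, MvPolynomial.aeval_X, ← MvPolynomial.smul_eq_C_mul, Fin.sum_univ_castSucc,
    vecMat_last_row, if_neg (Fin.castSucc_lt_last k).ne, zero_smul, add_zero]
  simp_rw [MvPolynomial.smul_eq_C_mul]

/-- Since `e_n` is fixed, the block of the first `n - 1` coordinates is orthogonal by itself. -/
theorem sum_vecMat (x : spinPrime p m) (i j : Fin m) :
    ∑ k : Fin m, vecMat p m x i.castSucc k.castSucc * eps p k.castSucc
      * vecMat p m x j.castSucc k.castSucc = if i = j then eps p i.castSucc else 0 := by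
  have h := congrFun (congrFun (vecMat_orth' p m x) i.castSucc) j.castSucc
  rw [Matrix.mul_apply, Fin.sum_univ_castSucc, Matrix.diagonal_apply] at h
  simp_rw [Matrix.mul_diagonal, Matrix.transpose_apply] at h
  rw [vecMat_last_col, if_neg (Fin.castSucc_lt_last i).ne, zero_mul, zero_mul, add_zero] at h
  rw [h]
  by_cases hij : i = j
  · rw [if_pos hij, if_pos (by rw [hij])]
  · rw [if_neg hij, if_neg (fun h' => hij (Fin.castSucc_injective m h'))]

theorem leviSubst_normPoly (l : LeviGroup p m) : leviSubst p m l (normPoly p m)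
    = MvPolynomial.C (spinSign p m l.1 * ((l.2 : ℝ) : ℂ)⁻¹) ^ 2 * normPoly p m := by
  have h1 : ∀ k : Fin m, leviSubst p m l (MvPolynomial.C (eps p k.castSucc)
      * MvPolynomial.X k.castSucc ^ 2)
      = ∑ i : Fin m, ∑ j : Fin m, MvPolynomial.C (spinSign p m l.1 * ((l.2 : ℝ) : ℂ)⁻¹) ^ 2 *
        (MvPolynomial.C (vecMat p m l.1 i.castSucc k.castSucc * eps p k.castSucc
          * vecMat p m l.1 j.castSucc k.castSucc)
          * (MvPolynomial.X i.castSucc * MvPolynomial.X j.castSucc)) := by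
    intro k
    have hC : leviSubst p m l (MvPolynomial.C (eps p k.castSucc)) = MvPolynomial.C (eps p k.castSucc) :=
      MvPolynomial.aeval_C _ _
    rw [map_mul, map_pow, leviSubst_castSucc, hC, mul_pow, sq (∑ j : Fin m, _), Finset.sum_mul_sum,
      Finset.mul_sum, Finset.mul_sum]
    refine Finset.sum_congr rfl fun i _ => ?_
    rw [Finset.mul_sum, Finset.mul_sum]
    refine Finset.sum_congr rfl fun j _ => ?_
    simp only [map_mul]
    ring
  rw [normPoly, map_sum]
  simp_rw [h1]
  rw [Finset.sum_comm, Finset.mul_sum]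
  refine Finset.sum_congr rfl fun i _ => ?_
  rw [Finset.sum_comm]
  simp_rw [← Finset.mul_sum, ← Finset.sum_mul, ← map_sum, sum_vecMat]
  rw [Finset.sum_eq_single i]
  · rw [if_pos rfl]; ring
  · intro j _ hj
    rw [if_neg (Ne.symm hj), map_zero, zero_mul]
  · intro h; exact absurd (Finset.mem_univ _) h

/-- Rotations fix `r` and `ξ_n`, so only the scaling remains. The bound on `L` ensures that no
exponent `d - 2k` is truncated, so that the polynomial is homogeneous. -/
theorem leviSubst_radial (l : LeviGroup p m) (c : ℕ → ℂ) (d L : ℕ) (hL : 2 * (L - 1) ≤ d) :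
    leviSubst p m l (radial p m c d L)
      = MvPolynomial.C (spinSign p m l.1 * ((l.2 : ℝ) : ℂ)⁻¹) ^ d * radial p m c d L := by
  rw [radial, map_sum, Finset.mul_sum]
  refine Finset.sum_congr rfl fun k hk => ?_
  have hk' := Finset.mem_range.1 hk
  have hC : leviSubst p m l (MvPolynomial.C (c k)) = MvPolynomial.C (c k) :=
      MvPolynomial.aeval_C _ _
  rw [map_mul, map_mul, map_pow, map_pow, leviSubst_normPoly, leviSubst_last, hC, mul_pow, mul_pow,
    ← pow_mul]
  have : ∀ z : Poly m, z ^ d = z ^ (2 * k) * z ^ (d - 2 * k) := fun z => by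
    rw [← pow_add]; congr 1; omega
  rw [this]
  ring

end RadialPolynomials

end

end SpinorSingular

namespace SpinorSingular

noncomputable section

/-! ### Recursions between Gegenbauer coefficients -/

section GegenbauerRecursions

/-- Writing `[l/2] = k + j` removes the floors and truncated differences; the recursions are stated
in these indices. -/
theorem gegCoeff_even (α : ℂ) (k j : ℕ) : gegCoeff α (2 * (k + j)) k
    = (-1) ^ k * (ascPochhammer ℂ j).eval (α + ((k + j : ℕ) : ℂ))
      / ((k.factorial : ℂ) * ((2 * j).factorial : ℂ)) * 2 ^ (2 * j) := by
  rw [gegCoeff, show (2 * (k + j) + 1) / 2 = k + j by omega,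
    show 2 * (k + j) - k - (k + j) = j by omega, show 2 * (k + j) - 2 * k = 2 * j by omega]

theorem gegCoeff_odd (α : ℂ) (k j : ℕ) : gegCoeff α (2 * (k + j) + 1) k
    = (-1) ^ k * (ascPochhammer ℂ j).eval (α + ((k + j : ℕ) : ℂ) + 1)
      / ((k.factorial : ℂ) * ((2 * j + 1).factorial : ℂ)) * 2 ^ (2 * j + 1) := by
  rw [gegCoeff, show (2 * (k + j) + 1 + 1) / 2 = k + j + 1 by omega,
    show 2 * (k + j) + 1 - k - (k + j + 1) = j by omega,
    show 2 * (k + j) + 1 - 2 * k = 2 * j + 1 by omega]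
  push_cast
  simp only [add_assoc]

theorem ascPochhammer_succ_eval_left (j : ℕ) (x : ℂ) :
    (ascPochhammer ℂ (j + 1)).eval x = x * (ascPochhammer ℂ j).eval (x + 1) := by
  rw [ascPochhammer_succ_left, Polynomial.eval_mul, Polynomial.eval_X, Polynomial.eval_comp]
  simp

/-- The four recursions are the coefficient forms of `flat_eq` (index 1) and `pderiv_eq` (index 2)
of `IsRadialPair`, for either parity of `K`. They compare Pochhammer products that agree up to one
factor at an end. -/
theorem gegCoeff_rec_even₁ (α : ℂ) (k j : ℕ) :
    2 * ((k : ℂ) + 1) * gegCoeff α (2 * (k + 1 + j)) (k + 1)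
      = (2 * j + 1) * -gegCoeff α (2 * (k + j) + 1) k := by
  rw [gegCoeff_even, gegCoeff_odd, Nat.factorial_succ, Nat.factorial_succ]
  have h1 : (k.factorial : ℂ) ≠ 0 := Nat.cast_ne_zero.2 (Nat.factorial_ne_zero _)
  have h2 : ((2 * j).factorial : ℂ) ≠ 0 := Nat.cast_ne_zero.2 (Nat.factorial_ne_zero _)
  have h3 : (k : ℂ) + 1 ≠ 0 := Nat.cast_add_one_ne_zero k
  have h4 : 2 * (j : ℂ) + 1 ≠ 0 := by exact_mod_cast Nat.succ_ne_zero (2 * j)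
  have h5 : α + ((k + 1 + j : ℕ) : ℂ) = α + ((k + j : ℕ) : ℂ) + 1 := by push_cast; ring
  rw [h5]
  push_cast
  field_simp
  ring

theorem gegCoeff_rec_even₂ (α : ℂ) (k j : ℕ) :
    (2 * (j : ℂ) + 2) * gegCoeff α (2 * (k + (j + 1))) k
      = (2 * k + (2 - 2 * α - 4 * (k + j + 1))) * -gegCoeff α (2 * (k + j) + 1) k := by
  rw [gegCoeff_even, gegCoeff_odd, show 2 * (j + 1) = 2 * j + 1 + 1 by ring,
    Nat.factorial_succ (2 * j + 1), ascPochhammer_succ_eval]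
  have h1 : (k.factorial : ℂ) ≠ 0 := Nat.cast_ne_zero.2 (Nat.factorial_ne_zero _)
  have h2 : ((2 * j + 1).factorial : ℂ) ≠ 0 := Nat.cast_ne_zero.2 (Nat.factorial_ne_zero _)
  have h4 : 2 * (j : ℂ) + 1 + 1 ≠ 0 := by exact_mod_cast Nat.succ_ne_zero (2 * j + 1)
  have h5 : α + ((k + (j + 1) : ℕ) : ℂ) = α + ((k + j : ℕ) : ℂ) + 1 := by push_cast; ring
  rw [h5]
  push_cast
  field_simp
  ring

theorem gegCoeff_rec_odd₁ (α : ℂ) (k j : ℕ) :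
    2 * ((k : ℂ) + 1) * -((α + (k + 1 + j)) * gegCoeff α (2 * (k + 1 + j) + 1) (k + 1))
      = (2 * j + 2) * gegCoeff α (2 * (k + (j + 1))) k := by
  rw [gegCoeff_even, gegCoeff_odd, Nat.factorial_succ k, show 2 * (j + 1) = 2 * j + 1 + 1 by ring,
    Nat.factorial_succ (2 * j + 1), ascPochhammer_succ_eval_left]
  have h1 : (k.factorial : ℂ) ≠ 0 := Nat.cast_ne_zero.2 (Nat.factorial_ne_zero _)
  have h2 : ((2 * j + 1).factorial : ℂ) ≠ 0 := Nat.cast_ne_zero.2 (Nat.factorial_ne_zero _)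
  have h3 : (k : ℂ) + 1 ≠ 0 := Nat.cast_add_one_ne_zero k
  have h4 : 2 * (j : ℂ) + 1 + 1 ≠ 0 := by exact_mod_cast Nat.succ_ne_zero (2 * j + 1)
  have h5 : α + ((k + 1 + j : ℕ) : ℂ) + 1 = α + ((k + (j + 1) : ℕ) : ℂ) + 1 := by push_cast; ring
  rw [h5]
  push_cast
  field_simp
  ring

theorem gegCoeff_rec_odd₂ (α : ℂ) (k j : ℕ) :
    (2 * (j : ℂ) + 1) * -((α + (k + j)) * gegCoeff α (2 * (k + j) + 1) k)
      = (2 * k + (-2 * α - 4 * (k + j))) * gegCoeff α (2 * (k + j)) k := by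
  -- Two windows of length `j` shifted by one: `x (x+1)_j = (x)_j (x + j)`, both sides being
  -- `(x)_{j+1}`.
  have h0 : (α + (k + j)) * (ascPochhammer ℂ j).eval (α + ((k + j : ℕ) : ℂ) + 1)
      = (ascPochhammer ℂ j).eval (α + ((k + j : ℕ) : ℂ)) * (α + (k + j) + j) := by
    have := ascPochhammer_succ_eval j (α + ((k + j : ℕ) : ℂ))
    rw [ascPochhammer_succ_eval_left] at this
    push_cast at this ⊢
    exact this
  have h1 : (k.factorial : ℂ) ≠ 0 := Nat.cast_ne_zero.2 (Nat.factorial_ne_zero _)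
  have h2 : ((2 * j).factorial : ℂ) ≠ 0 := Nat.cast_ne_zero.2 (Nat.factorial_ne_zero _)
  have h4 : 2 * (j : ℂ) + 1 ≠ 0 := by exact_mod_cast Nat.succ_ne_zero (2 * j)
  have h6 : (α + (k + j)) * gegCoeff α (2 * (k + j) + 1) k
      = (-1) ^ k * ((ascPochhammer ℂ j).eval (α + ((k + j : ℕ) : ℂ)) * (α + (k + j) + j))
      / ((k.factorial : ℂ) * ((2 * j + 1).factorial : ℂ)) * 2 ^ (2 * j + 1) := by
    rw [gegCoeff_odd, ← h0]
    ring
  rw [h6, gegCoeff_even, Nat.factorial_succ]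
  push_cast
  field_simp
  ring

end GegenbauerRecursions

/-! ### The first-order system for the two radial components -/

section RadialPairs

variable (p m : ℕ) (lam : ℂ)

/-- The conditions on the coefficients under which `a ⊗ σ + ξ' (b ⊗ e_n σ)` is a solution, where
`a = radial p m c K L` and `b = radial p m c' (K - 1) L'`. -/
structure IsRadialPair (K : ℕ) (c c' : ℕ → ℂ) (L L' : ℕ) : Prop where
  le : 2 * (L - 1) ≤ K
  le' : 2 * (L' - 1) ≤ K - 1
  -- For `K = 0` this forces `L' = 0`, hence `b = 0`, and the truncated degree `K - 1` does no harm.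
  pos : L' ≤ K
  flat_eq : radialFlat p m c K L
    = MvPolynomial.pderiv (Fin.last m) (radial p m c' (K - 1) L')
  pderiv_eq : MvPolynomial.pderiv (Fin.last m) (radial p m c K L)
    = normPoly p m * radialFlat p m c' (K - 1) L'
      + MvPolynomial.C (m + 2 * (lam - K + 1 / 2)) * radial p m c' (K - 1) L'
  length_pos : 0 < L
  -- `c 0` is the coefficient of `ξ_n^K`; its nonvanishing matters only for exhaustion.
  leading : (∀ k : ℕ, alpha m lam + k ≠ 0) → c 0 ≠ 0

theorem gegCoeff_zero_ne_zero {α : ℂ} (h : ∀ k : ℕ, α + k ≠ 0) (l : ℕ) : gegCoeff α l 0 ≠ 0 := by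
  have h1 : ∀ d j : ℕ, (ascPochhammer ℂ d).eval (α + j) ≠ 0 := by
    intro d j
    induction d with
    | zero => simp
    | succ d ih =>
      rw [ascPochhammer_succ_eval]
      refine mul_ne_zero ih ?_
      have := h (j + d)
      push_cast at this
      rwa [add_assoc]
  rw [gegCoeff]
  refine mul_ne_zero (div_ne_zero (mul_ne_zero (by simp) (h1 _ _)) ?_) (by simp)
  exact mul_ne_zero (by simp) (Nat.cast_ne_zero.2 (Nat.factorial_ne_zero _))

/-- Differentiation with respect to `r` shifts the index by one, which matches `L = N + 1` with `L'
= N`; in `∂_n a` the top term drops out because it is free of `ξ_n`. The sign of the second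
component comes from `ε_n = -1` in `ε_n e_n ξ_n`. -/
theorem isRadialPair_even (N : ℕ) : IsRadialPair p m lam (2 * N) (gegCoeff (alpha m lam) (2 * N))
    (fun k => -gegCoeff (alpha m lam) (2 * N - 1) k) (N + 1) N where
  le := by omega
  le' := by omega
  pos := by omega
  flat_eq := by
    rw [radialFlat, pderiv_last_radial, Finset.sum_range_succ']
    simp only [Nat.cast_zero, mul_zero, zero_mul, map_zero, add_zero]
    refine Finset.sum_congr rfl fun k hk => ?_
    obtain ⟨j, rfl⟩ := Nat.exists_eq_add_of_lt (Finset.mem_range.1 hk)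
    have h := gegCoeff_rec_even₁ (alpha m lam) k j
    rw [show 2 * (k + j + 1) - 1 - 2 * k - 1 = 2 * (k + j + 1) - 2 * (k + 1) by omega,
      show k + 1 - 1 = k by omega, show 2 * (k + j + 1) - 1 - 2 * k = 2 * j + 1 by omega,
      show 2 * (k + j + 1) - 1 = 2 * (k + j) + 1 by omega,
      show k + j + 1 = k + 1 + j by omega]
    push_cast
    rw [h]
  pderiv_eq := by
    rw [normPoly_mul_radialFlat, pderiv_last_radial, Finset.sum_range_succ, radial, Finset.mul_sum,
      ← Finset.sum_add_distrib, show 2 * N - 2 * N = 0 by omega]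
    simp only [Nat.cast_zero, zero_mul, map_zero, add_zero]
    refine Finset.sum_congr rfl fun k hk => ?_
    obtain ⟨j, rfl⟩ := Nat.exists_eq_add_of_lt (Finset.mem_range.1 hk)
    have h := gegCoeff_rec_even₂ (alpha m lam) k j
    rw [show 2 * (k + j + 1) - 2 * k - 1 = 2 * (k + j + 1) - 1 - 2 * k by omega,
      show 2 * (k + j + 1) - 2 * k = 2 * j + 2 by omega,
      show 2 * (k + j + 1) - 1 = 2 * (k + j) + 1 by omega,
      show k + j + 1 = k + (j + 1) by omega, ← mul_assoc, ← mul_assoc, ← map_mul, ← add_mul,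
      ← add_mul, ← map_add, ← add_mul]
    congr 3
    push_cast
    rw [h, alpha]
    push_cast
    ring
  length_pos := by omega
  leading h := gegCoeff_zero_ne_zero h _

/-- The components exchange their roles: `a` now carries `ε_n e_n ξ_n`, hence the sign, and `α + N`
is the factor `-λ - n/2 + N + 1` of `F̃_{2N+1}`. -/
theorem isRadialPair_odd (N : ℕ) : IsRadialPair p m lam (2 * N + 1)
    (fun k => -((alpha m lam + N) * gegCoeff (alpha m lam) (2 * N + 1) k))
    (gegCoeff (alpha m lam) (2 * N)) (N + 1) (N + 1) where
  le := by omega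
  le' := by omega
  pos := by omega
  flat_eq := by
    rw [radialFlat, pderiv_last_radial, Finset.sum_range_succ', Finset.sum_range_succ,
      show 2 * N + 1 - 1 - 2 * N = 0 by omega]
    simp only [Nat.cast_zero, mul_zero, zero_mul, map_zero, add_zero]
    refine Finset.sum_congr rfl fun k hk => ?_
    obtain ⟨j, rfl⟩ := Nat.exists_eq_add_of_lt (Finset.mem_range.1 hk)
    have h := gegCoeff_rec_odd₁ (alpha m lam) k j
    rw [show k + 1 + j = k + j + 1 by omega, show k + (j + 1) = k + j + 1 by omega] at h
    rw [show 2 * (k + j + 1) + 1 - 1 - 2 * k - 1 = 2 * (k + j + 1) + 1 - 2 * (k + 1) by omega,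
      show k + 1 - 1 = k by omega, show 2 * (k + j + 1) + 1 - 1 - 2 * k = 2 * j + 2 by omega]
    push_cast
    rw [← h]
    congr 3
    ring
  pderiv_eq := by
    rw [normPoly_mul_radialFlat, pderiv_last_radial, radial, Finset.mul_sum,
      ← Finset.sum_add_distrib]
    refine Finset.sum_congr rfl fun k hk => ?_
    obtain ⟨j, rfl⟩ := Nat.exists_eq_add_of_le (Nat.lt_succ_iff.1 (Finset.mem_range.1 hk))
    have h := gegCoeff_rec_odd₂ (alpha m lam) k j
    rw [show 2 * (k + j) + 1 - 2 * k - 1 = 2 * (k + j) + 1 - 1 - 2 * k by omega,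
      show 2 * (k + j) + 1 - 2 * k = 2 * j + 1 by omega, ← mul_assoc, ← mul_assoc, ← map_mul,
      ← add_mul, ← add_mul, ← map_add, ← add_mul]
    congr 3
    push_cast
    rw [h, alpha]
    push_cast
    ring
  length_pos := by omega
  leading h := neg_ne_zero.2 (mul_ne_zero (h N) (gegCoeff_zero_ne_zero h _))

end RadialPairs

/-! ### The spinors `F̃_K s` in radial form -/

theorem e_last_smul_smul (p m : ℕ) {S : Type*} [AddCommGroup S] [Module (Cl p m) S]
    (he : eps p (Fin.last m) = -1) (s : S) :
    e p m (Fin.last m) • e p m (Fin.last m) • s = s := by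
  rw [smul_smul, e_mul_self, he, neg_neg, map_one, one_smul]

section Spinors

variable (p m : ℕ) (lam : ℂ) (S : Type*) [AddCommGroup S] [Module ℂ S] [Module (Cl p m) S]
  [IsScalarTower ℂ (Cl p m) S]

/-- `a ⊗ σ + ξ' (b ⊗ e_n σ)`. -/
def radialSpinor (a b : Poly m) (σ : S) : Poly m ⊗[ℂ] S :=
  a ⊗ₜ σ + xiOp p m S (b ⊗ₜ (e p m (Fin.last m) • σ))

theorem xiOp_tmul (f : Poly m) (σ : S) : xiOp p m S (f ⊗ₜ σ)
    = ∑ k : Fin m, (MvPolynomial.C (eps p k.castSucc) * MvPolynomial.X k.castSucc * f)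
        ⊗ₜ (e p m k.castSucc • σ) := by
  rw [xiOp, LinearMap.sum_apply]
  refine Finset.sum_congr rfl fun k _ => ?_
  rw [LinearMap.smul_apply, Module.End.mul_apply, act_tmul, mulX_tmul, TensorProduct.smul_tmul',
    MvPolynomial.smul_eq_C_mul, mul_assoc]

theorem spinorFMul_apply (K : ℕ) (s : S) : spinorFMul p m lam S K s
    = LinearMap.lTensor (Poly m) ((Algebra.lsmul ℂ ℂ S).toLinearMap.flip s) (spinorF p m lam K) :=
  rfl

/-- The power of `e_n` by which the two kinds of `F̃_K` are brought into the same form. -/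
def lastTwist (K : ℕ) : Cl p m := if Even K then 1 else e p m (Fin.last m)

theorem spinorFMul_even (he : eps p (Fin.last m) = -1) (N : ℕ) (s : S) :
    spinorFMul p m lam S (2 * N) s = radialSpinor p m S
      (radial p m (gegCoeff (alpha m lam) (2 * N)) (2 * N) (N + 1))
      (radial p m (fun k => -gegCoeff (alpha m lam) (2 * N - 1) k) (2 * N - 1) N) s := by
  rw [spinorFMul_apply, spinorF, if_pos (even_two_mul N), show 2 * N / 2 = N by omega,
    spinorF_even, map_add, LinearMap.lTensor_tmul, gegPoly_eq_radial p m he,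
    show 2 * N / 2 = N by omega, radialSpinor]
  congr 1
  · simp
  · split_ifs with hN
    · subst hN
      simp [radial]
    · rw [gegPoly_eq_radial p m he, show (2 * N - 1) / 2 = N - 1 by omega,
        show N - 1 + 1 = N by omega, xiPrime, xiLast, Finset.sum_mul, Finset.mul_sum, map_sum,
        xiOp_tmul]
      refine Finset.sum_congr rfl fun k _ => ?_
      rw [Algebra.TensorProduct.tmul_mul_tmul, Algebra.TensorProduct.tmul_mul_tmul,
        LinearMap.lTensor_tmul, one_mul]
      have h := C_mul_X_mul_radial p m (-1) (gegCoeff (alpha m lam) (2 * N - 1)) (2 * (N - 1)) N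
        (by omega)
      rw [show 2 * (N - 1) + 1 = 2 * N - 1 by omega] at h
      simp only [neg_one_mul] at h
      rw [← h, he]
      congr 1
      · ring
      · simp

/-- With `σ = e_n s` one has `e_n σ = s`, so the summand with `ξ'` acting on `s` takes the shape
`ξ'(b ⊗ e_n σ)`. -/
theorem spinorFMul_odd (he : eps p (Fin.last m) = -1) (N : ℕ) (s : S) :
    spinorFMul p m lam S (2 * N + 1) s = radialSpinor p m S
      (radial p m (fun k => -((alpha m lam + N) * gegCoeff (alpha m lam) (2 * N + 1) k))
        (2 * N + 1) (N + 1))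
      (radial p m (gegCoeff (alpha m lam) (2 * N)) (2 * N) (N + 1)) (e p m (Fin.last m) • s) := by
  rw [spinorFMul_apply, spinorF, if_neg (Nat.not_even_two_mul_add_one N),
    show (2 * N + 1) / 2 = N by omega, spinorF_odd, map_add, gegPoly_eq_radial p m he,
    gegPoly_eq_radial p m he, show (2 * N + 1) / 2 = N by omega,
    show 2 * N / 2 = N by omega, radialSpinor, e_last_smul_smul p m he]
  refine (add_comm _ _).trans ?_
  congr 1
  · rw [xiLast, map_smul, Algebra.TensorProduct.tmul_mul_tmul, LinearMap.lTensor_tmul,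
      TensorProduct.smul_tmul', MvPolynomial.smul_eq_C_mul]
    have h := C_mul_X_mul_radial p m (-(alpha m lam + N)) (gegCoeff (alpha m lam) (2 * N + 1))
      (2 * N) (N + 1) (by omega)
    simp only [neg_mul] at h
    rw [← h, he, show -lam - ((m + 1 : ℕ) : ℂ) / 2 + N + 1 = alpha m lam + N by rw [alpha]; ring]
    congr 1
    · simp only [map_neg, map_one]; ring
    · simp
  · rw [xiPrime, Finset.mul_sum, map_sum, xiOp_tmul]
    refine Finset.sum_congr rfl fun k _ => ?_
    rw [Algebra.TensorProduct.tmul_mul_tmul, LinearMap.lTensor_tmul, one_mul]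
    congr 1
    ring

/-- Both parities in one form. Everything proved later about `F̃_K s` goes through this description
and not through the explicit coefficients. -/
theorem exists_isRadialPair (he : eps p (Fin.last m) = -1) (K : ℕ) :
    ∃ (c c' : ℕ → ℂ) (L L' : ℕ), IsRadialPair p m lam K c c' L L' ∧
      ∀ s : S, spinorFMul p m lam S K s = radialSpinor p m S (radial p m c K L)
        (radial p m c' (K - 1) L') (lastTwist p m K • s) := by
  rcases Nat.even_or_odd' K with ⟨N, rfl | rfl⟩
  · refine ⟨_, _, _, _, isRadialPair_even p m lam N, fun s => ?_⟩
    rw [spinorFMul_even p m lam S he, lastTwist, if_pos (even_two_mul N), one_smul]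
  · refine ⟨_, _, _, _, isRadialPair_odd p m lam N, fun s => ?_⟩
    rw [spinorFMul_odd p m lam S he, lastTwist, if_neg (Nat.not_even_two_mul_add_one N)]
    rfl

end Spinors

end

end SpinorSingular

namespace SpinorSingular

noncomputable section

/-! ### The spinors `F̃_K s` are solutions -/

section Spinors

variable (p m : ℕ) (lam : ℂ) (S : Type*) [AddCommGroup S] [Module ℂ S] [Module (Cl p m) S]
  [IsScalarTower ℂ (Cl p m) S]

theorem euler_tmul {V : Type*} [AddCommGroup V] [Module ℂ V] {f : Poly m} {d : ℕ}
    (hf : f.IsHomogeneous d) (v : V) : euler (f ⊗ₜ[ℂ] v) = (d : ℂ) • (f ⊗ₜ[ℂ] v) := by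
  have h : ∀ k, (mulX k * dX k : Module.End ℂ (Poly m ⊗[ℂ] V)) (f ⊗ₜ v)
      = (MvPolynomial.X k * MvPolynomial.pderiv k f) ⊗ₜ v := fun k => rfl
  rw [euler, LinearMap.sum_apply, Finset.sum_congr rfl fun k _ => h k, ← TensorProduct.sum_tmul,
    hf.sum_X_mul_pderiv, Nat.cast_smul_eq_nsmul, TensorProduct.smul_tmul']

theorem dX_radial {V : Type*} [AddCommGroup V] [Module ℂ V] (c : ℕ → ℂ) (d L : ℕ) (j : Fin m)
    (v : V) : dX j.castSucc (radial p m c d L ⊗ₜ[ℂ] v)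
      = eps p j.castSucc • mulX j.castSucc (radialFlat p m c d L ⊗ₜ[ℂ] v) := by
  rw [dX_tmul, pderiv_radial, mulX_tmul, TensorProduct.smul_tmul', MvPolynomial.smul_eq_C_mul]

theorem diracPrime_radial (c : ℕ → ℂ) (d L : ℕ) (s : S) :
    dirac' p m S (radial p m c d L ⊗ₜ s) = xiOp p m S (radialFlat p m c d L ⊗ₜ s) := by
  rw [dirac', xiOp, LinearMap.sum_apply, LinearMap.sum_apply]
  refine Finset.sum_congr rfl fun k _ => ?_
  rw [Module.End.mul_apply, dX_radial, map_smul, LinearMap.smul_apply, Module.End.mul_apply]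
  rfl

theorem normOp_tmul (p m : ℕ) (S : Type*) [AddCommGroup S] [Module ℂ S] (f : Poly m) (s : S) :
    normOp p m S (f ⊗ₜ s) = (normPoly p m * f) ⊗ₜ s := by
  rw [normOp, LinearMap.sum_apply, normPoly, Finset.sum_mul, TensorProduct.sum_tmul]
  refine Finset.sum_congr rfl fun k _ => ?_
  rw [LinearMap.smul_apply, Module.End.mul_apply, mulX_tmul, mulX_tmul, TensorProduct.smul_tmul',
    MvPolynomial.smul_eq_C_mul]
  congr 1
  ring

theorem eulerPrime_radial (p m : ℕ) (S : Type*) [AddCommGroup S] [Module ℂ S] (c : ℕ → ℂ)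
    (d L : ℕ) (s : S) :
    eulerPrime m S (radial p m c d L ⊗ₜ s) = normOp p m S (radialFlat p m c d L ⊗ₜ s) := by
  rw [eulerPrime, normOp, LinearMap.sum_apply, LinearMap.sum_apply]
  refine Finset.sum_congr rfl fun k _ => ?_
  rw [Module.End.mul_apply, dX_radial, map_smul, LinearMap.smul_apply, Module.End.mul_apply]

variable {p m lam}

theorem euler_radialSpinor {K : ℕ} {c c' : ℕ → ℂ} {L L' : ℕ} (h : IsRadialPair p m lam K c c' L L')
    (s : S) : euler (radialSpinor p m S (radial p m c K L) (radial p m c' (K - 1) L') s)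
      = (K : ℂ) • radialSpinor p m S (radial p m c K L) (radial p m c' (K - 1) L') s := by
  rw [radialSpinor, map_add, euler_tmul m (isHomogeneous_radial p m c K L h.le),
    ← Module.End.mul_apply, euler_mul_xiOp, LinearMap.add_apply, Module.End.mul_apply,
    euler_tmul m (isHomogeneous_radial p m c' _ L' h.le'), map_smul, smul_add]
  congr 1
  rcases Nat.eq_zero_or_pos K with hK | hK
  · have : L' = 0 := by have := h.pos; omega
    simp [this, radial]
  · obtain ⟨k, rfl⟩ : ∃ k, K = k + 1 := ⟨K - 1, by omega⟩
    rw [Nat.add_sub_cancel]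
    push_cast
    rw [add_smul, one_smul]

/-- The terms containing `ξ'` cancel by `flat_eq`, once `e_n` has been moved past `ξ'` and `e_n² =
1` is used; the remaining multiples of `e_n s` combine by `pderiv_eq`. -/
theorem dirac_radialSpinor (he : eps p (Fin.last m) = -1) {K : ℕ} {c c' : ℕ → ℂ} {L L' : ℕ}
    (h : IsRadialPair p m lam K c c' L L') (s : S) :
    dirac p m S (radialSpinor p m S (radial p m c K L) (radial p m c' (K - 1) L') s)
      = (2 * (lam - K + 1 / 2)) • (radial p m c' (K - 1) L' ⊗ₜ (e p m (Fin.last m) • s)) := by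
  have h1 : (act (e p m (Fin.last m)) * dX (Fin.last m) : Module.End ℂ (Poly m ⊗[ℂ] S)) (xiOp p m S
      (radial p m c' (K - 1) L' ⊗ₜ (e p m (Fin.last m) • s)))
      = -xiOp p m S (radialFlat p m c K L ⊗ₜ s) := by
    rw [← Module.End.mul_apply, mul_assoc, dX_last_mul_xiOp, ← mul_assoc, act_last_mul_xiOp,
      neg_mul, LinearMap.neg_apply, mul_assoc, Module.End.mul_apply, Module.End.mul_apply, dX_tmul,
      act_tmul, e_last_smul_smul p m he, h.flat_eq]
  have h2 : dirac' p m S (xiOp p m S (radial p m c' (K - 1) L' ⊗ₜ (e p m (Fin.last m) • s)))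
      = -((normPoly p m * radialFlat p m c' (K - 1) L') ⊗ₜ (e p m (Fin.last m) • s))
        - (m : ℂ) • (radial p m c' (K - 1) L' ⊗ₜ (e p m (Fin.last m) • s)) := by
    rw [← Module.End.mul_apply, diracPrime_mul_xiOp, LinearMap.sub_apply, LinearMap.sub_apply,
      LinearMap.neg_apply, Module.End.mul_apply, diracPrime_radial, ← Module.End.mul_apply,
      xiOp_sq, LinearMap.neg_apply, neg_neg, LinearMap.smul_apply, eulerPrime_radial,
      LinearMap.smul_apply, Module.End.one_apply, normOp_tmul]
    module
  rw [dirac_eq, radialSpinor, LinearMap.add_apply, map_add, map_add, h1, h2, diracPrime_radial,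
    Module.End.mul_apply, dX_tmul, act_tmul, h.pderiv_eq, TensorProduct.add_tmul,
    ← MvPolynomial.smul_eq_C_mul, ← TensorProduct.smul_tmul']
  module

/-- Spinors built from radial pairs are solutions. -/
theorem radialSpinor_mem_Sol (he : eps p (Fin.last m) = -1) {K : ℕ} {c c' : ℕ → ℂ} {L L' : ℕ}
    (h : IsRadialPair p m lam K c c' L L') (s : S) :
    radialSpinor p m S (radial p m c K L) (radial p m c' (K - 1) L') s ∈ Sol p m lam S := by
  rw [mem_Sol_iff]
  intro j
  set f := radialSpinor p m S (radial p m c K L) (radial p m c' (K - 1) L') s with hf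
  set B := radial p m c' (K - 1) L' ⊗ₜ[ℂ] (e p m (Fin.last m) • s) with hB
  -- The choice makes `D B = G` and `∂_j f = ε_j (ξ_j G + e_j B)` hold simultaneously.
  set G := radialFlat p m c K L ⊗ₜ[ℂ] s
    + xiOp p m S (radialFlat p m c' (K - 1) L' ⊗ₜ (e p m (Fin.last m) • s)) with hG
  have hD : dirac p m S f = (2 * (lam - K + 1 / 2)) • B := dirac_radialSpinor S he h s
  have hDB : dirac p m S B = G := by
    rw [dirac_eq, LinearMap.add_apply, hB, diracPrime_radial, Module.End.mul_apply, dX_tmul,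
      act_tmul, e_last_smul_smul p m he, ← h.flat_eq, hG]
    exact add_comm _ _
  have hbox : box p f = -((2 * (lam - K + 1 / 2)) • G) := by
    rw [← neg_neg (box p), ← dirac_sq p m S, LinearMap.neg_apply, Module.End.mul_apply, hD, map_smul,
      hDB]
  have hdX : dX j.castSucc f = eps p j.castSucc • mulX j.castSucc G
      + eps p j.castSucc • act (e p m j.castSucc) B := by
    rw [hf, radialSpinor, map_add, dX_radial, ← Module.End.mul_apply (dX _), dX_mul_xiOp,
      LinearMap.add_apply, Module.End.mul_apply, dX_radial, LinearMap.smul_apply, map_smul,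
      ← Module.End.mul_apply (xiOp p m S), ← mulX_mul_xiOp, Module.End.mul_apply, hG, map_add,
      smul_add, add_assoc]
  have hE : euler (dX j.castSucc f) = ((K : ℂ) - 1) • dX j.castSucc f := by
    have h1 : (dX j.castSucc * euler : Module.End ℂ (Poly m ⊗[ℂ] S)) f
        = (euler * dX j.castSucc + dX j.castSucc : Module.End ℂ (Poly m ⊗[ℂ] S)) f := by rw [dX_mul_euler]
    rw [Module.End.mul_apply, hf, euler_radialSpinor S h, ← hf, map_smul, LinearMap.add_apply,
      Module.End.mul_apply] at h1
    exact eq_sub_of_add_eq h1.symm |>.trans (by module)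
  -- With `μ = λ - K + 1/2` and up to the factor `-i ε_j`, the three terms are `-μ ξ_j G`, `μ (ξ_j G
  -- + e_j B)` and `-μ e_j B`.
  rw [dpi_eq, LinearMap.smul_apply, LinearMap.sub_apply, LinearMap.add_apply, LinearMap.smul_apply,
    LinearMap.smul_apply, Module.End.mul_apply, Module.End.mul_apply, Module.End.mul_apply,
    LinearMap.sub_apply, LinearMap.smul_apply, Module.End.one_apply, hE, hbox, hD, hdX]
  simp only [map_neg, map_smul]
  refine (congrArg _ ?_).trans (smul_zero (-Complex.I))
  module

theorem spinorFMul_mem_Sol (he : eps p (Fin.last m) = -1) (K : ℕ) (s : S) :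
    spinorFMul p m lam S K s ∈ Sol p m lam S := by
  obtain ⟨c, c', L, L', h, hs⟩ := exists_isRadialPair p m lam S he K
  rw [hs]
  exact radialSpinor_mem_Sol S he h _

theorem euler_spinorFMul (he : eps p (Fin.last m) = -1) (K : ℕ) (s : S) :
    euler (spinorFMul p m lam S K s) = (K : ℂ) • spinorFMul p m lam S K s := by
  obtain ⟨c, c', L, L', h, hs⟩ := exists_isRadialPair p m lam S he K
  rw [hs, euler_radialSpinor S h]

theorem spinorFSpace_le_Sol (he : eps p (Fin.last m) = -1) (K : ℕ) (W : Submodule ℂ S) :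
    spinorFSpace p m lam K W ≤ Sol p m lam S := by
  rintro _ ⟨s, -, rfl⟩
  exact spinorFMul_mem_Sol S he K s

/-- The spaces lie in different eigenspaces of the Euler operator. -/
theorem spinorFSpace_iSupIndep (he : eps p (Fin.last m) = -1) (W : ℕ → Submodule ℂ S) :
    iSupIndep fun K : ℕ => spinorFSpace p m lam K (W K) := by
  have h := (Module.End.eigenspaces_iSupIndep (euler : Module.End ℂ (Poly m ⊗[ℂ] S))).comp
    (Nat.cast_injective (R := ℂ))
  refine h.mono fun K => ?_
  rintro _ ⟨s, -, rfl⟩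
  exact Module.End.mem_eigenspace_iff.2 (euler_spinorFMul S he K s)

/-! ### Stability of the solution spaces under the Levi factor -/

section LeviStable

theorem leviPrime_block_last {A : so p m} (hA : A ∈ leviPrime p m) (k : Fin (m + 1)) :
    A.1 (Sum.inl k) (Sum.inl (Fin.last m)) = 0 := hA.2.2 _

theorem leviPrime_last_block {A : so p m} (hA : A ∈ leviPrime p m) (k : Fin (m + 1)) :
    A.1 (Sum.inl (Fin.last m)) (Sum.inl k) = 0 := by
  have h := so_block A.2 (Fin.last m) k
  rw [leviPrime_block_last hA, mul_zero, neg_zero] at h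
  have he := eps_mul_eps p (Fin.last m)
  linear_combination eps p (Fin.last m) * h - A.1 (Sum.inl (Fin.last m)) (Sum.inl k) * he

theorem so_block_symm {A : so p m} (j k : Fin (m + 1)) :
    eps p k * A.1 (Sum.inl j) (Sum.inl k) = -(eps p j * A.1 (Sum.inl k) (Sum.inl j)) := by
  have h := so_block A.2 j k
  have hj := eps_mul_eps p j
  have hk := eps_mul_eps p k
  linear_combination (eps p j * eps p k) * h - eps p k * A.1 (Sum.inl j) (Sum.inl k) * hj
    - eps p j * A.1 (Sum.inl k) (Sum.inl j) * hk

variable (p m lam)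

theorem leviAct_eq_euler {V : Type*} [AddCommGroup V] [Module ℂ V] [Module (ClEven p m) V]
    [IsScalarTower ℂ (ClEven p m) V] (A : so p m) : leviAct p m lam V A
      = (∑ j, ∑ k, A.1 (Sum.inl j) (Sum.inl k) • (mulX j * dX k))
        - A.1 (Sum.inr 0) (Sum.inr 0) • euler
        + (lam * A.1 (Sum.inr 0) (Sum.inr 0)) • 1 + act (spinEl p m A.1.toBlocks₁₁) := by
  rw [leviAct_eq]
  congr 2
  simp_rw [leviVF, sub_smul, Finset.sum_sub_distrib, ite_smul, zero_smul]
  congr 1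
  rw [euler, Finset.smul_sum]
  simp

theorem act_spinEl (B : Matrix (Fin (m + 1)) (Fin (m + 1)) ℂ) :
    (act (spinEl p m B) : Module.End ℂ (Poly m ⊗[ℂ] S)) = act (spinEl p m B : Cl p m) := rfl

theorem leviAct_mul_act_e (A : so p m) (k : Fin (m + 1)) :
    leviAct p m lam S A * act (e p m k) = act (e p m k) * leviAct p m lam S A
      + ∑ j, A.1 (Sum.inl j) (Sum.inl k) • act (e p m j) := by
  have h := spinEl_comm_e p m A.1.toBlocks₁₁ (fun j k => so_block A.2 j k) k
  rw [sub_eq_iff_eq_add] at h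
  have h1 : (act (spinEl p m A.1.toBlocks₁₁) * act (e p m k) : Module.End ℂ (Poly m ⊗[ℂ] S))
      = act (e p m k) * act (spinEl p m A.1.toBlocks₁₁)
        + ∑ j, A.1 (Sum.inl j) (Sum.inl k) • act (e p m j) := by
    rw [act_spinEl, ← act_mul, h, act_add, act_sum, act_mul]
    simp_rw [act_smul]
    exact add_comm _ _
  have h2 : ((∑ a, ∑ b, leviVF A a b • (mulX a * dX b)) * act (e p m k)
      : Module.End ℂ (Poly m ⊗[ℂ] S)) = act (e p m k) * ∑ a, ∑ b, leviVF A a b • (mulX a * dX b) := by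
    simp_rw [Finset.sum_mul, Finset.mul_sum, smul_mul_assoc, mul_smul_comm, ← mul_assoc,
      act_mul_mulX, mul_assoc, act_mul_dX]
  rw [leviAct_eq, add_mul, add_mul, mul_add, mul_add, h1, h2, smul_mul_assoc, mul_smul_comm,
    one_mul, mul_one]
  abel

/-- Coordinates and Clifford generators rotate together, and skewness cancels the two double sums
(`h0`). Only the grading notices that `ξ'` raises the degree by one. -/
theorem leviAct_mul_xiOp {A : so p m} (hA : A ∈ leviPrime p m) :
    leviAct p m lam S A * xiOp p m S = xiOp p m S * leviAct p m lam S A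
      - A.1 (Sum.inr 0) (Sum.inr 0) • xiOp p m S := by
  set c := A.1 (Sum.inr 0) (Sum.inr 0) with hc
  have h1 : ∀ k : Fin m, leviAct p m lam S A * (eps p k.castSucc • (mulX k.castSucc *
        act (e p m k.castSucc)))
      = eps p k.castSucc • (mulX k.castSucc * act (e p m k.castSucc)) * leviAct p m lam S A
        + (∑ j : Fin m, (eps p k.castSucc * A.1 (Sum.inl j.castSucc) (Sum.inl k.castSucc)) •
            (mulX k.castSucc * act (e p m j.castSucc))
          + ∑ j : Fin m, (eps p k.castSucc * A.1 (Sum.inl j.castSucc) (Sum.inl k.castSucc)) •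
            (mulX j.castSucc * act (e p m k.castSucc)))
        - c • (eps p k.castSucc • (mulX k.castSucc * act (e p m k.castSucc))) := by
    intro k
    have h2 : (∑ a, leviVF A a k.castSucc • mulX a : Module.End ℂ (Poly m ⊗[ℂ] S))
        = ∑ j : Fin m, A.1 (Sum.inl j.castSucc) (Sum.inl k.castSucc) • mulX j.castSucc
          - c • mulX k.castSucc := by
      have : ∀ a, (leviVF A a k.castSucc • mulX a : Module.End ℂ (Poly m ⊗[ℂ] S))
          = A.1 (Sum.inl a) (Sum.inl k.castSucc) • mulX a
            - if a = k.castSucc then c • mulX a else 0 := fun a => by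
        rw [leviVF, sub_smul, ite_smul, zero_smul]
      simp_rw [this, Finset.sum_sub_distrib]
      rw [Fin.sum_univ_castSucc, leviPrime_last_block hA, zero_smul, add_zero]
      simp
    rw [mul_smul_comm, ← mul_assoc, leviAct_mul_mulX, add_mul, mul_assoc, leviAct_mul_act_e,
      Fin.sum_univ_castSucc (fun j => A.1 (Sum.inl j) (Sum.inl k.castSucc) • act (e p m j)),
      leviPrime_last_block hA, zero_smul, add_zero, h2, mul_add, sub_mul, Finset.mul_sum,
      Finset.sum_mul]
    simp_rw [smul_add, smul_sub, smul_mul_assoc, mul_smul_comm, Finset.smul_sum, smul_smul,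
      mul_assoc, mul_comm c]
    abel
  have h0 : ∑ k : Fin m, (∑ j : Fin m, (eps p k.castSucc * A.1 (Sum.inl j.castSucc)
        (Sum.inl k.castSucc)) • (mulX k.castSucc * act (e p m j.castSucc)
          : Module.End ℂ (Poly m ⊗[ℂ] S))
      + ∑ j : Fin m, (eps p k.castSucc * A.1 (Sum.inl j.castSucc) (Sum.inl k.castSucc)) •
          (mulX j.castSucc * act (e p m k.castSucc))) = 0 := by
    rw [Finset.sum_add_distrib, Finset.sum_comm, ← Finset.sum_add_distrib]
    refine Finset.sum_eq_zero fun j _ => ?_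
    rw [← Finset.sum_add_distrib]
    refine Finset.sum_eq_zero fun k _ => ?_
    rw [so_block_symm, ← add_smul, neg_add_cancel, zero_smul]
  rw [xiOp, Finset.mul_sum, Finset.sum_congr rfl fun k _ => h1 k, Finset.sum_sub_distrib,
    Finset.sum_add_distrib, ← Finset.sum_mul, ← Finset.smul_sum, h0, add_zero]

theorem leviAct_radial {V : Type*} [AddCommGroup V] [Module ℂ V] [Module (ClEven p m) V]
    [IsScalarTower ℂ (ClEven p m) V] {A : so p m} (hA : A ∈ leviPrime p m) (c : ℕ → ℂ) (d L : ℕ)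
    (hL : 2 * (L - 1) ≤ d) (v : V) : leviAct p m lam V A (radial p m c d L ⊗ₜ v)
      = radial p m c d L ⊗ₜ (((lam - d) * A.1 (Sum.inr 0) (Sum.inr 0)) • v
        + spinEl p m A.1.toBlocks₁₁ • v) := by
  -- Rotations kill polynomials in `r` and `ξ_n`: the coefficients are skew while `ξ_j ξ_k` is
  -- symmetric, so the sum equals its own negative.
  have h1 : (∑ j, ∑ k, A.1 (Sum.inl j) (Sum.inl k) • (mulX j * dX k)
      : Module.End ℂ (Poly m ⊗[ℂ] V)) (radial p m c d L ⊗ₜ v) = 0 := by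
    have h2 : ∀ j k : Fin m, (A.1 (Sum.inl j.castSucc) (Sum.inl k.castSucc) •
        (mulX j.castSucc * dX k.castSucc) : Module.End ℂ (Poly m ⊗[ℂ] V)) (radial p m c d L ⊗ₜ v)
        = (eps p k.castSucc * A.1 (Sum.inl j.castSucc) (Sum.inl k.castSucc)) •
          (mulX j.castSucc * mulX k.castSucc : Module.End ℂ (Poly m ⊗[ℂ] V))
            (radialFlat p m c d L ⊗ₜ v) := fun j k => by
      rw [LinearMap.smul_apply, Module.End.mul_apply, dX_radial, map_smul, smul_smul, mul_comm]
      rfl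
    have h3 : ∀ T : Poly m ⊗[ℂ] V, T = -T → T = 0 := fun T hT => by
      have h4 : (2 : ℂ) • T = 0 := by
        rw [two_smul]; nth_rewrite 1 [hT]; exact neg_add_cancel T
      exact (smul_eq_zero.1 h4).resolve_left two_ne_zero
    rw [Fin.sum_univ_castSucc]
    simp_rw [leviPrime_last_block hA, zero_smul, Finset.sum_const_zero, add_zero]
    simp_rw [Fin.sum_univ_castSucc, leviPrime_block_last hA, zero_smul, add_zero,
      LinearMap.sum_apply, h2]
    apply h3
    conv_lhs => rw [Finset.sum_comm]
    simp_rw [← Finset.sum_neg_distrib]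
    refine Finset.sum_congr rfl fun j _ => Finset.sum_congr rfl fun k _ => ?_
    rw [so_block_symm, mulX_mul_mulX]
    exact neg_smul (eps p k.castSucc * A.1 (Sum.inl j.castSucc) (Sum.inl k.castSucc))
      (_ : Poly m ⊗[ℂ] V)
  rw [leviAct_eq_euler, LinearMap.add_apply, LinearMap.add_apply, LinearMap.sub_apply, h1,
    LinearMap.smul_apply, LinearMap.smul_apply, euler_tmul m (isHomogeneous_radial p m c d L hL),
    Module.End.one_apply, act_tmul, TensorProduct.tmul_add,
    TensorProduct.tmul_smul ((lam - d) * A.1 (Sum.inr 0) (Sum.inr 0)) (radial p m c d L) v]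
  module

theorem spinEl_commute_e_last {A : so p m} (hA : A ∈ leviPrime p m) :
    (spinEl p m A.1.toBlocks₁₁ : Cl p m) * e p m (Fin.last m)
      = e p m (Fin.last m) * (spinEl p m A.1.toBlocks₁₁ : Cl p m) := by
  have h := spinEl_comm_e p m A.1.toBlocks₁₁ (fun j k => so_block A.2 j k) (Fin.last m)
  have h0 : ∀ j, A.1.toBlocks₁₁ j (Fin.last m) = 0 := leviPrime_block_last hA
  simp_rw [h0, zero_smul, Finset.sum_const_zero] at h
  exact sub_eq_zero.1 h

/-- The degree shift caused by `ξ'` makes up for `b` having degree `K - 1`, and `e_n` commutes with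
the spin action of `𝔩'`; thus `A` acts through the spinor `s` alone. -/
theorem leviAct_radialSpinor {A : so p m} (hA : A ∈ leviPrime p m) {K : ℕ} {c c' : ℕ → ℂ}
    {L L' : ℕ} (h : IsRadialPair p m lam K c c' L L') (s : S) :
    leviAct p m lam S A (radialSpinor p m S (radial p m c K L) (radial p m c' (K - 1) L') s)
      = radialSpinor p m S (radial p m c K L) (radial p m c' (K - 1) L')
        (((lam - K) * A.1 (Sum.inr 0) (Sum.inr 0)) • s + spinEl p m A.1.toBlocks₁₁ • s) := by
  rw [radialSpinor, map_add, leviAct_radial p m lam hA c K L h.le, ← Module.End.mul_apply,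
    leviAct_mul_xiOp p m lam S hA, LinearMap.sub_apply, Module.End.mul_apply, LinearMap.smul_apply,
    leviAct_radial p m lam hA c' (K - 1) L' h.le', radialSpinor]
  congr 1
  rw [← map_smul, ← map_sub, ← TensorProduct.tmul_smul, ← TensorProduct.tmul_sub]
  rcases Nat.eq_zero_or_pos K with hK | hK
  · have : L' = 0 := by have := h.pos; omega
    simp [this, radial]
  · obtain ⟨k, rfl⟩ : ∃ k, K = k + 1 := ⟨K - 1, by omega⟩
    congr 2
    rw [Nat.add_sub_cancel, smul_add, Subalgebra.smul_def, Subalgebra.smul_def, smul_smul, smul_smul,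
      spinEl_commute_e_last p m hA, smul_comm (e p m (Fin.last m)) (_ : ℂ)]
    generalize e p m (Fin.last m) • s = u
    generalize (e p m (Fin.last m) * (spinEl p m A.1.toBlocks₁₁ : Cl p m)) • s = v
    push_cast
    module

theorem lastTwist_commute (p m : ℕ) (S : Type*) [AddCommGroup S] [Module (Cl p m) S]
    {u : ClEven p m}
    (hu : (u : Cl p m) * e p m (Fin.last m) = e p m (Fin.last m) * u) (K : ℕ) (s : S) :
    u • lastTwist p m K • s = lastTwist p m K • u • s := by
  rw [Subalgebra.smul_def, Subalgebra.smul_def, smul_smul, smul_smul, lastTwist]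
  split_ifs
  · rw [mul_one, one_mul]
  · rw [hu]

theorem leviAct_spinorFMul (he : eps p (Fin.last m) = -1) {A : so p m} (hA : A ∈ leviPrime p m)
    (K : ℕ) (s : S) : leviAct p m lam S A (spinorFMul p m lam S K s) = spinorFMul p m lam S K
      (((lam - K) * A.1 (Sum.inr 0) (Sum.inr 0)) • s + spinEl p m A.1.toBlocks₁₁ • s) := by
  obtain ⟨c, c', L, L', h, hs⟩ := exists_isRadialPair p m lam S he K
  rw [hs, hs, leviAct_radialSpinor p m lam S hA h, smul_add,
    lastTwist_commute p m S (spinEl_commute_e_last p m hA), smul_comm (lastTwist p m K) (_ : ℂ)]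

theorem leviRep_apply (l : LeviGroup p m) (s : S) : leviRep p m lam S l s
    = (((l.2 : ℝ) : ℂ) ^ lam) • (((l.1 : (ClEven p m)ˣ) : Cl p m) • s) := rfl

theorem polyAct_tmul (l : LeviGroup p m) (f : Poly m) (s : S) :
    polyAct p m lam S l (f ⊗ₜ s) = leviSubst p m l f ⊗ₜ leviRep p m lam S l s := rfl

theorem leviRep_e (l : LeviGroup p m) (k : Fin (m + 1)) (s : S) :
    leviRep p m lam S l (e p m k • s)
      = ∑ i, vecMat p m l.1 i k • e p m i • leviRep p m lam S l s := by
  have h := congrArg (· * (((l.1 : (ClEven p m)ˣ) : ClEven p m) : Cl p m)) (vecMat_spec p m l.1 k)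
  simp only [mul_assoc, inv_mul_coe, mul_one, Finset.sum_mul] at h
  rw [leviRep_apply, smul_smul, h, leviRep_apply, Finset.sum_smul, Finset.smul_sum]
  refine Finset.sum_congr rfl fun i _ => ?_
  rw [smul_mul_assoc, smul_assoc, mul_smul, smul_comm (e p m i) (((l.2 : ℝ) : ℂ) ^ lam)]
  exact smul_comm _ _ _

/-- The `ξ_k` and the `e_k` are transformed by the same orthogonal matrix, so `∑ ε_k ξ_k e_k` is
invariant up to the character. -/
theorem polyAct_xiOp (l : LeviGroup p m) (f : Poly m ⊗[ℂ] S) :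
    polyAct p m lam S l (xiOp p m S f)
      = (spinSign p m l.1 * ((l.2 : ℝ) : ℂ)⁻¹) • xiOp p m S (polyAct p m lam S l f) := by
  set z := spinSign p m l.1 * ((l.2 : ℝ) : ℂ)⁻¹ with hz
  induction f with
  | zero => simp
  | add f g hf hg => rw [map_add, map_add, hf, hg, map_add, map_add, smul_add]
  | tmul f s =>
    set g := leviSubst p m l f
    set t := leviRep p m lam S l s
    have h1 : ∀ k : Fin m, polyAct p m lam S l
        ((MvPolynomial.C (eps p k.castSucc) * MvPolynomial.X k.castSucc * f)
          ⊗ₜ (e p m k.castSucc • s))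
        = ∑ i : Fin m, ∑ j : Fin m, (z * (vecMat p m l.1 i.castSucc k.castSucc * eps p k.castSucc
          * vecMat p m l.1 j.castSucc k.castSucc)) •
            ((MvPolynomial.X j.castSucc * g) ⊗ₜ[ℂ] (e p m i.castSucc • t)) := by
      intro k
      have hC : leviSubst p m l (MvPolynomial.C (eps p k.castSucc))
          = MvPolynomial.C (eps p k.castSucc) := MvPolynomial.aeval_C _ _
      rw [polyAct_tmul, leviRep_e, Fin.sum_univ_castSucc, vecMat_last_row,
        if_neg (Fin.castSucc_lt_last k).ne, zero_smul, add_zero, TensorProduct.tmul_sum]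
      refine Finset.sum_congr rfl fun i _ => ?_
      rw [map_mul, map_mul, hC, leviSubst_castSucc, Finset.mul_sum, Finset.mul_sum, Finset.sum_mul,
        TensorProduct.sum_tmul]
      refine Finset.sum_congr rfl fun j _ => ?_
      rw [TensorProduct.tmul_smul, TensorProduct.smul_tmul', TensorProduct.smul_tmul',
        MvPolynomial.smul_eq_C_mul, MvPolynomial.smul_eq_C_mul]
      congr 1
      simp only [z, g, map_mul]
      ring
    rw [xiOp_tmul, map_sum, Finset.sum_congr rfl fun k _ => h1 k, polyAct_tmul, xiOp_tmul,
      Finset.sum_comm, Finset.smul_sum]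
    refine Finset.sum_congr rfl fun i _ => ?_
    rw [Finset.sum_comm]
    simp_rw [← Finset.sum_smul, ← Finset.mul_sum, sum_vecMat]
    rw [Finset.sum_eq_single i]
    · rw [if_pos rfl, mul_smul, mul_assoc, ← MvPolynomial.smul_eq_C_mul,
        ← TensorProduct.smul_tmul' (eps p i.castSucc)]
    · intro j _ hj
      rw [if_neg (Ne.symm hj), mul_zero, zero_smul]
    · intro h; exact absurd (Finset.mem_univ _) h

theorem leviRep_e_last (l : LeviGroup p m) (s : S) :
    leviRep p m lam S l (e p m (Fin.last m) • s)
      = e p m (Fin.last m) • leviRep p m lam S l s := by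
  rw [leviRep_apply, leviRep_apply, smul_smul, (spinPrime_commute_e_last p m l.1).eq, mul_smul,
    smul_comm (e p m (Fin.last m)) (_ : ℂ)]

theorem polyAct_radialSpinor (l : LeviGroup p m) {K : ℕ} {c c' : ℕ → ℂ}
    {L L' : ℕ} (h : IsRadialPair p m lam K c c' L L') (s : S) :
    polyAct p m lam S l (radialSpinor p m S (radial p m c K L) (radial p m c' (K - 1) L') s)
      = (spinSign p m l.1 * ((l.2 : ℝ) : ℂ)⁻¹) ^ K •
        radialSpinor p m S (radial p m c K L) (radial p m c' (K - 1) L')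
          (leviRep p m lam S l s) := by
  have hr : ∀ (c : ℕ → ℂ) d L, 2 * (L - 1) ≤ d → ∀ t : S,
      polyAct p m lam S l (radial p m c d L ⊗ₜ t) = (spinSign p m l.1 * ((l.2 : ℝ) : ℂ)⁻¹) ^ d •
        (radial p m c d L ⊗ₜ leviRep p m lam S l t) := fun c d L hL t => by
    rw [polyAct_tmul, leviSubst_radial p m l c d L hL, ← map_pow, ← MvPolynomial.smul_eq_C_mul,
      TensorProduct.smul_tmul']
  rw [radialSpinor, radialSpinor, map_add, hr c K L h.le, polyAct_xiOp, hr c' _ L' h.le', map_smul,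
    smul_smul, leviRep_e_last, smul_add]
  congr 1
  rcases Nat.eq_zero_or_pos K with hK | hK
  · have : L' = 0 := by have := h.pos; omega
    simp [this, radial]
  · obtain ⟨k, rfl⟩ : ∃ k, K = k + 1 := ⟨K - 1, by omega⟩
    rw [Nat.add_sub_cancel, pow_succ']

theorem polyAct_spinorFMul (he : eps p (Fin.last m) = -1) (l : LeviGroup p m) (K : ℕ) (s : S) :
    polyAct p m lam S l (spinorFMul p m lam S K s) = spinorFMul p m lam S K
      ((spinSign p m l.1 * ((l.2 : ℝ) : ℂ)⁻¹) ^ K • leviRep p m lam S l s) := by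
  obtain ⟨c, c', L, L', h, hs⟩ := exists_isRadialPair p m lam S he K
  have h1 : leviRep p m lam S l (lastTwist p m K • s) = lastTwist p m K • leviRep p m lam S l s := by
    rw [lastTwist]
    split_ifs
    · rw [one_smul, one_smul]
    · exact leviRep_e_last p m lam S l s
  rw [map_smul, hs, hs, polyAct_radialSpinor p m lam S l h, h1]

theorem spinorFSpace_isLeviStable (he : eps p (Fin.last m) = -1) (K : ℕ) (W : Submodule ℂ S)
    (hW : ∀ (u : ClEven p m), ∀ s ∈ W, u • s ∈ W) :
    IsLeviStable p m lam (spinorFSpace p m lam K W) := by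
  constructor
  · rintro l _ ⟨s, hs, rfl⟩
    rw [polyAct_spinorFMul p m lam S he]
    exact Submodule.mem_map_of_mem (W.smul_mem _ (W.smul_mem _ (hW _ s hs)))
  · rintro A hA _ ⟨s, hs, rfl⟩
    rw [leviAct_spinorFMul p m lam S he hA]
    exact Submodule.mem_map_of_mem (W.add_mem (W.smul_mem _ hs) (hW _ s hs))

end LeviStable

end Spinors

end

end SpinorSingular

namespace SpinorSingular

noncomputable section

/-! ### Homogeneous components and powers of `∂_n` -/

section Homogeneous

variable {m : ℕ} {V : Type*} [AddCommGroup V] [Module ℂ V]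

theorem euler_dX {f : Poly m ⊗[ℂ] V} {d : ℂ} (hf : euler f = d • f) (k : Fin (m + 1)) :
    euler (dX k f) = (d - 1) • dX k f := by
  have h := LinearMap.congr_fun (dX_mul_euler (V := V) k) f
  rw [Module.End.mul_apply, hf, map_smul, LinearMap.add_apply, Module.End.mul_apply] at h
  exact (eq_sub_of_add_eq h.symm).trans (by module)

theorem euler_mulX {f : Poly m ⊗[ℂ] V} {d : ℂ} (hf : euler f = d • f) (k : Fin (m + 1)) :
    euler (mulX k f) = (d + 1) • mulX k f := by
  have h := LinearMap.congr_fun (euler_mul_mulX (V := V) k) f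
  rw [Module.End.mul_apply, LinearMap.add_apply, Module.End.mul_apply, hf, map_smul] at h
  rw [add_smul, one_smul, h]

theorem euler_dX_pow {f : Poly m ⊗[ℂ] V} {d : ℂ} (hf : euler f = d • f) (k : Fin (m + 1))
    (b : ℕ) : euler ((dX k ^ b) f) = (d - b) • (dX k ^ b) f := by
  induction b with
  | zero => simpa using hf
  | succ b ih =>
    rw [pow_succ', Module.End.mul_apply, euler_dX ih]
    push_cast
    rw [sub_sub]

/-- Vector-valued polynomials are sums of homogeneous ones. -/
theorem exists_sum_homogeneous (f : Poly m ⊗[ℂ] V) : ∃ (N : ℕ) (g : ℕ → Poly m ⊗[ℂ] V),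
    (∀ i, euler (g i) = (i : ℂ) • g i) ∧ f = ∑ i ∈ Finset.range N, g i ∧
      (∀ i, N ≤ i → g i = 0) ∧ ∃ v : V, g 0 = 1 ⊗ₜ v := by
  induction f with
  | zero => exact ⟨0, fun _ => 0, by simp, by simp, by simp, 0, by simp⟩
  | add f f' hf hf' =>
    obtain ⟨N, g, h1, h2, h3, v, h4⟩ := hf
    obtain ⟨N', g', h1', h2', h3', v', h4'⟩ := hf'
    refine ⟨max N N', g + g', fun i => ?_, ?_, fun i hi => ?_, v + v', ?_⟩
    · rw [Pi.add_apply, map_add, h1, h1', smul_add]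
    · simp only [Pi.add_apply]
      rw [Finset.sum_add_distrib, h2, h2']
      congr 1
      · exact Finset.sum_subset (Finset.range_mono (le_max_left _ _))
          fun i _ hi => h3 i (by simpa using hi)
      · exact Finset.sum_subset (Finset.range_mono (le_max_right _ _))
          fun i _ hi => h3' i (by simpa using hi)
    · rw [Pi.add_apply, h3 i (le_trans (le_max_left _ _) hi),
        h3' i (le_trans (le_max_right _ _) hi), add_zero]
    · rw [Pi.add_apply, h4, h4', TensorProduct.tmul_add]
  | tmul q v =>
    refine ⟨q.totalDegree + 1, fun i => MvPolynomial.homogeneousComponent i q ⊗ₜ v, fun i => ?_, ?_,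
      fun i hi => ?_, q.coeff 0 • v, ?_⟩
    · exact euler_tmul m (MvPolynomial.homogeneousComponent_isHomogeneous i q) v
    · rw [← TensorProduct.sum_tmul, MvPolynomial.sum_homogeneousComponent]
    · simp only
      rw [MvPolynomial.homogeneousComponent_eq_zero _ _ (by omega), TensorProduct.zero_tmul]
    · simp only
      rw [MvPolynomial.homogeneousComponent_zero, TensorProduct.tmul_smul, TensorProduct.smul_tmul',
        MvPolynomial.smul_eq_C_mul, mul_one]

/-- Eigenspaces of the Euler operator are independent. The shift `d` allows an application to images
under operators that change the degree. -/
theorem eq_zero_of_sum_homogeneous {s : Finset ℕ} {d : ℂ} {g : ℕ → Poly m ⊗[ℂ] V}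
    (hg : ∀ i ∈ s, euler (g i) = ((i : ℂ) + d) • g i) (h : ∑ i ∈ s, g i = 0) :
    ∀ i ∈ s, g i = 0 := by
  have h1 := (Module.End.eigenspaces_iSupIndep (euler : Module.End ℂ (Poly m ⊗[ℂ] V))).comp
    (f := fun i : ℕ => (i : ℂ) + d) fun i j hij => by simpa using hij
  exact (iSupIndep_iff_finsetSum_eq_zero_imp_eq_zero _).1 h1 s g
    (fun i hi => Module.End.mem_eigenspace_iff.2 (hg i hi)) h

theorem exists_one_tmul_of_euler_eq_zero {f : Poly m ⊗[ℂ] V} (hf : euler f = 0) :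
    ∃ v : V, f = 1 ⊗ₜ v := by
  obtain ⟨N, g, h1, h2, h3, v, h4⟩ := exists_sum_homogeneous f
  refine ⟨v, ?_⟩
  have h5 : euler f = ∑ i ∈ Finset.range N, (i : ℂ) • g i := by
    rw [h2, map_sum]
    exact Finset.sum_congr rfl fun i _ => h1 i
  rw [hf] at h5
  have h6 := eq_zero_of_sum_homogeneous (s := Finset.range N) (d := 0)
    (g := fun i => (i : ℂ) • g i) (fun i _ => by rw [map_smul, h1, add_zero]) h5.symm
  rw [h2, ← h4]
  rcases Nat.eq_zero_or_pos N with hN | hN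
  · rw [h3 0 hN.le, hN, Finset.sum_range_zero]
  · rw [Finset.sum_eq_single_of_mem 0 (Finset.mem_range.2 hN)]
    intro i hi hi0
    exact (smul_eq_zero.1 (h6 i hi)).resolve_left (Nat.cast_ne_zero.2 hi0)

theorem dX_pow_tmul_X_pow {g : Poly m} {k : Fin (m + 1)} (hg : MvPolynomial.pderiv k g = 0) (d : ℕ)
    (v : V) : (dX k ^ d) ((g * MvPolynomial.X k ^ d) ⊗ₜ[ℂ] v) = (d.factorial : ℂ) • (g ⊗ₜ v) := by
  induction d with
  | zero => simp
  | succ d ih =>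
    have h : MvPolynomial.pderiv k (g * MvPolynomial.X k ^ (d + 1))
        = ((d + 1 : ℕ) : ℂ) • (g * MvPolynomial.X k ^ d) := by
      rw [Derivation.leibniz, hg, Derivation.leibniz_pow, MvPolynomial.pderiv_X_self,
        MvPolynomial.smul_eq_C_mul]
      simp only [smul_eq_mul, nsmul_eq_mul, map_natCast, Nat.add_sub_cancel]
      ring
    rw [pow_succ, Module.End.mul_apply, dX_tmul, h, ← TensorProduct.smul_tmul', map_smul, ih,
      smul_smul, Nat.factorial_succ, Nat.cast_mul]

theorem dX_pow_tmul_X_pow_of_lt {g : Poly m} {k : Fin (m + 1)} (hg : MvPolynomial.pderiv k g = 0)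
    {b d : ℕ} (hb : b < d) (v : V) : (dX k ^ d) ((g * MvPolynomial.X k ^ b) ⊗ₜ[ℂ] v) = 0 := by
  obtain ⟨j, rfl⟩ := Nat.exists_eq_add_of_lt hb
  rw [show b + j + 1 = j + 1 + b by ring, pow_add, Module.End.mul_apply, dX_pow_tmul_X_pow hg,
    map_smul, pow_succ, Module.End.mul_apply, dX_tmul, hg, TensorProduct.zero_tmul, map_zero,
    smul_zero]

theorem pderiv_last_C_mul_normPoly_pow (p : ℕ) (c : ℂ) (k : ℕ) :
    MvPolynomial.pderiv (Fin.last m) (MvPolynomial.C c * normPoly p m ^ k) = 0 := by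
  rw [MvPolynomial.pderiv_C_mul, Derivation.leibniz_pow, pderiv_last_normPoly]
  simp

/-- Only the term `k = 0` contains `ξ_n` to the full power `d`. -/
theorem dX_last_pow_radial (p : ℕ) (c : ℕ → ℂ) {d L : ℕ} (hL : 0 < L) (hd : 2 * (L - 1) ≤ d)
    (v : V) : (dX (Fin.last m) ^ d) (radial p m c d L ⊗ₜ[ℂ] v)
      = ((d.factorial : ℂ) * c 0) • (1 ⊗ₜ v) := by
  have h : (MvPolynomial.C (c 0) : Poly m) ⊗ₜ[ℂ] v = c 0 • (1 ⊗ₜ v) := by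
    rw [TensorProduct.smul_tmul', MvPolynomial.smul_eq_C_mul, mul_one]
  rw [radial, TensorProduct.sum_tmul, map_sum,
    Finset.sum_eq_single_of_mem 0 (Finset.mem_range.2 hL), mul_zero, Nat.sub_zero,
    dX_pow_tmul_X_pow (pderiv_last_C_mul_normPoly_pow p _ _), pow_zero, mul_one, mul_smul, h]
  intro k hk hk0
  have := Finset.mem_range.1 hk
  exact dX_pow_tmul_X_pow_of_lt (pderiv_last_C_mul_normPoly_pow p _ _) (by omega) v

theorem dX_last_pow_radial_of_lt (p : ℕ) (c : ℕ → ℂ) {b d : ℕ} (hb : b < d) (L : ℕ) (v : V) :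
    (dX (Fin.last m) ^ d) (radial p m c b L ⊗ₜ[ℂ] v) = 0 := by
  rw [radial, TensorProduct.sum_tmul, map_sum]
  exact Finset.sum_eq_zero fun k _ =>
    dX_pow_tmul_X_pow_of_lt (pderiv_last_C_mul_normPoly_pow p _ _) (by omega) v

theorem eulerPrime_of_dX_last {f : Poly m ⊗[ℂ] V} (hf : dX (Fin.last m) f = 0) :
    eulerPrime m V f = euler f := by
  rw [euler_eq m V, LinearMap.add_apply, Module.End.mul_apply, hf, map_zero, add_zero]

end Homogeneous

/-! ### All solutions for generic parameters -/

section Exhaustion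

variable {p m : ℕ} {lam : ℂ} {S : Type*} [AddCommGroup S] [Module ℂ S] [Module (Cl p m) S]
  [IsScalarTower ℂ (Cl p m) S]

theorem euler_diracPrime {f : Poly m ⊗[ℂ] S} {d : ℂ} (hf : euler f = d • f) :
    euler (dirac' p m S f) = (d - 1) • dirac' p m S f := by
  have h := LinearMap.congr_fun (diracPrime_mul_euler p m S) f
  rw [Module.End.mul_apply, hf, map_smul, LinearMap.add_apply, Module.End.mul_apply] at h
  exact (eq_sub_of_add_eq h.symm).trans (by module)

theorem euler_xiOp {f : Poly m ⊗[ℂ] S} {d : ℂ} (hf : euler f = d • f) :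
    euler (xiOp p m S f) = (d + 1) • xiOp p m S f := by
  have h := LinearMap.congr_fun (euler_mul_xiOp p m S) f
  rw [Module.End.mul_apply, LinearMap.add_apply, Module.End.mul_apply, hf, map_smul] at h
  rw [add_smul, one_smul, h]

theorem euler_act {f : Poly m ⊗[ℂ] S} {d : ℂ} (hf : euler f = d • f) (a : Cl p m) :
    euler (act a f) = d • act a f := by
  have h := LinearMap.congr_fun (act_mul_euler p m S a) f
  rw [Module.End.mul_apply, Module.End.mul_apply, hf, map_smul] at h
  exact h.symm

theorem dX_last_diracPrime {f : Poly m ⊗[ℂ] S} (hf : dX (Fin.last m) f = 0) :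
    dX (Fin.last m) (dirac' p m S f) = 0 := by
  rw [← Module.End.mul_apply, dX_mul_diracPrime, Module.End.mul_apply, hf, map_zero]

theorem dX_last_xiOp {f : Poly m ⊗[ℂ] S} (hf : dX (Fin.last m) f = 0) :
    dX (Fin.last m) (xiOp p m S f) = 0 := by
  rw [← Module.End.mul_apply, dX_last_mul_xiOp, Module.End.mul_apply, hf, map_zero]

theorem dX_act {f : Poly m ⊗[ℂ] S} {k : Fin (m + 1)} (hf : dX k f = 0) (a : Cl p m) :
    dX k (act a f) = 0 := by
  rw [← Module.End.mul_apply, ← act_mul_dX, Module.End.mul_apply, hf, map_zero]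

theorem diracPrime_xiOp {f : Poly m ⊗[ℂ] S} {d : ℂ} (hf : euler f = d • f)
    (hf' : dX (Fin.last m) f = 0) : dirac' p m S (xiOp p m S f)
      = -xiOp p m S (dirac' p m S f) - (2 * d + m) • f := by
  rw [← Module.End.mul_apply, diracPrime_mul_xiOp, LinearMap.sub_apply, LinearMap.sub_apply,
    LinearMap.neg_apply, LinearMap.smul_apply, LinearMap.smul_apply, Module.End.mul_apply,
    eulerPrime_of_dX_last hf', hf, Module.End.one_apply]
  module

theorem dpi_of_homogeneous {f : Poly m ⊗[ℂ] S} {d : ℂ} (hf : euler f = d • f) (j : Fin (m + 1)) :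
    dpi p m lam S j f = (-Complex.I) • ((1 / 2 * eps p j : ℂ) • mulX j (box p f)
      + (lam - d + 1 / 2) • dX j f
      - (1 / 2 * eps p j : ℂ) • act (e p m j) (dirac p m S f)) := by
  rw [dpi_eq, LinearMap.smul_apply, LinearMap.sub_apply, LinearMap.add_apply, LinearMap.smul_apply,
    LinearMap.smul_apply, Module.End.mul_apply, Module.End.mul_apply, Module.End.mul_apply,
    LinearMap.sub_apply, LinearMap.smul_apply, Module.End.one_apply, euler_dX hf]
  congr 3
  module

theorem euler_dpi {f : Poly m ⊗[ℂ] S} {d : ℂ} (hf : euler f = d • f) (j : Fin (m + 1)) :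
    euler (dpi p m lam S j f) = (d - 1) • dpi p m lam S j f := by
  have hdir : euler (dirac p m S f) = (d - 1) • dirac p m S f := by
    rw [dirac, LinearMap.sum_apply, map_sum, Finset.smul_sum]
    exact Finset.sum_congr rfl fun k _ => euler_act (euler_dX hf k) _
  have hbox : euler (box p f) = (d - 1 - 1) • box p f := by
    rw [box, LinearMap.sum_apply, map_sum, Finset.smul_sum]
    refine Finset.sum_congr rfl fun k _ => ?_
    rw [LinearMap.smul_apply, map_smul, Module.End.mul_apply, euler_dX (euler_dX hf k), smul_comm]
  rw [dpi_of_homogeneous hf, map_smul, map_sub, map_add, map_smul, map_smul, map_smul,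
    euler_mulX hbox, euler_dX hf, euler_act hdir]
  module

/-- Each `P_j` lowers the degree by one, so the homogeneous components of `P_j f` are the images of
those of `f`. -/
theorem mem_Sol_of_sum {s : Finset ℕ} {g : ℕ → Poly m ⊗[ℂ] S}
    (hg : ∀ i ∈ s, euler (g i) = (i : ℂ) • g i) (h : ∑ i ∈ s, g i ∈ Sol p m lam S) :
    ∀ i ∈ s, g i ∈ Sol p m lam S := by
  intro i hi
  rw [mem_Sol_iff] at h ⊢
  intro j
  have hj := h j
  rw [map_sum] at hj
  exact eq_zero_of_sum_homogeneous (d := -1) (g := fun i => dpi p m lam S j.castSucc (g i))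
    (fun i hi => by rw [euler_dpi (hg i hi), sub_eq_add_neg]) hj i hi

/-- For `j < n` the only ingredient of `P_j` that fails to commute with `∂_n` is `E`, and `[∂_n, E]
= ∂_n` is absorbed by the shift of `λ`. -/
theorem dX_last_mul_dpi (j : Fin m) : dX (Fin.last m) * dpi p m lam S j.castSucc
    = dpi p m (lam - 1) S j.castSucc * dX (Fin.last m) := by
  have h1 : (dX (Fin.last m) * (mulX j.castSucc * box p) : Module.End ℂ (Poly m ⊗[ℂ] S))
      = mulX j.castSucc * box p * dX (Fin.last m) := by
    have hb : (dX (Fin.last m) * box p : Module.End ℂ (Poly m ⊗[ℂ] S))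
        = box p * dX (Fin.last m) := by
      rw [box, Finset.mul_sum, Finset.sum_mul]
      refine Finset.sum_congr rfl fun k _ => ?_
      rw [mul_smul_comm, smul_mul_assoc, ← mul_assoc, dX_mul_dX, mul_assoc, dX_mul_dX, mul_assoc]
    rw [← mul_assoc, dX_mul_mulX, if_neg (Fin.castSucc_lt_last j).ne', add_zero, mul_assoc, hb,
      mul_assoc]
  have h2 : (dX (Fin.last m) * (((lam - 1 / 2) • 1 - euler) * dX j.castSucc)
      : Module.End ℂ (Poly m ⊗[ℂ] S))
      = ((lam - 1 - 1 / 2) • 1 - euler) * dX j.castSucc * dX (Fin.last m) := by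
    rw [mul_assoc _ (dX j.castSucc), ← dX_mul_dX (Fin.last m), ← mul_assoc, ← mul_assoc]
    congr 1
    rw [mul_sub, sub_mul, dX_mul_euler, mul_smul_comm, smul_mul_assoc, one_mul, mul_one]
    module
  have h3 : (dX (Fin.last m) * (act (e p m j.castSucc) * dirac p m S)
      : Module.End ℂ (Poly m ⊗[ℂ] S))
      = act (e p m j.castSucc) * dirac p m S * dX (Fin.last m) := by
    rw [← mul_assoc, ← act_mul_dX, mul_assoc, dX_mul_dirac, mul_assoc]
  rw [dpi_eq, dpi_eq, mul_smul_comm, smul_mul_assoc, mul_sub, mul_add, mul_smul_comm,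
    mul_smul_comm, h1, h2, h3, sub_mul _ _ (dX (Fin.last m)), add_mul _ _ (dX (Fin.last m)),
    smul_mul_assoc, smul_mul_assoc]

theorem dX_last_mem_Sol {f : Poly m ⊗[ℂ] S} (hf : f ∈ Sol p m lam S) :
    dX (Fin.last m) f ∈ Sol p m (lam - 1) S := by
  rw [mem_Sol_iff] at hf ⊢
  intro j
  rw [← Module.End.mul_apply, ← dX_last_mul_dpi, Module.End.mul_apply, hf j, map_zero]

theorem dX_last_pow_mem_Sol {f : Poly m ⊗[ℂ] S} (hf : f ∈ Sol p m lam S) (b : ℕ) :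
    (dX (Fin.last m) ^ b) f ∈ Sol p m (lam - b) S := by
  induction b with
  | zero => simpa using hf
  | succ b ih =>
    rw [pow_succ', Module.End.mul_apply]
    have := dX_last_mem_Sol ih
    rwa [sub_sub, ← Nat.cast_succ] at this

/-- Solutions of positive degree not depending on `ξ_n` vanish for generic parameters. -/
theorem eq_zero_of_mem_Sol_of_dX_last {f : Poly m ⊗[ℂ] S} (hf : f ∈ Sol p m lam S) {d : ℕ}
    (hd : euler f = (d : ℂ) • f) (hd0 : d ≠ 0) (hlast : dX (Fin.last m) f = 0)
    (h0 : m ≠ 0 → lam - d + 1 / 2 ≠ 0) (h1 : m ≠ 0 → lam - d + 1 / 2 + m - 1 ≠ 0)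
    (h2 : 2 * (lam - d + 1 / 2) + m + d - 1 ≠ 0) : f = 0 := by
  have hdC : (d : ℂ) ≠ 0 := Nat.cast_ne_zero.2 hd0
  have hE' : eulerPrime m S f = (d : ℂ) • f := by rw [eulerPrime_of_dX_last hlast, hd]
  -- For `n = 1` no variable is left, so positive degree forces `f = 0` with no condition on the
  -- parameter.
  rcases Nat.eq_zero_or_pos m with rfl | hm
  · rw [eulerPrime, Finset.univ_eq_empty, Finset.sum_empty, LinearMap.zero_apply] at hE'
    exact (smul_eq_zero.1 hE'.symm).resolve_left hdC
  replace h0 := h0 hm.ne'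
  replace h1 := h1 hm.ne'
  set μ := lam - d + 1 / 2 with hμ
  set T := dirac' p m S f with hT
  have hdir : dirac p m S f = T := by
    rw [dirac_eq, LinearMap.add_apply, Module.End.mul_apply, hlast, map_zero, add_zero]
  have hbox : box p f = -dirac' p m S T := by
    have hb := LinearMap.congr_fun (diracPrime_sq p m S) f
    rw [LinearMap.neg_apply, Module.End.mul_apply] at hb
    rw [hT, hb, neg_neg, box_eq p m S, LinearMap.add_apply, LinearMap.smul_apply,
      Module.End.mul_apply, hlast, map_zero, smul_zero, add_zero]
  -- This is `P_j f = 0` with `D f = T` and `□ f = -D' T` inserted.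
  have hQ : ∀ j : Fin m, μ • dX j.castSucc f
      = (1 / 2 * eps p j.castSucc : ℂ) • (mulX j.castSucc (dirac' p m S T)
        + act (e p m j.castSucc) T) := fun j => by
    have := (mem_Sol_iff p m lam S f).1 hf j
    rw [dpi_of_homogeneous hd, hbox, hdir, map_neg, smul_eq_zero] at this
    have h := this.resolve_left (neg_ne_zero.2 Complex.I_ne_zero)
    rw [sub_eq_zero, smul_neg, neg_add_eq_iff_eq_add, ← hμ, ← smul_add] at h
    exact h
  have hTlast : dX (Fin.last m) T = 0 := dX_last_diracPrime hlast
  have hTd : euler T = ((d : ℂ) - 1) • T := euler_diracPrime hd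
  -- Contract `hQ` with `e_j`; the term `m T` collects the squares `e_j²`.
  have c1 : xiOp p m S (dirac' p m S T) = (2 * μ + m) • T := by
    have hs : μ • T = (1 / 2 : ℂ) • (xiOp p m S (dirac' p m S T) - (m : ℂ) • T) := by
      have hsq : ∀ j : Fin m, act (e p m j.castSucc) (act (e p m j.castSucc) T)
          = -(eps p j.castSucc • T) := fun j => by
        rw [← Module.End.mul_apply, act_e_sq, LinearMap.smul_apply, Module.End.one_apply]
        exact neg_smul _ _
      have hj : ∀ j : Fin m, act (e p m j.castSucc) (μ • dX j.castSucc f)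
          = (1 / 2 : ℂ) • ((eps p j.castSucc • (mulX j.castSucc * act (e p m j.castSucc))
            : Module.End ℂ (Poly m ⊗[ℂ] S)) (dirac' p m S T) - T) := fun j => by
        rw [hQ, map_smul, map_add, hsq, ← Module.End.mul_apply, act_mul_mulX, mul_smul, smul_add,
          smul_neg, smul_smul (eps p j.castSucc), eps_mul_eps, one_smul, ← sub_eq_add_neg]
        rfl
      have hl : ∀ j : Fin m, μ • (act (e p m j.castSucc) * dX j.castSucc : Module.End ℂ (Poly m ⊗[ℂ] S)) f
          = act (e p m j.castSucc) (μ • dX j.castSucc f) := fun j => by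
        rw [map_smul, Module.End.mul_apply]
      have hTs : μ • T = ∑ j : Fin m,
          μ • (act (e p m j.castSucc) * dX j.castSucc : Module.End ℂ (Poly m ⊗[ℂ] S)) f := by
        rw [hT, dirac', LinearMap.sum_apply, Finset.smul_sum]
      rw [hTs, Finset.sum_congr rfl fun j _ => (hl j).trans (hj j), ← Finset.smul_sum,
        Finset.sum_sub_distrib, ← LinearMap.sum_apply, Finset.sum_const, Finset.card_univ,
        Fintype.card_fin, Nat.cast_smul_eq_nsmul]
      rfl
    have h3 : xiOp p m S (dirac' p m S T) = (2 : ℂ) • (μ • T) + (m : ℂ) • T := by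
      rw [hs]; module
    rw [h3]; module
  -- Contract `hQ` with `ξ_j`; by `r = -ξ'²` and `c1` the term `r D' T` is a multiple of `ξ' T`.
  have c2 : (μ * d) • f = -((μ + (m - 1) / 2) • xiOp p m S T) := by
    have hs : (μ * d) • f = (1 / 2 : ℂ) • (normOp p m S (dirac' p m S T) + xiOp p m S T) := by
      rw [mul_smul, ← hE', eulerPrime, LinearMap.sum_apply, Finset.smul_sum, normOp, xiOp,
        LinearMap.sum_apply, LinearMap.sum_apply, ← Finset.sum_add_distrib, Finset.smul_sum]
      refine Finset.sum_congr rfl fun j _ => ?_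
      rw [Module.End.mul_apply, ← map_smul, hQ, map_smul, map_add, mul_smul, smul_add]
      rfl
    have hn : normOp p m S (dirac' p m S T) = -((2 * μ + m) • xiOp p m S T) := by
      rw [← neg_neg (normOp p m S), ← xiOp_sq, LinearMap.neg_apply, Module.End.mul_apply, c1,
        map_smul]
    rw [hs, hn]; module
  have c3 : dirac' p m S (xiOp p m S T) = -((2 * (μ + m + d - 1)) • T) := by
    rw [diracPrime_xiOp hTd hTlast, c1]; module
  -- Applying `D'` to `c2` gives `μ d T = (2μ + m - 1)(μ + m + d - 1) T`, and the difference of the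
  -- two scalars factors as stated.
  have c4 : ((2 * μ + m + d - 1) * (μ + m - 1)) • T = 0 := by
    have h := congrArg (dirac' p m S) c2
    rw [map_smul, map_neg, map_smul, c3, ← hT] at h
    have h5 : ((2 * μ + m + d - 1) * (μ + m - 1)) • T
        = -((μ + (m - 1) / 2) • -((2 * (μ + m + d - 1)) • T)) - (μ * d) • T := by module
    rw [h5, h, sub_self]
  have hT0 : T = 0 := (smul_eq_zero.1 c4).resolve_left (mul_ne_zero h2 h1)
  rw [hT0, map_zero, smul_zero, neg_zero] at c2
  exact (smul_eq_zero.1 c2).resolve_left (mul_ne_zero h0 hdC)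

/-- Descend from `b = K` to `b = 0`: when `∂_n^{b+1} f = 0`, the polynomial `∂_n^b f` is a solution
for `λ - b` of degree `K - b` that does not depend on `ξ_n`. For all `b` the relevant `μ` is `λ - K
+ 1/2`, so the excluded values are `K + m - 1` and `K` in the first hypothesis and `K + b` in the
second. -/
theorem eq_zero_of_mem_Sol_of_dX_last_pow {f : Poly m ⊗[ℂ] S} (hf : f ∈ Sol p m lam S)
    (h1 : ∀ k : ℕ, 1 ≤ k → lam + ((m + 1 : ℕ) : ℂ) - 3 / 2 ≠ (k : ℂ))
    (h2 : ∀ k : ℕ, 1 ≤ k → 2 * lam + ((m + 1 : ℕ) : ℂ) - 1 ≠ (k : ℂ)) {K : ℕ}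
    (hK : euler f = (K : ℂ) • f) (hlast : (dX (Fin.last m) ^ K) f = 0) : f = 0 := by
  have key : ∀ c b : ℕ, b + c = K → (dX (Fin.last m) ^ b) f = 0 := by
    intro c
    induction c with
    | zero => rintro b rfl; exact hlast
    | succ c ih =>
      intro b hb
      have hKb : (K : ℂ) = b + ((c + 1 : ℕ) : ℂ) := by rw [← hb]; push_cast; ring
      refine eq_zero_of_mem_Sol_of_dX_last (dX_last_pow_mem_Sol hf b) (d := c + 1) ?_
        (Nat.succ_ne_zero c) ?_ ?_ ?_ ?_
      · rw [euler_dX_pow hK, hKb, add_sub_cancel_left]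
      · rw [← Module.End.mul_apply, ← pow_succ']
        exact ih (b + 1) (by omega)
      · intro hm h
        apply h1 (K + (m - 1)) (by omega)
        have : ((m - 1 : ℕ) : ℂ) = m - 1 := by
          rw [Nat.cast_sub (Nat.one_le_iff_ne_zero.2 hm), Nat.cast_one]
        push_cast [this, hKb] at h ⊢
        linear_combination h
      · intro _ h
        apply h1 K (by omega)
        push_cast [hKb] at h ⊢
        linear_combination h
      · intro h
        apply h2 (K + b) (by omega)
        push_cast [hKb] at h ⊢
        linear_combination h
  exact key K 0 (zero_add K)

theorem dX_last_pow_spinorFMul (he : eps p (Fin.last m) = -1) (hα : ∀ k : ℕ, alpha m lam + k ≠ 0)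
    (K : ℕ) : ∃ c : ℂ, c ≠ 0 ∧ ∀ s : S, (dX (Fin.last m) ^ K) (spinorFMul p m lam S K s)
      = c • (1 ⊗ₜ (lastTwist p m K • s)) := by
  obtain ⟨c, c', L, L', h, hs⟩ := exists_isRadialPair p m lam S he K
  refine ⟨(K.factorial : ℂ) * c 0, mul_ne_zero (Nat.cast_ne_zero.2 (Nat.factorial_ne_zero K))
    (h.leading hα), fun s => ?_⟩
  have hx : dX (Fin.last m) ^ K * xiOp p m S = xiOp p m S * dX (Fin.last m) ^ K := by
    have : Commute (dX (Fin.last m)) (xiOp p m S) := dX_last_mul_xiOp p m S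
    exact this.pow_left K
  rw [hs, radialSpinor, map_add, dX_last_pow_radial p c h.length_pos h.le, ← Module.End.mul_apply,
    hx, Module.End.mul_apply]
  rcases Nat.eq_zero_or_pos K with hK | hK
  · have : L' = 0 := by have := h.pos; omega
    simp [this, radial]
  · rw [dX_last_pow_radial_of_lt p c' (by omega), map_zero, add_zero]

theorem lastTwist_smul_smul (p m : ℕ) (S : Type*) [AddCommGroup S] [Module (Cl p m) S]
    (he : eps p (Fin.last m) = -1) (K : ℕ) (s : S) :
    lastTwist p m K • lastTwist p m K • s = s := by
  rw [lastTwist]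
  split_ifs
  · rw [one_smul, one_smul]
  · exact e_last_smul_smul p m he s

/-- For generic parameters all solutions are given by Gegenbauer polynomials. -/
theorem Sol_eq_iSup (he : eps p (Fin.last m) = -1)
    (h1 : ∀ k : ℕ, 1 ≤ k → lam + ((m + 1 : ℕ) : ℂ) - 3 / 2 ≠ (k : ℂ))
    (h2 : ∀ k : ℕ, 1 ≤ k → 2 * lam + ((m + 1 : ℕ) : ℂ) - 1 ≠ (k : ℂ)) :
    Sol p m lam S = ⨆ K : ℕ, spinorFSpace p m lam K (⊤ : Submodule ℂ S) := by
  refine le_antisymm (fun f hf => ?_) (iSup_le fun K => spinorFSpace_le_Sol S he K _)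
  -- `α + k = 0` would mean `2λ + n - 1 = 2k + 1`.
  have hα : ∀ k : ℕ, alpha m lam + k ≠ 0 := fun k hk => by
    apply h2 (2 * k + 1) (by omega)
    rw [alpha] at hk
    push_cast at hk ⊢
    linear_combination -2 * hk
  obtain ⟨N, g, hg, rfl, -⟩ := exists_sum_homogeneous f
  refine Submodule.sum_mem _ fun K hK => Submodule.mem_iSup_of_mem K ?_
  have hgK := mem_Sol_of_sum (fun i _ => hg i) hf K hK
  obtain ⟨c, hc, hs⟩ := dX_last_pow_spinorFMul (S := S) he hα K
  obtain ⟨v, hv⟩ := exists_one_tmul_of_euler_eq_zero (f := (dX (Fin.last m) ^ K) (g K))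
    (by rw [euler_dX_pow (hg K), sub_self, zero_smul])
  -- The spinor is chosen so that `∂_n^K` takes the same value on `F̃_K s` and on the component;
  -- `lastTwist` is an involution.
  refine ⟨c⁻¹ • lastTwist p m K • v, trivial, ?_⟩
  refine (sub_eq_zero.1 (eq_zero_of_mem_Sol_of_dX_last_pow (K := K)
    (Submodule.sub_mem _ hgK (spinorFMul_mem_Sol S he K _)) h1 h2 ?_ ?_)).symm
  · rw [map_sub, hg, euler_spinorFMul S he, smul_sub]
  · rw [map_sub, hv, map_smul, map_smul, hs, lastTwist_smul_smul p m S he, smul_smul,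
      inv_mul_cancel₀ hc, one_smul, sub_self]

end Exhaustion

end

end SpinorSingular

namespace SpinorSingular

noncomputable section

/-! ### Squares and commutation of the volume elements -/

section VolumeElements

variable (p m : ℕ)

theorem gam_mul_gam (k : Fin (m + 1)) : gam p m k * gam p m k = 1 := by
  have h : (Complex.I • Complex.I • algebraMap ℂ (Cl p m) (-1)) = 1 := by
    rw [smul_smul, Complex.I_mul_I, Algebra.algebraMap_eq_smul_one, smul_smul]
    norm_num
  rw [gam, smul_mul_assoc, mul_smul_comm, e_mul_self, eps]
  split_ifs
  · exact h
  · rw [one_smul, one_smul, neg_neg, map_one]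

/-- Moving the first factor through the remaining ones costs one sign each, and these lengths add up
to the binomial coefficient. -/
theorem prod_gam_sq (l : List (Fin (m + 1))) (hl : l.Nodup) :
    (l.map (gam p m)).prod * (l.map (gam p m)).prod
      = algebraMap ℂ (Cl p m) ((-1) ^ (l.length.choose 2)) := by
  induction l with
  | nil => simp
  | cons k l ih =>
    rw [List.nodup_cons] at hl
    have h : gam p m k * (l.map (gam p m)).prod
        = (-1 : ℂ) ^ l.length • ((l.map (gam p m)).prod * gam p m k) := by
      rw [gam, smul_mul_assoc, e_mul_prod_gam, List.count_eq_zero_of_not_mem hl.1, add_zero,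
        mul_smul_comm, smul_comm]
    rw [List.map_cons, List.prod_cons]
    nth_rewrite 1 [h]
    rw [smul_mul_assoc, mul_assoc _ (gam p m k), ← mul_assoc (gam p m k) (gam p m k), gam_mul_gam,
      one_mul, ih hl.2, List.length_cons, Nat.choose_succ_succ' l.length 1, Nat.choose_one_right,
      pow_add, map_mul, Algebra.smul_def]

/-- The total exponent of `-1` is `h + h(2h - 1) = 2h²`. -/
theorem I_pow_mul_neg_one_pow_choose {n h : ℕ} (hn : n = h + h) :
    Complex.I ^ h * Complex.I ^ h * (-1) ^ (n.choose 2) = 1 := by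
  rw [← two_mul] at hn
  subst hn
  have h1 : (2 * h).choose 2 = h * (2 * h - 1) := by
    rw [Nat.choose_two_right, mul_assoc, Nat.mul_div_cancel_left _ two_pos]
  have h2 : Complex.I ^ h * Complex.I ^ h = (-1) ^ h := by rw [← mul_pow, Complex.I_mul_I]
  rw [h1, h2, ← pow_add]
  refine Even.neg_one_pow ?_
  rcases Nat.eq_zero_or_pos h with rfl | hh
  · simp
  · exact ⟨h * h, by
      obtain ⟨k, rfl⟩ : ∃ k, h = k + 1 := ⟨h - 1, by omega⟩
      rw [show 2 * (k + 1) - 1 = 2 * k + 1 by omega]; ring⟩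

theorem volume_sq (hm : Even (m + 1)) : volume p m * volume p m = 1 := by
  obtain ⟨h, hh⟩ := hm
  have h2 : (m + 1) / 2 = h := by omega
  rw [volume, smul_mul_assoc, mul_smul_comm, prod_gam_sq p m _ (List.nodup_finRange _),
    List.length_finRange, h2, Algebra.algebraMap_eq_smul_one, smul_smul, smul_smul,
    I_pow_mul_neg_one_pow_choose hh, one_smul]

theorem volume'_sq (hm : Even m) : volume' p m * volume' p m = 1 := by
  obtain ⟨h, hh⟩ := hm
  have h2 : m / 2 = h := by omega
  have h3 : (List.finRange m).map (fun k => gam p m k.castSucc)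
      = ((List.finRange m).map Fin.castSucc).map (gam p m) := by rw [List.map_map]; rfl
  rw [volume', h3, smul_mul_assoc, mul_smul_comm, prod_gam_sq p m _
    ((List.nodup_finRange _).map (Fin.castSucc_injective m)), List.length_map,
    List.length_finRange, h2, Algebra.algebraMap_eq_smul_one, smul_smul, smul_smul,
    I_pow_mul_neg_one_pow_choose hh, one_smul]

theorem e_mul_volume (hm : Even (m + 1)) (i : Fin (m + 1)) :
    e p m i * volume p m = -(volume p m * e p m i) := by
  have h := vec_mul_volume p m (Pi.single i 1)
  have hodd : Odd m := by
    rcases Nat.even_or_odd m with h' | h'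
    · exact absurd h'.add_one (Nat.not_odd_iff_even.2 hm)
    · exact h'
  rw [hodd.neg_one_pow, neg_smul, one_smul] at h
  exact h

theorem e_castSucc_mul_volume' (hm : Even m) (i : Fin m) :
    e p m i.castSucc * volume' p m = -(volume' p m * e p m i.castSucc) := by
  have h3 : (List.finRange m).map (fun k => gam p m k.castSucc)
      = ((List.finRange m).map Fin.castSucc).map (gam p m) := by rw [List.map_map]; rfl
  rw [volume', h3, mul_smul_comm, e_mul_prod_gam, List.length_map, List.length_finRange,
    List.count_eq_one_of_mem ((List.nodup_finRange _).map (Fin.castSucc_injective m))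
      (List.mem_map_of_mem (List.mem_finRange i)), hm.add_one.neg_one_pow, neg_smul, one_smul,
    smul_neg, smul_mul_assoc]

end VolumeElements

/-! ### Half-spin values and monogenic solutions -/

section HalfSpin

variable (p m : ℕ) (lam : ℂ) (S : Type*) [AddCommGroup S] [Module ℂ S] [Module (Cl p m) S]
  [IsScalarTower ℂ (Cl p m) S]

-- Polynomials are flat over `ℂ`, so tensoring with them preserves the kernel that cuts out `W`.
-- Having values in `W` thus becomes an eigenvalue equation.
variable {p m S} in
theorem mem_polyVal_iff {W : Submodule ℂ S} {c : Cl p m} {z : ℂ} (hW : ∀ s, s ∈ W ↔ c • s = z • s)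
    (f : Poly m ⊗[ℂ] S) : f ∈ polyVal m W ↔ act c f = z • f := by
  have h1 : W = LinearMap.ker (Algebra.lsmul ℂ ℂ S c - z • LinearMap.id) := by
    ext s
    rw [hW, LinearMap.mem_ker, LinearMap.sub_apply, sub_eq_zero]
    rfl
  subst h1
  have h2 := Module.Flat.ker_lTensor_eq (R := ℂ) (S := ℂ) (M := Poly m)
    (f := Algebra.lsmul ℂ ℂ S c - z • LinearMap.id)
  have h3 : f ∈ polyVal m (LinearMap.ker (Algebra.lsmul ℂ ℂ S c - z • LinearMap.id)) ↔
      f ∈ LinearMap.ker ((Algebra.lsmul ℂ ℂ S c - z • LinearMap.id).lTensor (Poly m)) :=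
    (SetLike.ext_iff.1 h2 f).symm
  rw [h3, LinearMap.mem_ker, LinearMap.lTensor_sub,
    LinearMap.lTensor_smul, LinearMap.lTensor_id, LinearMap.sub_apply, sub_eq_zero]
  rfl

theorem polyVal_top : polyVal m (⊤ : Submodule ℂ S) = ⊤ := by
  rw [polyVal, LinearMap.range_eq_top]
  exact LinearMap.lTensor_surjective _ fun s => ⟨⟨s, trivial⟩, rfl⟩

variable {S} in
theorem mem_polyVal_halfSpinC_iff (ε : ℤˣ) (f : Poly m ⊗[ℂ] S) :
    f ∈ polyVal m (halfSpinC p m S ε) ↔ act (volume p m) f = ((ε : ℤ) : ℂ) • f :=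
  mem_polyVal_iff (fun _ => Iff.rfl) f

variable {S} in
theorem mem_polyVal_halfSpin'_iff (ε : ℤˣ) (f : Poly m ⊗[ℂ] S) :
    f ∈ polyVal m (halfSpin' p m S ε) ↔ act (volume' p m) f = ((ε : ℤ) : ℂ) • f :=
  mem_polyVal_iff (fun _ => Iff.rfl) f

theorem dpi_lTensor {V V' : Type*} [AddCommGroup V] [Module ℂ V] [Module (ClEven p m) V]
    [IsScalarTower ℂ (ClEven p m) V] [AddCommGroup V'] [Module ℂ V'] [Module (ClEven p m) V']
    [IsScalarTower ℂ (ClEven p m) V'] (φ : V →ₗ[ClEven p m] V') (j : Fin (m + 1))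
    (f : Poly m ⊗[ℂ] V) : dpi p m lam V' j ((φ.restrictScalars ℂ).lTensor (Poly m) f)
      = (φ.restrictScalars ℂ).lTensor (Poly m) (dpi p m lam V j f) := by
  set J := (φ.restrictScalars ℂ).lTensor (Poly m) with hJ
  have hd : ∀ k f, dX k (J f) = J (dX k f) := fun k f =>
    LinearMap.congr_fun (TensorProduct.ext' (g := (dX k).comp J) (h := J.comp (dX k))
      fun _ _ => rfl) f
  have hX : ∀ k f, mulX k (J f) = J (mulX k f) := fun k f =>
    LinearMap.congr_fun (TensorProduct.ext' (g := (mulX k).comp J) (h := J.comp (mulX k))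
      fun _ _ => rfl) f
  have ha : ∀ (a : ClEven p m) f, act a (J f) = J (act a f) := fun a f =>
    LinearMap.congr_fun (TensorProduct.ext' (g := (act a).comp J) (h := J.comp (act a))
      fun q v => congrArg (q ⊗ₜ[ℂ] ·) (φ.map_smul a v).symm) f
  simp only [dpi, euler, box, LinearMap.smul_apply, LinearMap.sub_apply, LinearMap.add_apply,
    LinearMap.sum_apply, Module.End.mul_apply, Module.End.one_apply, map_smul, map_sub, map_add,
    map_sum, hd, hX, ha]

/-- The inclusion of the half-spin space commutes with the operators and stays injective after
tensoring, so half-spin solutions can be treated inside `𝕊`-valued ones. -/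
theorem halfSol_eq (ε : ℤˣ) :
    halfSol p m lam S ε = Sol p m lam S ⊓ polyVal m (halfSpinC p m S ε) := by
  have hinj : Function.Injective
      (((halfSpin p m S ε).subtype.restrictScalars ℂ).lTensor (Poly m)) :=
    Module.Flat.lTensor_preserves_injective_linearMap _ Subtype.val_injective
  ext f
  constructor
  · rintro ⟨g, hg, rfl⟩
    refine ⟨(mem_Sol_iff p m lam S _).2 fun j => ?_, ⟨g, rfl⟩⟩
    rw [dpi_lTensor, (mem_Sol_iff p m lam _ g).1 hg j, map_zero]
  · rintro ⟨hf, g, rfl⟩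
    refine ⟨g, (mem_Sol_iff p m lam _ _).2 fun j => hinj ?_, rfl⟩
    rw [map_zero]
    refine (dpi_lTensor p m lam (halfSpin p m S ε).subtype j.castSucc _).symm.trans ?_
    exact (mem_Sol_iff p m lam S _).1 hf j

theorem act_volume_mul_xiOp (hm : Even (m + 1)) :
    act (volume p m) * xiOp p m S = -(xiOp p m S * act (volume p m)) := by
  rw [xiOp, Finset.mul_sum, Finset.sum_mul, ← Finset.sum_neg_distrib]
  refine Finset.sum_congr rfl fun k _ => ?_
  have h : volume p m * e p m k.castSucc = -(e p m k.castSucc * volume p m) := by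
    rw [e_mul_volume p m hm, neg_neg]
  rw [mul_smul_comm, smul_mul_assoc, ← mul_assoc, act_mul_mulX, mul_assoc, mul_assoc, ← act_mul,
    ← act_mul, h, ← neg_one_smul ℂ (e p m k.castSucc * volume p m), act_smul, mul_smul_comm,
    neg_one_smul, smul_neg]

/-- For `n` even the volume element anticommutes with vectors, and `F̃_K` has the Clifford parity of
`K`; hence the half-spin index `(-1)^K ε`. -/
theorem act_volume_spinorFMul (he : eps p (Fin.last m) = -1) (hm : Even (m + 1)) (K : ℕ) (s : S) :
    act (volume p m) (spinorFMul p m lam S K s)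
      = spinorFMul p m lam S K ((-1 : ℂ) ^ K • volume p m • s) := by
  obtain ⟨c, c', L, L', h, hs⟩ := exists_isRadialPair p m lam S he K
  have h1 : ∀ t : S, volume p m • e p m (Fin.last m) • t
      = -(e p m (Fin.last m) • volume p m • t) := fun t => by
    rw [smul_smul, smul_smul, e_mul_volume p m hm, neg_smul, neg_neg]
  have h2 : volume p m • lastTwist p m K • s
      = (-1 : ℂ) ^ K • lastTwist p m K • volume p m • s := by
    rw [lastTwist]
    split_ifs with hK
    · rw [hK.neg_one_pow, one_smul, one_smul, one_smul]
    · rw [(Nat.not_even_iff_odd.1 hK).neg_one_pow, h1, neg_one_smul]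
  rw [hs, hs, radialSpinor, radialSpinor, map_add, act_tmul, ← Module.End.mul_apply,
    act_volume_mul_xiOp p m S hm, LinearMap.neg_apply, Module.End.mul_apply, act_tmul, h1,
    TensorProduct.tmul_neg, map_neg, neg_neg, h2, smul_comm (lastTwist p m K) (_ : ℂ)]

theorem coe_neg_one_pow_mul (K : ℕ) (ε : ℤˣ) :
    ((((-1) ^ K * ε : ℤˣ) : ℤ) : ℂ) = (-1) ^ K * ((ε : ℤ) : ℂ) := by
  push_cast
  rfl

theorem spinorFSpace_le_halfSol (he : eps p (Fin.last m) = -1) (hm : Even (m + 1)) (ε : ℤˣ)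
    (K : ℕ) : spinorFSpace p m lam K (halfSpinC p m S ((-1) ^ K * ε)) ≤ halfSol p m lam S ε := by
  rw [halfSol_eq]
  refine le_inf (spinorFSpace_le_Sol S he K _) ?_
  rintro _ ⟨s, hs, rfl⟩
  have hs' : volume p m • s = ((((-1) ^ K * ε : ℤˣ) : ℤ) : ℂ) • s := hs
  rw [mem_polyVal_halfSpinC_iff, act_volume_spinorFMul p m lam S he hm, hs', smul_smul,
    coe_neg_one_pow_mul, ← mul_assoc, ← mul_pow, neg_one_mul, neg_neg, one_pow, one_mul, map_smul]

theorem coe_sign_mul_self (ε : ℤˣ) : ((ε : ℤ) : ℂ) * ((ε : ℤ) : ℂ) = 1 := by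
  rcases Int.units_eq_one_or ε with rfl | rfl <;> norm_num

theorem halfSol_eq_iSup (he : eps p (Fin.last m) = -1) (hm : Even (m + 1)) (ε : ℤˣ)
    (h1 : ∀ k : ℕ, 1 ≤ k → lam + ((m + 1 : ℕ) : ℂ) - 3 / 2 ≠ (k : ℂ))
    (h2 : ∀ k : ℕ, 1 ≤ k → 2 * lam + ((m + 1 : ℕ) : ℂ) - 1 ≠ (k : ℂ)) :
    halfSol p m lam S ε
      = ⨆ K : ℕ, spinorFSpace p m lam K (halfSpinC p m S ((-1) ^ K * ε)) := by
  refine le_antisymm ?_ (iSup_le fun K => spinorFSpace_le_halfSol p m lam S he hm ε K)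
  set z : ℂ := ((ε : ℤ) : ℂ) with hz
  have hzz : z * z = 1 := coe_sign_mul_self ε
  -- The projector `(1 + ε · volume)/2` is applied to the decomposition of all `𝕊`-valued solutions.
  -- It maps `F̃_K s` to `F̃_K` times the projection of `s` to the half-spin space of sign `(-1)^K
  -- ε`.
  have key : ∀ f ∈ Sol p m lam S, (1 / 2 : ℂ) • (f + z • act (volume p m) f)
      ∈ ⨆ K : ℕ, spinorFSpace p m lam K (halfSpinC p m S ((-1) ^ K * ε)) := by
    intro f hf
    rw [Sol_eq_iSup he h1 h2] at hf
    induction hf using Submodule.iSup_induction' with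
    | mem K f hf =>
      obtain ⟨s, -, rfl⟩ := hf
      refine Submodule.mem_iSup_of_mem K
        ⟨(1 / 2 : ℂ) • (s + (z * (-1) ^ K) • volume p m • s), ?_, ?_⟩
      · change volume p m • _ = ((((-1) ^ K * ε : ℤˣ) : ℤ) : ℂ) • _
        rw [coe_neg_one_pow_mul, ← hz, smul_comm (volume p m) (_ : ℂ), smul_add,
          smul_comm (volume p m) (_ : ℂ) (volume p m • s), smul_smul (volume p m) (volume p m),
          volume_sq p m hm, one_smul]
        have hK : ((-1 : ℂ) ^ K * z) * (z * (-1) ^ K) = 1 := by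
          have : ((-1 : ℂ) ^ K) * (-1) ^ K = 1 := by rw [← mul_pow]; simp
          linear_combination ((-1 : ℂ) ^ K) * (-1) ^ K * hzz + this
        generalize volume p m • s = t
        have h5 : ((-1 : ℂ) ^ K * z) • (1 / 2 : ℂ) • (s + (z * (-1) ^ K) • t)
            = (1 / 2 : ℂ) • ((z * (-1) ^ K) • s + ((-1 : ℂ) ^ K * z * (z * (-1) ^ K)) • t) := by
          module
        rw [h5, hK, one_smul, add_comm t]
      · rw [act_volume_spinorFMul p m lam S he hm, map_smul, map_add, map_smul (spinorFMul p m lam S K) (z * (-1) ^ K),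
          map_smul (spinorFMul p m lam S K) ((-1 : ℂ) ^ K), mul_smul]
    | zero => simp
    | add f g _ _ hf hg =>
      have : (1 / 2 : ℂ) • (f + g + z • act (volume p m) (f + g))
          = (1 / 2 : ℂ) • (f + z • act (volume p m) f)
            + (1 / 2 : ℂ) • (g + z • act (volume p m) g) := by
        rw [map_add]; module
      rw [this]
      exact Submodule.add_mem _ hf hg
  intro f hf
  rw [halfSol_eq] at hf
  have h3 := key f hf.1
  rw [(mem_polyVal_halfSpinC_iff p m ε f).1 hf.2, smul_smul, ← hz, hzz, one_smul,
    ← two_smul ℂ f, smul_smul] at h3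
  simpa using h3

/-- `D f = 0` removes the Dirac term and, by `D² = -□`, the second-order term; the first-order term
has the scalar `λ - (l + 1) + 1/2 = 0`. -/
theorem monogenic_le_Sol {l : ℕ} (hl : lam = l + 1 / 2) (W : Submodule ℂ S) :
    monogenic p m (l + 1) W ≤ Sol p m lam S := by
  rintro f ⟨⟨-, hD⟩, hE⟩
  replace hD : dirac p m S f = 0 := hD
  have hE' : euler f = ((l + 1 : ℕ) : ℂ) • f := by
    rw [SetLike.mem_coe, LinearMap.mem_ker, LinearMap.sub_apply, sub_eq_zero] at hE
    exact hE
  have hbox : box p f = 0 := by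
    rw [← neg_neg (box p), ← dirac_sq p m S, LinearMap.neg_apply, Module.End.mul_apply, hD,
      map_zero, neg_zero]
  rw [mem_Sol_iff]
  intro j
  have h0 : lam - ((l + 1 : ℕ) : ℂ) + 1 / 2 = 0 := by rw [hl]; push_cast; ring
  rw [dpi_of_homogeneous hE', hbox, hD, h0]
  simp

theorem monogenic_le_halfSol {l : ℕ} (hl : lam = l + 1 / 2) (ε : ℤˣ) :
    monogenic p m (l + 1) (halfSpinC p m S ε) ≤ halfSol p m lam S ε := by
  rw [halfSol_eq]
  exact le_inf (monogenic_le_Sol p m lam S hl _) (inf_le_left.trans inf_le_left)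

end HalfSpin

end

end SpinorSingular

namespace SpinorSingular

noncomputable section

/-! ### Generators of `𝔪'` and their Casimir element on spinors -/

section Rotations

variable (p m : ℕ)

/-- The matrix `ε_b E_{ab} - ε_a E_{ba}` of an infinitesimal rotation. -/
def rotMat (a b : Fin m) : Matrix (Fin (m + 1)) (Fin (m + 1)) ℂ :=
  eps p b.castSucc • Matrix.single a.castSucc b.castSucc 1
    - eps p a.castSucc • Matrix.single b.castSucc a.castSucc 1

theorem rotMat_mem_so (a b : Fin m) :
    Matrix.fromBlocks (rotMat p m a b) 0 0 (0 : Matrix (Fin 2) (Fin 2) ℂ) ∈ so p m := by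
  have h : (rotMat p m a b).transpose * Matrix.diagonal (eps p)
      = -(Matrix.diagonal (eps p) * rotMat p m a b) := by
    ext j k
    rw [Matrix.mul_diagonal, Matrix.neg_apply, Matrix.diagonal_mul]
    simp only [rotMat, Matrix.transpose_apply, Matrix.sub_apply, Matrix.smul_apply,
      Matrix.single_apply, smul_eq_mul]
    have e1 : (a.castSucc = j ∧ b.castSucc = k) ↔ (b.castSucc = k ∧ a.castSucc = j) := and_comm
    have e2 : (b.castSucc = j ∧ a.castSucc = k) ↔ (a.castSucc = k ∧ b.castSucc = j) := and_comm
    simp only [e1, e2]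
    split_ifs with h1 h2 h2
    · have h : eps p a.castSucc = eps p b.castSucc := by rw [h1.1, h2.1]
      rw [← h1.1, ← h1.2, h]; ring
    · rw [← h1.1, ← h1.2]; ring
    · rw [← h2.1, ← h2.2]; ring
    · ring
  rw [mem_so_iff, gram, Matrix.fromBlocks_transpose, Matrix.fromBlocks_multiply,
    Matrix.fromBlocks_multiply, Matrix.fromBlocks_neg]
  simp [h]

/-- The standard generators of `𝔪'`. -/
def rot (a b : Fin m) : so p m := ⟨_, rotMat_mem_so p m a b⟩

theorem rot_mem_mPrime (a b : Fin m) : rot p m a b ∈ mPrime p m := by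
  refine ⟨⟨?_, ?_, ?_⟩, ?_⟩
  · rintro (i | i) - <;> simp [rot]
  · rintro (i | i) - <;> simp [rot]
  · rintro (i | i)
    · simp [rot, rotMat]
    · simp [rot]
  · simp [rot]

theorem coe_spinEl_rot (a b : Fin m) :
    (spinEl p m (rot p m a b).1.toBlocks₁₁ : Cl p m)
      = -(1 / 4 : ℂ) • (e p m a.castSucc * e p m b.castSucc)
        - -(1 / 4 : ℂ) • (e p m b.castSucc * e p m a.castSucc) := by
  have h : ∀ (x y : Fin (m + 1)) (z : ℂ), ∑ j, ∑ k,
      (eps p k * (z • Matrix.single x y (1 : ℂ)) j k) • (e p m j * e p m k)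
      = (eps p y * z) • (e p m x * e p m y) := fun x y z => by
    rw [Finset.sum_eq_single x, Finset.sum_eq_single y]
    · simp
    · intro k _ hk; simp [Ne.symm hk]
    · intro h; exact absurd (Finset.mem_univ _) h
    · intro j _ hj; simp [Ne.symm hj]
    · intro h; exact absurd (Finset.mem_univ _) h
  have h1 : (rot p m a b).1.toBlocks₁₁ = rotMat p m a b := by
    rw [rot, Matrix.toBlocks_fromBlocks₁₁]
  rw [coe_spinEl, h1, rotMat]
  simp_rw [Matrix.sub_apply, mul_sub, sub_smul, Finset.sum_sub_distrib]
  rw [h, h, eps_mul_eps, eps_mul_eps, one_smul, one_smul, smul_sub]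

/-- The correction for `a = b`, where the rotation is zero, allows sums over all pairs. -/
theorem coe_spinEl_rot' (a b : Fin m) :
    (spinEl p m (rot p m a b).1.toBlocks₁₁ : Cl p m)
      = -(1 / 2 : ℂ) • (e p m a.castSucc * e p m b.castSucc)
        - (if a = b then 1 / 2 * eps p a.castSucc else 0 : ℂ) • 1 := by
  have h := e_mul_e_add_swap p m a.castSucc b.castSucc
  rw [← eq_sub_iff_add_eq'] at h
  rw [coe_spinEl_rot, h, Algebra.algebraMap_eq_smul_one]
  simp only [(Fin.castSucc_injective m).eq_iff]
  split_ifs <;> module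

-- Against a skew factor, `u a b - u b a` may be replaced by `2 u a b`; so only one of the two
-- factors in a Casimir sum has to be written out as a difference.
variable {m} in
theorem sum_antisymm {R : Type*} [Ring R] [Algebra ℂ R] (u w : Fin m → Fin m → R)
    (c : Fin m → Fin m → ℂ) (hc : ∀ a b, c a b = c b a) (hw : ∀ a b, w b a = -w a b) :
    ∑ a, ∑ b, c a b • ((u a b - u b a) * w a b) = (2 : ℂ) • ∑ a, ∑ b, c a b • (u a b * w a b) := by
  have h : ∑ a, ∑ b, c a b • (u b a * w a b) = -∑ a, ∑ b, c a b • (u a b * w a b) := by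
    rw [Finset.sum_comm, ← Finset.sum_neg_distrib]
    refine Finset.sum_congr rfl fun a _ => ?_
    rw [← Finset.sum_neg_distrib]
    refine Finset.sum_congr rfl fun b _ => ?_
    rw [hw, hc, mul_neg, smul_neg]
  simp_rw [sub_mul, smul_sub, Finset.sum_sub_distrib]
  rw [h, sub_neg_eq_add, two_smul]

/-- The scalar by which the Casimir operator of `𝔪'` acts on spinors (up to normalization). -/
def spinCasimir (m : ℕ) : ℂ := -((m : ℂ) * (m - 1)) / 4

/-- For `a ≠ b` the square of `e_a e_b` is `-ε_a ε_b`, so each of the `m(m - 1)` ordered pairs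
contributes `-1/4`. -/
theorem sum_spinEl_rot : ∑ a : Fin m, ∑ b : Fin m, (eps p a.castSucc * eps p b.castSucc) •
    ((spinEl p m (rot p m a b).1.toBlocks₁₁ : Cl p m) * (spinEl p m (rot p m a b).1.toBlocks₁₁))
      = spinCasimir m • 1 := by
  have h1 : ∀ a b : Fin m, (spinEl p m (rot p m b a).1.toBlocks₁₁ : Cl p m)
      = -(spinEl p m (rot p m a b).1.toBlocks₁₁ : Cl p m) := fun a b => by
    rw [coe_spinEl_rot, coe_spinEl_rot, neg_sub]
  have h2 := sum_antisymm (fun a b : Fin m =>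
      -(1 / 4 : ℂ) • (e p m a.castSucc * e p m b.castSucc))
    (fun a b => (spinEl p m (rot p m a b).1.toBlocks₁₁ : Cl p m))
    (fun a b => eps p a.castSucc * eps p b.castSucc) (fun a b => mul_comm _ _) h1
  have h3 : ∀ a b : Fin m, (eps p a.castSucc * eps p b.castSucc) •
      (-(1 / 4 : ℂ) • (e p m a.castSucc * e p m b.castSucc)
        * (spinEl p m (rot p m a b).1.toBlocks₁₁ : Cl p m))
      = (-1 / 8 + if a = b then 1 / 8 else 0 : ℂ) • 1 := fun a b => by
    have h4 : e p m a.castSucc * e p m b.castSucc * (e p m a.castSucc * e p m b.castSucc)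
        = (-(eps p a.castSucc * eps p b.castSucc) + if a = b then 2 else 0 : ℂ) • 1 := by
      have h5 : e p m a.castSucc * e p m b.castSucc * (e p m a.castSucc * e p m b.castSucc)
          = e p m a.castSucc * (e p m b.castSucc * e p m a.castSucc
              + e p m a.castSucc * e p m b.castSucc) * e p m b.castSucc
            - (e p m a.castSucc * e p m a.castSucc) * (e p m b.castSucc * e p m b.castSucc) := by
        noncomm_ring
      rw [h5, e_mul_e_add_swap, e_mul_self, e_mul_self, ← Algebra.commutes, mul_assoc, ← map_mul]
      simp only [(Fin.castSucc_injective m).eq_iff]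
      by_cases hab : a = b
      · subst hab
        rw [if_pos rfl, if_pos rfl, e_mul_self, ← map_mul, ← map_sub,
          Algebra.algebraMap_eq_smul_one]
        congr 1
        linear_combination 2 * eps_mul_eps p a.castSucc
      · rw [if_neg (Ne.symm hab), if_neg hab, map_zero, zero_mul, zero_sub, ← map_neg,
          Algebra.algebraMap_eq_smul_one]
        congr 1
        ring
    have hab : (eps p a.castSucc * eps p b.castSucc) * (eps p a.castSucc * eps p b.castSucc)
        = 1 := by
      linear_combination eps_mul_eps p a.castSucc + eps p a.castSucc * eps p a.castSucc *
        eps_mul_eps p b.castSucc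
    rw [coe_spinEl_rot', smul_mul_assoc, mul_sub, mul_smul_comm, h4, mul_smul_comm, mul_one]
    by_cases h : a = b
    · subst h
      rw [if_pos rfl, if_pos rfl, if_pos rfl, e_mul_self, Algebra.algebraMap_eq_smul_one]
      simp only [smul_smul, ← sub_smul]
      congr 1
      linear_combination (1 / 4 : ℂ) * (eps_mul_eps p a.castSucc - hab)
    · rw [if_neg h, if_neg h, if_neg h]
      simp only [smul_smul, zero_smul, sub_zero]
      congr 1
      linear_combination (-1 / 8 : ℂ) * hab
  have h5 : ∑ a : Fin m, ∑ b : Fin m, (-1 / 8 + if a = b then 1 / 8 else 0 : ℂ)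
      = (1 / 2) * spinCasimir m := by
    simp_rw [Finset.sum_add_distrib]
    simp only [Finset.sum_const, Finset.card_univ, Fintype.card_fin, Finset.sum_ite_eq,
      Finset.mem_univ, if_true, nsmul_eq_mul, spinCasimir]
    ring
  simp_rw [h3, ← Finset.sum_smul, ← coe_spinEl_rot] at h2
  rw [h5, smul_smul, ← mul_assoc, mul_one_div_cancel two_ne_zero, one_mul] at h2
  exact h2

end Rotations

/-! ### The Casimir operator of `𝔪'` on spinor-valued polynomials -/

section Casimir

variable (p m : ℕ) (lam : ℂ) (S : Type*) [AddCommGroup S] [Module ℂ S] [Module (Cl p m) S]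
  [IsScalarTower ℂ (Cl p m) S]

theorem leviAct_of_mem_mPrime {A : so p m} (hA : A ∈ mPrime p m) :
    leviAct p m lam S A = leviAct p m 0 S A := by
  rw [leviAct_eq_euler, leviAct_eq_euler, hA.2, mul_zero, mul_zero]

theorem leviAct_rot (a b : Fin m) : leviAct p m 0 S (rot p m a b)
    = (eps p b.castSucc • (mulX a.castSucc * dX b.castSucc)
        - eps p a.castSucc • (mulX b.castSucc * dX a.castSucc))
      + act (spinEl p m (rot p m a b).1.toBlocks₁₁ : Cl p m) := by
  have h : ∀ (x y : Fin (m + 1)) (z : ℂ), ∑ j, ∑ k,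
      (z • Matrix.single x y (1 : ℂ)) j k • (mulX j * dX k : Module.End ℂ (Poly m ⊗[ℂ] S))
      = z • (mulX x * dX y) := fun x y z => by
    rw [Finset.sum_eq_single x, Finset.sum_eq_single y]
    · simp
    · intro k _ hk; simp [Ne.symm hk]
    · intro h; exact absurd (Finset.mem_univ _) h
    · intro j _ hj; simp [Ne.symm hj]
    · intro h; exact absurd (Finset.mem_univ _) h
  have h1 : ∀ j k, (rot p m a b).1 (Sum.inl j) (Sum.inl k) = rotMat p m a b j k :=
    fun j k => rfl
  rw [leviAct_eq_euler, (rot_mem_mPrime p m a b).2, zero_smul, mul_zero, zero_smul, sub_zero,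
    add_zero, act_spinEl]
  congr 1
  simp_rw [h1, rotMat, Matrix.sub_apply, sub_smul, Finset.sum_sub_distrib]
  rw [h, h]

/-- The Casimir operator of `𝔪'` on spinor-valued polynomials (up to normalization). -/
def casimir : Module.End ℂ (Poly m ⊗[ℂ] S) :=
  ∑ a : Fin m, ∑ b : Fin m, (eps p a.castSucc * eps p b.castSucc) •
    (leviAct p m 0 S (rot p m a b) * leviAct p m 0 S (rot p m a b))


-- The orbital part is the classical `r □' - E'(E' + m - 2)`, doubled because ordered pairs are
-- summed.
variable {m} in
theorem sum_rot_sq (S : Type*) [AddCommGroup S] [Module ℂ S] : ∑ a : Fin m, ∑ b : Fin m, (eps p a.castSucc * eps p b.castSucc) •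
    ((eps p b.castSucc • (mulX a.castSucc * dX b.castSucc)
        - eps p a.castSucc • (mulX b.castSucc * dX a.castSucc)) *
      (eps p b.castSucc • (mulX a.castSucc * dX b.castSucc)
        - eps p a.castSucc • (mulX b.castSucc * dX a.castSucc)) : Module.End ℂ (Poly m ⊗[ℂ] S))
      = (2 : ℂ) • (normOp p m S * boxPrime p m S + (2 - m : ℂ) • eulerPrime m S
        - eulerPrime m S * eulerPrime m S) := by
  rw [sum_antisymm (R := Module.End ℂ (Poly m ⊗[ℂ] S))
    (fun a b : Fin m => eps p b.castSucc • (mulX a.castSucc * dX b.castSucc))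
    (fun a b => eps p b.castSucc • (mulX a.castSucc * dX b.castSucc)
        - eps p a.castSucc • (mulX b.castSucc * dX a.castSucc))
    (fun a b => eps p a.castSucc * eps p b.castSucc) (fun a b => mul_comm _ _)
    fun a b => (neg_sub _ _).symm]
  congr 1
  have h1 : ∀ a b : Fin m, (mulX a.castSucc * dX b.castSucc * (mulX a.castSucc * dX b.castSucc)
      : Module.End ℂ (Poly m ⊗[ℂ] S))
      = mulX a.castSucc * mulX a.castSucc * (dX b.castSucc * dX b.castSucc)
        + if a = b then mulX a.castSucc * dX b.castSucc else 0 := fun a b => by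
    rw [mul_assoc, ← mul_assoc (dX _), dX_mul_mulX, add_mul, mul_add, mul_assoc, mul_assoc]
    simp only [(Fin.castSucc_injective m).eq_iff]
    by_cases h : a = b
    · subst h; simp
    · rw [if_neg h, if_neg (Ne.symm h), zero_mul, mul_zero]
  have h2 : ∀ a b : Fin m, (mulX a.castSucc * dX b.castSucc * (mulX b.castSucc * dX a.castSucc)
      : Module.End ℂ (Poly m ⊗[ℂ] S))
      = mulX a.castSucc * dX a.castSucc * (mulX b.castSucc * dX b.castSucc)
        + mulX a.castSucc * dX a.castSucc
        - if a = b then mulX a.castSucc * dX a.castSucc else 0 := fun a b => by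
    rw [mul_assoc, ← mul_assoc (dX _), dX_mul_mulX, if_pos rfl, mul_assoc (mulX a.castSucc),
      ← mul_assoc (dX a.castSucc), dX_mul_mulX, add_mul, add_mul, mul_add, mul_add, one_mul,
      mul_assoc, mul_assoc, dX_mul_dX b.castSucc]
    simp only [(Fin.castSucc_injective m).eq_iff]
    by_cases h : a = b
    · subst h; simp
    · rw [if_neg h, if_neg h, zero_mul, mul_zero, add_zero, sub_zero]
  have h3 : ∀ a b : Fin m, (eps p a.castSucc * eps p b.castSucc) •
      (eps p b.castSucc • (mulX a.castSucc * dX b.castSucc) *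
        (eps p b.castSucc • (mulX a.castSucc * dX b.castSucc)
          - eps p a.castSucc • (mulX b.castSucc * dX a.castSucc)) : Module.End ℂ (Poly m ⊗[ℂ] S))
      = (eps p a.castSucc • (mulX a.castSucc * mulX a.castSucc))
          * (eps p b.castSucc • (dX b.castSucc * dX b.castSucc))
        + (if a = b then (2 : ℂ) • (mulX a.castSucc * dX a.castSucc) else 0)
        - mulX a.castSucc * dX a.castSucc * (mulX b.castSucc * dX b.castSucc)
        - mulX a.castSucc * dX a.castSucc := fun a b => by
    have ha := eps_mul_eps p a.castSucc
    have hb := eps_mul_eps p b.castSucc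
    rw [smul_mul_assoc, mul_sub, mul_smul_comm, mul_smul_comm, h1, h2, smul_mul_assoc,
      mul_smul_comm]
    have e1 : (eps p a.castSucc * eps p b.castSucc) * eps p b.castSucc * eps p b.castSucc
        = eps p a.castSucc * eps p b.castSucc := by
      linear_combination (eps p a.castSucc * eps p b.castSucc) * hb
    have e2 : (eps p a.castSucc * eps p b.castSucc) * eps p b.castSucc * eps p a.castSucc = 1 := by
      linear_combination ha + eps p a.castSucc * eps p a.castSucc * hb
    rw [smul_smul, smul_sub, smul_smul, smul_smul, e1, e2, one_smul,
      smul_smul (eps p a.castSucc) (eps p b.castSucc)]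
    by_cases h : a = b
    · subst h
      simp only [if_pos, ha]
      module
    · simp only [if_neg h]
      module
  simp_rw [h3, Finset.sum_sub_distrib, Finset.sum_add_distrib]
  rw [normOp, boxPrime, eulerPrime, Finset.sum_mul_sum, Finset.sum_mul_sum]
  simp only [Finset.sum_ite_eq, Finset.mem_univ, if_true, Finset.sum_const, Finset.card_univ,
    Fintype.card_fin, ← Finset.smul_sum, ← Nat.cast_smul_eq_nsmul ℂ]
  module

-- The mixed part of orbital and spin action: the terms `ε_a ξ_a e_a e_b ∂_b` add up to `ξ' D'`, and
-- the correction for `a = b` contributes `E'`.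
variable {m} in
theorem sum_rot_mul_spinEl : ∑ a : Fin m, ∑ b : Fin m, (eps p a.castSucc * eps p b.castSucc) •
    ((eps p b.castSucc • (mulX a.castSucc * dX b.castSucc)
        - eps p a.castSucc • (mulX b.castSucc * dX a.castSucc)) *
      act (spinEl p m (rot p m a b).1.toBlocks₁₁ : Cl p m) : Module.End ℂ (Poly m ⊗[ℂ] S))
      = -(xiOp p m S * dirac' p m S) - eulerPrime m S := by
  rw [sum_antisymm (R := Module.End ℂ (Poly m ⊗[ℂ] S))
    (fun a b : Fin m => eps p b.castSucc • (mulX a.castSucc * dX b.castSucc))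
    (fun a b => act (spinEl p m (rot p m a b).1.toBlocks₁₁ : Cl p m))
    (fun a b => eps p a.castSucc * eps p b.castSucc) (fun a b => mul_comm _ _)
    fun a b => by
      rw [coe_spinEl_rot, coe_spinEl_rot, ← neg_sub, ← neg_one_smul ℂ, act_smul, neg_one_smul]]
  have h3 : ∀ a b : Fin m, (eps p a.castSucc * eps p b.castSucc) •
      (eps p b.castSucc • (mulX a.castSucc * dX b.castSucc) *
        act (spinEl p m (rot p m a b).1.toBlocks₁₁ : Cl p m) : Module.End ℂ (Poly m ⊗[ℂ] S))
      = -(1 / 2 : ℂ) • ((eps p a.castSucc • (mulX a.castSucc * act (e p m a.castSucc)))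
          * (act (e p m b.castSucc) * dX b.castSucc)
        + if a = b then (mulX a.castSucc * dX a.castSucc) else 0) := fun a b => by
    have e1 : (eps p a.castSucc * eps p b.castSucc) * eps p b.castSucc = eps p a.castSucc := by
      linear_combination (eps p a.castSucc) * eps_mul_eps p b.castSucc
    have e3 : (mulX a.castSucc * dX b.castSucc * (act (e p m a.castSucc) * act (e p m b.castSucc))
        : Module.End ℂ (Poly m ⊗[ℂ] S))
        = mulX a.castSucc * act (e p m a.castSucc) * (act (e p m b.castSucc) * dX b.castSucc) := by
      rw [← act_mul, mul_assoc, ← act_mul_dX, act_mul, mul_assoc, mul_assoc]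
    rw [coe_spinEl_rot', act_sub, act_smul, act_smul, act_mul, act_one, smul_mul_assoc, smul_smul,
      e1, mul_sub, mul_smul_comm, mul_smul_comm, e3, mul_one, smul_mul_assoc]
    by_cases h : a = b
    · subst h
      simp only [if_pos]
      have ha := eps_mul_eps p a.castSucc
      rw [smul_sub, smul_smul (eps p a.castSucc) (1 / 2 * _), show eps p a.castSucc *
        (1 / 2 * eps p a.castSucc) = 1 / 2 by linear_combination (1 / 2) * ha]
      module
    · simp only [if_neg h]
      module
  simp_rw [h3, ← Finset.smul_sum, Finset.sum_add_distrib]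
  rw [xiOp, dirac', eulerPrime, Finset.sum_mul_sum]
  simp only [Finset.sum_ite_eq, Finset.mem_univ, if_true]
  module

/-- Orbital and spin action commute, so the square splits into the orbital square, twice the mixed
part and the spin square. On polynomials in the kernel of `D'` only `E'` and the spin scalar remain.
-/
theorem casimir_eq : casimir p m S
    = (2 : ℂ) • (normOp p m S * boxPrime p m S + (1 - m : ℂ) • eulerPrime m S
        - eulerPrime m S * eulerPrime m S - xiOp p m S * dirac' p m S) + spinCasimir m • 1 := by
  have h : ∀ (a b : Fin m), (eps p a.castSucc * eps p b.castSucc) •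
      (leviAct p m 0 S (rot p m a b) * leviAct p m 0 S (rot p m a b))
      = (eps p a.castSucc * eps p b.castSucc) •
        ((eps p b.castSucc • (mulX a.castSucc * dX b.castSucc)
          - eps p a.castSucc • (mulX b.castSucc * dX a.castSucc)) *
        (eps p b.castSucc • (mulX a.castSucc * dX b.castSucc)
          - eps p a.castSucc • (mulX b.castSucc * dX a.castSucc)))
        + (2 : ℂ) • ((eps p a.castSucc * eps p b.castSucc) •
          ((eps p b.castSucc • (mulX a.castSucc * dX b.castSucc)
            - eps p a.castSucc • (mulX b.castSucc * dX a.castSucc)) *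
          act (spinEl p m (rot p m a b).1.toBlocks₁₁ : Cl p m)))
        + act ((eps p a.castSucc * eps p b.castSucc) •
          ((spinEl p m (rot p m a b).1.toBlocks₁₁ : Cl p m) *
            (spinEl p m (rot p m a b).1.toBlocks₁₁))) := fun a b => by
    rw [leviAct_rot, act_smul, act_mul]
    set x : Module.End ℂ (Poly m ⊗[ℂ] S) := eps p b.castSucc • (mulX a.castSucc * dX b.castSucc)
      - eps p a.castSucc • (mulX b.castSucc * dX a.castSucc) with hx
    generalize hc : (spinEl p m (rot p m a b).1.toBlocks₁₁ : Cl p m) = c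
    have hxc : act c * x = x * act c := by
      rw [hx, mul_sub, sub_mul, mul_smul_comm, mul_smul_comm, smul_mul_assoc, smul_mul_assoc,
        ← mul_assoc, ← mul_assoc, act_mul_mulX, act_mul_mulX, mul_assoc, mul_assoc, act_mul_dX,
        act_mul_dX, mul_assoc, mul_assoc]
    rw [add_mul, mul_add, mul_add, hxc]
    module
  rw [casimir]
  simp_rw [h, Finset.sum_add_distrib, ← Finset.smul_sum]
  rw [sum_rot_sq, sum_rot_mul_spinEl]
  simp_rw [← act_sum]
  rw [sum_spinEl_rot, act_smul, act_one]
  module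

end Casimir

end

end SpinorSingular

namespace SpinorSingular

noncomputable section

/-! ### Direct sums separated by Casimir eigenvalues -/

theorem iSupIndep_disjoint_sup {α ι : Type*} [CompleteLattice α] [IsModularLattice α] {A : ι → α}
    {b : α} (hA : iSupIndep A) (hAb : Disjoint (⨆ i, A i) b) (i : ι) :
    Disjoint (A i) ((⨆ (j) (_ : j ≠ i), A j) ⊔ b) :=
  (hA i).disjoint_sup_right_of_disjoint_sup_left
    (hAb.mono_left (sup_le (le_iSup _ i) (iSup_le fun j => iSup_le fun _ => le_iSup _ j)))

theorem iSupIndep_sumElim {α ι κ : Type*} [CompleteLattice α] [IsModularLattice α] {A : ι → α}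
    {B : κ → α} (hA : iSupIndep A) (hB : iSupIndep B) (hAB : Disjoint (⨆ i, A i) (⨆ k, B k)) :
    iSupIndep (Sum.elim A B) := by
  rintro (i | k)
  · refine (iSupIndep_disjoint_sup hA hAB i).mono_right (iSup_le ?_)
    rintro (j | j)
    · exact iSup_le fun h => le_sup_of_le_left
        (le_iSup₂_of_le j (fun h' => h (congrArg Sum.inl h')) le_rfl)
    · exact iSup_le fun _ => le_sup_of_le_right (le_iSup B j)
  · refine (iSupIndep_disjoint_sup hB hAB.symm k).mono_right (iSup_le ?_)
    rintro (j | j)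
    · exact iSup_le fun _ => le_sup_of_le_right (le_iSup A j)
    · exact iSup_le fun h => le_sup_of_le_left
        (le_iSup₂_of_le j (fun h' => h (congrArg Sum.inr h')) le_rfl)

section CasimirEigenspaces

variable (p m : ℕ) (lam : ℂ) (S : Type*) [AddCommGroup S] [Module ℂ S] [Module (Cl p m) S]
  [IsScalarTower ℂ (Cl p m) S]

/-- The eigenvalue of the Casimir operator on monogenic polynomials of degree `i` in `m` variables. -/
def monogenicCasimir (m i : ℕ) : ℂ := spinCasimir m - 2 * (i * (i + m - 1))

variable {p m S}

theorem mem_monogenic'_iff {i : ℕ} {W : Submodule ℂ S} {f : Poly m ⊗[ℂ] S} :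
    f ∈ monogenic' p m i W ↔ f ∈ polyVal m W ∧ dirac' p m S f = 0 ∧ euler f = (i : ℂ) • f ∧
      dX (Fin.last m) f = 0 := by
  simp only [monogenic', Submodule.mem_inf, LinearMap.mem_ker, LinearMap.sub_apply,
    LinearMap.smul_apply, Module.End.one_apply, sub_eq_zero, and_assoc]

theorem mem_monogenic_iff {j : ℕ} {W : Submodule ℂ S} {f : Poly m ⊗[ℂ] S} :
    f ∈ monogenic p m j W ↔ f ∈ polyVal m W ∧ dirac p m S f = 0 ∧ euler f = (j : ℂ) • f := by
  simp only [monogenic, Submodule.mem_inf, LinearMap.mem_ker, LinearMap.sub_apply,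
    LinearMap.smul_apply, Module.End.one_apply, sub_eq_zero, and_assoc]

theorem casimir_monogenic' {i : ℕ} {W : Submodule ℂ S} {f : Poly m ⊗[ℂ] S}
    (hf : f ∈ monogenic' p m i W) : casimir p m S f = monogenicCasimir m i • f := by
  obtain ⟨-, hD, hE, hlast⟩ := mem_monogenic'_iff.1 hf
  have hE' : eulerPrime m S f = (i : ℂ) • f := by rw [eulerPrime_of_dX_last hlast, hE]
  have hbox : boxPrime p m S f = 0 := by
    rw [← neg_neg (boxPrime p m S), ← diracPrime_sq p m S, LinearMap.neg_apply,
      Module.End.mul_apply, hD, map_zero, neg_zero]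
  rw [casimir_eq, LinearMap.add_apply, LinearMap.smul_apply, LinearMap.sub_apply,
    LinearMap.sub_apply, LinearMap.add_apply, Module.End.mul_apply, Module.End.mul_apply,
    Module.End.mul_apply, hbox, hD, LinearMap.smul_apply, hE', map_smul, hE', map_zero, map_zero,
    LinearMap.smul_apply, Module.End.one_apply, monogenicCasimir]
  module

/-- The Casimir operator acts in the same way on isomorphic `𝔪'`-modules. -/
theorem casimir_of_isCopy {M N : Submodule ℂ (Poly m ⊗[ℂ] S)} (h : IsCopy p m M N) {z : ℂ}
    (hM : ∀ f ∈ M, casimir p m S f = z • f) : ∀ f ∈ N, casimir p m S f = z • f := by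
  obtain ⟨T, -, rfl, hT⟩ := h
  rintro _ ⟨f, rfl⟩
  -- The intertwining property gives membership in `M` together with each equation, so it can be
  -- iterated to squares of generators.
  have h1 : ∀ a b : Fin m, ∃ g : M, (g : Poly m ⊗[ℂ] S)
      = (leviAct p m 0 S (rot p m a b) * leviAct p m 0 S (rot p m a b)) f ∧
        T g = (leviAct p m 0 S (rot p m a b) * leviAct p m 0 S (rot p m a b)) (T f) := by
    intro a b
    obtain ⟨g, hg, hg'⟩ := hT _ (rot_mem_mPrime p m a b) f
    obtain ⟨k, hk, hk'⟩ := hT _ (rot_mem_mPrime p m a b) g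
    exact ⟨k, by rw [hk, hg, Module.End.mul_apply], by rw [hk', hg', Module.End.mul_apply]⟩
  choose g hg hg' using h1
  have h2 : (∑ a, ∑ b, (eps p a.castSucc * eps p b.castSucc) • g a b : M) = z • f := by
    apply Subtype.ext
    rw [Submodule.coe_smul, ← hM f f.2, casimir]
    simp only [Submodule.coe_sum, Submodule.coe_smul, hg, LinearMap.sum_apply,
      LinearMap.smul_apply]
  rw [← map_smul, ← h2, map_sum, casimir]
  simp only [map_sum, map_smul, hg', LinearMap.sum_apply, LinearMap.smul_apply]

/-- `𝔪'` acts on `F̃_K s` through `s`, so its Casimir operator is the scalar known on spinors,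
whatever `K` is. -/
theorem casimir_spinorFMul (he : eps p (Fin.last m) = -1) (K : ℕ) (s : S) :
    casimir p m S (spinorFMul p m lam S K s) = spinCasimir m • spinorFMul p m lam S K s := by
  have h1 : ∀ (a b : Fin m) (t : S), leviAct p m 0 S (rot p m a b) (spinorFMul p m lam S K t)
      = spinorFMul p m lam S K ((spinEl p m (rot p m a b).1.toBlocks₁₁ : Cl p m) • t) := by
    intro a b t
    have h := rot_mem_mPrime p m a b
    rw [← leviAct_of_mem_mPrime p m lam S h, leviAct_spinorFMul p m lam S he h.1, h.2, mul_zero,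
      zero_smul, zero_add]
    rfl
  have h2 : spinCasimir m • s = ∑ a : Fin m, ∑ b : Fin m, (eps p a.castSucc * eps p b.castSucc) •
      ((spinEl p m (rot p m a b).1.toBlocks₁₁ : Cl p m) •
        (spinEl p m (rot p m a b).1.toBlocks₁₁ : Cl p m) • s) := by
    have h := congrArg (· • s) (sum_spinEl_rot p m)
    simp only [Finset.sum_smul, smul_assoc, one_smul, mul_smul] at h
    simp only [mul_smul]
    exact h.symm
  rw [← map_smul, h2, casimir]
  simp only [map_sum, LinearMap.sum_apply, LinearMap.smul_apply, Module.End.mul_apply, h1, map_smul]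

theorem iSup_spinorFSpace_le (he : eps p (Fin.last m) = -1) (W : ℕ → Submodule ℂ S) :
    ⨆ K : ℕ, spinorFSpace p m lam K (W K)
      ≤ Module.End.eigenspace (casimir p m S) (spinCasimir m) := by
  refine iSup_le fun K => ?_
  rintro _ ⟨s, -, rfl⟩
  exact Module.End.mem_eigenspace_iff.2 (casimir_spinorFMul lam he K s)

theorem monogenic'_eq_bot_of_eq_zero (hm : m = 0) {i : ℕ} (hi : i ≠ 0) (W : Submodule ℂ S) :
    monogenic' p m i W = ⊥ := by
  subst hm
  rw [eq_bot_iff]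
  intro f hf
  obtain ⟨-, -, hE, hlast⟩ := mem_monogenic'_iff.1 hf
  rw [← eulerPrime_of_dX_last hlast, eulerPrime, Finset.univ_eq_empty, Finset.sum_empty,
    LinearMap.zero_apply] at hE
  exact (smul_eq_zero.1 hE.symm).resolve_left (Nat.cast_ne_zero.2 hi)

/-- For `m ≥ 1` the eigenvalue differs from the spinor scalar by `2i(i + m - 1) ≠ 0`. For `m = 0`
this number vanishes at `i = 1`, but then there are no monogenics of positive degree. -/
theorem le_iSup_eigenspace_of_isCopy {i : ℕ} (hi : i ≠ 0) {W : Submodule ℂ S}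
    {N : Submodule ℂ (Poly m ⊗[ℂ] S)} (h : IsCopy p m (monogenic' p m i W) N) :
    N ≤ ⨆ (z : ℂ) (_ : z ≠ spinCasimir m), Module.End.eigenspace (casimir p m S) z := by
  rcases Nat.eq_zero_or_pos m with hm | hm
  · obtain ⟨T, -, rfl, -⟩ := h
    rintro _ ⟨⟨f, hf⟩, rfl⟩
    have h0 : f ∈ (⊥ : Submodule ℂ (Poly m ⊗[ℂ] S)) := by
      rwa [← monogenic'_eq_bot_of_eq_zero (p := p) hm hi W]
    have h1 : (⟨f, hf⟩ : monogenic' p m i W) = 0 := Subtype.ext h0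
    rw [h1, map_zero]
    exact Submodule.zero_mem _
  · refine le_iSup₂_of_le (monogenicCasimir m i) ?_ fun f hf => Module.End.mem_eigenspace_iff.2
      (casimir_of_isCopy h (fun f hf => casimir_monogenic' hf) f hf)
    rw [monogenicCasimir, ne_eq, sub_eq_self, mul_eq_zero, mul_eq_zero, not_or, not_or]
    refine ⟨two_ne_zero, Nat.cast_ne_zero.2 hi, ?_⟩
    obtain ⟨k, rfl⟩ : ∃ k, m = k + 1 := ⟨m - 1, by omega⟩
    rw [Nat.cast_succ, ← add_assoc, add_sub_cancel_right]
    exact_mod_cast (by omega : i + k ≠ 0)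

theorem disjoint_iSup_spinorFSpace (he : eps p (Fin.last m) = -1) (W : ℕ → Submodule ℂ S)
    {κ : Type*} {i : κ → ℕ} (hi : ∀ x, i x ≠ 0) {W' : κ → Submodule ℂ S}
    {N : κ → Submodule ℂ (Poly m ⊗[ℂ] S)}
    (h : ∀ x, IsCopy p m (monogenic' p m (i x) (W' x)) (N x)) :
    Disjoint (⨆ K : ℕ, spinorFSpace p m lam K (W K)) (⨆ x, N x) :=
  (Module.End.eigenspaces_iSupIndep (casimir p m S) (spinCasimir m)).mono
    (iSup_spinorFSpace_le lam he W) (iSup_le fun x => le_iSup_eigenspace_of_isCopy (hi x) (h x))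

theorem iSupIndep_sumElim_spinorFSpace (he : eps p (Fin.last m) = -1) (W : ℕ → Submodule ℂ S)
    {κ : Type*} {i : κ → ℕ} (hi : ∀ x, i x ≠ 0) {W' : κ → Submodule ℂ S}
    {N : κ → Submodule ℂ (Poly m ⊗[ℂ] S)}
    (h : ∀ x, IsCopy p m (monogenic' p m (i x) (W' x)) (N x)) (hN : iSupIndep N) :
    iSupIndep (Sum.elim (fun K : ℕ => spinorFSpace p m lam K (W K)) N) :=
  iSupIndep_sumElim (spinorFSpace_iSupIndep S he W) hN
    (disjoint_iSup_spinorFSpace lam he W hi h)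

end CasimirEigenspaces

end

end SpinorSingular

namespace SpinorSingular

noncomputable section

/-! ### Truncated exponentials of locally nilpotent operators -/

section TruncatedExponential

variable {V : Type*} [AddCommGroup V] [Module ℂ V]

/-- The truncated exponential series of an endomorphism. -/
def truncExp (Y : Module.End ℂ V) (N : ℕ) : Module.End ℂ V :=
  ∑ k ∈ Finset.range (N + 1), (k.factorial : ℂ)⁻¹ • Y ^ k

theorem truncExp_apply (Y : Module.End ℂ V) (N : ℕ) (f : V) :
    truncExp Y N f = ∑ k ∈ Finset.range (N + 1), (k.factorial : ℂ)⁻¹ • (Y ^ k) f := by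
  simp [truncExp, LinearMap.sum_apply]

theorem truncExp_truncExp_neg (Y : Module.End ℂ V) (N : ℕ) {f : V} (hf : (Y ^ (N + 1)) f = 0) :
    truncExp Y N (truncExp (-Y) N f) = f := by
  -- This kernel is stable under `Y`, and `Y` is nilpotent on it, so there the truncated series is a
  -- genuine exponential with the usual inverse.
  let E : Submodule ℂ V := LinearMap.ker (Y ^ (N + 1))
  have hE : ∀ v ∈ E, Y v ∈ E := fun v hv => by
    rw [LinearMap.mem_ker, ← Module.End.mul_apply, ← pow_succ, pow_succ', Module.End.mul_apply,
      LinearMap.mem_ker.1 hv, map_zero]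
  let y : Module.End ℂ E := Y.restrict hE
  -- `IsNilpotent.exp` has rational coefficients; the rational structure is the one restricted from
  -- `ℂ`.
  let _ : Module ℚ E := Module.compHom E (algebraMap ℚ ℂ)
  have _ : IsScalarTower ℚ ℂ E := ⟨fun a b c => by
    change (a • b) • c = algebraMap ℚ ℂ a • b • c
    rw [Algebra.smul_def, mul_smul]⟩
  have hpow : ∀ (z : Module.End ℂ E) (Z : Module.End ℂ V), (∀ v : E, ((z v : E) : V) = Z v) →
      ∀ k (v : E), (((z ^ k) v : E) : V) = (Z ^ k) v := fun z Z h k => by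
    induction k with
    | zero => intro v; rfl
    | succ k ih =>
      intro v
      rw [pow_succ', pow_succ', Module.End.mul_apply, Module.End.mul_apply, h, ih]
  have hy : y ^ (N + 1) = 0 :=
    LinearMap.ext fun v => Subtype.ext ((hpow y Y (fun _ => rfl) _ v).trans v.2)
  have hyY : ∀ v : E, (((-y) v : E) : V) = (-Y) v := fun _ => rfl
  have hy' : (-y) ^ (N + 1) = 0 := LinearMap.ext fun v => Subtype.ext <| by
    rw [hpow (-y) (-Y) hyY]
    rcases Nat.even_or_odd (N + 1) with h | h
    · rw [h.neg_pow]; exact v.2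
    · rw [h.neg_pow, LinearMap.neg_apply]; exact neg_eq_zero.2 v.2
  have hsmul : ∀ (k : ℕ) (v : E), ((((k.factorial : ℚ)⁻¹ • v : E)) : V)
      = (k.factorial : ℂ)⁻¹ • (v : V) := fun k v => by
    have h : ((k.factorial : ℚ)⁻¹ • v : E) = (algebraMap ℚ ℂ (k.factorial : ℚ)⁻¹) • v := rfl
    rw [h, map_inv₀, map_natCast, Submodule.coe_smul]
  have h1 : ∀ v : E, ((IsNilpotent.exp y v : E) : V) = truncExp Y N v := fun v => by
    rw [IsNilpotent.exp_eq_sum hy, truncExp_apply, LinearMap.sum_apply, Submodule.coe_sum]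
    exact Finset.sum_congr rfl fun k _ => by rw [LinearMap.smul_apply, hsmul, hpow y Y fun _ => rfl]
  have h2 : ∀ v : E, ((IsNilpotent.exp (-y) v : E) : V) = truncExp (-Y) N v := fun v => by
    rw [IsNilpotent.exp_eq_sum hy', truncExp_apply, LinearMap.sum_apply, Submodule.coe_sum]
    exact Finset.sum_congr rfl fun k _ => by rw [LinearMap.smul_apply, hsmul, hpow (-y) (-Y) hyY]
  have h3 := LinearMap.congr_fun (IsNilpotent.exp_mul_exp_neg_self (a := y) ⟨N + 1, hy⟩) ⟨f, hf⟩
  have h4 := congrArg (Subtype.val) h3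
  rw [Module.End.mul_apply, h1, h2] at h4
  exact h4

theorem truncExp_neg_truncExp (Y : Module.End ℂ V) (N : ℕ) {f : V} (hf : (Y ^ (N + 1)) f = 0) :
    truncExp (-Y) N (truncExp Y N f) = f := by
  have h := truncExp_truncExp_neg (-Y) N (f := f) (by
    rcases Nat.even_or_odd (N + 1) with h | h
    · rw [h.neg_pow, hf]
    · rw [h.neg_pow, LinearMap.neg_apply, hf, neg_zero])
  rwa [neg_neg] at h

end TruncatedExponential

/-- Only natural numbers occur as degrees. It is used to see that degree-lowering operators are
nilpotent on homogeneous polynomials. -/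
theorem eq_zero_of_euler_eq_smul {m : ℕ} {V : Type*} [AddCommGroup V] [Module ℂ V]
    {f : Poly m ⊗[ℂ] V} {z : ℂ} (hf : euler f = z • f) (hz : ∀ i : ℕ, (i : ℂ) ≠ z) : f = 0 := by
  obtain ⟨N, g, h1, h2, -⟩ := exists_sum_homogeneous f
  have h3 : ∑ i ∈ Finset.range N, ((i : ℂ) - z) • g i = 0 := by
    have h4 : euler f = ∑ i ∈ Finset.range N, (i : ℂ) • g i := by
      rw [h2, map_sum]
      exact Finset.sum_congr rfl fun i _ => h1 i
    have h5 : ∀ i : ℕ, ((i : ℂ) - z) • g i = (i : ℂ) • g i - z • g i := fun i => by module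
    rw [Finset.sum_congr rfl fun i _ => h5 i, Finset.sum_sub_distrib, ← h4, ← Finset.smul_sum,
      ← h2, hf, sub_self]
  have h6 := eq_zero_of_sum_homogeneous (d := 0) (g := fun i : ℕ => ((i : ℂ) - z) • g i)
    (fun i _ => by rw [map_smul, h1, add_zero, smul_comm]) h3
  rw [h2]
  exact Finset.sum_eq_zero fun i hi =>
    (smul_eq_zero.1 (h6 i hi)).resolve_left (sub_ne_zero.2 (hz i))

/-! ### The Cauchy-Kovalevskaya extension -/

section CauchyKovalevskaya

variable (p m : ℕ) (S : Type*) [AddCommGroup S] [Module ℂ S] [Module (Cl p m) S]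
  [IsScalarTower ℂ (Cl p m) S]

theorem truncExp_commute {Y B : Module.End ℂ (Poly m ⊗[ℂ] S)} (h : Commute B Y) (N : ℕ) :
    Commute B (truncExp Y N) := by
  refine Finset.sum_induction _ (fun T => Commute B T) (fun _ _ => Commute.add_right)
    (Commute.zero_right B) fun k _ => ?_
  have h1 : B * Y ^ k = Y ^ k * B := h.pow_right k
  change B * ((k.factorial : ℂ)⁻¹ • Y ^ k) = ((k.factorial : ℂ)⁻¹ • Y ^ k) * B
  rw [mul_smul_comm, h1, smul_mul_assoc]

/-- The operator `-e_n D'`; monogenic polynomials are those with `∂_n f = -e_n D' f`. -/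
def tangentialDirac : Module.End ℂ (Poly m ⊗[ℂ] S) := -(act (e p m (Fin.last m)) * dirac' p m S)

/-- The exponent `-ξ_n e_n D'` of the Cauchy-Kovalevskaya extension. -/
def extensionExponent : Module.End ℂ (Poly m ⊗[ℂ] S) :=
  mulX (Fin.last m) * tangentialDirac p m S

variable {p m S}

theorem act_last_sq (he : eps p (Fin.last m) = -1) :
    (act (e p m (Fin.last m)) * act (e p m (Fin.last m)) : Module.End ℂ (Poly m ⊗[ℂ] S)) = 1 := by
  rw [act_e_sq, he, neg_neg, one_smul]

theorem act_last_act_last (he : eps p (Fin.last m) = -1) (f : Poly m ⊗[ℂ] S) :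
    act (e p m (Fin.last m)) (act (e p m (Fin.last m)) f) = f :=
  LinearMap.congr_fun (act_last_sq he) f

/-- Multiplying `D f = 0` by `e_n` with `e_n² = 1` turns it into an evolution equation in `ξ_n`,
which the exponential of `-ξ_n e_n D'` solves. -/
theorem dirac_eq_zero_iff (he : eps p (Fin.last m) = -1) (f : Poly m ⊗[ℂ] S) :
    dirac p m S f = 0 ↔ dX (Fin.last m) f = tangentialDirac p m S f := by
  rw [dirac_eq, LinearMap.add_apply, Module.End.mul_apply, tangentialDirac, LinearMap.neg_apply,
    Module.End.mul_apply]
  constructor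
  · intro h
    rw [← act_last_act_last he (dX (Fin.last m) f), eq_neg_of_add_eq_zero_right h, map_neg]
  · intro h
    rw [h, map_neg, act_last_act_last he, add_neg_cancel]

theorem dX_last_mul_tangentialDirac :
    dX (Fin.last m) * tangentialDirac p m S = tangentialDirac p m S * dX (Fin.last m) := by
  rw [tangentialDirac, mul_neg, neg_mul, ← mul_assoc, ← act_mul_dX, mul_assoc, dX_mul_diracPrime,
    mul_assoc]

theorem mulX_last_mul_tangentialDirac :
    mulX (Fin.last m) * tangentialDirac p m S = tangentialDirac p m S * mulX (Fin.last m) := by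
  rw [tangentialDirac, mul_neg, neg_mul, ← mul_assoc, ← act_mul_mulX, mul_assoc,
    mulX_last_mul_diracPrime, mul_assoc]

theorem tangentialDirac_commute_extensionExponent :
    Commute (tangentialDirac p m S) (extensionExponent p m S) := by
  change _ * _ = _ * _
  rw [extensionExponent, ← mul_assoc, ← mulX_last_mul_tangentialDirac]

theorem dX_last_mul_extensionExponent_pow (k : ℕ) :
    dX (Fin.last m) * extensionExponent p m S ^ k
      = extensionExponent p m S ^ k * dX (Fin.last m)
        + (k : ℂ) • (extensionExponent p m S ^ (k - 1) * tangentialDirac p m S) := by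
  have h1 : dX (Fin.last m) * extensionExponent p m S
      = extensionExponent p m S * dX (Fin.last m) + tangentialDirac p m S := by
    rw [extensionExponent, ← mul_assoc, dX_mul_mulX, if_pos rfl, add_mul, one_mul, mul_assoc,
      dX_last_mul_tangentialDirac, mul_assoc]
  have hc : tangentialDirac p m S * extensionExponent p m S
      = extensionExponent p m S * tangentialDirac p m S := tangentialDirac_commute_extensionExponent
  induction k with
  | zero => rw [pow_zero, Nat.cast_zero, zero_smul, mul_one, one_mul, add_zero]
  | succ k ih =>
    have h3 : (k : ℂ) • (extensionExponent p m S ^ (k - 1) * tangentialDirac p m S *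
        extensionExponent p m S) = (k : ℂ) • (extensionExponent p m S ^ k *
          tangentialDirac p m S) := by
      rcases Nat.eq_zero_or_pos k with rfl | hk
      · rw [Nat.cast_zero, zero_smul, zero_smul]
      · rw [mul_assoc, hc, ← mul_assoc, ← pow_succ, Nat.sub_add_cancel hk]
    rw [Nat.add_sub_cancel, pow_succ, ← mul_assoc, ih, add_mul, mul_assoc, h1, mul_add,
      smul_mul_assoc, h3, ← mul_assoc]
    push_cast
    module

theorem tangentialDirac_pow_eq_zero {N : ℕ} {f : Poly m ⊗[ℂ] S} (hf : euler f = (N : ℂ) • f) :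
    (tangentialDirac p m S ^ (N + 1)) f = 0 := by
  have h1 : ∀ k : ℕ, euler ((tangentialDirac p m S ^ k) f)
      = ((N : ℂ) - k) • (tangentialDirac p m S ^ k) f := fun k => by
    induction k with
    | zero => rw [pow_zero, Nat.cast_zero, sub_zero]; exact hf
    | succ k ih =>
      rw [pow_succ', Module.End.mul_apply, tangentialDirac, LinearMap.neg_apply, map_neg,
        Module.End.mul_apply, ← tangentialDirac, euler_act (euler_diracPrime ih)]
      push_cast
      module
  refine eq_zero_of_euler_eq_smul (h1 (N + 1)) fun i hi => ?_
  have h2 : ((i + 1 : ℕ) : ℂ) = 0 := by push_cast at hi ⊢; linear_combination hi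
  exact Nat.cast_ne_zero.2 (Nat.succ_ne_zero i) h2

theorem extensionExponent_pow (k : ℕ) : extensionExponent p m S ^ k
    = mulX (Fin.last m) ^ k * tangentialDirac p m S ^ k := by
  have h : Commute (mulX (Fin.last m)) (tangentialDirac p m S) := mulX_last_mul_tangentialDirac
  exact h.mul_pow k

theorem extensionExponent_pow_eq_zero {N : ℕ} {f : Poly m ⊗[ℂ] S} (hf : euler f = (N : ℂ) • f) :
    (extensionExponent p m S ^ (N + 1)) f = 0 := by
  rw [extensionExponent_pow, Module.End.mul_apply, tangentialDirac_pow_eq_zero hf, map_zero]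

/-- The truncation loses nothing, because the next term vanishes for reasons of degree. With `c = 1`
it shows that extensions are monogenic, with `c = -1` that undoing the extension of a monogenic
polynomial removes `ξ_n`. -/
theorem dX_last_truncExp {N : ℕ} {f : Poly m ⊗[ℂ] S} (hf : euler f = (N : ℂ) • f) (c : ℂ) :
    dX (Fin.last m) (truncExp (c • extensionExponent p m S) N f)
      = truncExp (c • extensionExponent p m S) N
        (dX (Fin.last m) f + c • tangentialDirac p m S f) := by
  have h0 : (extensionExponent p m S ^ N) (tangentialDirac p m S f) = 0 := by
    rw [extensionExponent_pow, Module.End.mul_apply, ← Module.End.mul_apply _ (tangentialDirac _ _ _),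
      ← pow_succ, tangentialDirac_pow_eq_zero hf, map_zero]
  have h1 : ∀ k : ℕ, dX (Fin.last m) (((c • extensionExponent p m S) ^ k) f)
      = ((c • extensionExponent p m S) ^ k) (dX (Fin.last m) f)
        + (k * c ^ k : ℂ) • (extensionExponent p m S ^ (k - 1)) (tangentialDirac p m S f) := by
    intro k
    have h2 := LinearMap.congr_fun (dX_last_mul_extensionExponent_pow (p := p) (S := S) k) f
    rw [Module.End.mul_apply, LinearMap.add_apply, Module.End.mul_apply, LinearMap.smul_apply,
      Module.End.mul_apply] at h2
    rw [smul_pow, LinearMap.smul_apply, map_smul, h2, LinearMap.smul_apply, smul_add, smul_smul,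
      mul_comm (c ^ k)]
  simp only [truncExp_apply, map_sum, map_smul, h1, map_add, smul_add, Finset.sum_add_distrib]
  congr 1
  rw [Finset.sum_range_succ', Finset.sum_range_succ (fun k => (k.factorial : ℂ)⁻¹ •
    ((c • extensionExponent p m S) ^ k) (tangentialDirac p m S f))]
  have h3 : ((c • extensionExponent p m S) ^ N) (tangentialDirac p m S f) = 0 := by
    rw [smul_pow, LinearMap.smul_apply, h0, smul_zero]
  rw [h3, smul_zero, add_zero, Nat.cast_zero, zero_mul, zero_smul, smul_zero, add_zero,
    Finset.smul_sum]
  refine Finset.sum_congr rfl fun k _ => ?_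
  rw [Nat.add_sub_cancel, smul_pow, LinearMap.smul_apply, smul_smul, smul_smul, smul_smul]
  congr 1
  have h4 : (k.factorial : ℂ) ≠ 0 := Nat.cast_ne_zero.2 k.factorial_ne_zero
  have h5 : ((k : ℂ) + 1) ≠ 0 := Nat.cast_add_one_ne_zero k
  rw [Nat.factorial_succ]
  push_cast
  field_simp
  ring

end CauchyKovalevskaya

end

end SpinorSingular

namespace SpinorSingular

noncomputable section

/-! ### Operators commuting with `𝔪'` and with the volume elements -/

section LeviCommute

variable {p m : ℕ} {S : Type*} [AddCommGroup S] [Module ℂ S] [Module (Cl p m) S]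
  [IsScalarTower ℂ (Cl p m) S]

theorem leviVF_of_mem_mPrime {A : so p m} (hA : A ∈ mPrime p m) (j k : Fin (m + 1)) :
    leviVF A j k = A.1 (Sum.inl j) (Sum.inl k) := by
  rw [leviVF, hA.2, ite_self, sub_zero]

theorem leviAct_commute_mulX_last {A : so p m} (hA : A ∈ mPrime p m) :
    Commute (leviAct p m 0 S A) (mulX (Fin.last m)) := by
  refine (leviAct_mul_mulX p m 0 S A (Fin.last m)).trans ?_
  simp_rw [leviVF_of_mem_mPrime hA, leviPrime_block_last hA.1]
  exact (congrArg _ (Finset.sum_eq_zero fun _ _ => zero_smul _ _)).trans (add_zero _)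

theorem leviAct_commute_dX_last {A : so p m} (hA : A ∈ mPrime p m) :
    Commute (leviAct p m 0 S A) (dX (Fin.last m)) := by
  refine ((dX_mul_leviAct p m 0 S A (Fin.last m)).trans ?_).symm
  simp_rw [leviVF_of_mem_mPrime hA, leviPrime_last_block hA.1]
  exact (congrArg _ (Finset.sum_eq_zero fun _ _ => zero_smul _ _)).trans (add_zero _)

theorem leviAct_commute_xiOp {A : so p m} (hA : A ∈ mPrime p m) :
    Commute (leviAct p m 0 S A) (xiOp p m S) := by
  refine (leviAct_mul_xiOp p m 0 S hA.1).trans ?_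
  rw [hA.2, zero_smul, sub_zero]

theorem leviAct_commute_act {A : so p m} {c : Cl p m}
    (h : Commute (spinEl p m A.1.toBlocks₁₁ : Cl p m) c) :
    Commute (leviAct p m 0 S A) (act c) := by
  rw [leviAct_eq]
  refine Commute.add_left (Commute.add_left (Commute.sum_left _ _ _ fun j _ =>
    Commute.sum_left _ _ _ fun k _ => Commute.smul_left ?_ _) (Commute.smul_left (Commute.one_left _) _)) ?_
  · exact Commute.mul_left (act_mul_mulX c j).symm (act_mul_dX c k).symm
  · rw [act_spinEl]
    change _ * _ = _ * _
    rw [← act_mul, ← act_mul, h.eq]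

theorem leviAct_commute_act_last {A : so p m} (hA : A ∈ mPrime p m) :
    Commute (leviAct p m 0 S A) (act (e p m (Fin.last m))) :=
  leviAct_commute_act (spinEl_commute_e_last p m hA.1)

theorem leviAct_commute_euler (A : so p m) :
    Commute (leviAct p m 0 S A) euler := by
  rw [leviAct_eq]
  refine Commute.add_left (Commute.add_left (Commute.sum_left _ _ _ fun j _ =>
    Commute.sum_left _ _ _ fun k _ => Commute.smul_left ?_ _) (Commute.smul_left (Commute.one_left _) _)) ?_
  · change _ * _ = _ * _
    rw [mul_assoc, dX_mul_euler, mul_add, ← mul_assoc, ← mul_assoc, euler_mul_mulX, add_mul]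
  · rw [act_spinEl]
    exact act_mul_euler p m S _

/-- Rotating `e_k` and rotating `∂_k` produce the same double sum with the indices exchanged and
with opposite signs. -/
theorem leviAct_commute_diracPrime {A : so p m} (hA : A ∈ mPrime p m) :
    Commute (leviAct p m 0 S A) (dirac' p m S) := by
  have h1 : ∀ k : Fin m, leviAct p m 0 S A * (act (e p m k.castSucc) * dX k.castSucc)
      = act (e p m k.castSucc) * dX k.castSucc * leviAct p m 0 S A
        - ∑ j : Fin m, A.1 (Sum.inl k.castSucc) (Sum.inl j.castSucc) •
          (act (e p m k.castSucc) * dX j.castSucc)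
        + ∑ j : Fin m, A.1 (Sum.inl j.castSucc) (Sum.inl k.castSucc) •
          (act (e p m j.castSucc) * dX k.castSucc) := by
    intro k
    have h2 := dX_mul_leviAct p m 0 S A k.castSucc
    simp_rw [leviVF_of_mem_mPrime hA] at h2
    rw [Fin.sum_univ_castSucc, leviPrime_block_last hA.1, zero_smul, add_zero] at h2
    have h3 := leviAct_mul_act_e p m 0 S A k.castSucc
    rw [Fin.sum_univ_castSucc, leviPrime_last_block hA.1, zero_smul, add_zero] at h3
    rw [← mul_assoc, h3, mul_assoc (act _) (dX _), h2, add_mul, mul_add, Finset.sum_mul,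
      Finset.mul_sum, mul_assoc]
    simp_rw [smul_mul_assoc, mul_smul_comm]
    abel
  change _ * _ = _ * _
  rw [dirac', Finset.mul_sum, Finset.sum_congr rfl fun k _ => h1 k, Finset.sum_add_distrib,
    Finset.sum_sub_distrib, ← Finset.sum_mul, Finset.sum_comm (f := fun k j : Fin m =>
      A.1 (Sum.inl j.castSucc) (Sum.inl k.castSucc) • (act (e p m j.castSucc) * dX k.castSucc)),
    sub_add_cancel]

theorem leviAct_commute_act_volume (A : so p m) :
    Commute (leviAct p m 0 S A) (act (volume p m)) :=
  leviAct_commute_act (even_commute_volume p m _)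

theorem leviAct_commute_act_volume' {A : so p m} (hA : A ∈ mPrime p m) (hm : Even m) :
    Commute (leviAct p m 0 S A) (act (volume' p m)) := by
  refine leviAct_commute_act ?_
  rw [coe_spinEl]
  refine Commute.smul_left (Commute.sum_left _ _ _ fun j _ => Commute.sum_left _ _ _ fun k _ => ?_) _
  refine Fin.lastCases ?_ (fun j => ?_) j
  · have h : A.1.toBlocks₁₁ (Fin.last m) k = 0 := leviPrime_last_block hA.1 k
    rw [h, mul_zero, zero_smul]
    exact Commute.zero_left _
  refine Fin.lastCases ?_ (fun k => ?_) k
  · have h : A.1.toBlocks₁₁ j.castSucc (Fin.last m) = 0 := leviPrime_block_last hA.1 _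
    rw [h, mul_zero, zero_smul]
    exact Commute.zero_left _
  refine Commute.smul_left ?_ _
  change _ * _ = _ * _
  rw [mul_assoc, e_castSucc_mul_volume' p m hm, mul_neg, ← mul_assoc, e_castSucc_mul_volume' p m hm,
    neg_mul, neg_neg, mul_assoc]

theorem leviAct_commute_tangentialDirac {A : so p m} (hA : A ∈ mPrime p m) :
    Commute (leviAct p m 0 S A) (tangentialDirac p m S) :=
  ((leviAct_commute_act_last hA).mul_right (leviAct_commute_diracPrime hA)).neg_right

theorem leviAct_commute_extensionExponent {A : so p m} (hA : A ∈ mPrime p m) :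
    Commute (leviAct p m 0 S A) (extensionExponent p m S) :=
  (leviAct_commute_mulX_last hA).mul_right (leviAct_commute_tangentialDirac hA)

theorem euler_commute_extensionExponent :
    Commute euler (extensionExponent p m S) := by
  change _ * _ = _ * _
  have h1 : tangentialDirac p m S * euler = euler * tangentialDirac p m S + tangentialDirac p m S := by
    rw [tangentialDirac, neg_mul, mul_assoc, diracPrime_mul_euler, mul_add, ← mul_assoc,
      act_mul_euler, mul_neg, neg_add, mul_assoc]
  rw [extensionExponent, mul_assoc, h1, ← mul_assoc, euler_mul_mulX, add_mul, mul_add, mul_assoc]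

/-- The operator `e_n ξ'`. -/
def tangentialXi (p m : ℕ) (S : Type*) [AddCommGroup S] [Module ℂ S] [Module (Cl p m) S]
    [IsScalarTower ℂ (Cl p m) S] : Module.End ℂ (Poly m ⊗[ℂ] S) :=
  act (e p m (Fin.last m)) * xiOp p m S

theorem leviAct_commute_tangentialXi {A : so p m} (hA : A ∈ mPrime p m) :
    Commute (leviAct p m 0 S A) (tangentialXi p m S) :=
  (leviAct_commute_act_last hA).mul_right (leviAct_commute_xiOp hA)

theorem act_volume_commute_tangentialXi (hm : Even (m + 1)) :
    Commute (act (volume p m)) (tangentialXi p m S) := by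
  change _ * _ = _ * _
  rw [tangentialXi, ← mul_assoc, ← act_mul, ← neg_eq_iff_eq_neg.2 (e_mul_volume p m hm _), ← neg_one_smul ℂ,
    act_smul, act_mul, neg_one_smul, neg_mul, mul_assoc, act_volume_mul_xiOp p m S hm, mul_neg,
    neg_neg, mul_assoc]

theorem act_volume_commute_tangentialDirac (hm : Even (m + 1)) :
    Commute (act (volume p m)) (tangentialDirac p m S) := by
  refine Commute.neg_right ?_
  rw [dirac', Finset.mul_sum]
  refine Commute.sum_right _ _ _ fun k _ => ?_
  rw [← mul_assoc, ← act_mul]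
  refine Commute.mul_right ?_ (act_mul_dX _ _)
  change _ * _ = _ * _
  rw [← act_mul, ← act_mul, mul_assoc (e p m _) _ (volume p m), e_mul_volume p m hm, mul_neg,
    ← mul_assoc (e p m _), e_mul_volume p m hm, neg_mul, neg_neg, mul_assoc]

end LeviCommute

end

end SpinorSingular

/-! ### The Fischer decomposition on the hyperplane `ξ_n = 0` -/

namespace SpinorSingular

noncomputable section

/-- The coefficients in `-e_n D' (e_n ξ')^k g = c_{i,k} (e_n ξ')^{k-1} g` for monogenic polynomials
`g` of degree `i`. -/
def fischerCoeff (m i k : ℕ) : ℂ := if Even k then -(k : ℂ) else -(2 * i + m + k - 1)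

theorem fischerCoeff_succ (m i k : ℕ) :
    fischerCoeff m i (k + 1) = -fischerCoeff m i k - (2 * ((i : ℂ) + k) + m) := by
  unfold fischerCoeff
  by_cases h : Even k
  · rw [if_pos h, if_neg (by simpa using h.add_one)]
    push_cast
    ring
  · rw [if_neg h, if_pos (Nat.not_even_iff_odd.1 h).add_one]
    push_cast
    ring

/-- The odd coefficient is `-(2i + m + k)`; for `i = k = 0` it is nonzero only because `m ≥ 1`. -/
theorem fischerCoeff_ne_zero {m : ℕ} (hm : 1 ≤ m) (i k : ℕ) : fischerCoeff m i (k + 1) ≠ 0 := by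
  unfold fischerCoeff
  split_ifs
  · exact neg_ne_zero.2 (Nat.cast_ne_zero.2 k.succ_ne_zero)
  · have h : (2 * (i : ℂ) + m + (k + 1 : ℕ) - 1) = ((2 * i + m + k : ℕ) : ℂ) := by push_cast; ring
    rw [h]
    exact neg_ne_zero.2 (Nat.cast_ne_zero.2 (by omega))

section Fischer

variable {p m : ℕ} {S : Type*} [AddCommGroup S] [Module ℂ S] [Module (Cl p m) S]
  [IsScalarTower ℂ (Cl p m) S]

theorem euler_tangentialXi {f : Poly m ⊗[ℂ] S} {d : ℂ} (hf : euler f = d • f) :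
    euler (tangentialXi p m S f) = (d + 1) • tangentialXi p m S f := by
  rw [tangentialXi, Module.End.mul_apply]
  exact euler_act (euler_xiOp hf) _

theorem euler_tangentialDirac {f : Poly m ⊗[ℂ] S} {d : ℂ} (hf : euler f = d • f) :
    euler (tangentialDirac p m S f) = (d - 1) • tangentialDirac p m S f := by
  rw [tangentialDirac, LinearMap.neg_apply, Module.End.mul_apply, map_neg,
    euler_act (euler_diracPrime hf), smul_neg]

theorem dX_last_tangentialXi {f : Poly m ⊗[ℂ] S} (hf : dX (Fin.last m) f = 0) :
    dX (Fin.last m) (tangentialXi p m S f) = 0 := by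
  rw [tangentialXi, Module.End.mul_apply]
  exact dX_act (dX_last_xiOp hf) _

theorem dX_last_tangentialDirac {f : Poly m ⊗[ℂ] S} (hf : dX (Fin.last m) f = 0) :
    dX (Fin.last m) (tangentialDirac p m S f) = 0 := by
  rw [tangentialDirac, LinearMap.neg_apply, Module.End.mul_apply, map_neg,
    dX_act (dX_last_diracPrime hf), neg_zero]

theorem tangentialDirac_eq_zero_iff (he : eps p (Fin.last m) = -1) {f : Poly m ⊗[ℂ] S} :
    tangentialDirac p m S f = 0 ↔ dirac' p m S f = 0 := by
  rw [tangentialDirac, LinearMap.neg_apply, neg_eq_zero, Module.End.mul_apply]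
  refine ⟨fun h => ?_, fun h => by rw [h, map_zero]⟩
  rw [← act_last_act_last he (dirac' p m S f), h, map_zero]

/-- The two factors `e_n` cancel, so `-e_n D'` and `e_n ξ'` satisfy the same relation as `D'` and
`ξ'`. Unlike the latter they are even and preserve the half-spin spaces. -/
theorem tangentialDirac_tangentialXi (he : eps p (Fin.last m) = -1) {f : Poly m ⊗[ℂ] S} {d : ℂ}
    (hf : euler f = d • f) (hf' : dX (Fin.last m) f = 0) :
    tangentialDirac p m S (tangentialXi p m S f)
      = -tangentialXi p m S (tangentialDirac p m S f) - (2 * d + m) • f := by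
  have h1 : ∀ g : Poly m ⊗[ℂ] S, dirac' p m S (act (e p m (Fin.last m)) g)
      = -act (e p m (Fin.last m)) (dirac' p m S g) := fun g =>
    neg_eq_iff_eq_neg.1 (LinearMap.congr_fun (act_last_mul_diracPrime p m S) g).symm
  have h2 : ∀ g : Poly m ⊗[ℂ] S, xiOp p m S (act (e p m (Fin.last m)) g)
      = -act (e p m (Fin.last m)) (xiOp p m S g) := fun g =>
    neg_eq_iff_eq_neg.1 (LinearMap.congr_fun (act_last_mul_xiOp p m S) g).symm
  simp only [tangentialDirac, tangentialXi, LinearMap.neg_apply, Module.End.mul_apply, h1, h2,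
    map_neg, neg_neg, act_last_act_last he]
  exact diracPrime_xiOp hf hf'

theorem euler_tangentialXi_pow {f : Poly m ⊗[ℂ] S} {d : ℂ} (hf : euler f = d • f) (k : ℕ) :
    euler ((tangentialXi p m S ^ k) f) = (d + k) • (tangentialXi p m S ^ k) f := by
  induction k with
  | zero => rw [pow_zero, Nat.cast_zero, add_zero]; exact hf
  | succ k ih =>
    rw [pow_succ', Module.End.mul_apply, euler_tangentialXi ih]
    push_cast
    module

theorem dX_last_tangentialXi_pow {f : Poly m ⊗[ℂ] S} (hf : dX (Fin.last m) f = 0) (k : ℕ) :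
    dX (Fin.last m) ((tangentialXi p m S ^ k) f) = 0 := by
  induction k with
  | zero => exact hf
  | succ k ih =>
    rw [pow_succ', Module.End.mul_apply]
    exact dX_last_tangentialXi ih

theorem tangentialDirac_tangentialXi_pow (he : eps p (Fin.last m) = -1) {f : Poly m ⊗[ℂ] S} {i : ℕ}
    (h0 : tangentialDirac p m S f = 0) (hf : euler f = (i : ℂ) • f) (hf' : dX (Fin.last m) f = 0)
    (k : ℕ) : tangentialDirac p m S ((tangentialXi p m S ^ (k + 1)) f)
      = fischerCoeff m i (k + 1) • (tangentialXi p m S ^ k) f := by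
  induction k with
  | zero =>
    rw [zero_add, pow_one, tangentialDirac_tangentialXi he hf hf', h0, map_zero, neg_zero, zero_sub,
      pow_zero, Module.End.one_apply, fischerCoeff, if_neg (by decide)]
    push_cast
    module
  | succ k ih =>
    rw [pow_succ', Module.End.mul_apply, tangentialDirac_tangentialXi he
      (euler_tangentialXi_pow hf _) (dX_last_tangentialXi_pow hf' _), ih, fischerCoeff_succ m i (k + 1),
      map_smul, ← Module.End.mul_apply (tangentialXi p m S), ← pow_succ']
    module

/-- Each application of `-e_n D'` strips one factor `e_n ξ'` at the cost of a nonzero scalar. -/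
theorem tangentialXi_pow_injective (he : eps p (Fin.last m) = -1) (hm : 1 ≤ m)
    {f : Poly m ⊗[ℂ] S} {i : ℕ}
    (h0 : tangentialDirac p m S f = 0) (hf : euler f = (i : ℂ) • f) (hf' : dX (Fin.last m) f = 0)
    (k : ℕ) (h : (tangentialXi p m S ^ k) f = 0) : f = 0 := by
  induction k with
  | zero => exact h
  | succ k ih =>
    have h1 := tangentialDirac_tangentialXi_pow he h0 hf hf' k
    rw [h, map_zero] at h1
    exact ih ((smul_eq_zero.1 h1.symm).resolve_left (fischerCoeff_ne_zero hm i k))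

/-- The Fischer decomposition of the homogeneous polynomials on the hyperplane `ξ_n = 0`. -/
theorem exists_fischer_decomposition (he : eps p (Fin.last m) = -1) (hm : 1 ≤ m)
    {U : Submodule ℂ (Poly m ⊗[ℂ] S)} (hU : ∀ f ∈ U, tangentialDirac p m S f ∈ U)
    (hU' : ∀ f ∈ U, tangentialXi p m S f ∈ U) (d : ℕ) :
    ∀ f ∈ U, euler f = (d : ℂ) • f → dX (Fin.last m) f = 0 → ∃ g : ℕ → Poly m ⊗[ℂ] S,
      (∀ k, k ≤ d → g k ∈ U ∧ tangentialDirac p m S (g k) = 0 ∧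
        euler (g k) = ((d - k : ℕ) : ℂ) • g k ∧ dX (Fin.last m) (g k) = 0) ∧
      f = ∑ k ∈ Finset.range (d + 1), (tangentialXi p m S ^ k) (g k) := by
  have hU'' : ∀ (k : ℕ), ∀ f ∈ U, (tangentialXi p m S ^ k) f ∈ U := fun k => by
    induction k with
    | zero => exact fun f hf => hf
    | succ k ih =>
      intro f hf
      rw [pow_succ', Module.End.mul_apply]
      exact hU' _ (ih f hf)
  induction d with
  | zero =>
    intro f hfU hf hf'
    refine ⟨fun _ => f, fun k hk => ⟨hfU, ?_, ?_, hf'⟩, by simp⟩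
    · refine eq_zero_of_euler_eq_smul (euler_tangentialDirac hf) fun i hi => ?_
      have h : ((i + 1 : ℕ) : ℂ) = 0 := by push_cast at hi ⊢; linear_combination hi
      exact Nat.cast_ne_zero.2 i.succ_ne_zero h
    · rw [Nat.le_zero.1 hk]
      exact hf
  | succ d ih =>
    intro f hfU hf hf'
    obtain ⟨g, hg, hsum⟩ := ih _ (hU f hfU)
      ((euler_tangentialDirac hf).trans (by push_cast; rw [add_sub_cancel_right]))
      (dX_last_tangentialDirac hf')
    -- The rescaling makes `h` have the same image as `f` under `-e_n D'`, so that `f - h` is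
    -- monogenic.
    let g' : ℕ → Poly m ⊗[ℂ] S := fun k => (fischerCoeff m (d - k) (k + 1))⁻¹ • g k
    let h := ∑ k ∈ Finset.range (d + 1), (tangentialXi p m S ^ (k + 1)) (g' k)
    have hg' : ∀ k, k ≤ d → g' k ∈ U ∧ tangentialDirac p m S (g' k) = 0 ∧
        euler (g' k) = ((d - k : ℕ) : ℂ) • g' k ∧ dX (Fin.last m) (g' k) = 0 := fun k hk => by
      obtain ⟨h1, h2, h3, h4⟩ := hg k hk
      exact ⟨U.smul_mem _ h1, by rw [map_smul, h2, smul_zero], by rw [map_smul, h3, smul_comm],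
        by rw [map_smul, h4, smul_zero]⟩
    have hle : ∀ k ∈ Finset.range (d + 1), k ≤ d := fun k hk =>
      Nat.lt_succ_iff.1 (Finset.mem_range.1 hk)
    have hZ : tangentialDirac p m S h = tangentialDirac p m S f := by
      rw [hsum, map_sum]
      refine Finset.sum_congr rfl fun k hk => ?_
      obtain ⟨h1, h2, h3, h4⟩ := hg' k (hle k hk)
      rw [tangentialDirac_tangentialXi_pow he h2 h3 h4, ← map_smul,
        smul_inv_smul₀ (fischerCoeff_ne_zero hm _ _)]
    have hE : euler h = ((d + 1 : ℕ) : ℂ) • h := by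
      rw [map_sum, Finset.smul_sum]
      refine Finset.sum_congr rfl fun k hk => ?_
      rw [euler_tangentialXi_pow (hg' k (hle k hk)).2.2.1, ← Nat.cast_add]
      congr 2
      have := hle k hk
      omega
    have hX : dX (Fin.last m) h = 0 := by
      rw [map_sum]
      exact Finset.sum_eq_zero fun k hk => dX_last_tangentialXi_pow (hg' k (hle k hk)).2.2.2 _
    have hhU : h ∈ U := Submodule.sum_mem _ fun k hk => hU'' _ _ (hg' k (hle k hk)).1
    -- The new component at `k = 0` is the monogenic remainder; the others move up by one power of
    -- `e_n ξ'`.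
    refine ⟨fun k => Nat.casesOn k (f - h) g', fun k hk => ?_, ?_⟩
    · rcases k with _ | k
      · change f - h ∈ U ∧ tangentialDirac p m S (f - h) = 0 ∧
          euler (f - h) = ((d + 1 : ℕ) : ℂ) • (f - h) ∧ dX (Fin.last m) (f - h) = 0
        exact ⟨U.sub_mem hfU hhU, by rw [map_sub, hZ, sub_self],
          by rw [map_sub, hE, hf]; module, by rw [map_sub, hf', hX, sub_self]⟩
      · have := hg' k (Nat.le_of_succ_le_succ hk)
        rw [Nat.add_sub_add_right]
        exact this
    · rw [Finset.sum_range_succ']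
      exact (add_sub_cancel h f).symm

end Fischer

end

end SpinorSingular

/-! ### The branching law for monogenic polynomials -/

namespace SpinorSingular

noncomputable section

theorem monogenicCasimir_injective {m : ℕ} (hm : 1 ≤ m) :
    Function.Injective (monogenicCasimir m) := by
  intro i k h
  -- The difference of the eigenvalues factors; since `m ≥ 1`, the second factor is zero only if `i
  -- = k = 0`.
  have h1 : ((i : ℂ) - k) * ((i + k + m - 1 : ℕ) : ℂ) = 0 := by
    rw [Nat.cast_sub (by omega)]
    unfold monogenicCasimir at h
    push_cast
    linear_combination -(1 / 2 : ℂ) * h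
  rcases mul_eq_zero.1 h1 with h2 | h2
  · exact_mod_cast sub_eq_zero.1 h2
  · have := Nat.cast_eq_zero.1 h2
    omega

section Branching

variable {p m : ℕ} {S : Type*} [AddCommGroup S] [Module ℂ S] [Module (Cl p m) S]
  [IsScalarTower ℂ (Cl p m) S]

theorem isCopy_map {M : Submodule ℂ (Poly m ⊗[ℂ] S)} {B : Module.End ℂ (Poly m ⊗[ℂ] S)}
    (hB : ∀ f ∈ M, B f = 0 → f = 0)
    (hM : ∀ A ∈ mPrime p m, ∀ f ∈ M, leviAct p m 0 S A f ∈ M)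
    (hcomm : ∀ A ∈ mPrime p m, Commute (leviAct p m 0 S A) B) : IsCopy p m M (M.map B) := by
  refine ⟨B.domRestrict M, ?_, LinearMap.range_domRestrict _ _, fun A hA f =>
    ⟨⟨_, hM A hA f f.2⟩, rfl, (LinearMap.congr_fun (hcomm A hA).eq (f : Poly m ⊗[ℂ] S)).symm⟩⟩
  exact (injective_iff_map_eq_zero _).2 fun f hf => Subtype.ext (hB f f.2 hf)

theorem mulX_mem_polyVal {W : Submodule ℂ S} (k : Fin (m + 1)) {f : Poly m ⊗[ℂ] S}
    (hf : f ∈ polyVal m W) : mulX k f ∈ polyVal m W := by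
  obtain ⟨g, rfl⟩ := hf
  exact ⟨mulX k g, LinearMap.congr_fun (TensorProduct.ext'
    (g := (W.subtype.lTensor (Poly m)).comp (mulX k))
    (h := (mulX k).comp (W.subtype.lTensor (Poly m))) fun _ _ => rfl) g⟩

/-- The subspace `W` is stable under the products of two of the generators `e_i`, in the form
needed for `W`-valued polynomials. -/
structure IsEvenStable (p m : ℕ) {S : Type*} [AddCommGroup S] [Module ℂ S] [Module (Cl p m) S]
    [IsScalarTower ℂ (Cl p m) S] (W : Submodule ℂ S) : Prop where
  tangentialDirac_mem : ∀ f ∈ polyVal m W, tangentialDirac p m S f ∈ polyVal m W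
  tangentialXi_mem : ∀ f ∈ polyVal m W, tangentialXi p m S f ∈ polyVal m W

theorem isEvenStable_top : IsEvenStable p m (⊤ : Submodule ℂ S) := by
  constructor <;> exact fun f _ => by rw [polyVal_top]; trivial

theorem isEvenStable_halfSpinC (hm : Even (m + 1)) (ε : ℤˣ) :
    IsEvenStable p m (halfSpinC p m S ε) := by
  have h : ∀ B : Module.End ℂ (Poly m ⊗[ℂ] S), Commute (act (volume p m)) B →
      ∀ f ∈ polyVal m (halfSpinC p m S ε), B f ∈ polyVal m (halfSpinC p m S ε) := by
    intro B hB f hf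
    rw [mem_polyVal_halfSpinC_iff p m] at hf ⊢
    rw [← Module.End.mul_apply, hB.eq, Module.End.mul_apply, hf, map_smul]
  exact ⟨h _ (act_volume_commute_tangentialDirac hm), h _ (act_volume_commute_tangentialXi hm)⟩

theorem leviAct_mem_monogenic' {A : so p m} (hA : A ∈ mPrime p m) {i : ℕ} {W : Submodule ℂ S}
    (hW : ∀ f ∈ polyVal m W, leviAct p m 0 S A f ∈ polyVal m W) {f : Poly m ⊗[ℂ] S}
    (hf : f ∈ monogenic' p m i W) : leviAct p m 0 S A f ∈ monogenic' p m i W := by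
  obtain ⟨h1, h2, h3, h4⟩ := mem_monogenic'_iff.1 hf
  have hc : ∀ {B : Module.End ℂ (Poly m ⊗[ℂ] S)}, Commute (leviAct p m 0 S A) B →
      B (leviAct p m 0 S A f) = leviAct p m 0 S A (B f) := fun h =>
    (LinearMap.congr_fun h.eq f).symm
  refine mem_monogenic'_iff.2 ⟨hW f h1, ?_, ?_, ?_⟩
  · rw [hc (leviAct_commute_diracPrime hA), h2, map_zero]
  · rw [hc (leviAct_commute_euler A), h3, map_smul]
  · rw [hc (leviAct_commute_dX_last hA), h4, map_zero]

/-- The operator which maps a monogenic polynomial `g` of degree `i` on the hyperplane `ξ_n = 0` to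
the Cauchy-Kovalevskaya extension of `(e_n ξ')^{j-i} g`, a monogenic polynomial of degree `j`. -/
def monogenicExtension (p m : ℕ) (S : Type*) [AddCommGroup S] [Module ℂ S] [Module (Cl p m) S]
    [IsScalarTower ℂ (Cl p m) S] (j i : ℕ) : Module.End ℂ (Poly m ⊗[ℂ] S) :=
  truncExp (extensionExponent p m S) j * tangentialXi p m S ^ (j - i)

/-- The exponential is invertible on polynomials of degree `j`, and the power of `e_n ξ'` is
injective on monogenics. -/
theorem monogenicExtension_injective (he : eps p (Fin.last m) = -1) (hm : 1 ≤ m) {i j : ℕ}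
    (hij : i ≤ j) {W : Submodule ℂ S} {f : Poly m ⊗[ℂ] S} (hf : f ∈ monogenic' p m i W)
    (h : monogenicExtension p m S j i f = 0) : f = 0 := by
  obtain ⟨-, h2, h3, h4⟩ := mem_monogenic'_iff.1 hf
  have h5 := euler_tangentialXi_pow (p := p) h3 (j - i)
  rw [← Nat.cast_add, Nat.add_sub_cancel' hij] at h5
  have h6 := truncExp_neg_truncExp (extensionExponent p m S) j (extensionExponent_pow_eq_zero h5)
  rw [monogenicExtension, Module.End.mul_apply] at h
  rw [h, map_zero] at h6
  exact tangentialXi_pow_injective he hm ((tangentialDirac_eq_zero_iff he).2 h2) h3 h4 _ h6.symm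

theorem leviAct_commute_monogenicExtension {A : so p m} (hA : A ∈ mPrime p m) (j i : ℕ) :
    Commute (leviAct p m 0 S A) (monogenicExtension p m S j i) :=
  (truncExp_commute m S (leviAct_commute_extensionExponent hA) j).mul_right
    ((leviAct_commute_tangentialXi hA).pow_right _)

theorem isCopy_monogenicExtension (he : eps p (Fin.last m) = -1) (hm : 1 ≤ m) {i j : ℕ}
    (hij : i ≤ j) {W : Submodule ℂ S}
    (hW : ∀ A ∈ mPrime p m, ∀ f ∈ polyVal m W, leviAct p m 0 S A f ∈ polyVal m W) :
    IsCopy p m (monogenic' p m i W) ((monogenic' p m i W).map (monogenicExtension p m S j i)) :=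
  isCopy_map (fun _ hf => monogenicExtension_injective he hm hij hf)
    (fun A hA _ hf => leviAct_mem_monogenic' hA (hW A hA) hf)
    fun _ hA => leviAct_commute_monogenicExtension hA j i

theorem truncExp_mem {U : Submodule ℂ (Poly m ⊗[ℂ] S)} {Y : Module.End ℂ (Poly m ⊗[ℂ] S)}
    (hY : ∀ f ∈ U, Y f ∈ U) (N : ℕ) {f : Poly m ⊗[ℂ] S} (hf : f ∈ U) : truncExp Y N f ∈ U := by
  have h : ∀ k, (Y ^ k) f ∈ U := fun k => by
    induction k with
    | zero => exact hf
    | succ k ih =>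
      rw [pow_succ', Module.End.mul_apply]
      exact hY _ ih
  rw [truncExp_apply]
  exact Submodule.sum_mem _ fun k _ => U.smul_mem _ (h k)

theorem extensionExponent_mem {W : Submodule ℂ S} (hW : IsEvenStable p m W) :
    ∀ f ∈ polyVal m W, extensionExponent p m S f ∈ polyVal m W := fun f hf =>
  mulX_mem_polyVal _ (hW.tangentialDirac_mem f hf)

/-- Extensions are monogenic by `dX_last_truncExp`. Conversely, undoing the extension of a monogenic
polynomial leaves one without `ξ_n`; its Fischer components are then extended one by one. -/
theorem iSup_map_monogenicExtension (he : eps p (Fin.last m) = -1) (hm : 1 ≤ m) {W : Submodule ℂ S}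
    (hW : IsEvenStable p m W) (j : ℕ) :
    ⨆ i : Fin (j + 1), (monogenic' p m i W).map (monogenicExtension p m S j i)
      = monogenic p m j W := by
  refine le_antisymm (iSup_le fun i => ?_) fun f hf => ?_
  · rintro _ ⟨f, hf, rfl⟩
    obtain ⟨h1, -, h3, h4⟩ := mem_monogenic'_iff.1 hf
    rw [monogenicExtension, Module.End.mul_apply]
    have hE := euler_tangentialXi_pow (p := p) h3 (j - i)
    rw [← Nat.cast_add, Nat.add_sub_cancel' (Nat.lt_succ_iff.1 i.2)] at hE
    have hX := dX_last_tangentialXi_pow (p := p) h4 (j - i)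
    have hU : ∀ k, (tangentialXi p m S ^ k) f ∈ polyVal m W := fun k => by
      induction k with
      | zero => exact h1
      | succ k ih =>
        rw [pow_succ', Module.End.mul_apply]
        exact hW.tangentialXi_mem _ ih
    refine mem_monogenic_iff.2 ⟨truncExp_mem (extensionExponent_mem hW) j (hU _), ?_, ?_⟩
    · rw [dirac_eq_zero_iff he]
      have h := dX_last_truncExp (p := p) hE 1
      rw [one_smul, one_smul, hX, zero_add] at h
      rw [h]
      exact (LinearMap.congr_fun
        (truncExp_commute m S tangentialDirac_commute_extensionExponent j).eq _).symm
    · rw [← Module.End.mul_apply, (truncExp_commute m S euler_commute_extensionExponent j).eq,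
        Module.End.mul_apply, hE, map_smul]
  · obtain ⟨h1, h2, h3⟩ := mem_monogenic_iff.1 hf
    have hY : -extensionExponent p m S = (-1 : ℂ) • extensionExponent p m S :=
      (neg_one_smul ℂ _).symm
    have hYU : ∀ f ∈ polyVal m W, (-extensionExponent p m S) f ∈ polyVal m W := fun f hf =>
      neg_mem (extensionExponent_mem hW f hf)
    obtain ⟨g, hg, hsum⟩ := exists_fischer_decomposition he hm hW.tangentialDirac_mem
      hW.tangentialXi_mem j _ (truncExp_mem hYU j h1)
      (by
        rw [← Module.End.mul_apply,
          (truncExp_commute m S euler_commute_extensionExponent.neg_right j).eq,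
          Module.End.mul_apply, h3, map_smul])
      (by
        rw [hY, dX_last_truncExp h3, (dirac_eq_zero_iff he f).1 h2, ← one_smul ℂ
          (tangentialDirac p m S f), smul_smul, ← add_smul]
        norm_num)
    rw [← truncExp_truncExp_neg (extensionExponent p m S) j (extensionExponent_pow_eq_zero h3),
      hsum, map_sum]
    refine Submodule.sum_mem _ fun k hk => ?_
    have hk' : k ≤ j := Nat.lt_succ_iff.1 (Finset.mem_range.1 hk)
    obtain ⟨h4, h5, h6, h7⟩ := hg k hk'
    refine Submodule.mem_iSup_of_mem (⟨j - k, by omega⟩ : Fin (j + 1)) ⟨g k,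
      mem_monogenic'_iff.2 ⟨h4, (tangentialDirac_eq_zero_iff he).1 h5, h6, h7⟩, ?_⟩
    rw [monogenicExtension, Module.End.mul_apply]
    change truncExp _ _ ((tangentialXi p m S ^ (j - (j - k))) (g k)) = _
    rw [Nat.sub_sub_self hk']

/-- The Casimir eigenvalue determines `i`, but it does not see the index in `κ`; hence the inner
supremum. -/
theorem iSupIndep_of_isCopy (hm : 1 ≤ m) {n : ℕ} {κ : Type*} {W : κ → Submodule ℂ S}
    {N : Fin n → κ → Submodule ℂ (Poly m ⊗[ℂ] S)}
    (h : ∀ (i : Fin n) k, IsCopy p m (monogenic' p m i (W k)) (N i k)) : iSupIndep fun i => ⨆ k, N i k := by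
  refine ((casimir p m S).eigenspaces_iSupIndep.comp (f := fun i : Fin n => monogenicCasimir m i)
    fun i k hik => Fin.ext (monogenicCasimir_injective hm hik)).mono fun i => iSup_le fun k => ?_
  exact fun f hf => Module.End.mem_eigenspace_iff.2
    (casimir_of_isCopy (h i k) (fun f hf => casimir_monogenic' hf) f hf)

theorem exists_isBranchingEven (S : Type*) [AddCommGroup S] [Module ℂ S] [Module (Cl p m) S]
    [IsScalarTower ℂ (Cl p m) S] (he : eps p (Fin.last m) = -1) (heven : Even (m + 1)) (ε : ℤˣ)
    (j : ℕ) : ∃ N : Fin (j + 1) → Submodule ℂ (Poly m ⊗[ℂ] S), IsBranchingEven p m ε j N := by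
  have hm : 1 ≤ m := by
    rcases Nat.eq_zero_or_pos m with rfl | h
    · exact absurd heven (by decide)
    · exact h
  have hW : ∀ A ∈ mPrime p m, ∀ f ∈ polyVal m (halfSpinC p m S ε),
      leviAct p m 0 S A f ∈ polyVal m (halfSpinC p m S ε) := by
    intro A _ f hf
    rw [mem_polyVal_halfSpinC_iff p m] at hf ⊢
    rw [← Module.End.mul_apply, ← (leviAct_commute_act_volume A).eq, Module.End.mul_apply, hf,
      map_smul]
  have hcopy : ∀ i : Fin (j + 1), IsCopy p m (monogenic' p m i (halfSpinC p m S ε))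
      ((monogenic' p m i (halfSpinC p m S ε)).map (monogenicExtension p m S j i)) := fun i =>
    isCopy_monogenicExtension he hm (Nat.lt_succ_iff.1 i.2) hW
  refine ⟨fun i => (monogenic' p m i (halfSpinC p m S ε)).map (monogenicExtension p m S j i),
    hcopy, ?_, iSup_map_monogenicExtension he hm (isEvenStable_halfSpinC heven ε) j⟩
  have h := iSupIndep_of_isCopy hm (κ := Unit) (fun (i : Fin (j + 1)) _ => hcopy i)
  simpa only [iSup_const] using h

/-- The volume element of the hyperplane anticommutes with `D'` and squares to `1`, so it preserves
monogenics, and `f` is half the sum of its projections `f ± volume' f`. -/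
theorem monogenic'_halfSpin'_sup (hm : Even m) (i : ℕ) :
    ⨆ ε : ℤˣ, monogenic' p m i (halfSpin' p m S ε) = monogenic' p m i ⊤ := by
  refine le_antisymm (iSup_le fun ε f hf => ?_) fun f hf => ?_
  · obtain ⟨-, h⟩ := mem_monogenic'_iff.1 hf
    exact mem_monogenic'_iff.2 ⟨by rw [polyVal_top]; trivial, h⟩
  · obtain ⟨-, h2, h3, h4⟩ := mem_monogenic'_iff.1 hf
    have hD : dirac' p m S (act (volume' p m) f) = 0 := by
      have h : dirac' p m S * act (volume' p m) = -(act (volume' p m) * dirac' p m S) := by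
        rw [dirac', Finset.mul_sum, Finset.sum_mul, ← Finset.sum_neg_distrib]
        refine Finset.sum_congr rfl fun k _ => ?_
        rw [mul_assoc, ← act_mul_dX, ← mul_assoc, ← mul_assoc, ← act_mul, ← act_mul,
          e_castSucc_mul_volume' p m hm, ← neg_one_smul ℂ (volume' p m * _), act_smul, neg_one_smul,
          neg_mul]
      rw [← Module.End.mul_apply, h, LinearMap.neg_apply, Module.End.mul_apply, h2, map_zero, neg_zero]
    have hv : act (volume' p m) (act (volume' p m) f) = f := by
      rw [← Module.End.mul_apply, ← act_mul, volume'_sq p m hm, act_one]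
      rfl
    have h5 : ∀ ε : ℤˣ, f + ((ε : ℤ) : ℂ) • act (volume' p m) f
        ∈ monogenic' p m i (halfSpin' p m S ε) := fun ε => by
      refine mem_monogenic'_iff.2 ⟨?_, ?_, ?_, ?_⟩
      · rw [mem_polyVal_halfSpin'_iff p m, map_add, map_smul, hv, smul_add, smul_smul,
          coe_sign_mul_self, one_smul]
        exact add_comm _ _
      · rw [map_add, map_smul, h2, hD, smul_zero, add_zero]
      · rw [map_add, map_smul, h3, euler_act h3]
        module
      · rw [map_add, map_smul, h4, dX_act h4, smul_zero, add_zero]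
    have h6 : f = (1 / 2 : ℂ) • ((f + (((1 : ℤˣ) : ℤ) : ℂ) • act (volume' p m) f)
        + (f + (((-1 : ℤˣ) : ℤ) : ℂ) • act (volume' p m) f)) := by
      push_cast
      module
    rw [h6]
    exact Submodule.smul_mem _ _ (Submodule.add_mem _ (Submodule.mem_iSup_of_mem _ (h5 1))
      (Submodule.mem_iSup_of_mem _ (h5 (-1))))

/-- There are only two signs, so inside a fixed `i` it suffices to separate `ε` from `-ε`. -/
theorem iSupIndep_prod_units {α ι : Type*} [CompleteLattice α] [IsModularLattice α]
    {N : ι → ℤˣ → α} (h : iSupIndep fun i => ⨆ ε, N i ε) (h' : ∀ i ε, Disjoint (N i ε) (N i (-ε))) :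
    iSupIndep fun x : ι × ℤˣ => N x.1 x.2 := by
  rintro ⟨i, ε⟩
  have h1 : Disjoint (N i ε) (N i (-ε) ⊔ ⨆ (k) (_ : k ≠ i), ⨆ ε, N k ε) :=
    (h' i ε).disjoint_sup_right_of_disjoint_sup_left
      ((h i).mono_left (sup_le (le_iSup _ ε) (le_iSup _ (-ε))))
  refine h1.mono_right (iSup₂_le fun x hx => ?_)
  by_cases hi : x.1 = i
  · have hε : x.2 = -ε := Int.units_ne_iff_eq_neg.1 fun h => hx (Prod.ext hi h)
    change N x.1 x.2 ≤ _
    rw [hi, hε]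
    exact le_sup_left
  · exact le_sup_of_le_right (le_iSup₂_of_le x.1 hi (le_iSup _ x.2))

/-- For `n` odd, `e_n ξ'` and `-e_n D'` exchange the two eigenspaces of `volume'`. Therefore the
decomposition is made for all of `𝕊`, and only the monogenics on the hyperplane are split by sign.
The two signs share a Casimir eigenvalue; injectivity of the extension keeps them apart. -/
theorem exists_isBranchingOdd (S : Type*) [AddCommGroup S] [Module ℂ S] [Module (Cl p m) S]
    [IsScalarTower ℂ (Cl p m) S] (he : eps p (Fin.last m) = -1) (hm : 1 ≤ m) (hodd : Odd (m + 1))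
    (j : ℕ) :
    ∃ N : Fin (j + 1) → ℤˣ → Submodule ℂ (Poly m ⊗[ℂ] S), IsBranchingOdd p m j N := by
  have hm' : Even m := by
    rcases Nat.even_or_odd m with h | h
    · exact h
    · exact absurd h.add_one (Nat.not_even_iff_odd.2 hodd)
  have hW : ∀ (ε : ℤˣ), ∀ A ∈ mPrime p m, ∀ f ∈ polyVal m (halfSpin' p m S ε),
      leviAct p m 0 S A f ∈ polyVal m (halfSpin' p m S ε) := by
    intro ε A hA f hf
    rw [mem_polyVal_halfSpin'_iff p m] at hf ⊢
    rw [← Module.End.mul_apply, ← (leviAct_commute_act_volume' hA hm').eq, Module.End.mul_apply, hf,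
      map_smul]
  have hcopy : ∀ (i : Fin (j + 1)) (ε : ℤˣ), IsCopy p m (monogenic' p m i (halfSpin' p m S ε))
      ((monogenic' p m i (halfSpin' p m S ε)).map (monogenicExtension p m S j i)) := fun i ε =>
    isCopy_monogenicExtension he hm (Nat.lt_succ_iff.1 i.2) (hW ε)
  refine ⟨fun i ε => (monogenic' p m i (halfSpin' p m S ε)).map (monogenicExtension p m S j i),
    hcopy, iSupIndep_prod_units (iSupIndep_of_isCopy hm hcopy) fun i ε => ?_, ?_⟩
  · rw [Submodule.disjoint_def]
    rintro _ ⟨f, hf, rfl⟩ ⟨g, hg, hgf⟩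
    have htop : ∀ (δ : ℤˣ), monogenic' p m i (halfSpin' p m S δ) ≤ monogenic' p m i ⊤ := fun δ => by
      rw [← monogenic'_halfSpin'_sup hm']
      exact le_iSup (fun δ => monogenic' p m i (halfSpin' p m S δ)) δ
    have h1 : f = g := (sub_eq_zero.1 (monogenicExtension_injective he hm (Nat.lt_succ_iff.1 i.2)
      (Submodule.sub_mem _ (htop _ hf) (htop _ hg)) (by rw [map_sub, hgf, sub_self])))
    have h2 := (mem_polyVal_halfSpin'_iff p m ε f).1 (mem_monogenic'_iff.1 hf).1
    have h3 := (mem_polyVal_halfSpin'_iff p m (-ε) g).1 (mem_monogenic'_iff.1 hg).1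
    rw [← h1, h2] at h3
    have h4 : (2 * ((ε : ℤ) : ℂ)) • f = 0 := by
      push_cast at h3
      rw [two_mul, add_smul]
      nth_rewrite 1 [h3]
      module
    have h5 : f = 0 := (smul_eq_zero.1 h4).resolve_left (mul_ne_zero two_ne_zero fun h => by
      have := coe_sign_mul_self ε
      rw [h, zero_mul] at this
      exact zero_ne_one this)
    rw [h5, map_zero]
  · rw [← iSup_map_monogenicExtension he hm isEvenStable_top j, iSup_prod]
    refine iSup_congr fun i => ?_
    rw [← monogenic'_halfSpin'_sup hm']
    exact (Submodule.map_iSup (ι := ℤˣ) (monogenicExtension p m S j i)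
      fun ε => monogenic' p m i (halfSpin' p m S ε)).symm

end Branching

end

end SpinorSingular

/-! ### Assembly of the theorem -/

theorem mainTheorem6 (p q m : ℕ) (hp : 1 ≤ p) (hq : 2 ≤ q) (hm : p + q - 2 = m + 1)
    (S : Type*) [AddCommGroup S] [Module ℂ S] [Module (Cl p m) S] [IsScalarTower ℂ (Cl p m) S]
    [IsSimpleModule (Cl p m) S] (lam : ℂ) :
    -- the isomorphisms given by the inverse Fourier transform
    (IsFourierIso p m lam S ∧
      (Even (m + 1) → ∀ ε : ℤˣ, IsFourierIso p m lam (halfSpin p m S ε))) ∧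
    -- the solutions built from Gegenbauer polynomials, for all values of the parameter
    ((∀ K, IsLeviStable p m lam (spinorFSpace p m lam K (⊤ : Submodule ℂ S))) ∧
      iSupIndep (fun K : ℕ => spinorFSpace p m lam K (⊤ : Submodule ℂ S)) ∧
      (⨆ K : ℕ, spinorFSpace p m lam K (⊤ : Submodule ℂ S)) ≤ Sol p m lam S) ∧
    (Even (m + 1) → ∀ ε : ℤˣ,
      (∀ K, IsLeviStable p m lam (spinorFSpace p m lam K (halfSpinC p m S ((-1) ^ K * ε)))) ∧
      iSupIndep (fun K : ℕ => spinorFSpace p m lam K (halfSpinC p m S ((-1) ^ K * ε))) ∧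
      (⨆ K : ℕ, spinorFSpace p m lam K (halfSpinC p m S ((-1) ^ K * ε))) ≤ halfSol p m lam S ε) ∧
    -- they exhaust all solutions for generic parameters
    ((∀ k : ℕ, 1 ≤ k → lam + ((m + 1 : ℕ) : ℂ) - 3 / 2 ≠ (k : ℂ)) →
      (∀ k : ℕ, 1 ≤ k → 2 * lam + ((m + 1 : ℕ) : ℂ) - 1 ≠ (k : ℂ)) →
      Sol p m lam S = ⨆ K : ℕ, spinorFSpace p m lam K (⊤ : Submodule ℂ S) ∧
      (Even (m + 1) → ∀ ε : ℤˣ,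
        halfSol p m lam S ε
          = ⨆ K : ℕ, spinorFSpace p m lam K (halfSpinC p m S ((-1) ^ K * ε)))) ∧
    -- the additional solutions for half-integral parameters
    (∀ l : ℕ, lam = (l : ℂ) + 1 / 2 →
      (Odd (m + 1) →
        (2 ≤ m + 1 → ∃ N : Fin (l + 1 + 1) → ℤˣ → Submodule ℂ (Poly m ⊗[ℂ] S),
          IsBranchingOdd p m (l + 1) N) ∧
        ∀ N : Fin (l + 1 + 1) → ℤˣ → Submodule ℂ (Poly m ⊗[ℂ] S),
          IsBranchingOdd p m (l + 1) N →
          iSupIndep (Sum.elim (fun K : ℕ => spinorFSpace p m lam K (⊤ : Submodule ℂ S))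
            (fun x : Fin (l + 1) × ℤˣ => N x.1.succ x.2)) ∧
          (⨆ K : ℕ, spinorFSpace p m lam K (⊤ : Submodule ℂ S))
            ⊔ (⨆ x : Fin (l + 1) × ℤˣ, N x.1.succ x.2) ≤ Sol p m lam S) ∧
      (Even (m + 1) → ∀ ε : ℤˣ,
        (∃ N : Fin (l + 1 + 1) → Submodule ℂ (Poly m ⊗[ℂ] S),
          IsBranchingEven p m ε (l + 1) N) ∧
        ∀ N : Fin (l + 1 + 1) → Submodule ℂ (Poly m ⊗[ℂ] S),
          IsBranchingEven p m ε (l + 1) N →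
          iSupIndep (Sum.elim
            (fun K : ℕ => spinorFSpace p m lam K (halfSpinC p m S ((-1) ^ K * ε)))
            (fun i : Fin (l + 1) => N i.succ)) ∧
          (⨆ K : ℕ, spinorFSpace p m lam K (halfSpinC p m S ((-1) ^ K * ε)))
            ⊔ (⨆ i : Fin (l + 1), N i.succ) ≤ halfSol p m lam S ε)) := by
  -- `q ≥ 2` means `n ≥ p`, so the last sign is negative.
  have he : eps p (Fin.last m) = -1 := by
    rw [eps, if_neg]
    rw [Fin.val_last]
    omega
  refine ⟨⟨isFourierIso p m lam S, fun _ ε => isFourierIso p m lam _⟩, ⟨fun K => ?_, ?_, ?_⟩,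
    fun hm ε => ⟨fun K => ?_, ?_, ?_⟩, fun h1 h2 => ⟨Sol_eq_iSup he h1 h2, fun hm ε =>
      halfSol_eq_iSup p m lam S he hm ε h1 h2⟩, fun l hl => ⟨fun hm => ⟨fun hm2 => ?_,
      fun N hN => ⟨?_, ?_⟩⟩, fun hm ε => ⟨?_, fun N hN => ⟨?_, ?_⟩⟩⟩⟩
  · exact spinorFSpace_isLeviStable p m lam S he K _ fun _ _ _ => trivial
  · exact spinorFSpace_iSupIndep S he fun _ => ⊤
  · exact iSup_le fun K => spinorFSpace_le_Sol S he K _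
  · exact spinorFSpace_isLeviStable p m lam S he K _ fun u s hs =>
      (halfSpin p m S ((-1) ^ K * ε)).smul_mem u hs
  · exact spinorFSpace_iSupIndep S he _
  · exact iSup_le fun K => spinorFSpace_le_halfSol p m lam S he hm ε K
  · exact exists_isBranchingOdd S he (by omega) hm (l + 1)
  -- The summands with `i = 0` are left out: their Casimir eigenvalue is that of the `F̃_K s`, so
  -- directness could not be deduced for them.
  · exact iSupIndep_sumElim_spinorFSpace lam he _ (i := fun x : Fin (l + 1) × ℤˣ => x.1.succ)
      (fun x => by simp) (fun x => hN.1 x.1.succ x.2)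
      (hN.2.1.comp (f := fun x : Fin (l + 1) × ℤˣ => (x.1.succ, x.2)) fun x y h => by
        simpa [Prod.ext_iff] using h)
  · refine sup_le (iSup_le fun K => spinorFSpace_le_Sol S he K _)
      (iSup_le fun x => le_trans ?_ (monogenic_le_Sol p m lam S hl ⊤))
    rw [← hN.2.2]
    exact le_iSup (fun x : Fin (l + 1 + 1) × ℤˣ => N x.1 x.2) (x.1.succ, x.2)
  · exact exists_isBranchingEven S he hm ε (l + 1)
  · exact iSupIndep_sumElim_spinorFSpace lam he _ (i := fun x : Fin (l + 1) => x.succ)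
      (fun x => by simp) (fun x => hN.1 x.succ)
      (hN.2.1.comp (Fin.succ_injective _))
  · refine sup_le (iSup_le fun K => spinorFSpace_le_halfSol p m lam S he hm ε K)
      (iSup_le fun x => le_trans ?_ (monogenic_le_halfSol p m lam S hl ε))
    rw [← hN.2.2]
    exact le_iSup N x.succ
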